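/- Let $\alpha\in\mathbb R$, $\kappa>0$, $\omega\ge 0$, $\gamma=2\omega$, and consider the two coupled Stuart–Landau oscillators $$\dot z_1=(\alpha+i\omega-|z_1|^2)z_1+\tfrac{\kappa}{2}(z_2-z_1),\qquad \dot z_2=(\alpha-i\omega-|z_2|^2)z_2+\tfrac{\kappa}{2}(z_1-z_2)$$ on $\mathbb C^2$. Write $z_j=r_je^{i\phi_j}$, $R=r_1/r_2$, $\Phi=\phi_1-\phi_2$ (mod $2\pi$), $\Psi=\frac12(\phi_1+\phi_2)$. A solution tends to *Amplitude Death* if $r_1,r_2\to0$; it is *Active* if $r_1\not\to0$ and $r_2\not\to0$; it is *Phase-Locked* if $\Phi$ converges to a constant, and *Incoherent* otherwise. Put $\mathcal M=\{(z_1,z_2):R=1\}=\{|z_1|=|z_2|\ne0\}$, $\kappa^*(\gamma)=\frac{4\alpha^2+\gamma^2}{4\alpha}$ (for $\alpha>0$) and, for $\gamma\le\kappa$, $\Phi_\infty=\arcsin(\gamma/\kappa)$ and $r_\infty^2=\alpha+\frac12\big(\sqrt{\kappa^2-\gamma^2}-\kappa\big)$. If $\gamma\le\kappa$, call an initial datum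 *exceptional* if its phase difference is $\pi-\Phi_\infty$. **(a) Invariance.** Every initial datum has a solution on $[0,\infty)$. $\mathcal M$ is a smooth real hypersurface in $\mathbb C^2$, and a solution on any time interval that is in $\mathcal M$ at one time is in $\mathcal M$ at all times of the interval. **(b) Asymptotic states on $\mathcal M$.** For every solution starting in $\mathcal M$: - if $\kappa<\gamma$ and $\kappa<2\alpha$, it is Active and Incoherent; - if $2\alpha\le\kappa<\gamma$, it tends to Amplitude Death and is Incoherent; - if $\gamma\le\kappa$ and either $\alpha\le0$, or $\alpha>0$, $2\alpha\le\gamma$ and $\kappa\le\kappa^*(\gamma)$, it tends to Amplitude Death and is Phase-Locked; - if $\gamma\le\kappa$, $\alpha>0$, and either $\gamma<2\alpha$ or $\kappa>\kappa^*(\gamma)$, it is Phase-Locked, and it is Active with $r_1^2,r_2^2\to r_\infty^2$ unless $\gamma<\kappa$ and the initial datum is exceptional. In the two Incoherent cases the phases form a periodic orbit: $\Psi$ is constant, $\dot\Phi>0$, and $\Phi$ is periodic modulo $2\pi$. If $\gamma<\kappa$ and the initial datum is not exceptional, $e^{i\Phi}\to e^{i\Phi_\infty}$ at the exponential rate $O(e^{-\sqrt{\kappa^2-\gamma^2}\,t})$.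 If $\gamma=\kappa$, then $e^{i\Phi}\to e^{i\Phi_\infty}=i$, at the exact rate $t^{-1}$ unless $e^{i\Phi(0)}=i$. **(c) Rate of Amplitude Death for $\alpha\le0$.** If $\alpha<0$, all solutions in $\mathbb C^2$ satisfy $r_j(t)\le Ce^{-ct}$ with $c>0$ depending only on the parameters. If $\alpha=0$, all solutions in $\mathbb C^2$ satisfy $r_j(t)\le C(1+t)^{-1/2}$; on $\mathcal M$ this is the exact order $t^{-1/2}$ if $\gamma=0$ and the datum is not exceptional, while for $\gamma>0$ the decay on $\mathcal M$ is again exponential, with a rate depending only on the parameters. **(d) Stability.** - If $\kappa\ge2\alpha$, the distance to $\mathcal M$ in $\mathbb C^2$ is uniformly Lyapunov stable, and it tends to $0$ along every solution. - For all parameters, let $p\in\mathcal M$, excluding exceptional $p$ if $\gamma<\kappa$ or if $\gamma=\kappa\ge2\alpha$. For every $\varepsilon>0$ all solutions in $\mathbb C^2$ starting close enough to $p$ satisfy $|R(t)-1|<\varepsilon$ for all $t\ge0$; moreover, if $\gamma\le\kappa$ or $\kappa\le2\alpha$, all solutions in $\mathbb C^2$ starting close enough to $p$ satisfy $R(t)\to1$.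 - For such $p$, all solutions in $\mathbb C^2$ starting close enough to $p$ have the same asymptotic state as the solution $z$ starting at $p$: any limits of $r_1,r_2$ or of $\Phi$ that exist for $z$ are shared, and they are Active, respectively Incoherent, if $z$ is. - Every solution starting in $\mathcal M$ is Lyapunov stable in $\mathbb C^2$, unless $\gamma\le\kappa$ and its datum is exceptional. - If $\alpha\le0$, or $\alpha>0$ and $2\alpha<\kappa<\kappa^*(\gamma)$, the origin is Lyapunov stable and every solution in $\mathbb C^2$ tends to Amplitude Death. **(e) Almost every initial datum.** If $\kappa>2\alpha$, then for Lebesgue-almost every initial datum in $\mathbb C^2$: if $\kappa<\gamma$ the solution tends to Amplitude Death and is Incoherent; if $\gamma\le\kappa$ then $\Phi\to\Phi_\infty$, and the solution tends to Amplitude Death if $\alpha\le0$ or $\kappa\le\kappa^*(\gamma)$, while it is Active with $r_1^2,r_2^2\to r_\infty^2$ if $\alpha>0$ and $\kappa>\kappa^*(\gamma)$. -/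

import Mathlib

open Filter Topology Set MeasureTheory Asymptotics

noncomputable section

namespace TwinSL

/-- The right-hand side of the two coupled Stuart-Landau equations
`z₁' = (α + iω - |z₁|²) z₁ + (κ/2)(z₂ - z₁)`, `z₂' = (α - iω - |z₂|²) z₂ + (κ/2)(z₁ - z₂)`. -/
def field (α κ ω : ℝ) (w : ℂ × ℂ) : ℂ × ℂ :=
  (((α : ℂ) + Complex.I * (ω : ℂ) - (‖w.1‖ : ℂ) ^ 2) * w.1 + ((κ : ℂ) / 2) * (w.2 - w.1),
   ((α : ℂ) - Complex.I * (ω : ℂ) - (‖w.2‖ : ℂ) ^ 2) * w.2 + ((κ : ℂ) / 2) * (w.1 - w.2))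

/-- `z` solves the system on the time set `I` (one-sided derivatives at end points). -/
def IsSolutionOn (α κ ω : ℝ) (I : Set ℝ) (z : ℝ → ℂ × ℂ) : Prop :=
  ∀ t ∈ I, HasDerivWithinAt z (field α κ ω (z t)) I t

/-- A forward solution, defined for all times `t ≥ 0`. -/
abbrev IsSolution (α κ ω : ℝ) (z : ℝ → ℂ × ℂ) : Prop :=
  IsSolutionOn α κ ω (Ici 0) z

/-- The amplitude ratio `R = |z₁| / |z₂|`. -/
def ratio (w : ℂ × ℂ) : ℝ := ‖w.1‖ / ‖w.2‖

/-- The set `R = 1`; since `x / 0 = 0`, it does not contain the origin. -/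
def manifoldM : Set (ℂ × ℂ) := {w | ratio w = 1}

/-- `e^{iΦ}` for the phase difference `Φ = φ₁ - φ₂`; its value is `0` if a phase is undefined. -/
def phaseFactor (w : ℂ × ℂ) : ℂ :=
  w.1 * (starRingEnd ℂ) w.2 / ((‖w.1‖ : ℂ) * (‖w.2‖ : ℂ))

/-- `e^{2iΨ}` for the mean phase `Ψ = (φ₁ + φ₂)/2`; its value is `0` if a phase is undefined. -/
def meanPhaseFactor (w : ℂ × ℂ) : ℂ :=
  w.1 * w.2 / ((‖w.1‖ : ℂ) * (‖w.2‖ : ℂ))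

/-- The unit complex number `e^{iθ}`. -/
def unitAt (θ : ℝ) : ℂ := Complex.exp ((θ : ℂ) * Complex.I)

/-- Both amplitudes tend to zero. -/
def AmplitudeDeath (z : ℝ → ℂ × ℂ) : Prop :=
  Tendsto (fun t => ‖(z t).1‖) atTop (𝓝 0) ∧ Tendsto (fun t => ‖(z t).2‖) atTop (𝓝 0)

/-- Neither amplitude tends to zero. -/
def Active (z : ℝ → ℂ × ℂ) : Prop :=
  ¬ Tendsto (fun t => ‖(z t).1‖) atTop (𝓝 0) ∧ ¬ Tendsto (fun t => ‖(z t).2‖) atTop (𝓝 0)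

/-- The phase difference tends to `θ` (on the circle). -/
def PhaseLockedAt (z : ℝ → ℂ × ℂ) (θ : ℝ) : Prop :=
  Tendsto (fun t => phaseFactor (z t)) atTop (𝓝 (unitAt θ))

/-- The phase difference tends to some constant. -/
def PhaseLocked (z : ℝ → ℂ × ℂ) : Prop := ∃ θ : ℝ, PhaseLockedAt z θ

/-- Phase-locking does not occur. -/
def Incoherent (z : ℝ → ℂ × ℂ) : Prop := ¬ PhaseLocked z

/-- The periodic phase orbit: both phases are defined for all times, the mean phase is constant,
the phase difference has a differentiable lift `Φ` with `Φ' > 0`, and it is periodic modulo `2π`. -/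
def PeriodicPhase (z : ℝ → ℂ × ℂ) : Prop :=
  (∀ t, 0 ≤ t → (z t).1 ≠ 0 ∧ (z t).2 ≠ 0) ∧
  (∀ t, 0 ≤ t → meanPhaseFactor (z t) = meanPhaseFactor (z 0)) ∧
  (∃ Φ : ℝ → ℝ, ∀ t, 0 ≤ t → phaseFactor (z t) = unitAt (Φ t) ∧
    ∃ v : ℝ, 0 < v ∧ HasDerivWithinAt Φ v (Ici 0) t) ∧
  (∃ T : ℝ, 0 < T ∧ ∀ t, 0 ≤ t → phaseFactor (z (t + T)) = phaseFactor (z t))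

/-- A subset of `ℂ²` that is locally a regular level set of a smooth real function,
that is, an embedded smooth submanifold of real codimension one. -/
def IsSmoothHypersurface (S : Set (ℂ × ℂ)) : Prop :=
  ∀ p ∈ S, ∃ U : Set (ℂ × ℂ), IsOpen U ∧ p ∈ U ∧ ∃ g : ℂ × ℂ → ℝ,
    ContDiffOn ℝ ((⊤ : ℕ∞) : WithTop ℕ∞) g U ∧ (∀ x ∈ U, fderiv ℝ g x ≠ 0) ∧ S ∩ U = {x ∈ U | g x = 0}

/-- The curve `κ*(γ) = (4α² + γ²) / (4α)`, used only for `α > 0`. -/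
def kappaStar (α γ : ℝ) : ℝ := (4 * α ^ 2 + γ ^ 2) / (4 * α)

/-- The limiting phase difference `arcsin (γ/κ)`, for `γ ≤ κ`. -/
def lockAngle (κ γ : ℝ) : ℝ := Real.arcsin (γ / κ)

/-- The other zero `π - arcsin (γ/κ)` of `γ - κ sin`, for `γ ≤ κ`. -/
def unstableAngle (κ γ : ℝ) : ℝ := Real.pi - Real.arcsin (γ / κ)

/-- The squared limiting amplitude `α + (√(κ² - γ²) - κ)/2` of the active phase-locked state. -/
def lockedAmplitudeSq (α κ γ : ℝ) : ℝ := α + (Real.sqrt (κ ^ 2 - γ ^ 2) - κ) / 2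

/-- Lyapunov stability of the motion `z` among all forward solutions in `ℂ²`. -/
def LyapunovStable (α κ ω : ℝ) (z : ℝ → ℂ × ℂ) : Prop :=
  ∀ ε > 0, ∃ δ > 0, ∀ w : ℝ → ℂ × ℂ, IsSolution α κ ω w → dist (w 0) (z 0) < δ →
    ∀ t, 0 ≤ t → dist (w t) (z t) < ε

/-- The set `S` is uniformly Lyapunov stable, and every forward solution is attracted to it. -/
def GloballyAsymptoticallyStable (α κ ω : ℝ) (S : Set (ℂ × ℂ)) : Prop :=
  (∀ ε > 0, ∃ δ > 0, ∀ w : ℝ → ℂ × ℂ, IsSolution α κ ω w → Metric.infDist (w 0) S < δ →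
    ∀ t, 0 ≤ t → Metric.infDist (w t) S < ε) ∧
  (∀ w : ℝ → ℂ × ℂ, IsSolution α κ ω w →
    Tendsto (fun t => Metric.infDist (w t) S) atTop (𝓝 0))

/-- Solutions starting close to the point `p` keep an amplitude ratio close to `1`. -/
def RatioStableAt (α κ ω : ℝ) (p : ℂ × ℂ) : Prop :=
  ∀ ε > 0, ∃ δ > 0, ∀ w : ℝ → ℂ × ℂ, IsSolution α κ ω w → dist (w 0) p < δ →
    ∀ t, 0 ≤ t → |ratio (w t) - 1| < ε

/-- The amplitude ratio of every solution starting close to the point `p` tends to `1`. -/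
def RatioAttractingAt (α κ ω : ℝ) (p : ℂ × ℂ) : Prop :=
  ∃ δ > 0, ∀ w : ℝ → ℂ × ℂ, IsSolution α κ ω w → dist (w 0) p < δ →
    Tendsto (fun t => ratio (w t)) atTop (𝓝 1)

/-- All solutions starting close to `z 0`, on or off the manifold, have the same asymptotic state
as `z`: the same limits of the amplitudes and of the phase difference where these exist, and
activity and incoherence are inherited. -/
def AsymptoticStateStable (α κ ω : ℝ) (z : ℝ → ℂ × ℂ) : Prop :=
  ∃ δ > 0, ∀ w : ℝ → ℂ × ℂ, IsSolution α κ ω w → dist (w 0) (z 0) < δ →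
    (∀ ρ₁ ρ₂ : ℝ, Tendsto (fun t => ‖(z t).1‖) atTop (𝓝 ρ₁) →
      Tendsto (fun t => ‖(z t).2‖) atTop (𝓝 ρ₂) →
      Tendsto (fun t => ‖(w t).1‖) atTop (𝓝 ρ₁) ∧
        Tendsto (fun t => ‖(w t).2‖) atTop (𝓝 ρ₂)) ∧
    (∀ θ : ℝ, PhaseLockedAt z θ → PhaseLockedAt w θ) ∧
    (Active z → Active w) ∧
    (Incoherent z → Incoherent w)

end TwinSL

end

open TwinSL

noncomputable section

namespace TwinSL

/-! ### Differential inequalities on intervals -/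

/-! The common phase is removed by passing to `N = |z₁|² + |z₂|²`, `D = |z₁|² - |z₂|²` and `u + iv =
z₁ conj z₂`. These satisfy a closed system with `N² = D² + 4(u² + v²)` (`Orbit`), and the set `R =
1` becomes `D = 0 < N`. The equation for `D` is linear and homogeneous in `D`, which gives
invariance. All the other equations consist of a scalar factor `2α - κ - N`, a constant linear map
and a `D²` term, so a few linear forms in `N, u, v` control everything.

For `κ < γ` the form `W = γN - 2κv` satisfies `W' = (2α - κ - N)W - γD²` and is comparable with `N`
(`Orbit.hW`). For `γ ≤ κ` put `a = √(κ² - γ²)/κ` and `b = γ/κ`. The forms `P± = N ± 2au - 2bv` are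
squared distances from complex eigenlines and satisfy `P±' = (2α - κ ± κa - N)P± - D²` (`Orbit.hP`).
Amplitude death follows from Riccati inequalities for `W` and `P±`, because `N` dominates them; at
`γ = κ` the form `P = N - 2v` is degenerate and a bound for `u` in terms of `P` completes the
argument (`uniform_death`).

On the manifold `D = 0` and the phase is explicit. The quotient `P₋/P₊` decays exactly like
`exp(-2κat)`, and for `γ = κ` the quotient `u/P` grows with constant speed `κ/2`. Once the phase has
a limit, `N` solves a logistic equation with converging growth rate. For `κ < γ` the phase has a
speed bounded below, so it is periodic and cannot converge.

Off the manifold with `γ ≤ κ`, the set `u ≥ 0` is forward invariant and there the `D²` terms only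
help locking (`Orbit.exp_lock`, `Orbit.algebraic_lock`), so locking is uniform over all orbits with
`u > 0` initially. Non-exceptional solutions on the manifold reach this open set. For `κ < γ` the
cones `D² ≤ mW²` are forward invariant (`Orbit.D_sq_le_W`). For `γ = κ < 2α` the form `P + r²N`
takes the place of `W`.

Lyapunov stability of active motions needs control of the phases as well. If the phase difference is
locked, `D` decays exponentially and the drift of the mean phase is integrable. If `κ < γ`, the
linear part acts by similarities of the form `W`. The cosine of the angle between two solutions in
this form then changes little, and the damping keeps the quotient of their `W` values near `1`.

For almost every datum with `γ ≤ κ < ∞` and `2α < κ`, every solution off a complex eigenline must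
reach `u > 0`. For `κ < γ` a locked solution would approach one of two eigenlines in direction. The
flow rescaled by `exp((κ - 2α)t/2)` contracts distances only by a bounded factor, so the set of such
data has measure at most a constant times that of shrinking neighbourhoods of these lines, hence
measure zero. -/

/-- `f' t` is the derivative of `f` within `S` at every `t ∈ S`. -/
def DerivOn {E : Type*} [NormedAddCommGroup E] [NormedSpace ℝ E] (f f' : ℝ → E) (S : Set ℝ) :
    Prop := ∀ t ∈ S, HasDerivWithinAt f (f' t) S t

namespace DerivOn

section Vector

variable {E : Type*} [NormedAddCommGroup E] [NormedSpace ℝ E] {f f' g g' : ℝ → E} {S T : Set ℝ}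

theorem mono (h : DerivOn f f' S) (hT : T ⊆ S) : DerivOn f f' T :=
  fun t ht => (h t (hT ht)).mono hT

theorem congr (h : DerivOn f f' S) (e : ∀ t ∈ S, f' t = g' t) : DerivOn f g' S :=
  fun t ht => e t ht ▸ h t ht

theorem continuousOn (h : DerivOn f f' S) : ContinuousOn f S :=
  fun t ht => (h t ht).continuousWithinAt

theorem shift (h : DerivOn f f' (Ici 0)) {τ : ℝ} (hτ : 0 ≤ τ) :
    DerivOn (fun t => f (t + τ)) (fun t => f' (t + τ)) (Ici 0) := by
  intro t ht
  have h1 : HasDerivWithinAt f (f' (t + τ)) (Ici 0) (t + τ) := h _ (add_nonneg ht hτ)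
  have h2 : HasDerivWithinAt (fun t : ℝ => t + τ) 1 (Ici 0) t :=
    ((hasDerivAt_id t).add_const τ).hasDerivWithinAt
  simpa [Function.comp_def] using h1.scomp t h2 (fun s hs => add_nonneg hs hτ)

theorem Ici_of_le (h : DerivOn f f' (Ici 0)) {a : ℝ} (ha : 0 ≤ a) : DerivOn f f' (Ici a) :=
  h.mono (Ici_subset_Ici.2 ha)

end Vector

variable {f f' g g' : ℝ → ℝ} {S : Set ℝ} {a b c k K M : ℝ}

theorem antitoneOn (h : DerivOn f f' S) (hS : Convex ℝ S) (hf : ∀ t ∈ S, f' t ≤ 0) :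
    AntitoneOn f S :=
  antitoneOn_of_hasDerivWithinAt_nonpos hS h.continuousOn
    (fun t ht => (h t (interior_subset ht)).mono interior_subset)
    (fun t ht => hf t (interior_subset ht))

theorem monotoneOn (h : DerivOn f f' S) (hS : Convex ℝ S) (hf : ∀ t ∈ S, 0 ≤ f' t) :
    MonotoneOn f S :=
  monotoneOn_of_hasDerivWithinAt_nonneg hS h.continuousOn
    (fun t ht => (h t (interior_subset ht)).mono interior_subset)
    (fun t ht => hf t (interior_subset ht))

theorem add (hf : DerivOn f f' S) (hg : DerivOn g g' S) :
    DerivOn (fun t => f t + g t) (fun t => f' t + g' t) S :=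
  fun t ht => (hf t ht).add (hg t ht)

theorem sub (hf : DerivOn f f' S) (hg : DerivOn g g' S) :
    DerivOn (fun t => f t - g t) (fun t => f' t - g' t) S :=
  fun t ht => (hf t ht).sub (hg t ht)

theorem neg (hf : DerivOn f f' S) : DerivOn (fun t => -f t) (fun t => -f' t) S :=
  fun t ht => (hf t ht).neg

theorem mul (hf : DerivOn f f' S) (hg : DerivOn g g' S) :
    DerivOn (fun t => f t * g t) (fun t => f' t * g t + f t * g' t) S :=
  fun t ht => (hf t ht).mul (hg t ht)

theorem const_mul (c : ℝ) (hf : DerivOn f f' S) :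
    DerivOn (fun t => c * f t) (fun t => c * f' t) S :=
  fun t ht => (hf t ht).const_mul c

theorem sq (hf : DerivOn f f' S) : DerivOn (fun t => f t ^ 2) (fun t => 2 * f t * f' t) S :=
  fun t ht => by simpa using (hf t ht).fun_pow 2

theorem div (hf : DerivOn f f' S) (hg : DerivOn g g' S) (h0 : ∀ t ∈ S, g t ≠ 0) :
    DerivOn (fun t => f t / g t) (fun t => (f' t * g t - f t * g' t) / g t ^ 2) S :=
  fun t ht => (hf t ht).div (hg t ht) (h0 t ht)

theorem log (hf : DerivOn f f' S) (h0 : ∀ t ∈ S, f t ≠ 0) :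
    DerivOn (fun t => Real.log (f t)) (fun t => f' t / f t) S :=
  fun t ht => (hf t ht).log (h0 t ht)

theorem affine (k c a : ℝ) (S : Set ℝ) : DerivOn (fun t => k + c * (t - a)) (fun _ => c) S :=
  fun t _ => by
    simpa using ((((hasDerivAt_id t).sub_const a).const_mul c).const_add k).hasDerivWithinAt

theorem exp_affine (c a : ℝ) (S : Set ℝ) :
    DerivOn (fun t => Real.exp (c * (t - a))) (fun t => Real.exp (c * (t - a)) * c) S :=
  fun t _ => by
    simpa using ((((hasDerivAt_id t).sub_const a).const_mul c).exp).hasDerivWithinAt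

/-- A function that does not increase above the level `M` stays below it. -/
theorem le_barrier (h : DerivOn f f' (Ici a)) (ha : f a ≤ M)
    (hM : ∀ t, a ≤ t → M < f t → f' t ≤ 0) {t : ℝ} (ht : a ≤ t) : f t ≤ M := by
  -- Tilting the barrier with slope `ε` makes the inequality at a contact point strict, as the
  -- comparison theorem requires.
  have key : ∀ ε > 0, f t ≤ M + ε * (1 + (t - a)) := by
    intro ε hε
    refine image_le_of_deriv_right_lt_deriv_boundary (f := f) (f' := f') (a := a) (b := t)
      (B := fun s => M + ε * (1 + (s - a))) (B' := fun _ => ε)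
      (h.continuousOn.mono Icc_subset_Ici_self)
      (fun x hx => (h x hx.1).mono (Ici_subset_Ici.2 hx.1)) (by simp; linarith) ?_ ?_
      (right_mem_Icc.2 ht)
    · intro x
      simpa using ((((hasDerivAt_id x).sub_const a).const_add 1).const_mul ε).const_add M
    · intro x hx he
      have h1 : 0 ≤ x - a := sub_nonneg.2 hx.1
      have : M < f x := by rw [he]; nlinarith [mul_nonneg hε.le h1]
      exact (hM x hx.1 this).trans_lt hε
  have hp : 0 < 1 + (t - a) := by linarith
  refine le_of_forall_pos_le_add fun ε hε => ?_
  have := key (ε / (1 + (t - a))) (by positivity)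
  rwa [div_mul_cancel₀ _ hp.ne'] at this

/-- A function that does not decrease below the level `M` stays above it. -/
theorem ge_barrier (h : DerivOn f f' (Ici a)) (ha : M ≤ f a)
    (hM : ∀ t, a ≤ t → f t < M → 0 ≤ f' t) {t : ℝ} (ht : a ≤ t) : M ≤ f t := by
  have := le_barrier (M := -M) h.neg (by linarith)
    (fun s hs h1 => by linarith [hM s hs (by linarith)]) ht
  linarith

/-- A function that decreases with a definite speed above the level `M` falls below it. -/
theorem le_of_speed (h : DerivOn f f' (Ici a)) (hM : ∀ t, a ≤ t → M < f t → f' t ≤ -c)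
    (hc : 0 ≤ c) {t : ℝ} (ht : a ≤ t) (hf : f a - M ≤ c * (t - a)) : f t ≤ M := by
  by_cases H : ∃ s ∈ Icc a t, f s ≤ M
  · obtain ⟨s, hs, hfs⟩ := H
    exact le_barrier (h.mono (Ici_subset_Ici.2 hs.1)) hfs
      (fun r hr h1 => by linarith [hM r (hs.1.trans hr) h1]) hs.2
  · push Not at H
    have h1 : DerivOn (fun r => f r + (0 + c * (r - a))) (fun r => f' r + c) (Icc a t) :=
      (h.mono Icc_subset_Ici_self).add (affine 0 c a _)
    have := h1.antitoneOn (convex_Icc a t) (fun r hr => by linarith [hM r hr.1 (H r hr)])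
      (left_mem_Icc.2 ht) (right_mem_Icc.2 ht) ht
    simp only [sub_self, mul_zero, add_zero, zero_add] at this
    linarith

theorem eventually_le_of_speed (h : DerivOn f f' (Ici a))
    (hM : ∀ t, a ≤ t → M < f t → f' t ≤ -c) (hc : 0 < c) : ∀ᶠ t in atTop, f t ≤ M := by
  filter_upwards [eventually_ge_atTop (max a (a + (f a - M) / c))] with t ht
  refine h.le_of_speed hM hc.le ((le_max_left _ _).trans ht) ?_
  have h1 := (le_max_right _ _).trans ht
  have : (f a - M) / c ≤ t - a := by linarith
  rw [div_le_iff₀ hc] at this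
  linarith

theorem le_mul_exp (h : DerivOn f f' (Ici a)) (hf : ∀ t, a ≤ t → f' t ≤ c * f t) {t : ℝ}
    (ht : a ≤ t) : f t ≤ f a * Real.exp (c * (t - a)) := by
  have h1 := (h.mul (exp_affine (-c) a _)).antitoneOn (convex_Ici a) (fun s hs => by
    have := mul_le_mul_of_nonneg_right (hf s hs) (Real.exp_pos (-c * (s - a))).le
    nlinarith) self_mem_Ici ht ht
  have e : Real.exp (-c * (t - a)) * Real.exp (c * (t - a)) = 1 := by
    rw [← Real.exp_add]; simp
  simp only [sub_self, mul_zero, Real.exp_zero, mul_one] at h1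
  have := mul_le_mul_of_nonneg_right h1 (Real.exp_pos (c * (t - a))).le
  rwa [mul_assoc, e, mul_one] at this

theorem ge_mul_exp (h : DerivOn f f' (Ici a)) (hf : ∀ t, a ≤ t → c * f t ≤ f' t) {t : ℝ}
    (ht : a ≤ t) : f a * Real.exp (c * (t - a)) ≤ f t := by
  have := h.neg.le_mul_exp (c := c) (fun s hs => by linarith [hf s hs]) ht
  linarith

theorem pos_of_ge (h : DerivOn f f' (Ici a)) (hf : ∀ t, a ≤ t → c * f t ≤ f' t) (ha : 0 < f a)
    {t : ℝ} (ht : a ≤ t) : 0 < f t :=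
  (mul_pos ha (Real.exp_pos _)).trans_le (h.ge_mul_exp hf ht)

/-- Two-sided Grönwall inequality for `|f'| ≤ K |f|`. -/
theorem two_sided (h : DerivOn f f' (Icc a b)) (hab : a ≤ b)
    (hK : ∀ t ∈ Icc a b, |f' t| ≤ K * |f t|) : (f a = 0 ↔ f b = 0) := by
  have hb : ∀ t ∈ Icc a b, |2 * f t * f' t| ≤ 2 * K * f t ^ 2 := by
    intro t ht
    rw [abs_mul, abs_mul, abs_two, ← sq_abs (f t)]
    nlinarith [mul_le_mul_of_nonneg_left (hK t ht) (abs_nonneg (f t))]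
  have h1 := (h.sq.mul (exp_affine (-(2 * K)) a _)).antitoneOn (convex_Icc a b) (fun t ht => by
      have := mul_le_mul_of_nonneg_right (abs_le.1 (hb t ht)).2 (Real.exp_pos (-(2*K) * (t - a))).le
      nlinarith) (left_mem_Icc.2 hab) (right_mem_Icc.2 hab) hab
  have h2 := (h.sq.mul (exp_affine (2 * K) a _)).monotoneOn (convex_Icc a b) (fun t ht => by
      have := mul_le_mul_of_nonneg_right (abs_le.1 (hb t ht)).1 (Real.exp_pos (2*K * (t - a))).le
      nlinarith) (left_mem_Icc.2 hab) (right_mem_Icc.2 hab) hab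
  simp only [sub_self, mul_zero, Real.exp_zero, mul_one] at h1 h2
  constructor
  · intro h0
    rw [h0] at h1
    have h3 := Real.exp_pos (-(2 * K) * (b - a))
    have : f b ^ 2 ≤ 0 := by
      by_contra hc
      push Not at hc
      nlinarith [mul_pos hc h3]
    exact pow_eq_zero_iff (two_ne_zero) |>.1 (le_antisymm this (sq_nonneg _))
  · intro h0
    rw [h0] at h2
    exact pow_eq_zero_iff (two_ne_zero) |>.1 (le_antisymm (by simpa using h2) (sq_nonneg _))

/-- Upper bound from `f' ≤ -c f²`. -/
theorem mul_affine_le_one (h : DerivOn f f' (Ici a)) (hf : ∀ t, a ≤ t → f' t ≤ -c * f t ^ 2)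
    (hc : 0 ≤ c) (hk : 0 ≤ k) (ha : f a * k ≤ 1) {t : ℝ} (ht : a ≤ t) :
    f t * (k + c * (t - a)) ≤ 1 := by
  refine (h.mul (affine k c a _)).le_barrier (by simpa using ha) ?_ ht
  intro s hs h1
  have h2 : 0 ≤ k + c * (s - a) := by
    have := mul_nonneg hc (sub_nonneg.2 hs); linarith
  have h3 : 0 < f s := by
    by_contra h4
    push Not at h4
    nlinarith
  have h5 := mul_le_mul_of_nonneg_right (hf s hs) h2
  nlinarith [mul_nonneg hc h3.le]

/-- Lower bound from `f' ≥ -c f²`. -/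
theorem one_le_mul_affine (h : DerivOn f f' (Ici a)) (hf : ∀ t, a ≤ t → -c * f t ^ 2 ≤ f' t)
    (h0 : ∀ t, a ≤ t → 0 ≤ f t)
    (hc : 0 ≤ c) (hk : 0 ≤ k) (ha : 1 ≤ f a * k) {t : ℝ} (ht : a ≤ t) :
    1 ≤ f t * (k + c * (t - a)) := by
  refine (h.mul (affine k c a _)).ge_barrier (by simpa using ha) ?_ ht
  intro s hs h1
  have h2 : 0 ≤ k + c * (s - a) := by
    have := mul_nonneg hc (sub_nonneg.2 hs); linarith
  have h5 := mul_le_mul_of_nonneg_right (hf s hs) h2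
  nlinarith [mul_nonneg hc (h0 s hs)]

theorem exists_deriv_eq (h : DerivOn f f' (Ici a)) {s t : ℝ} (hs : a ≤ s) (hst : s < t) :
    ∃ ξ ∈ Ioo s t, f' ξ = (f t - f s) / (t - s) := by
  refine exists_hasDerivAt_eq_slope f f' hst
    (h.continuousOn.mono fun x hx => hs.trans hx.1) fun x hx => ?_
  have hx' : a < x := hs.trans_lt hx.1
  exact (h x hx'.le).hasDerivAt (Ici_mem_nhds hx')

/-- If a function and its derivative converge, then the derivative tends to zero. -/
theorem limit_deriv_eq_zero (h : DerivOn f f' (Ici a)) {L c : ℝ} (hL : Tendsto f atTop (𝓝 L))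
    (hc : Tendsto f' atTop (𝓝 c)) : c = 0 := by
  have h1 : ∀ t, ∃ ξ, t ≤ ξ ∧ (a ≤ t → f' ξ = f (t + 1) - f t) := by
    intro t
    by_cases ht : a ≤ t
    · obtain ⟨ξ, hξ, e⟩ := h.exists_deriv_eq ht (lt_add_one t)
      exact ⟨ξ, hξ.1.le, fun _ => by simpa using e⟩
    · exact ⟨t, le_rfl, fun h => absurd h ht⟩
  choose ξ hξ e using h1
  have h2 : Tendsto (fun t => f' (ξ t)) atTop (𝓝 c) :=
    hc.comp (tendsto_atTop_mono hξ tendsto_id)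
  have h3 : Tendsto (fun t => f (t + 1) - f t) atTop (𝓝 (L - L)) :=
    (hL.comp (tendsto_atTop_add_const_right _ 1 tendsto_id)).sub hL
  rw [sub_self] at h3
  refine tendsto_nhds_unique (h2.congr' ?_) h3
  filter_upwards [eventually_ge_atTop a] with t ht using e t ht

/-- A variant of Barbalat's lemma: if `f` converges and `f' - g` tends to zero for some `g` with
bounded derivative, then `g` tends to zero. -/
theorem tendsto_zero_of_sub {L : ℝ} (h : DerivOn f f' (Ici a))
    (h2 : DerivOn g g' (Ici a)) (hK : ∀ t, a ≤ t → |g' t| ≤ K) (hL : Tendsto f atTop (𝓝 L))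
    (hfg : Tendsto (fun t => f' t - g t) atTop (𝓝 0)) : Tendsto g atTop (𝓝 0) := by
  have hK0 : 0 ≤ K := (abs_nonneg _).trans (hK a le_rfl)
  rw [Metric.tendsto_atTop]
  intro ε hε
  -- Over an interval of this length `g` varies by at most `ε / 4`. The mean value theorem finds a
  -- point of the interval where `|f'| < ε / 4`, because the increment of `f` is eventually small
  -- compared with `δ`.
  set δ : ℝ := ε / (4 * (K + 1)) with hδ
  have hδ0 : 0 < δ := by positivity
  have h3 : Tendsto (fun t => f (t + δ) - f t) atTop (𝓝 (L - L)) :=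
    (hL.comp (tendsto_atTop_add_const_right _ δ tendsto_id)).sub hL
  rw [sub_self, Metric.tendsto_atTop] at h3
  obtain ⟨T, hT⟩ := h3 (δ * (ε / 4)) (by positivity)
  rw [Metric.tendsto_atTop] at hfg
  obtain ⟨T', hT'⟩ := hfg (ε / 4) (by positivity)
  refine ⟨max a (max T T'), fun t ht => ?_⟩
  have hat : a ≤ t := (le_max_left _ _).trans ht
  have hmt := (le_max_right a (max T T')).trans ht
  obtain ⟨ξ, hξ, e⟩ := h.exists_deriv_eq hat (lt_add_of_pos_right t hδ0)
  obtain ⟨η, hη, e2⟩ := h2.exists_deriv_eq hat hξ.1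
  have h4 := hT t ((le_max_left _ _).trans hmt)
  have h9 := hT' ξ (((le_max_right _ _).trans hmt).trans hξ.1.le)
  rw [Real.dist_eq, sub_zero] at h4 h9 ⊢
  have h5 : |f' ξ| < ε / 4 := by
    rw [e, add_sub_cancel_left, abs_div, abs_of_pos hδ0, div_lt_iff₀ hδ0]
    linarith
  have hd : 0 < ξ - t := sub_pos.2 hξ.1
  have h6 : |g ξ - g t| ≤ K * δ := by
    have h7 : g ξ - g t = g' η * (ξ - t) := by
      rw [e2, div_mul_cancel₀ _ hd.ne']
    rw [h7, abs_mul, abs_of_pos hd]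
    exact mul_le_mul (hK η (hat.trans hη.1.le)) (by linarith [hξ.2]) hd.le hK0
  have h8 : K * δ ≤ ε / 4 := by
    have : (K + 1) * δ = ε / 4 := by rw [hδ]; field_simp
    nlinarith
  rw [abs_lt] at h5 h9 ⊢
  rw [abs_le] at h6
  constructor <;> linarith [h5.1, h5.2, h9.1, h9.2, h6.1, h6.2]

/-- Barbalat's lemma, for a bounded second derivative. -/
theorem tendsto_deriv_zero {f'' : ℝ → ℝ} (h : DerivOn f f' (Ici a)) (h2 : DerivOn f' f'' (Ici a))
    (hK : ∀ t, a ≤ t → |f'' t| ≤ K) {L : ℝ} (hL : Tendsto f atTop (𝓝 L)) :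
    Tendsto f' atTop (𝓝 0) :=
  h.tendsto_zero_of_sub h2 hK hL (by simp)

/-- Solutions of a logistic equation with converging growth rate. -/
theorem tendsto_logistic {r : ℝ → ℝ} {B : ℝ} (h : DerivOn f f' (Ici a))
    (hf : ∀ t, a ≤ t → f' t = f t * (r t - f t)) (h0 : ∀ t, a ≤ t → 0 < f t)
    (hr : Tendsto r atTop (𝓝 B)) : Tendsto f atTop (𝓝 (max B 0)) := by
  have upper : ∀ M, max B 0 < M → ∀ᶠ t in atTop, f t ≤ M := by
    intro M hM
    have hB : B < M := (le_max_left _ _).trans_lt hM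
    have hM0 : 0 < M := (le_max_right _ _).trans_lt hM
    obtain ⟨T, hT⟩ := eventually_atTop.1 (hr.eventually_lt_const (show B < (B + M) / 2 by linarith))
    refine (h.mono (Ici_subset_Ici.2 (le_max_left a T))).eventually_le_of_speed
      (c := M * ((M - B) / 2)) (fun t ht h1 => ?_) (by have : 0 < M - B := by linarith
                                                       positivity)
    rw [hf t ((le_max_left _ _).trans ht)]
    have h2 := hT t ((le_max_right _ _).trans ht)
    nlinarith
  -- Below the level `m` the logarithmic derivative `r - f` is at least `(B - m) / 2`, so `log f`
  -- rises with a definite speed.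
  have lower : ∀ m, 0 < m → m < B → ∀ᶠ t in atTop, m ≤ f t := by
    intro m hm hB
    obtain ⟨T, hT⟩ := eventually_atTop.1 (hr.eventually_const_lt (show (B + m) / 2 < B by linarith))
    have h1 := ((h.mono (Ici_subset_Ici.2 (le_max_left a T))).log
      (fun t ht => (h0 t ((le_max_left _ _).trans ht)).ne')).neg
    have := h1.eventually_le_of_speed (M := -Real.log m) (c := (B - m) / 2) (fun t ht h2 => ?_)
      (by linarith)
    · filter_upwards [this, eventually_ge_atTop a] with t ht hat
      exact (Real.log_le_log_iff hm (h0 t hat)).1 (by linarith)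
    · have hat := (le_max_left _ _).trans ht
      have h3 := h0 t hat
      have h4 : f t < m := (Real.log_lt_log_iff h3 hm).1 (by linarith)
      have h5 := hT t ((le_max_right _ _).trans ht)
      rw [hf t hat, mul_div_cancel_left₀ _ h3.ne']
      linarith
  rw [tendsto_order]
  constructor
  · intro m hm
    by_cases hm0 : m < 0
    · filter_upwards [eventually_ge_atTop a] with t ht using hm0.trans (h0 t ht)
    · push Not at hm0
      have hB : m < B := by
        rcases max_lt_iff.not.1 (not_lt.2 hm.le) with _
        rcases lt_max_iff.1 hm with h | h
        · exact h
        · exact absurd h (not_lt.2 hm0)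
      filter_upwards [lower ((m + B) / 2) (by linarith) (by linarith)] with t ht
      linarith
  · intro M hM
    filter_upwards [upper ((max B 0 + M) / 2) (by linarith)] with t ht
    linarith

end DerivOn

/-- A differential inequality `f' ≤ -c f` that holds eventually gives an exponential bound. -/
theorem exists_exp_bound {f f' : ℝ → ℝ} {c : ℝ} (h : DerivOn f f' (Ici 0))
    (h0 : ∀ t, 0 ≤ t → 0 ≤ f t) (hf : ∀ᶠ t in atTop, f' t ≤ -c * f t) :
    ∃ C, 0 ≤ C ∧ ∀ t, 0 ≤ t → f t ≤ C * Real.exp (-(c * t)) := by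
  obtain ⟨T, hT⟩ := eventually_atTop.1 hf
  have hT0 : 0 ≤ max T 0 := le_max_right _ _
  have hcont : ContinuousOn (fun t => f t * Real.exp (c * t)) (Icc 0 (max T 0)) :=
    (h.continuousOn.mono Icc_subset_Ici_self).mul (by fun_prop)
  obtain ⟨B, hB⟩ := (isCompact_Icc.bddAbove_image hcont)
  have hB' : ∀ t ∈ Icc 0 (max T 0), f t * Real.exp (c * t) ≤ B :=
    fun t ht => hB (mem_image_of_mem _ ht)
  have key : ∀ t, 0 ≤ t → f t * Real.exp (c * t) ≤ B := by
    intro t ht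
    rcases le_total t (max T 0) with h1 | h1
    · exact hB' t ⟨ht, h1⟩
    · have h2 := (h.Ici_of_le hT0).le_mul_exp (c := -c)
        (fun s hs => hT s ((le_max_left _ _).trans hs)) h1
      have h3 := mul_le_mul_of_nonneg_right h2 (Real.exp_pos (c * t)).le
      rw [mul_assoc, ← Real.exp_add] at h3
      have e : -c * (t - max T 0) + c * t = c * max T 0 := by ring
      rw [e] at h3
      exact h3.trans (hB' _ (right_mem_Icc.2 hT0))
  refine ⟨B, ?_, fun t ht => ?_⟩
  · exact (mul_nonneg (h0 0 le_rfl) (Real.exp_pos _).le).trans (key 0 le_rfl)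
  · rw [Real.exp_neg, ← div_eq_mul_inv, le_div_iff₀ (Real.exp_pos _)]
    exact key t ht

/-! ### Stokes variables -/

/-- `|z₁|² + |z₂|²`. -/
def stokesN (w : ℂ × ℂ) : ℝ := Complex.normSq w.1 + Complex.normSq w.2

/-- `|z₁|² - |z₂|²`. -/
def stokesD (w : ℂ × ℂ) : ℝ := Complex.normSq w.1 - Complex.normSq w.2

/-- Real part of `z₁ * conj z₂`. -/
def stokesU (w : ℂ × ℂ) : ℝ := w.1.re * w.2.re + w.1.im * w.2.im

/-- Imaginary part of `z₁ * conj z₂`. -/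
def stokesV (w : ℂ × ℂ) : ℝ := w.1.im * w.2.re - w.1.re * w.2.im

theorem stokesN_nonneg (w : ℂ × ℂ) : 0 ≤ stokesN w :=
  add_nonneg (Complex.normSq_nonneg _) (Complex.normSq_nonneg _)

theorem stokes_identity (w : ℂ × ℂ) :
    stokesN w ^ 2 = stokesD w ^ 2 + 4 * (stokesU w ^ 2 + stokesV w ^ 2) := by
  simp only [stokesN, stokesD, stokesU, stokesV, Complex.normSq_apply]; ring

theorem stokesN_eq (w : ℂ × ℂ) : stokesN w = ‖w.1‖ ^ 2 + ‖w.2‖ ^ 2 := by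
  simp [stokesN, Complex.normSq_eq_norm_sq]

theorem stokesD_eq (w : ℂ × ℂ) : stokesD w = ‖w.1‖ ^ 2 - ‖w.2‖ ^ 2 := by
  simp [stokesD, Complex.normSq_eq_norm_sq]

theorem stokesN_pos_iff {w : ℂ × ℂ} : 0 < stokesN w ↔ w ≠ 0 := by
  rw [stokesN_eq, Ne, Prod.ext_iff, not_and_or]
  constructor
  · intro h
    by_contra hc
    push Not at hc
    simp [hc.1, hc.2] at h
  · rintro (h | h)
    · have := norm_pos_iff.2 h; positivity
    · have := norm_pos_iff.2 h; positivity

theorem norm_le_sqrt_stokesN (w : ℂ × ℂ) : ‖w‖ ≤ √(stokesN w) := by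
  rw [stokesN_eq, Prod.norm_def]
  exact max_le (Real.le_sqrt_of_sq_le (by nlinarith [sq_nonneg ‖w.2‖]))
    (Real.le_sqrt_of_sq_le (by nlinarith [sq_nonneg ‖w.1‖]))

theorem stokesN_le_norm (w : ℂ × ℂ) : stokesN w ≤ 2 * ‖w‖ ^ 2 := by
  rw [stokesN_eq]
  have h1 : ‖w.1‖ ≤ ‖w‖ := norm_fst_le w
  have h2 : ‖w.2‖ ≤ ‖w‖ := norm_snd_le w
  nlinarith [norm_nonneg w.1, norm_nonneg w.2]

theorem continuous_stokesN : Continuous stokesN := by unfold stokesN; fun_prop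
theorem continuous_stokesD : Continuous stokesD := by unfold stokesD; fun_prop
theorem continuous_stokesU : Continuous stokesU := by unfold stokesU; fun_prop
theorem continuous_stokesV : Continuous stokesV := by unfold stokesV; fun_prop

/-- The real form of the field. -/
theorem field_re_im (α κ ω : ℝ) (w : ℂ × ℂ) :
    ((field α κ ω w).1.re = (α - Complex.normSq w.1) * w.1.re - ω * w.1.im
        + κ / 2 * (w.2.re - w.1.re)) ∧
    ((field α κ ω w).1.im = (α - Complex.normSq w.1) * w.1.im + ω * w.1.re
        + κ / 2 * (w.2.im - w.1.im)) ∧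
    ((field α κ ω w).2.re = (α - Complex.normSq w.2) * w.2.re + ω * w.2.im
        + κ / 2 * (w.1.re - w.2.re)) ∧
    ((field α κ ω w).2.im = (α - Complex.normSq w.2) * w.2.im - ω * w.2.re
        + κ / 2 * (w.1.im - w.2.im)) := by
  have e1 : ((‖w.1‖ : ℂ)) ^ 2 = ((Complex.normSq w.1 : ℝ) : ℂ) := by
    rw [Complex.normSq_eq_norm_sq]; push_cast; rfl
  have e2 : ((‖w.2‖ : ℂ)) ^ 2 = ((Complex.normSq w.2 : ℝ) : ℂ) := by
    rw [Complex.normSq_eq_norm_sq]; push_cast; rfl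
  have e3 : (κ : ℂ) / 2 = ((κ / 2 : ℝ) : ℂ) := by push_cast; rfl
  simp only [field, e1, e2, e3]
  refine ⟨?_, ?_, ?_, ?_⟩ <;> (simp; try ring)

section Derivatives

variable {z : ℝ → ℂ × ℂ} {z' : ℂ × ℂ} {S : Set ℝ} {t : ℝ}

theorem hasDerivWithinAt_coords (h : HasDerivWithinAt z z' S t) :
    HasDerivWithinAt (fun s => (z s).1.re) z'.1.re S t ∧
    HasDerivWithinAt (fun s => (z s).1.im) z'.1.im S t ∧
    HasDerivWithinAt (fun s => (z s).2.re) z'.2.re S t ∧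
    HasDerivWithinAt (fun s => (z s).2.im) z'.2.im S t := by
  have h1 : HasDerivWithinAt (fun s => (z s).1) z'.1 S t :=
    (ContinuousLinearMap.fst ℝ ℂ ℂ).hasFDerivAt.comp_hasDerivWithinAt t h
  have h2 : HasDerivWithinAt (fun s => (z s).2) z'.2 S t :=
    (ContinuousLinearMap.snd ℝ ℂ ℂ).hasFDerivAt.comp_hasDerivWithinAt t h
  exact ⟨Complex.reCLM.hasFDerivAt.comp_hasDerivWithinAt t h1,
    Complex.imCLM.hasFDerivAt.comp_hasDerivWithinAt t h1,
    Complex.reCLM.hasFDerivAt.comp_hasDerivWithinAt t h2,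
    Complex.imCLM.hasFDerivAt.comp_hasDerivWithinAt t h2⟩

theorem hasDerivWithinAt_stokesN (h : HasDerivWithinAt z z' S t) :
    HasDerivWithinAt (fun s => stokesN (z s))
      (2 * ((z t).1.re * z'.1.re + (z t).1.im * z'.1.im + (z t).2.re * z'.2.re
        + (z t).2.im * z'.2.im)) S t := by
  obtain ⟨a, b, c, d⟩ := hasDerivWithinAt_coords h
  simp only [stokesN, Complex.normSq_apply]
  exact (((a.mul a).add (b.mul b)).add ((c.mul c).add (d.mul d))).congr_deriv (by ring)

variable {α κ ω : ℝ}

theorem IsSolutionOn.stokesN (h : IsSolutionOn α κ ω S z) :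
    DerivOn (fun t => stokesN (z t)) (fun t => (2 * α - κ) * stokesN (z t) - stokesN (z t) ^ 2
      - stokesD (z t) ^ 2 + 2 * κ * stokesU (z t)) S := by
  intro t ht
  refine (hasDerivWithinAt_stokesN (h t ht)).congr_deriv ?_
  obtain ⟨a, b, c, d⟩ := field_re_im α κ ω (z t)
  rw [a, b, c, d]
  simp only [TwinSL.stokesN, stokesD, stokesU, Complex.normSq_apply]
  ring

theorem IsSolutionOn.stokesD (h : IsSolutionOn α κ ω S z) :
    DerivOn (fun t => stokesD (z t))
      (fun t => (2 * α - κ - 2 * TwinSL.stokesN (z t)) * stokesD (z t)) S := by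
  intro t ht
  obtain ⟨a, b, c, d⟩ := hasDerivWithinAt_coords (h t ht)
  simp only [TwinSL.stokesD, Complex.normSq_apply]
  refine (((a.mul a).add (b.mul b)).sub ((c.mul c).add (d.mul d))).congr_deriv ?_
  obtain ⟨a, b, c, d⟩ := field_re_im α κ ω (z t)
  rw [a, b, c, d]
  simp only [TwinSL.stokesN, Complex.normSq_apply]
  ring

theorem IsSolutionOn.stokesU (h : IsSolutionOn α κ ω S z) :
    DerivOn (fun t => stokesU (z t))
      (fun t => (2 * α - κ - TwinSL.stokesN (z t)) * stokesU (z t) - 2 * ω * stokesV (z t)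
        + κ / 2 * TwinSL.stokesN (z t)) S := by
  intro t ht
  obtain ⟨a, b, c, d⟩ := hasDerivWithinAt_coords (h t ht)
  simp only [TwinSL.stokesU]
  refine ((a.mul c).add (b.mul d)).congr_deriv ?_
  obtain ⟨a, b, c, d⟩ := field_re_im α κ ω (z t)
  rw [a, b, c, d]
  simp only [TwinSL.stokesN, stokesV, Complex.normSq_apply]
  ring

theorem IsSolutionOn.stokesV (h : IsSolutionOn α κ ω S z) :
    DerivOn (fun t => stokesV (z t))
      (fun t => (2 * α - κ - TwinSL.stokesN (z t)) * stokesV (z t)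
        + 2 * ω * TwinSL.stokesU (z t)) S := by
  intro t ht
  obtain ⟨a, b, c, d⟩ := hasDerivWithinAt_coords (h t ht)
  simp only [TwinSL.stokesV]
  refine ((b.mul c).sub (a.mul d)).congr_deriv ?_
  obtain ⟨a, b, c, d⟩ := field_re_im α κ ω (z t)
  rw [a, b, c, d]
  simp only [TwinSL.stokesN, TwinSL.stokesU, Complex.normSq_apply]
  ring

end Derivatives

/-! ### Existence, boundedness, continuous dependence -/

theorem contDiff_field (α κ ω : ℝ) : ContDiff ℝ 1 (field α κ ω) := by
  have e : field α κ ω = fun w : ℂ × ℂ =>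
      (((α : ℂ) + Complex.I * (ω : ℂ) - w.1 * Complex.conjCLE w.1) * w.1
        + ((κ : ℂ) / 2) * (w.2 - w.1),
       ((α : ℂ) - Complex.I * (ω : ℂ) - w.2 * Complex.conjCLE w.2) * w.2
        + ((κ : ℂ) / 2) * (w.1 - w.2)) := by
    funext w
    simp [field, Complex.mul_conj, Complex.normSq_eq_norm_sq]
  rw [e]
  fun_prop

/-- The field, cut off outside a large ball. -/
def cutField (α κ ω r : ℝ) (hr : 0 < r) (w : ℂ × ℂ) : ℂ × ℂ :=
  (ContDiffBump.mk r (r + 1) hr (lt_add_one r) : ContDiffBump (0 : ℂ × ℂ)) w • field α κ ω w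

theorem cutField_eq {α κ ω r : ℝ} (hr : 0 < r) {w : ℂ × ℂ} (hw : ‖w‖ ≤ r) :
    cutField α κ ω r hr w = field α κ ω w := by
  rw [cutField, ContDiffBump.one_of_mem_closedBall, one_smul]
  simpa using hw

theorem cutField_lipschitz (α κ ω r : ℝ) (hr : 0 < r) :
    (∃ K, LipschitzWith K (cutField α κ ω r hr)) ∧ ∃ L, ∀ w, ‖cutField α κ ω r hr w‖ ≤ L := by
  set b : ContDiffBump (0 : ℂ × ℂ) := ContDiffBump.mk r (r + 1) hr (lt_add_one r)
  have h1 : ContDiff ℝ 1 (cutField α κ ω r hr) := by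
    have hb : ContDiff ℝ 1 b := by exact_mod_cast b.contDiff (n := 1)
    exact hb.smul (contDiff_field α κ ω)
  have h2 : HasCompactSupport (cutField α κ ω r hr) := b.hasCompactSupport.smul_right
  exact ⟨h1.lipschitzWith_of_hasCompactSupport h2 one_ne_zero,
    h2.exists_bound_of_continuous h1.continuous⟩

/-- The energy decreases on large spheres. -/
theorem energy_rate_le {α κ : ℝ} (hκ : 0 < κ) (w : ℂ × ℂ) :
    (2 * α - κ) * stokesN w - stokesN w ^ 2 - stokesD w ^ 2 + 2 * κ * stokesU w
      ≤ 2 * α * stokesN w - stokesN w ^ 2 := by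
  have h : 2 * stokesU w ≤ stokesN w := by
    simp only [stokesU, stokesN, Complex.normSq_apply]
    nlinarith [sq_nonneg (w.1.re - w.2.re), sq_nonneg (w.1.im - w.2.im)]
  nlinarith [sq_nonneg (stokesD w)]

/-- The factor `b` is the value of the cut-off along the curve. The bound thus holds before the
curve is known to solve the original system, which is what allows the cut-off to be removed; `b = 1`
covers true solutions. -/
theorem stokesN_le_of_cut {α κ ω : ℝ} (hκ : 0 < κ) {z : ℝ → ℂ × ℂ} {b : ℝ → ℝ}
    (hb : ∀ t, 0 ≤ b t) {M : ℝ} (hM : 2 * α ≤ M) (hM0 : 0 ≤ M)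
    (hz : ∀ t, 0 ≤ t → HasDerivWithinAt z (b t • field α κ ω (z t)) (Ici 0) t)
    (h0 : stokesN (z 0) ≤ M) {t : ℝ} (ht : 0 ≤ t) : stokesN (z t) ≤ M := by
  have hd : DerivOn (fun t => stokesN (z t)) (fun t => b t * ((2 * α - κ) * stokesN (z t)
      - stokesN (z t) ^ 2 - stokesD (z t) ^ 2 + 2 * κ * stokesU (z t))) (Ici 0) := by
    intro t ht
    refine (hasDerivWithinAt_stokesN (hz t ht)).congr_deriv ?_
    obtain ⟨a, b, c, d⟩ := field_re_im α κ ω (z t)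
    simp only [Prod.smul_fst, Prod.smul_snd, Complex.smul_re, Complex.smul_im, smul_eq_mul]
    rw [a, b, c, d]
    simp only [stokesN, stokesD, stokesU, Complex.normSq_apply]
    ring
  refine hd.le_barrier h0 (fun s _ h1 => ?_) ht
  refine mul_nonpos_of_nonneg_of_nonpos (hb s) ((energy_rate_le hκ _).trans ?_)
  nlinarith

theorem stokesN_le {α κ ω : ℝ} (hκ : 0 < κ) {z : ℝ → ℂ × ℂ} (hz : IsSolution α κ ω z) {M : ℝ}
    (hM : 2 * α ≤ M) (hM0 : 0 ≤ M) (h0 : stokesN (z 0) ≤ M) {t : ℝ} (ht : 0 ≤ t) :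
    stokesN (z t) ≤ M :=
  stokesN_le_of_cut hκ (b := fun _ => 1) (fun _ => zero_le_one) hM hM0
    (fun s hs => by simpa using hz s hs) h0 ht

/-- Global solutions of a bounded Lipschitz field on `[0, ∞)`. -/
theorem exists_global_of_lipschitz {E : Type*} [NormedAddCommGroup E] [NormedSpace ℝ E]
    [CompleteSpace E] {G : E → E} {K : NNReal} (hK : LipschitzWith K G) {L : ℝ}
    (hL : ∀ w, ‖G w‖ ≤ L) (p : E) :
    ∃ z : ℝ → E, z 0 = p ∧ ∀ t, 0 ≤ t → HasDerivWithinAt z (G (z t)) (Ici 0) t := by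
  have hL0 : 0 ≤ L := (norm_nonneg _).trans (hL p)
  have h1 : ∀ n : ℕ, ∃ y : ℝ → E, y 0 = p ∧
      ∀ t ∈ Icc (0 : ℝ) n, HasDerivWithinAt y (G (y t)) (Icc 0 n) t := by
    intro n
    have hn : (0 : ℝ) ≤ n := n.cast_nonneg
    have := (IsPicardLindelof.of_time_independent (f := G) (tmin := 0) (tmax := n)
      (t₀ := ⟨0, left_mem_Icc.2 hn⟩) (x₀ := p) (a := ⟨L * n, by positivity⟩) (r := 0)
      (L := ⟨L, hL0⟩) (K := K) (fun x _ => hL x) hK.lipschitzOnWith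
      (by simp only [sub_zero, sub_self, NNReal.coe_zero, max_eq_left hn]; exact le_rfl)).exists_eq_forall_mem_Icc_hasDerivWithinAt₀
    exact this
  choose y hy0 hy using h1
  have hder : ∀ n : ℕ, ∀ b : ℝ, b ≤ n → ∀ t ∈ Ico (0 : ℝ) b,
      HasDerivWithinAt (y n) (G (y n t)) (Ici t) t := by
    intro n b hb t ht
    refine (hy n t ⟨ht.1, ht.2.le.trans hb⟩).mono_of_mem_nhdsWithin ?_
    exact mem_of_superset (Icc_mem_nhdsGE (ht.2.trans_le hb)) (Icc_subset_Icc_left ht.1)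
  have hag : ∀ m n : ℕ, ∀ t : ℝ, 0 ≤ t → t ≤ m → t ≤ n → y m t = y n t := by
    intro m n t h0 hm hn
    refine ODE_solution_unique (v := fun _ => G) (a := 0) (b := t) (fun _ => hK)
      (fun s hs => ((hy m s ⟨hs.1, hs.2.trans hm⟩).continuousWithinAt).mono
        (Icc_subset_Icc_right hm)) (hder m t hm)
      (fun s hs => ((hy n s ⟨hs.1, hs.2.trans hn⟩).continuousWithinAt).mono
        (Icc_subset_Icc_right hn)) (hder n t hn) (by rw [hy0, hy0]) (right_mem_Icc.2 h0)
  -- The index `⌊t⌋₊ + 1` exceeds `t`, so the chosen local solution is defined there. By uniqueness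
  -- the glued function equals `y (⌊t⌋₊ + 2)` on an interval that reaches beyond `t`, hence it has
  -- the right derivative at `t`.
  refine ⟨fun t => y (⌊t⌋₊ + 1) t, by simp [hy0], fun t ht => ?_⟩
  have hlt : t < (⌊t⌋₊ + 2 : ℕ) := by
    have := Nat.lt_floor_add_one t
    push_cast; linarith
  have he : ∀ s ∈ Icc (0 : ℝ) (⌊t⌋₊ + 2 : ℕ), y (⌊s⌋₊ + 1) s = y (⌊t⌋₊ + 2) s := by
    intro s hs
    refine hag _ _ s hs.1 ?_ hs.2
    have := Nat.lt_floor_add_one s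
    push_cast; linarith
  have h2 := hy (⌊t⌋₊ + 2) t ⟨ht, hlt.le⟩
  rw [← he t ⟨ht, hlt.le⟩] at h2
  have h3 := h2.congr he (he t ⟨ht, hlt.le⟩)
  refine h3.mono_of_mem_nhdsWithin ?_
  rw [← Ici_inter_Iic]
  exact inter_mem_nhdsWithin _ (Iic_mem_nhds hlt)

theorem exists_solution {α κ : ℝ} (ω : ℝ) (hκ : 0 < κ) (p : ℂ × ℂ) :
    ∃ z : ℝ → ℂ × ℂ, IsSolution α κ ω z ∧ z 0 = p := by
  set M : ℝ := max (2 * α) (stokesN p) with hM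
  have hM0 : 0 ≤ M := (stokesN_nonneg p).trans (le_max_right _ _)
  have hr : 0 < √M + 1 := by positivity
  obtain ⟨⟨K, hK⟩, L, hL⟩ := cutField_lipschitz α κ ω (√M + 1) hr
  obtain ⟨z, hz0, hz⟩ := exists_global_of_lipschitz hK hL p
  refine ⟨z, fun t ht => ?_, hz0⟩
  have h1 := stokesN_le_of_cut (α := α) (ω := ω) hκ (z := z) (M := M)
    (b := fun t => (ContDiffBump.mk (√M + 1) (√M + 1 + 1) hr (lt_add_one _) :
      ContDiffBump (0 : ℂ × ℂ)) (z t)) (fun t => ContDiffBump.nonneg _) (le_max_left _ _) hM0 hz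
    (by rw [hz0]; exact le_max_right _ _) ht
  have h2 : ‖z t‖ ≤ √M + 1 :=
    (norm_le_sqrt_stokesN _).trans ((Real.sqrt_le_sqrt h1).trans (by linarith))
  have := hz t ht
  rwa [cutField_eq hr h2] at this

/-- Solutions starting in a ball depend on the initial point in a Lipschitz way. -/
theorem exists_dist_le {α κ : ℝ} (ω : ℝ) (hκ : 0 < κ) (M : ℝ) :
    ∃ K : ℝ, 0 ≤ K ∧ ∀ z w : ℝ → ℂ × ℂ, IsSolution α κ ω z → IsSolution α κ ω w →
      stokesN (z 0) ≤ M → stokesN (w 0) ≤ M →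
      ∀ t, 0 ≤ t → dist (w t) (z t) ≤ dist (w 0) (z 0) * Real.exp (K * t) := by
  set M' : ℝ := max (max (2 * α) M) 0 with hM
  have hr : 0 < √M' + 1 := by positivity
  obtain ⟨⟨K, hK⟩, -⟩ := cutField_lipschitz α κ ω (√M' + 1) hr
  have key : ∀ z : ℝ → ℂ × ℂ, IsSolution α κ ω z → stokesN (z 0) ≤ M → ∀ t, 0 ≤ t →
      HasDerivWithinAt z (cutField α κ ω (√M' + 1) hr (z t)) (Ici 0) t := by
    intro z hz h0 t ht
    have h1 := stokesN_le hκ hz (M := M') ((le_max_left _ _).trans (le_max_left _ _))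
      (le_max_right _ _) (h0.trans ((le_max_right _ _).trans (le_max_left _ _))) ht
    have h2 : ‖z t‖ ≤ √M' + 1 :=
      (norm_le_sqrt_stokesN _).trans ((Real.sqrt_le_sqrt h1).trans (by linarith))
    rw [cutField_eq hr h2]
    exact hz t ht
  refine ⟨K, K.2, fun z w hz hw hz0 hw0 t ht => ?_⟩
  have := dist_le_of_trajectories_ODE (v := fun _ => cutField α κ ω (√M' + 1) hr) (a := 0) (b := t)
    (fun _ => hK)
    (fun s hs => ((hw s hs.1).continuousWithinAt).mono Icc_subset_Ici_self)
    (fun s hs => (key w hw hw0 s hs.1).mono (Ici_subset_Ici.2 hs.1))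
    (fun s hs => ((hz s hs.1).continuousWithinAt).mono Icc_subset_Ici_self)
    (fun s hs => (key z hz hz0 s hs.1).mono (Ici_subset_Ici.2 hs.1)) le_rfl t (right_mem_Icc.2 ht)
  simpa using this

theorem solution_unique {α κ ω : ℝ} (hκ : 0 < κ) {z w : ℝ → ℂ × ℂ} (hz : IsSolution α κ ω z)
    (hw : IsSolution α κ ω w) (h0 : w 0 = z 0) {t : ℝ} (ht : 0 ≤ t) : w t = z t := by
  obtain ⟨K, -, hK⟩ := exists_dist_le (α := α) ω hκ (stokesN (z 0))
  have := hK z w hz hw le_rfl (by rw [h0]) t ht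
  rw [h0, dist_self, zero_mul] at this
  exact dist_le_zero.1 this

/-- Continuous dependence on compact time intervals. -/
theorem continuous_dependence {α κ ω : ℝ} (hκ : 0 < κ) {z : ℝ → ℂ × ℂ} (hz : IsSolution α κ ω z)
    (T : ℝ) {ε : ℝ} (hε : 0 < ε) :
    ∃ δ > 0, ∀ w : ℝ → ℂ × ℂ, IsSolution α κ ω w → dist (w 0) (z 0) < δ →
      ∀ t, 0 ≤ t → t ≤ T → dist (w t) (z t) < ε := by
  set M := 2 * (‖z 0‖ + 1) ^ 2
  obtain ⟨K, hK0, hK⟩ := exists_dist_le (α := α) ω hκ M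
  refine ⟨min 1 (ε * Real.exp (-(K * T))), lt_min one_pos (by positivity), ?_⟩
  intro w hw hd t ht htT
  have hz0 : stokesN (z 0) ≤ M := (stokesN_le_norm _).trans (by
    simp only [M]; gcongr; linarith)
  have hw0 : stokesN (w 0) ≤ M := by
    refine (stokesN_le_norm _).trans ?_
    have h1 : ‖w 0‖ ≤ ‖z 0‖ + 1 := by
      have h2 := norm_le_norm_add_norm_sub' (w 0) (z 0)
      have h3 := hd.trans_le (min_le_left _ _)
      rw [dist_eq_norm] at h3
      linarith
    simp only [M]; gcongr
  calc dist (w t) (z t) ≤ dist (w 0) (z 0) * Real.exp (K * t) := hK z w hz hw hz0 hw0 t ht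
    _ ≤ dist (w 0) (z 0) * Real.exp (K * T) := by gcongr
    _ < ε * Real.exp (-(K * T)) * Real.exp (K * T) := by
        gcongr; exact hd.trans_le (min_le_right _ _)
    _ = ε := by rw [mul_assoc, ← Real.exp_add]; simp

/-! ### The Stokes system -/

/-- Functions on `[0, ∞)` that satisfy the closed system for the Stokes variables. -/
structure Orbit (α κ γ : ℝ) (N D u v : ℝ → ℝ) : Prop where
  hN : DerivOn N (fun t => (2 * α - κ) * N t - N t ^ 2 - D t ^ 2 + 2 * κ * u t) (Ici 0)
  hD : DerivOn D (fun t => (2 * α - κ - 2 * N t) * D t) (Ici 0)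
  hu : DerivOn u (fun t => (2 * α - κ - N t) * u t - γ * v t + κ / 2 * N t) (Ici 0)
  hv : DerivOn v (fun t => (2 * α - κ - N t) * v t + γ * u t) (Ici 0)
  nonneg : ∀ t, 0 ≤ N t
  ident : ∀ t, N t ^ 2 = D t ^ 2 + 4 * (u t ^ 2 + v t ^ 2)

theorem IsSolutionOn.orbit {α κ ω γ : ℝ} {z : ℝ → ℂ × ℂ} (hz : IsSolution α κ ω z)
    (hγ : γ = 2 * ω) :
    Orbit α κ γ (fun t => TwinSL.stokesN (z t)) (fun t => TwinSL.stokesD (z t))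
      (fun t => TwinSL.stokesU (z t)) (fun t => TwinSL.stokesV (z t)) := by
  subst hγ
  exact ⟨hz.stokesN, hz.stokesD, hz.stokesU, hz.stokesV, fun t => stokesN_nonneg _,
    fun t => stokes_identity _⟩

namespace Orbit

variable {α κ γ : ℝ} {N D u v : ℝ → ℝ} (O : Orbit α κ γ N D u v)
include O

theorem shift {τ : ℝ} (hτ : 0 ≤ τ) : Orbit α κ γ (fun t => N (t + τ)) (fun t => D (t + τ))
    (fun t => u (t + τ)) (fun t => v (t + τ)) :=
  ⟨O.hN.shift hτ, O.hD.shift hτ, O.hu.shift hτ, O.hv.shift hτ, fun _ => O.nonneg _,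
    fun _ => O.ident _⟩

theorem abs_D_le (t : ℝ) : |D t| ≤ N t :=
  abs_le_of_sq_le_sq (by nlinarith [O.ident t, sq_nonneg (u t), sq_nonneg (v t)]) (O.nonneg t)

theorem abs_u_le (t : ℝ) : |2 * u t| ≤ N t :=
  abs_le_of_sq_le_sq (by nlinarith [O.ident t, sq_nonneg (D t), sq_nonneg (v t)]) (O.nonneg t)

theorem abs_v_le (t : ℝ) : |2 * v t| ≤ N t :=
  abs_le_of_sq_le_sq (by nlinarith [O.ident t, sq_nonneg (D t), sq_nonneg (u t)]) (O.nonneg t)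

theorem u_le (t : ℝ) : 2 * u t ≤ N t := (abs_le.1 (O.abs_u_le t)).2
theorem neg_u_le (t : ℝ) : -N t ≤ 2 * u t := (abs_le.1 (O.abs_u_le t)).1
theorem v_le (t : ℝ) : 2 * v t ≤ N t := (abs_le.1 (O.abs_v_le t)).2
theorem neg_v_le (t : ℝ) : -N t ≤ 2 * v t := (abs_le.1 (O.abs_v_le t)).1

theorem rate_le (hκ : 0 < κ) (t : ℝ) :
    (2 * α - κ) * N t - N t ^ 2 - D t ^ 2 + 2 * κ * u t ≤ 2 * α * N t - N t ^ 2 := by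
  nlinarith [sq_nonneg (D t), O.u_le t]

theorem N_le (hκ : 0 < κ) {M : ℝ} (hM : 2 * α ≤ M) (hM0 : 0 ≤ M) (h0 : N 0 ≤ M) {t : ℝ}
    (ht : 0 ≤ t) : N t ≤ M :=
  O.hN.le_barrier h0 (fun s _ h1 => (O.rate_le hκ s).trans (by nlinarith)) ht

theorem exists_bound (hκ : 0 < κ) : ∃ M, 0 < M ∧ ∀ t, 0 ≤ t → N t ≤ M :=
  ⟨max (2 * α) (N 0) + |α| + 1, by
    have := O.nonneg 0
    have := le_max_right (2 * α) (N 0)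
    positivity, fun t ht => O.N_le hκ
    (by have := le_max_left (2 * α) (N 0); have := abs_nonneg α; linarith)
    (by have := O.nonneg 0; have := le_max_right (2 * α) (N 0); positivity)
    (by have := le_max_right (2 * α) (N 0); have := abs_nonneg α; linarith) ht⟩

theorem N_pos (hκ : 0 < κ) (h0 : 0 < N 0) {t : ℝ} (ht : 0 ≤ t) : 0 < N t := by
  obtain ⟨M, hM, hb⟩ := O.exists_bound hκ
  refine O.hN.pos_of_ge (c := 2 * α - 2 * κ - 2 * M) (fun s hs => ?_) h0 ht
  have h1 := O.neg_u_le s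
  have h2 := O.abs_D_le s
  have h3 : D s ^ 2 ≤ N s ^ 2 := by rw [← sq_abs (D s)]; gcongr
  nlinarith [hb s hs, O.nonneg s]

theorem D_eq_zero (hκ : 0 < κ) (h0 : D 0 = 0) {t : ℝ} (ht : 0 ≤ t) : D t = 0 := by
  obtain ⟨M, hM, hb⟩ := O.exists_bound hκ
  refine ((O.hD.mono (Icc_subset_Ici_self : Icc 0 t ⊆ Ici 0)).two_sided (K := |2 * α - κ| + 2 * M) ht
    fun s hs => ?_).1 h0
  rw [abs_mul]
  gcongr
  refine (abs_sub _ _).trans ?_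
  rw [abs_mul, abs_two, abs_of_nonneg (O.nonneg s)]
  linarith [hb s hs.1]

/-- The contributions `2κγu` of the coupling to `γN'` and of the detuning to `2κv'` cancel. For `κ <
γ` this form is positive definite and replaces `N` as a measure of size. -/
theorem hW : DerivOn (fun t => γ * N t - 2 * κ * v t)
    (fun t => (2 * α - κ - N t) * (γ * N t - 2 * κ * v t) - γ * D t ^ 2) (Ici 0) :=
  ((O.hN.const_mul γ).sub (O.hv.const_mul (2 * κ))).congr fun t _ => by ring

/-- The squared modulus of a left eigenvector; `a = ±√(κ² - γ²)/κ`, `b = γ/κ`. -/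
theorem hP {a b : ℝ} (hab : a ^ 2 + b ^ 2 = 1) (hb : γ = κ * b) :
    DerivOn (fun t => N t + 2 * a * u t - 2 * b * v t)
    (fun t => (2 * α - κ + κ * a - N t) * (N t + 2 * a * u t - 2 * b * v t) - D t ^ 2)
    (Ici 0) :=
  ((O.hN.add (O.hu.const_mul (2 * a))).sub (O.hv.const_mul (2 * b))).congr fun t _ => by
    subst hb
    linear_combination (-2 * κ * u t) * hab

/-- Cauchy–Schwarz for the unit vector `(a, -b)`, together with `4(u² + v²) ≤ N²`. -/
theorem P_nonneg {a b : ℝ} (hab : a ^ 2 + b ^ 2 = 1) (t : ℝ) :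
    0 ≤ N t + 2 * a * u t - 2 * b * v t := by
  have : |2 * a * u t - 2 * b * v t| ≤ N t := by
    refine abs_le_of_sq_le_sq ?_ (O.nonneg t)
    have : (2 * a * u t - 2 * b * v t) ^ 2 + 4 * (a * v t + b * u t) ^ 2
        = 4 * (a ^ 2 + b ^ 2) * (u t ^ 2 + v t ^ 2) := by ring
    rw [hab] at this
    nlinarith [O.ident t, sq_nonneg (D t), sq_nonneg (a * v t + b * u t)]
  linarith [(abs_le.1 this).1]

theorem P_le {a b : ℝ} (hab : a ^ 2 + b ^ 2 = 1) (t : ℝ) :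
    N t + 2 * a * u t - 2 * b * v t ≤ 2 * N t := by
  have := O.P_nonneg (a := -a) (b := -b) (by linarith) t
  linarith

end Orbit

/-! ### The manifold -/

theorem mem_manifoldM_iff {w : ℂ × ℂ} : w ∈ manifoldM ↔ stokesD w = 0 ∧ 0 < stokesN w := by
  simp only [manifoldM, ratio, mem_ofPred_eq, stokesD_eq, stokesN_eq]
  constructor
  · intro h
    have h2 : ‖w.2‖ ≠ 0 := by
      intro h0
      rw [h0, div_zero] at h
      exact zero_ne_one h
    have h1 : ‖w.1‖ = ‖w.2‖ := by rwa [div_eq_one_iff_eq h2] at h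
    have : 0 < ‖w.2‖ := lt_of_le_of_ne (norm_nonneg _) h2.symm
    exact ⟨by rw [h1]; ring, by positivity⟩
  · rintro ⟨h1, h2⟩
    have h3 : ‖w.1‖ = ‖w.2‖ := by
      have : ‖w.1‖ ^ 2 = ‖w.2‖ ^ 2 := by linarith
      exact (sq_eq_sq₀ (norm_nonneg _) (norm_nonneg _)).1 this
    rw [h3] at h2 ⊢
    exact div_self (by intro h0; rw [h0] at h2; simp at h2)

/-- On a compact interval `N` is bounded, hence `|D'| ≤ K|D|` and `|N'| ≤ K N`. The two-sided
Grönwall inequality then preserves both vanishing and non-vanishing, forwards and backwards in time.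
-/
theorem invariance {α κ ω : ℝ} {I : Set ℝ} {z : ℝ → ℂ × ℂ} (hI : I.OrdConnected)
    (hz : IsSolutionOn α κ ω I z) {t₀ : ℝ} (h₀ : t₀ ∈ I) (hM : z t₀ ∈ manifoldM) {t : ℝ}
    (ht : t ∈ I) : z t ∈ manifoldM := by
  have key : ∀ a b : ℝ, a ∈ I → b ∈ I → a ≤ b →
      ((stokesD (z a) = 0 ↔ stokesD (z b) = 0) ∧ (stokesN (z a) = 0 ↔ stokesN (z b) = 0)) := by
    intro a b ha hb hab
    have hs : Icc a b ⊆ I := hI.out ha hb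
    have hN := hz.stokesN.mono hs
    have hD := hz.stokesD.mono hs
    obtain ⟨B, hB⟩ := isCompact_Icc.bddAbove_image hN.continuousOn
    have hB' : ∀ s ∈ Icc a b, stokesN (z s) ≤ B := fun s hs => hB (mem_image_of_mem _ hs)
    have hB0 : 0 ≤ B := (stokesN_nonneg _).trans (hB' a (left_mem_Icc.2 hab))
    refine ⟨hD.two_sided (K := |2 * α - κ| + 2 * B) hab fun s hs => ?_,
      hN.two_sided (K := |2 * α - κ| + 2 * B + |κ|) hab fun s hs => ?_⟩
    · rw [abs_mul]
      gcongr
      refine (abs_sub _ _).trans ?_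
      rw [abs_mul, abs_two, abs_of_nonneg (stokesN_nonneg _)]
      linarith [hB' s hs]
    · have hn := stokesN_nonneg (z s)
      have hid := stokes_identity (z s)
      have hu : |2 * stokesU (z s)| ≤ stokesN (z s) :=
        abs_le_of_sq_le_sq (by nlinarith [sq_nonneg (stokesD (z s)), sq_nonneg (stokesV (z s))]) hn
      have hd : stokesD (z s) ^ 2 ≤ stokesN (z s) ^ 2 := by
        nlinarith [sq_nonneg (stokesU (z s)), sq_nonneg (stokesV (z s))]
      have e : (2 * α - κ) * stokesN (z s) - stokesN (z s) ^ 2 - stokesD (z s) ^ 2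
          + 2 * κ * stokesU (z s) = (2 * α - κ) * stokesN (z s)
          - (stokesN (z s) ^ 2 + stokesD (z s) ^ 2) + κ * (2 * stokesU (z s)) := by ring
      rw [e, abs_of_nonneg hn]
      refine (abs_add_le _ _).trans ?_
      have h1 : |κ * (2 * stokesU (z s))| ≤ |κ| * stokesN (z s) := by
        rw [abs_mul]; gcongr
      have h2 : |(2 * α - κ) * stokesN (z s) - (stokesN (z s) ^ 2 + stokesD (z s) ^ 2)|
          ≤ |2 * α - κ| * stokesN (z s) + 2 * B * stokesN (z s) := by
        refine (abs_sub _ _).trans ?_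
        rw [abs_mul, abs_of_nonneg hn,
          abs_of_nonneg (add_nonneg (sq_nonneg (stokesN (z s))) (sq_nonneg (stokesD (z s))))]
        nlinarith [hB' s hs]
      linarith
  rw [mem_manifoldM_iff] at hM ⊢
  have h2 : (stokesD (z t₀) = 0 ↔ stokesD (z t) = 0) ∧
      (stokesN (z t₀) = 0 ↔ stokesN (z t) = 0) := by
    rcases le_total t₀ t with h | h
    · exact key t₀ t h₀ ht h
    · exact ⟨(key t t₀ ht h₀ h).1.symm, (key t t₀ ht h₀ h).2.symm⟩
  exact ⟨h2.1.1 hM.1, lt_of_le_of_ne (stokesN_nonneg _)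
    (fun h => hM.2.ne' (h2.2.2 h.symm))⟩

theorem isSmoothHypersurface_manifoldM : IsSmoothHypersurface manifoldM := by
  intro p hp
  refine ⟨{w | 0 < stokesN w}, isOpen_lt continuous_const continuous_stokesN,
    (mem_manifoldM_iff.1 hp).2, stokesD, ?_, ?_, ?_⟩
  · have e : stokesD = fun w : ℂ × ℂ => (Complex.reCLM w.1 * Complex.reCLM w.1
        + Complex.imCLM w.1 * Complex.imCLM w.1) - (Complex.reCLM w.2 * Complex.reCLM w.2
        + Complex.imCLM w.2 * Complex.imCLM w.2) := by
      funext w; simp [stokesD, Complex.normSq_apply]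
    rw [e]
    fun_prop
  · intro w hw h0
    have hpos : stokesN w ≠ 0 := (show 0 < stokesN w from hw).ne'
    have hdiff : HasFDerivAt stokesD (fderiv ℝ stokesD w) w := by
      refine DifferentiableAt.hasFDerivAt ?_
      have e : stokesD = fun w : ℂ × ℂ => (Complex.reCLM w.1 * Complex.reCLM w.1
          + Complex.imCLM w.1 * Complex.imCLM w.1) - (Complex.reCLM w.2 * Complex.reCLM w.2
          + Complex.imCLM w.2 * Complex.imCLM w.2) := by
        funext w; simp [stokesD, Complex.normSq_apply]
      rw [e]
      fun_prop
    -- In the direction `(z₁, -z₂)` the derivative of `stokesD` is `2 * stokesN`, which is nonzero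
    -- on the chosen open set.
    have hl : HasDerivAt (fun t : ℝ => w + t • ((w.1, -w.2) : ℂ × ℂ)) ((w.1, -w.2) : ℂ × ℂ) 0 := by
      simpa using ((hasDerivAt_id (0 : ℝ)).smul_const ((w.1, -w.2) : ℂ × ℂ)).const_add w
    have h1 : HasDerivAt (fun t : ℝ => stokesD (w + t • ((w.1, -w.2) : ℂ × ℂ))) 0 0 := by
      have h2 : HasFDerivAt stokesD (fderiv ℝ stokesD w) (w + (0 : ℝ) • ((w.1, -w.2) : ℂ × ℂ)) := by
        simpa using hdiff
      have := h2.comp_hasDerivAt (0 : ℝ) hl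
      rw [h0] at this
      simpa [Function.comp_def] using this
    have h3 : HasDerivAt (fun t : ℝ => stokesD (w + t • ((w.1, -w.2) : ℂ × ℂ)))
        (2 * stokesN w) 0 := by
      have e : (fun t : ℝ => stokesD (w + t • ((w.1, -w.2) : ℂ × ℂ)))
          = fun t : ℝ => (1 + t ^ 2) * stokesD w + t * (2 * stokesN w) := by
        funext t
        simp [stokesD, stokesN, Complex.normSq_apply]
        ring
      rw [e]
      have := (((hasDerivAt_pow 2 (0 : ℝ)).const_add 1).mul_const (stokesD w)).add
        ((hasDerivAt_id (0 : ℝ)).mul_const (2 * stokesN w))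
      simpa [Pi.add_def] using this
    have := h3.unique h1
    exact hpos (by linarith)
  · ext w
    simp only [mem_inter_iff, mem_manifoldM_iff, mem_ofPred_eq]
    tauto

/-! ### Phase factors, ratio and amplitudes in Stokes variables -/

theorem q_eq (w : ℂ × ℂ) : w.1 * (starRingEnd ℂ) w.2 = ⟨stokesU w, stokesV w⟩ := by
  apply Complex.ext <;> (simp [stokesU, stokesV]; try ring)

theorem phaseFactor_eq_of_mem {w : ℂ × ℂ} (hw : w ∈ manifoldM) :
    phaseFactor w = ⟨2 * stokesU w / stokesN w, 2 * stokesV w / stokesN w⟩ := by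
  obtain ⟨h1, h2⟩ := mem_manifoldM_iff.1 hw
  have h3 : ‖w.1‖ = ‖w.2‖ := by
    rw [stokesD_eq] at h1
    have : ‖w.1‖ ^ 2 = ‖w.2‖ ^ 2 := by linarith
    exact (sq_eq_sq₀ (norm_nonneg _) (norm_nonneg _)).1 this
  have h4 : stokesN w = 2 * (‖w.1‖ * ‖w.2‖) := by rw [stokesN_eq, h3]; ring
  have h5 : ‖w.1‖ * ‖w.2‖ ≠ 0 := by
    intro h; rw [h] at h4; linarith
  rw [phaseFactor, q_eq, h4, ← Complex.ofReal_mul]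
  apply Complex.ext
  · rw [Complex.div_ofReal_re]; field_simp
  · rw [Complex.div_ofReal_im]; field_simp

theorem phaseFactor_eq_normalized (w : ℂ × ℂ) (hw : 0 < stokesN w) :
    phaseFactor w = (⟨2 * stokesU w / stokesN w, 2 * stokesV w / stokesN w⟩ : ℂ)
      / ((‖(⟨2 * stokesU w / stokesN w, 2 * stokesV w / stokesN w⟩ : ℂ)‖ : ℝ) : ℂ) := by
  have e : (⟨2 * stokesU w / stokesN w, 2 * stokesV w / stokesN w⟩ : ℂ)
      = ((2 / stokesN w : ℝ) : ℂ) * (w.1 * (starRingEnd ℂ) w.2) := by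
    rw [q_eq]
    apply Complex.ext
    · rw [Complex.re_ofReal_mul]; simp; ring
    · rw [Complex.im_ofReal_mul]; simp; ring
  have hp : 0 < 2 / stokesN w := by positivity
  rw [e, norm_mul, Complex.norm_real, Real.norm_of_nonneg hp.le, norm_mul, RCLike.norm_conj,
    phaseFactor, Complex.ofReal_mul, Complex.ofReal_mul]
  rw [mul_div_mul_left _ _ (by exact_mod_cast hp.ne')]

/-- With `r = |z₁|` and `s = |z₂|`, `R - 1 = (r² - s²)/(s(r + s))`. The hypothesis gives `r² ≤ 3s²`,
so the denominator is at least `N / 4`. -/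
theorem abs_ratio_sub_one_le {w : ℂ × ℂ} (h0 : 0 < stokesN w) (h : |stokesD w| ≤ stokesN w / 2) :
    |ratio w - 1| ≤ 4 * (|stokesD w| / stokesN w) := by
  rw [stokesN_eq, stokesD_eq] at *
  set r := ‖w.1‖
  set s := ‖w.2‖ with hs
  have hr0 : 0 ≤ r := norm_nonneg _
  have hs0 : 0 ≤ s := norm_nonneg _
  have h1 := (abs_le.1 h).2
  have hsp : 0 < s := by
    rcases hs0.lt_or_eq with h | h
    · exact h
    · rw [← h] at h1 h0; nlinarith
  have e : ratio w - 1 = (r ^ 2 - s ^ 2) / (s * (r + s)) := by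
    have : r + s ≠ 0 := by positivity
    rw [ratio, div_sub_one hsp.ne', div_eq_div_iff hsp.ne' (by positivity)]
    ring
  rw [e, abs_div, abs_of_pos (show 0 < s * (r + s) by positivity), ← mul_div_assoc,
    div_le_div_iff₀ (by positivity) (by positivity)]
  have h2 : r ^ 2 + s ^ 2 ≤ 4 * (s * (r + s)) := by nlinarith
  nlinarith [abs_nonneg (r ^ 2 - s ^ 2)]

theorem norm_sq_fst (w : ℂ × ℂ) : ‖w.1‖ ^ 2 = (stokesN w + stokesD w) / 2 := by
  rw [stokesN_eq, stokesD_eq]; ring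

theorem norm_sq_snd (w : ℂ × ℂ) : ‖w.2‖ ^ 2 = (stokesN w - stokesD w) / 2 := by
  rw [stokesN_eq, stokesD_eq]; ring

theorem tendsto_amplitudes {z : ℝ → ℂ × ℂ} {L : ℝ}
    (hN : Tendsto (fun t => stokesN (z t)) atTop (𝓝 L))
    (hD : Tendsto (fun t => stokesD (z t)) atTop (𝓝 0)) :
    Tendsto (fun t => ‖(z t).1‖ ^ 2) atTop (𝓝 (L / 2)) ∧
    Tendsto (fun t => ‖(z t).2‖ ^ 2) atTop (𝓝 (L / 2)) ∧
    Tendsto (fun t => ‖(z t).1‖) atTop (𝓝 √(L / 2)) ∧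
    Tendsto (fun t => ‖(z t).2‖) atTop (𝓝 √(L / 2)) := by
  have h1 : Tendsto (fun t => ‖(z t).1‖ ^ 2) atTop (𝓝 (L / 2)) := by
    simp only [norm_sq_fst]
    simpa using (hN.add hD).div_const 2
  have h2 : Tendsto (fun t => ‖(z t).2‖ ^ 2) atTop (𝓝 (L / 2)) := by
    simp only [norm_sq_snd]
    simpa using (hN.sub hD).div_const 2
  refine ⟨h1, h2, ?_, ?_⟩
  · simpa [Real.sqrt_sq (norm_nonneg _)] using h1.sqrt
  · simpa [Real.sqrt_sq (norm_nonneg _)] using h2.sqrt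

theorem amplitudeDeath_of_tendsto {z : ℝ → ℂ × ℂ}
    (hN : Tendsto (fun t => stokesN (z t)) atTop (𝓝 0)) : AmplitudeDeath z := by
  have hD : Tendsto (fun t => stokesD (z t)) atTop (𝓝 0) := by
    refine squeeze_zero_norm (fun t => ?_) hN
    rw [Real.norm_eq_abs, stokesD_eq, stokesN_eq]
    exact abs_le.2 ⟨by nlinarith [sq_nonneg ‖(z t).1‖], by nlinarith [sq_nonneg ‖(z t).2‖]⟩
  have := (tendsto_amplitudes hN hD).2.2
  simp only [zero_div, Real.sqrt_zero] at this
  exact this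

/-- If `|z₁|² + |z₂|²` stays away from zero and the relative difference vanishes asymptotically,
both oscillators are active. -/
theorem active_of_bound {z : ℝ → ℂ × ℂ} {m : ℝ} (hm : 0 < m)
    (hN : ∀ᶠ t in atTop, m ≤ stokesN (z t)) (hD : ∀ᶠ t in atTop, |stokesD (z t)| ≤ stokesN (z t) / 2) :
    Active z := by
  constructor
  · intro h
    have h1 : Tendsto (fun t => ‖(z t).1‖ ^ 2) atTop (𝓝 0) := by simpa using h.pow 2
    obtain ⟨t, h2, h3, h4⟩ := ((h1.eventually_lt_const (show 0 < m / 4 by positivity)).and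
      (hN.and hD)).exists
    rw [norm_sq_fst] at h2
    linarith [(abs_le.1 h4).1]
  · intro h
    have h1 : Tendsto (fun t => ‖(z t).2‖ ^ 2) atTop (𝓝 0) := by simpa using h.pow 2
    obtain ⟨t, h2, h3, h4⟩ := ((h1.eventually_lt_const (show 0 < m / 4 by positivity)).and
      (hN.and hD)).exists
    rw [norm_sq_snd] at h2
    linarith [(abs_le.1 h4).2]

/-- Convergence of the normalized Stokes vector to the equator. -/
theorem tendsto_of_locked {z : ℝ → ℂ × ℂ} {a b : ℝ} (hab : a ^ 2 + b ^ 2 = 1)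
    (hpos : ∀ᶠ t in atTop, 0 < stokesN (z t))
    (hX : Tendsto (fun t => 2 * stokesU (z t) / stokesN (z t)) atTop (𝓝 a))
    (hY : Tendsto (fun t => 2 * stokesV (z t) / stokesN (z t)) atTop (𝓝 b)) :
    Tendsto (fun t => phaseFactor (z t)) atTop (𝓝 (⟨a, b⟩ : ℂ)) ∧
    Tendsto (fun t => stokesD (z t) / stokesN (z t)) atTop (𝓝 0) ∧
    Tendsto (fun t => ratio (z t)) atTop (𝓝 1) := by
  have hd : Tendsto (fun t => stokesD (z t) / stokesN (z t)) atTop (𝓝 0) := by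
    -- The identity for `N²` reads `(D/N)² = 1 - X² - Y²` for the normalized `X = 2u/N`, `Y = 2v/N`,
    -- so a limit on the unit circle forces `D/N → 0`.
    have h1 : Tendsto (fun t => (stokesD (z t) / stokesN (z t)) ^ 2) atTop (𝓝 0) := by
      have h2 : Tendsto (fun t => 1 - ((2 * stokesU (z t) / stokesN (z t)) ^ 2
          + (2 * stokesV (z t) / stokesN (z t)) ^ 2)) atTop (𝓝 (1 - (a ^ 2 + b ^ 2))) :=
        tendsto_const_nhds.sub ((hX.pow 2).add (hY.pow 2))
      rw [hab, sub_self] at h2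
      refine h2.congr' ?_
      filter_upwards [hpos] with t ht
      have := stokes_identity (z t)
      field_simp
      linarith
    have h3 := h1.sqrt
    simp only [Real.sqrt_sq_eq_abs, Real.sqrt_zero] at h3
    exact (tendsto_zero_iff_abs_tendsto_zero _).2 h3
  refine ⟨?_, hd, ?_⟩
  · have e : ∀ x y : ℝ, (⟨x, y⟩ : ℂ) = (x : ℂ) + (y : ℂ) * Complex.I := fun x y =>
      (Complex.mk_eq_add_mul_I x y)
    have h1 : Tendsto (fun t => (⟨2 * stokesU (z t) / stokesN (z t),
        2 * stokesV (z t) / stokesN (z t)⟩ : ℂ)) atTop (𝓝 (⟨a, b⟩ : ℂ)) := by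
      simp only [e]
      exact ((Complex.continuous_ofReal.tendsto a).comp hX).add
        (((Complex.continuous_ofReal.tendsto b).comp hY).mul_const _)
    have hn : ‖(⟨a, b⟩ : ℂ)‖ = 1 := by
      rw [Complex.norm_def, Complex.normSq_mk, ← sq, ← sq, hab, Real.sqrt_one]
    have h2 := h1.div ((Complex.continuous_ofReal.tendsto _).comp h1.norm) (by simp [hn])
    rw [hn, Complex.ofReal_one, div_one] at h2
    refine h2.congr' ?_
    filter_upwards [hpos] with t ht
    exact (phaseFactor_eq_normalized _ ht).symm
  · have h0 := (tendsto_zero_iff_abs_tendsto_zero _).1 hd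
    rw [tendsto_iff_norm_sub_tendsto_zero]
    refine squeeze_zero' (Eventually.of_forall fun t => norm_nonneg _) ?_
      (by simpa using h0.const_mul 4)
    filter_upwards [hpos, h0.eventually_lt_const (show (0 : ℝ) < 1 / 2 by norm_num)] with t ht h1
    rw [Real.norm_eq_abs]
    simp only [Function.comp, abs_div, abs_of_pos ht] at h1 ⊢
    refine abs_ratio_sub_one_le ht ?_
    rw [div_lt_iff₀ ht] at h1
    linarith

/-! ### The locking angles -/

theorem sin_lock_sq {κ γ : ℝ} (hκ : 0 < κ) (h0 : 0 ≤ γ) (h : γ ≤ κ) :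
    (√(κ ^ 2 - γ ^ 2) / κ) ^ 2 + (γ / κ) ^ 2 = 1 := by
  rw [div_pow, Real.sq_sqrt (by nlinarith)]
  field_simp
  ring

theorem unitAt_lockAngle {κ γ : ℝ} (hκ : 0 < κ) (h0 : 0 ≤ γ) (h : γ ≤ κ) :
    unitAt (lockAngle κ γ) = ⟨√(κ ^ 2 - γ ^ 2) / κ, γ / κ⟩ ∧
    unitAt (unstableAngle κ γ) = ⟨-(√(κ ^ 2 - γ ^ 2) / κ), γ / κ⟩ := by
  have h1 : γ / κ ≤ 1 := (div_le_one hκ).2 h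
  have h2 : -1 ≤ γ / κ := by have : 0 ≤ γ / κ := by positivity
                             linarith
  have h3 : Real.cos (Real.arcsin (γ / κ)) = √(κ ^ 2 - γ ^ 2) / κ := by
    rw [Real.cos_arcsin, ← sin_lock_sq hκ h0 h, add_sub_cancel_right,
      Real.sqrt_sq (by positivity)]
  have h4 := Real.sin_arcsin h2 h1
  have e : ∀ θ : ℝ, unitAt θ = ⟨Real.cos θ, Real.sin θ⟩ := by
    intro θ
    rw [unitAt]
    apply Complex.ext
    · simp [Complex.exp_ofReal_mul_I_re]
    · simp [Complex.exp_ofReal_mul_I_im]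
  rw [e, e, lockAngle, unstableAngle, Real.cos_pi_sub, Real.sin_pi_sub, h3, h4]
  exact ⟨rfl, rfl⟩

/-! ### Amplitude death of all solutions -/

namespace Orbit

variable {α κ γ : ℝ} {N D u v : ℝ → ℝ} (O : Orbit α κ γ N D u v)
include O

theorem mul_time_le_one (hκ : 0 < κ) (hα : α ≤ 0) {k : ℝ} (hk : 0 ≤ k) (h0 : N 0 * k ≤ 1) {t : ℝ}
    (ht : 0 ≤ t) : N t * (k + t) ≤ 1 := by
  have := O.hN.mul_affine_le_one (c := 1) (k := k) (fun s _ => ?_) zero_le_one hk h0 ht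
  · simpa using this
  · have := O.rate_le hκ s
    nlinarith [O.nonneg s]

theorem W_le (hκ : 0 < κ) (t : ℝ) : γ * N t - 2 * κ * v t ≤ (γ + κ) * N t := by
  nlinarith [O.neg_v_le t]

theorem le_W (hκ : 0 < κ) (t : ℝ) : (γ - κ) * N t ≤ γ * N t - 2 * κ * v t := by
  nlinarith [O.v_le t]

/-- Since `N ≥ W/(γ + κ)`, the form satisfies the Riccati inequality `W' ≤ -W²/(γ + κ)`. The
resulting bound does not involve the initial value, which is why death is uniform. -/
theorem W_mul_time_le (hκ : 0 < κ) (h : κ < γ) (hα : 2 * α ≤ κ) {t : ℝ} (ht : 0 ≤ t) :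
    (γ * N t - 2 * κ * v t) * t ≤ γ + κ := by
  have hg : 0 < γ + κ := by linarith
  have := O.hW.mul_affine_le_one (c := 1 / (γ + κ)) (k := 0) (fun s _ => ?_) (by positivity) le_rfl
    (by simp) ht
  · simp only [zero_add, sub_zero] at this
    field_simp at this
    linarith
  · have h1 := O.W_le hκ s
    have h2 := O.le_W hκ s
    have h3 := O.nonneg s
    have h4 : 0 ≤ γ * N s - 2 * κ * v s := by nlinarith
    have h5 : (1 / (γ + κ)) * (γ * N s - 2 * κ * v s) ^ 2 ≤ N s * (γ * N s - 2 * κ * v s) := by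
      rw [one_div, inv_mul_le_iff₀ hg]
      nlinarith
    have h6 : 0 ≤ γ * D s ^ 2 := mul_nonneg (by linarith) (sq_nonneg _)
    nlinarith

/-- As for `W`: here `N ≥ P/2`, so `P' ≤ -P²/2`. -/
theorem P_mul_time_le {a b : ℝ} (hab : a ^ 2 + b ^ 2 = 1) (hb : γ = κ * b)
    (h : 2 * α - κ + κ * a ≤ 0) {t : ℝ} (ht : 0 ≤ t) :
    (N t + 2 * a * u t - 2 * b * v t) * t ≤ 2 := by
  have := (O.hP hab hb).mul_affine_le_one (c := 1 / 2) (k := 0) (fun s _ => ?_) (by positivity)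
    le_rfl (by simp) ht
  · simp only [zero_add, sub_zero] at this
    linarith
  · have h1 := O.P_nonneg hab s
    have h2 := O.P_le hab s
    nlinarith [sq_nonneg (D s)]

/-- Indeed `4u² ≤ (N - 2v)(N + 2v)` and `2v ≤ N`. At `γ = κ`, where `N - 2v` is the only decaying
form, this is how `u` is controlled. -/
theorem u_sq_le (t : ℝ) : 4 * u t ^ 2 ≤ 2 * N t * (N t - 2 * v t) := by
  nlinarith [O.ident t, sq_nonneg (D t), O.v_le t, O.neg_v_le t, O.nonneg t]

end Orbit

/-- Parameters for which every solution tends to the origin. -/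
def DeathRegime (α κ γ : ℝ) : Prop :=
  α ≤ 0 ∨ (κ < γ ∧ 2 * α ≤ κ) ∨ (γ ≤ κ ∧ 2 * α - κ + √(κ ^ 2 - γ ^ 2) ≤ 0)

theorem lock_params {κ γ : ℝ} (hκ : 0 < κ) (h0 : 0 ≤ γ) (h : γ ≤ κ) :
    ∃ a b : ℝ, a = √(κ ^ 2 - γ ^ 2) / κ ∧ b = γ / κ ∧ 0 ≤ a ∧ 0 ≤ b ∧ b ≤ 1 ∧ a ^ 2 + b ^ 2 = 1 ∧
      γ = κ * b ∧ κ * a = √(κ ^ 2 - γ ^ 2) ∧ (γ < κ → 0 < a ∧ b < 1) ∧ (γ = κ → a = 0 ∧ b = 1) := by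
  refine ⟨_, _, rfl, rfl, by positivity, by positivity, (div_le_one hκ).2 h, sin_lock_sq hκ h0 h,
    by field_simp, by field_simp, fun h1 => ⟨?_, (div_lt_one hκ).2 h1⟩, fun h1 => ?_⟩
  · have : 0 < √(κ ^ 2 - γ ^ 2) := Real.sqrt_pos.2 (by nlinarith)
    positivity
  · subst h1
    simp [hκ.ne']

/-- Uniform decay in the death regime. -/
theorem uniform_death {α κ γ : ℝ} (hκ : 0 < κ) (h0 : 0 ≤ γ) (h : DeathRegime α κ γ) (M : ℝ)
    {η : ℝ} (hη : 0 < η) : ∃ T, 0 ≤ T ∧ ∀ N D u v : ℝ → ℝ, Orbit α κ γ N D u v → N 0 ≤ M →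
      ∀ t, T ≤ t → N t ≤ η := by
  have simple : ∀ C : ℝ, 0 ≤ C → (∀ N D u v : ℝ → ℝ, Orbit α κ γ N D u v → ∀ t, 0 ≤ t →
      N t * t ≤ C) → ∃ T, 0 ≤ T ∧ ∀ N D u v : ℝ → ℝ, Orbit α κ γ N D u v → N 0 ≤ M →
      ∀ t, T ≤ t → N t ≤ η := by
    intro C hC H
    refine ⟨(C + 1) / η, by positivity, fun N D u v O _ t ht => ?_⟩
    have ht0 : 0 < t := lt_of_lt_of_le (by positivity) ht
    have h1 := H N D u v O t ht0.le
    rw [div_le_iff₀ hη] at ht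
    by_contra hc
    push Not at hc
    nlinarith
  rcases h with h | ⟨h, h'⟩ | ⟨h, h'⟩
  · exact simple 1 zero_le_one fun N D u v O t ht => by
      simpa using O.mul_time_le_one hκ h le_rfl (by simp) ht
  · have hg : 0 < γ - κ := by linarith
    refine simple ((γ + κ) / (γ - κ)) (by positivity) fun N D u v O t ht => ?_
    rw [le_div_iff₀ hg]
    have := mul_le_mul_of_nonneg_right (O.le_W hκ t) ht
    linarith [O.W_mul_time_le hκ h h' ht]
  · obtain ⟨a, b, -, -, ha, hb0, hb1, hab, hγ, hs, hlt, heq⟩ := lock_params hκ h0 h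
    rw [← hs] at h'
    rcases h.lt_or_eq with h1 | h1
    · obtain ⟨ha', hb'⟩ := hlt h1
      have hb2 : 0 < 1 - b := by linarith
      -- The forms for `a` and `-a` are both at most `2/t`, and their sum `2(N - 2bv)` is at least
      -- `2(1 - b)N`.
      refine simple (2 / (1 - b)) (by positivity) fun N D u v O t ht => ?_
      have h2 := O.P_mul_time_le hab hγ h' ht
      have h3 := O.P_mul_time_le (a := -a) (by linarith [neg_sq a]) hγ (by nlinarith) ht
      rw [le_div_iff₀ hb2]
      have h4 : b * (2 * v t) ≤ b * N t := mul_le_mul_of_nonneg_left (O.v_le t) hb0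
      nlinarith
    · obtain ⟨rfl, rfl⟩ := heq h1
      set M' := max (max (2 * α) M) 0
      have hM' : 0 ≤ M' := le_max_right _ _
      -- From `N - 2v ≤ p` and `N > η` it follows that `2κu ≤ N²/2`, hence `N' ≤ -N²/2 ≤ -η²/2 =
      -- -c`. The time `2/p` brings `N - 2v` below `p`, and a further time `M'/c` brings `N` below
      -- `η`.
      set p := η ^ 3 / (8 * κ ^ 2)
      have hp : 0 < p := by positivity
      set c := η ^ 2 / 2
      have hc : 0 < c := by positivity
      refine ⟨2 / p + M' / c, by positivity, fun N D u v O hN0 t ht => ?_⟩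
      have hb : ∀ s, 0 ≤ s → N s ≤ M' := fun s hs =>
        O.N_le hκ ((le_max_left _ _).trans (le_max_left _ _)) hM'
          (hN0.trans ((le_max_right _ _).trans (le_max_left _ _))) hs
      have hT : 0 < 2 / p := by positivity
      have hMc : 0 ≤ M' / c := by positivity
      refine (O.hN.Ici_of_le hT.le).le_of_speed (c := c) (M := η) (fun s hs hηs => ?_) hc.le
        (by linarith) ?_
      · have h2 := O.P_mul_time_le (a := 0) (b := 1) hab hγ h' (hT.le.trans hs)
        simp only [mul_zero, zero_mul, add_zero, mul_one] at h2
        have h2p : N s - 2 * v s ≤ p := by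
          rw [div_le_iff₀ hp] at hs
          have h5 : 0 < s := by
            by_contra h6
            push Not at h6
            nlinarith
          by_contra hcc
          push Not at hcc
          nlinarith
        have h3 := O.u_sq_le s
        have hN : 0 < N s := hη.trans hηs
        have h4 : 2 * κ * u s ≤ N s ^ 2 / 2 := by
          refine le_of_sq_le_sq ?_ (by positivity)
          have h5 : 8 * κ ^ 2 * (N s - 2 * v s) ≤ N s ^ 3 := by
            have h6 : 8 * κ ^ 2 * p = η ^ 3 := by simp only [p]; field_simp
            have h7 : η ^ 3 ≤ N s ^ 3 := by gcongr
            have h8 := mul_le_mul_of_nonneg_left h2p (show 0 ≤ 8 * κ ^ 2 by positivity)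
            linarith
          calc (2 * κ * u s) ^ 2 = κ ^ 2 * (4 * u s ^ 2) := by ring
            _ ≤ κ ^ 2 * (2 * N s * (N s - 2 * v s)) := by gcongr
            _ = N s * (8 * κ ^ 2 * (N s - 2 * v s)) / 4 := by ring
            _ ≤ N s * N s ^ 3 / 4 := by gcongr
            _ = (N s ^ 2 / 2) ^ 2 := by ring
        have h5 : η ^ 2 ≤ N s ^ 2 := by gcongr
        simp only [c]
        nlinarith [sq_nonneg (D s)]
      · have h2 : M' / c ≤ t - 2 / p := by linarith
        rw [div_le_iff₀ hc] at h2
        linarith [hb (2 / p) hT.le]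

theorem Orbit.tendsto_zero {α κ γ : ℝ} {N D u v : ℝ → ℝ} (O : Orbit α κ γ N D u v) (hκ : 0 < κ)
    (h0 : 0 ≤ γ) (h : DeathRegime α κ γ) : Tendsto N atTop (𝓝 0) := by
  rw [tendsto_order]
  refine ⟨fun m hm => Eventually.of_forall fun t => hm.trans_le (O.nonneg t), fun m hm => ?_⟩
  obtain ⟨T, -, hT⟩ := uniform_death hκ h0 h (N 0) (show 0 < m / 2 by positivity)
  filter_upwards [eventually_ge_atTop T] with t ht
  linarith [hT N D u v O le_rfl t ht]

/-- Linear stability bound at the origin. -/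
theorem exists_linear_bound {α κ γ : ℝ} (hκ : 0 < κ) (h0 : 0 ≤ γ)
    (h : DeathRegime α κ γ) (h' : α ≤ 0 ∨ 2 * α < κ) :
    ∃ C, 0 < C ∧ ∀ N D u v : ℝ → ℝ, Orbit α κ γ N D u v → ∀ t, 0 ≤ t → N t ≤ C * N 0 := by
  rcases h with h | ⟨h, h1⟩ | ⟨h, h1⟩
  · refine ⟨1, one_pos, fun N D u v O t ht => ?_⟩
    rw [one_mul]
    refine O.hN.antitoneOn (convex_Ici 0) (fun s _ => (O.rate_le hκ s).trans ?_) self_mem_Ici ht ht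
    nlinarith [O.nonneg s]
  · have hg : 0 < γ - κ := by linarith
    refine ⟨(γ + κ) / (γ - κ), by positivity, fun N D u v O t ht => ?_⟩
    have h2 := O.hW.antitoneOn (convex_Ici 0) (fun s _ => by
      have h3 : 0 ≤ γ * N s - 2 * κ * v s := by nlinarith [O.le_W hκ s, O.nonneg s]
      have h4 : 0 ≤ γ * D s ^ 2 := mul_nonneg (by linarith) (sq_nonneg _)
      nlinarith [O.nonneg s]) self_mem_Ici ht ht
    simp only at h2
    rw [div_mul_eq_mul_div, le_div_iff₀ hg]
    linarith [O.le_W hκ t, O.W_le hκ 0]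
  · obtain ⟨a, b, -, -, ha, hb0, hb1, hab, hγ, hs, hlt, heq⟩ := lock_params hκ h0 h
    rw [← hs] at h1
    rcases h.lt_or_eq with h2 | h2
    · obtain ⟨ha', hb'⟩ := hlt h2
      have hb2 : 0 < 1 - b := by linarith
      refine ⟨2 / (1 - b), by positivity, fun N D u v O t ht => ?_⟩
      have anti : ∀ a' : ℝ, a' ^ 2 + b ^ 2 = 1 → 2 * α - κ + κ * a' ≤ 0 →
          N t + 2 * a' * u t - 2 * b * v t ≤ N 0 + 2 * a' * u 0 - 2 * b * v 0 := by
        intro a' hab' h3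
        exact (O.hP hab' hγ).antitoneOn (convex_Ici 0) (fun s _ => by
          have h4 := O.P_nonneg hab' s
          nlinarith [O.nonneg s, sq_nonneg (D s)]) self_mem_Ici ht ht
      have h3 := anti a hab h1
      have h4 := anti (-a) (by linarith [neg_sq a]) (by nlinarith)
      have h5 : b * (2 * v t) ≤ b * N t := mul_le_mul_of_nonneg_left (O.v_le t) hb0
      have h6 : b * -N 0 ≤ b * (2 * v 0) := mul_le_mul_of_nonneg_left (O.neg_v_le 0) hb0
      have h7 : b * N 0 ≤ 1 * N 0 := mul_le_mul_of_nonneg_right hb1 (O.nonneg 0)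
      rw [div_mul_eq_mul_div, le_div_iff₀ hb2]
      nlinarith
    · obtain ⟨rfl, rfl⟩ := heq h2
      rcases h' with h' | h'
      · refine ⟨1, one_pos, fun N D u v O t ht => ?_⟩
        rw [one_mul]
        refine O.hN.antitoneOn (convex_Ici 0) (fun s _ => (O.rate_le hκ s).trans ?_)
          self_mem_Ici ht ht
        nlinarith [O.nonneg s]
      set c := κ - 2 * α with hc
      have hc0 : 0 < c := by linarith
      -- The linear part is a Jordan block here, and `N + K(N - 2v)` is a Lyapunov function. This
      -- `K` makes `(2κu)² ≤ 4(cN)(cK(N - 2v))`, so that `2κu ≤ cN + cK(N - 2v)` by the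
      -- arithmetic-geometric mean inequality.
      set K := κ ^ 2 / (2 * c ^ 2) with hK
      have hK0 : 0 < K := by positivity
      refine ⟨1 + 2 * K, by positivity, fun N D u v O t ht => ?_⟩
      have hP := (O.hP (a := 0) (b := 1) hab hγ).const_mul K
      have h3 := (O.hN.add hP).antitoneOn (convex_Ici 0) (fun s _ => by
        have h4 := O.P_nonneg (a := 0) (b := 1) hab s
        simp only [mul_zero, zero_mul, add_zero, mul_one] at h4 ⊢
        have h5 : 2 * κ * u s ≤ c * N s + c * K * (N s - 2 * v s) := by
          refine le_of_sq_le_sq ?_ (by have := O.nonneg s; positivity)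
          have h6 : c ^ 2 * K * 2 = κ ^ 2 := by rw [hK]; field_simp
          calc (2 * κ * u s) ^ 2 = κ ^ 2 * (4 * u s ^ 2) := by ring
            _ ≤ κ ^ 2 * (2 * N s * (N s - 2 * v s)) :=
                mul_le_mul_of_nonneg_left (O.u_sq_le s) (sq_nonneg κ)
            _ = 4 * (c * N s) * (c * K * (N s - 2 * v s)) := by rw [← h6]; ring
            _ ≤ _ := by nlinarith [sq_nonneg (c * N s - c * K * (N s - 2 * v s))]
        have h6 : 0 ≤ K * (N s * (N s - 2 * v s)) :=
          mul_nonneg hK0.le (mul_nonneg (O.nonneg s) h4)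
        have h7 : 0 ≤ K * D s ^ 2 := by positivity
        have e : 2 * α - κ = -c := by rw [hc]; ring
        rw [e]
        nlinarith [sq_nonneg (N s), sq_nonneg (D s)]) self_mem_Ici ht ht
      simp only [mul_zero, zero_mul, add_zero, mul_one] at h3
      have h4 := O.P_nonneg (a := 0) (b := 1) hab t
      simp only [mul_zero, zero_mul, add_zero, mul_one] at h4
      nlinarith [O.neg_v_le 0]

/-! ### Dynamics on the manifold -/

namespace Orbit

variable {α κ γ : ℝ} {N D u v : ℝ → ℝ} (O : Orbit α κ γ N D u v)
include O

/-- Distance of the normalized Stokes vector from the point `(a, b)` of the equator. -/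
theorem dist_sq_eq {a b : ℝ} (hab : a ^ 2 + b ^ 2 = 1) {t : ℝ} (ht : 0 < N t) :
    (2 * u t / N t - a) ^ 2 + (2 * v t / N t - b) ^ 2
      = 2 * (N t + 2 * (-a) * u t - 2 * b * v t) / N t - (D t / N t) ^ 2 := by
  have := O.ident t
  field_simp
  linear_combination (N t ^ 2) * hab - this

theorem dist_sq_le {a b : ℝ} (hab : a ^ 2 + b ^ 2 = 1) {t : ℝ} (ht : 0 < N t) :
    (2 * u t / N t - a) ^ 2 + (2 * v t / N t - b) ^ 2
      ≤ 2 * (N t + 2 * (-a) * u t - 2 * b * v t) / N t := by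
  rw [O.dist_sq_eq hab ht]
  linarith [sq_nonneg (D t / N t)]

theorem P_ne_zero_iff {a b : ℝ} (hab : a ^ 2 + b ^ 2 = 1) {t : ℝ} (ht : 0 < N t) (hD : D t = 0) :
    N t + 2 * a * u t - 2 * b * v t = 0 ↔ 2 * u t / N t = -a ∧ 2 * v t / N t = b := by
  have h := O.dist_sq_eq (a := -a) (b := b) (by linarith [neg_sq a]) ht
  rw [hD, neg_neg] at h
  simp only [zero_div, ne_eq, OfNat.ofNat_ne_zero, not_false_eq_true, zero_pow, sub_zero] at h
  constructor
  · intro h0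
    rw [h0] at h
    simp only [mul_zero, zero_div] at h
    exact ⟨by nlinarith [sq_nonneg (2 * u t / N t - -a), sq_nonneg (2 * v t / N t - b)],
      by nlinarith [sq_nonneg (2 * u t / N t - -a), sq_nonneg (2 * v t / N t - b)]⟩
  · rintro ⟨h1, h2⟩
    rw [h1, h2] at h
    simp only [sub_self, ne_eq, OfNat.ofNat_ne_zero, not_false_eq_true, zero_pow, add_zero] at h
    have := (div_eq_zero_iff.1 h.symm).resolve_right ht.ne'
    linarith

/-- When `D = 0` the form solves a linear homogeneous equation with bounded coefficient, so its zero
set, which is an exact phase value, is invariant. -/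
theorem P_zero_of_manifold (hκ : 0 < κ) {a b : ℝ} (hab : a ^ 2 + b ^ 2 = 1) (hb : γ = κ * b)
    (hD : D 0 = 0) {t : ℝ} (ht : 0 ≤ t) :
    (N 0 + 2 * a * u 0 - 2 * b * v 0 = 0 ↔ N t + 2 * a * u t - 2 * b * v t = 0) := by
  obtain ⟨M, hM, hb'⟩ := O.exists_bound hκ
  refine (((O.hP hab hb).mono (Icc_subset_Ici_self : Icc 0 t ⊆ Ici 0)).two_sided
    (K := |2 * α - κ + κ * a| + M) ht fun s hs => ?_)
  rw [O.D_eq_zero hκ hD hs.1]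
  simp only [ne_eq, OfNat.ofNat_ne_zero, not_false_eq_true, zero_pow, sub_zero]
  rw [abs_mul]
  gcongr
  refine (abs_sub _ _).trans ?_
  rw [abs_of_nonneg (O.nonneg s)]
  linarith [hb' s hs.1]

/-- Exponential locking on the manifold. -/
theorem manifold_exp_lock (hκ : 0 < κ) {a b : ℝ} (hab : a ^ 2 + b ^ 2 = 1) (hb : γ = κ * b)
    (hD : D 0 = 0) (hN : 0 < N 0) (hP : N 0 + 2 * a * u 0 - 2 * b * v 0 ≠ 0) :
    ∃ C, ∀ t, 0 ≤ t → (2 * u t / N t - a) ^ 2 + (2 * v t / N t - b) ^ 2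
      ≤ C * Real.exp (-(2 * (κ * a) * t)) := by
  have hab' : (-a) ^ 2 + b ^ 2 = 1 := by linarith [neg_sq a]
  have hpos : ∀ t, 0 ≤ t → 0 < N t + 2 * a * u t - 2 * b * v t := fun t ht =>
    lt_of_le_of_ne (O.P_nonneg hab t)
      (fun h => hP ((O.P_zero_of_manifold hκ hab hb hD ht).2 h.symm))
  have hZ := (O.hP hab' hb).div (O.hP hab hb) (fun t ht => (hpos t ht).ne')
  -- The growth rates of the two forms differ by `2κa` and the common amplitude factor cancels, so
  -- `Z' = -2κa Z` on the manifold.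
  set Z := fun t => (N t + 2 * (-a) * u t - 2 * b * v t) / (N t + 2 * a * u t - 2 * b * v t) with hZd
  refine ⟨4 * Z 0, fun t ht => ?_⟩
  have h1 : Z t ≤ Z 0 * Real.exp (-(2 * (κ * a)) * (t - 0)) := by
    refine hZ.le_mul_exp (fun s hs => ?_) ht
    rw [O.D_eq_zero hκ hD hs]
    have := hpos s hs
    have h2 := this.ne'
    apply le_of_eq
    simp only [hZd]
    field_simp
    ring
  have hNt := O.N_pos hκ hN ht
  refine (O.dist_sq_le hab hNt).trans ?_
  have h3 : 2 * (N t + 2 * (-a) * u t - 2 * b * v t) / N t ≤ 4 * Z t := by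
    rw [div_le_iff₀ hNt]
    have h4 : N t + 2 * (-a) * u t - 2 * b * v t = Z t * (N t + 2 * a * u t - 2 * b * v t) := by
      rw [hZd]; field_simp [(hpos t ht).ne']
    have h5 : 0 ≤ Z t := div_nonneg (O.P_nonneg hab' t) (hpos t ht).le
    rw [h4]
    nlinarith [O.P_le hab t]
  have e : -(2 * (κ * a) * t) = -(2 * (κ * a)) * (t - 0) := by ring
  rw [e]
  linarith

/-- Algebraic locking on the manifold, at equality of coupling and detuning. -/
theorem manifold_algebraic_lock (hκ : 0 < κ) (hγ : γ = κ) (hD : D 0 = 0) (hN : 0 < N 0)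
    (hP : N 0 - 2 * v 0 ≠ 0) {t : ℝ} (ht : 0 ≤ t) :
    (2 * u t / N t) ^ 2 + (2 * v t / N t - 1) ^ 2
      = 4 / (4 * (u 0 / (N 0 - 2 * v 0) + κ / 2 * t) ^ 2 + 1) := by
  have hab : (0 : ℝ) ^ 2 + 1 ^ 2 = 1 := by norm_num
  have hb : γ = κ * 1 := by linarith
  have hP' := O.hP hab hb
  have hz : ∀ t, 0 ≤ t → (N 0 - 2 * v 0 = 0 ↔ N t - 2 * v t = 0) := fun t ht => by
    simpa using O.P_zero_of_manifold hκ hab hb hD ht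
  have hPn : ∀ t, 0 ≤ t → N t - 2 * v t ≠ 0 := fun t ht h => hP ((hz t ht).2 h)
  simp only [mul_zero, zero_mul, add_zero, mul_one] at hP'
  -- For `γ = κ` and `D = 0` the derivative of `u/(N - 2v)` is exactly `κ/2`. This integrates the
  -- phase equation explicitly.
  have hτ := (O.hu.div hP' hPn).sub (DerivOn.affine 0 (κ / 2) 0 (Ici 0))
  have hc : ∀ s ∈ Ici (0 : ℝ), (((2 * α - κ - N s) * u s - γ * v s + κ / 2 * N s) * (N s - 2 * v s)
      - u s * ((2 * α - κ - N s) * (N s - 2 * v s) - D s ^ 2)) / (N s - 2 * v s) ^ 2 - κ / 2 = 0 := by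
    intro s hs
    rw [O.D_eq_zero hκ hD hs, hγ]
    have := hPn s hs
    field_simp
    ring
  have h1 := le_antisymm
    (hτ.antitoneOn (convex_Ici 0) (fun s hs => (hc s hs).le) self_mem_Ici ht ht)
    (hτ.monotoneOn (convex_Ici 0) (fun s hs => (hc s hs).ge) self_mem_Ici ht ht)
  simp only [sub_zero, zero_add, mul_zero] at h1
  have h2 : u 0 / (N 0 - 2 * v 0) + κ / 2 * t = u t / (N t - 2 * v t) := by linarith
  rw [h2]
  have hNt := O.N_pos hκ hN ht
  have hDt := O.D_eq_zero hκ hD ht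
  have hd := O.dist_sq_eq hab hNt
  rw [hDt] at hd
  simp only [neg_zero, mul_zero, zero_mul, add_zero, mul_one, sub_zero, zero_div, ne_eq,
    OfNat.ofNat_ne_zero, not_false_eq_true, zero_pow] at hd
  rw [hd]
  have hi := O.ident t
  rw [hDt] at hi
  have h3 := hPn t ht
  have h4 : 4 * u t ^ 2 + (N t - 2 * v t) ^ 2 = 2 * N t * (N t - 2 * v t) := by
    linear_combination -hi
  have e : 4 * (u t / (N t - 2 * v t)) ^ 2 + 1 = 2 * N t / (N t - 2 * v t) := by
    rw [div_pow, eq_div_iff h3]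
    field_simp
    linear_combination h4
  rw [e]
  field_simp
  ring

omit O in
/-- The amplitude equation. -/
theorem amplitude_eq {t : ℝ} (ht : 0 < N t) :
    (2 * α - κ) * N t - N t ^ 2 - D t ^ 2 + 2 * κ * u t
      = N t * ((2 * α - κ + κ * (2 * u t / N t) - N t * (D t / N t) ^ 2) - N t) := by
  field_simp
  ring

/-- The amplitude limit once the phase is locked. -/
theorem tendsto_amplitude (hκ : 0 < κ) (hN : 0 < N 0) {a : ℝ}
    (hX : Tendsto (fun t => 2 * u t / N t) atTop (𝓝 a))
    (hd : Tendsto (fun t => D t / N t) atTop (𝓝 0)) :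
    Tendsto N atTop (𝓝 (max (2 * α - κ + κ * a) 0)) := by
  obtain ⟨M, hM, hb⟩ := O.exists_bound hκ
  refine O.hN.tendsto_logistic (fun t ht => amplitude_eq (O.N_pos hκ hN ht))
    (fun t ht => O.N_pos hκ hN ht) ?_
  have h1 : Tendsto (fun t => N t * (D t / N t) ^ 2) atTop (𝓝 0) := by
    refine squeeze_zero' (Eventually.of_forall fun t => mul_nonneg (O.nonneg t) (sq_nonneg _)) ?_
      (by simpa using (hd.pow 2).const_mul M)
    filter_upwards [eventually_ge_atTop 0] with t ht
    exact mul_le_mul_of_nonneg_right (hb t ht) (sq_nonneg _)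
  simpa using ((hX.const_mul κ).const_add (2 * α - κ)).sub h1

end Orbit

/-! ### Derivatives of the phase factors -/

theorem DerivOn.sqrt {f f' : ℝ → ℝ} {S : Set ℝ} (hf : DerivOn f f' S) (h0 : ∀ t ∈ S, f t ≠ 0) :
    DerivOn (fun t => √(f t)) (fun t => f' t / (2 * √(f t))) S :=
  fun t ht => (hf t ht).sqrt (h0 t ht)

theorem norm_mul_norm_eq (w : ℂ × ℂ) :
    ‖w.1‖ * ‖w.2‖ = √(stokesU w ^ 2 + stokesV w ^ 2) := by
  have : ‖w.1 * (starRingEnd ℂ) w.2‖ = ‖w.1‖ * ‖w.2‖ := by rw [norm_mul, RCLike.norm_conj]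
  rw [← this, q_eq, Complex.norm_def, Complex.normSq_mk, ← sq, ← sq]

theorem phaseFactor_eq_mk (w : ℂ × ℂ) :
    phaseFactor w = ⟨stokesU w / √(stokesU w ^ 2 + stokesV w ^ 2),
      stokesV w / √(stokesU w ^ 2 + stokesV w ^ 2)⟩ := by
  rw [phaseFactor, q_eq, ← Complex.ofReal_mul, norm_mul_norm_eq]
  apply Complex.ext
  · rw [Complex.div_ofReal_re]
  · rw [Complex.div_ofReal_im]

theorem unitAt_eq_mk (θ : ℝ) : unitAt θ = ⟨Real.cos θ, Real.sin θ⟩ := by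
  rw [unitAt]
  apply Complex.ext
  · simp [Complex.exp_ofReal_mul_I_re]
  · simp [Complex.exp_ofReal_mul_I_im]

/-- In polar coordinates for `u + iv` the radial rates cancel, and the angular velocity is `γ -
κNv/(2(u² + v²))`. The formulas are valid off the manifold too, as long as `u + iv ≠ 0`. -/
theorem Orbit.deriv_phase {α κ γ : ℝ} {N D u v : ℝ → ℝ} (O : Orbit α κ γ N D u v) {T : ℝ}
    (hT : 0 ≤ T) (hr : ∀ t, T ≤ t → 0 < u t ^ 2 + v t ^ 2) :
    DerivOn (fun t => u t / √(u t ^ 2 + v t ^ 2))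
      (fun t => -(v t / √(u t ^ 2 + v t ^ 2)) * (γ - κ * N t * v t / (2 * (u t ^ 2 + v t ^ 2))))
      (Ici T) ∧
    DerivOn (fun t => v t / √(u t ^ 2 + v t ^ 2))
      (fun t => u t / √(u t ^ 2 + v t ^ 2) * (γ - κ * N t * v t / (2 * (u t ^ 2 + v t ^ 2))))
      (Ici T) := by
  have hu := O.hu.Ici_of_le hT
  have hv := O.hv.Ici_of_le hT
  have h2 := (hu.sq.add hv.sq).sqrt (fun t ht => (hr t ht).ne')
  have h0 : ∀ t ∈ Ici T, √(u t ^ 2 + v t ^ 2) ≠ 0 := fun t ht => (Real.sqrt_pos.2 (hr t ht)).ne'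
  constructor
  · refine (hu.div h2 h0).congr fun t ht => ?_
    have h3 := h0 t ht
    have h4 := Real.sq_sqrt (hr t ht).le
    have h5 := (hr t ht).ne'
    set r := √(u t ^ 2 + v t ^ 2)
    rw [← h4] at h5 ⊢
    field_simp
    have h6 : u t ^ 2 = r ^ 2 - v t ^ 2 := by linarith
    linear_combination
      (-(2 * (2 * α - κ - N t) * u t + κ * N t)) * h6
  · refine (hv.div h2 h0).congr fun t ht => ?_
    have h3 := h0 t ht
    have h4 := Real.sq_sqrt (hr t ht).le
    have h5 := (hr t ht).ne'
    set r := √(u t ^ 2 + v t ^ 2)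
    rw [← h4] at h5 ⊢
    field_simp
    have h6 : u t ^ 2 = r ^ 2 - v t ^ 2 := by linarith
    linear_combination (-2 * (2 * α - κ - N t) * v t) * h6

/-- Close to the manifold, phase-locking is impossible when the detuning exceeds the coupling. -/
theorem incoherent_of_near {α κ ω γ : ℝ} (hκ : 0 < κ) (hγ : γ = 2 * ω) (h : κ < γ)
    {z : ℝ → ℂ × ℂ} (hz : IsSolution α κ ω z)
    (hnear : ∀ᶠ t in atTop, 0 < stokesN (z t) ∧
      (γ + κ) ^ 2 * stokesD (z t) ^ 2 ≤ ((γ + κ) ^ 2 - 4 * κ ^ 2) * stokesN (z t) ^ 2) :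
    Incoherent z := by
  rintro ⟨θ, hθ⟩
  have O := hz.orbit hγ
  set N := fun t => stokesN (z t)
  set D := fun t => stokesD (z t)
  set u := fun t => stokesU (z t)
  set v := fun t => stokesV (z t)
  rw [PhaseLockedAt, unitAt_eq_mk] at hθ
  have hC : Tendsto (fun t => u t / √(u t ^ 2 + v t ^ 2)) atTop (𝓝 (Real.cos θ)) := by
    have := (Complex.continuous_re.tendsto _).comp hθ
    simpa [Function.comp_def, phaseFactor_eq_mk] using this
  have hS : Tendsto (fun t => v t / √(u t ^ 2 + v t ^ 2)) atTop (𝓝 (Real.sin θ)) := by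
    have := (Complex.continuous_im.tendsto _).comp hθ
    simpa [Function.comp_def, phaseFactor_eq_mk] using this
  have hB : Tendsto (fun t => u t / √(u t ^ 2 + v t ^ 2) * Real.cos θ
      + v t / √(u t ^ 2 + v t ^ 2) * Real.sin θ) atTop (𝓝 1) := by
    have := (hC.mul_const (Real.cos θ)).add (hS.mul_const (Real.sin θ))
    rwa [← sq, ← sq, Real.cos_sq_add_sin_sq] at this
  have hE : Tendsto (fun t => u t / √(u t ^ 2 + v t ^ 2) * Real.sin θ
      - v t / √(u t ^ 2 + v t ^ 2) * Real.cos θ) atTop (𝓝 0) := by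
    have := (hC.mul_const (Real.sin θ)).sub (hS.mul_const (Real.cos θ))
    rwa [mul_comm (Real.sin θ), sub_self] at this
  obtain ⟨T₁, hT₁⟩ := eventually_atTop.1
    (hnear.and (hB.eventually_const_lt (show (1 / 2 : ℝ) < 1 by norm_num)))
  set T := max T₁ 0
  have hT0 : 0 ≤ T := le_max_right _ _
  have hT : ∀ t, T ≤ t → T₁ ≤ t := fun t ht => (le_max_left _ _).trans ht
  -- The closeness hypothesis in terms of `|u + iv|`. It bounds the angular velocity below by `γ -
  -- (γ + κ)/2 = (γ - κ)/2`.
  have hr : ∀ t, T ≤ t → κ ^ 2 * N t ^ 2 ≤ (γ + κ) ^ 2 * (u t ^ 2 + v t ^ 2) := by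
    intro t ht
    have h1 := (hT₁ t (hT t ht)).1.2
    have h2 := O.ident t
    simp only [N, D] at h2 ⊢
    nlinarith
  have hr0 : ∀ t, T ≤ t → 0 < u t ^ 2 + v t ^ 2 := by
    intro t ht
    have h1 : 0 < κ ^ 2 * N t ^ 2 := by
      have : 0 < N t := (hT₁ t (hT t ht)).1.1
      positivity
    have h2 := h1.trans_le (hr t ht)
    have h3 : 0 < (γ + κ) ^ 2 := by
      have : 0 < γ + κ := by linarith
      positivity
    exact pos_of_mul_pos_right h2 h3.le
  obtain ⟨dC, dS⟩ := O.deriv_phase hT0 hr0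
  -- This function is `sin(θ - Φ)`. If `Φ → θ`, its derivative is eventually at most `-(γ - κ)/4`,
  -- so it would fall below `-1`, although it tends to `0`.
  have dE := (dC.mul (fun t _ => (hasDerivWithinAt_const t (Ici T) (Real.sin θ)))).sub
    (dS.mul (fun t _ => (hasDerivWithinAt_const t (Ici T) (Real.cos θ))))
  have hev := dE.eventually_le_of_speed (M := -1) (c := (γ - κ) / 4) (fun t ht _ => ?_)
    (by linarith)
  · obtain ⟨t, h1, h2⟩ := (hev.and (hE.eventually_const_lt (show (-1 : ℝ) < 0 by norm_num))).exists
    linarith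
  · have hψ : (γ - κ) / 2 ≤ γ - κ * N t * v t / (2 * (u t ^ 2 + v t ^ 2)) := by
      have h1 := hr0 t ht
      have h2 : κ * N t * v t ≤ (γ + κ) * (u t ^ 2 + v t ^ 2) := by
        refine le_of_sq_le_sq ?_ (by have : 0 < γ + κ := by linarith
                                     positivity)
        have h3 : v t ^ 2 ≤ u t ^ 2 + v t ^ 2 := by nlinarith [sq_nonneg (u t)]
        calc (κ * N t * v t) ^ 2 = (κ ^ 2 * N t ^ 2) * v t ^ 2 := by ring
          _ ≤ ((γ + κ) ^ 2 * (u t ^ 2 + v t ^ 2)) * (u t ^ 2 + v t ^ 2) := by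
              exact mul_le_mul (hr t ht) h3 (sq_nonneg _) (by positivity)
          _ = _ := by ring
      have h4 : κ * N t * v t / (2 * (u t ^ 2 + v t ^ 2)) ≤ (γ + κ) / 2 := by
        rw [div_le_div_iff₀ (by positivity) (by norm_num)]
        linarith
      linarith
    have h1 := (hT₁ t (hT t ht)).2
    have e : (-(v t / √(u t ^ 2 + v t ^ 2)) * (γ - κ * N t * v t / (2 * (u t ^ 2 + v t ^ 2)))
        * Real.sin θ + u t / √(u t ^ 2 + v t ^ 2) * 0)
        - (u t / √(u t ^ 2 + v t ^ 2) * (γ - κ * N t * v t / (2 * (u t ^ 2 + v t ^ 2)))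
        * Real.cos θ + v t / √(u t ^ 2 + v t ^ 2) * 0)
        = -((γ - κ * N t * v t / (2 * (u t ^ 2 + v t ^ 2))) * (u t / √(u t ^ 2 + v t ^ 2) * Real.cos θ
      + v t / √(u t ^ 2 + v t ^ 2) * Real.sin θ)) := by ring
    rw [e]
    nlinarith

/-- The mean phase moves slowly close to the manifold. -/
theorem meanPhase_deriv {α κ ω : ℝ} (hκ : 0 < κ) {z : ℝ → ℂ × ℂ} (hz : IsSolution α κ ω z) {t : ℝ}
    (ht : 0 ≤ t) (h0 : 0 < stokesN (z t)) (hD : |stokesD (z t)| ≤ stokesN (z t) / 2) :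
    ∃ m : ℂ, HasDerivWithinAt (fun s => meanPhaseFactor (z s)) m (Ici 0) t ∧
      ‖m‖ ≤ 4 * κ * (|stokesD (z t)| / stokesN (z t)) := by
  set N := stokesN (z t) with hN
  set D := stokesD (z t) with hDd
  set u := stokesU (z t) with hu
  set v := stokesV (z t) with hv
  set p := (z t).1 * (z t).2 with hp
  have hid : N ^ 2 = D ^ 2 + 4 * (u ^ 2 + v ^ 2) := stokes_identity (z t)
  have hD2 : D ^ 2 ≤ N ^ 2 / 4 := by
    have := abs_le.1 hD
    nlinarith
  have hr0 : 0 < u ^ 2 + v ^ 2 := by nlinarith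
  set r := √(u ^ 2 + v ^ 2) with hr
  have hrp : 0 < r := Real.sqrt_pos.2 hr0
  have hr2 : r ^ 2 = u ^ 2 + v ^ 2 := Real.sq_sqrt hr0.le
  have hrN : N / 4 ≤ r := by
    refine le_of_sq_le_sq ?_ hrp.le
    nlinarith
  have h1 : HasDerivWithinAt (fun s => (z s).1) (field α κ ω (z t)).1 (Ici 0) t :=
    (ContinuousLinearMap.fst ℝ ℂ ℂ).hasFDerivAt.comp_hasDerivWithinAt t (hz t ht)
  have h2 : HasDerivWithinAt (fun s => (z s).2) (field α κ ω (z t)).2 (Ici 0) t :=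
    (ContinuousLinearMap.snd ℝ ℂ ℂ).hasFDerivAt.comp_hasDerivWithinAt t (hz t ht)
  have h3 : HasDerivWithinAt (fun s => √(stokesU (z s) ^ 2 + stokesV (z s) ^ 2))
      (((2 * α - κ - N) * r ^ 2 + κ * N * u / 2) / r) (Ici 0) t := by
    have hU := (hz.stokesU t ht).fun_pow 2
    have hV := (hz.stokesV t ht).fun_pow 2
    refine ((hU.add hV).sqrt hr0.ne').congr_deriv ?_
    simp only [Pi.add_apply]
    rw [← hr, hr2]
    simp only [← hN, ← hu, ← hv]
    field_simp
    ring
  have h4 := (h1.mul h2).div h3.ofReal_comp (by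
    show ((r : ℝ) : ℂ) ≠ 0
    exact_mod_cast hrp.ne')
  have hrC : (r : ℂ) ≠ 0 := by exact_mod_cast hrp.ne'
  have hNC : (N : ℂ) ≠ 0 := by exact_mod_cast h0.ne'
  have e1 : (field α κ ω (z t)).1 * (z t).2 + (z t).1 * (field α κ ω (z t)).2
      = (2 * α - κ - N : ℝ) * p + (κ / 2 : ℝ) * ((z t).1 ^ 2 + (z t).2 ^ 2) := by
    have : (N : ℂ) = (‖(z t).1‖ : ℂ) ^ 2 + (‖(z t).2‖ : ℂ) ^ 2 := by
      rw [hN, stokesN_eq]; push_cast; rfl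
    push_cast
    rw [this, field, hp]
    ring
  -- This identity isolates a factor `D`: the part `4u z₁z₂` is absorbed by the derivative of the
  -- modulus, so only terms containing `D` survive in the derivative of the mean phase.
  have e2 : (N : ℂ) * ((z t).1 ^ 2 + (z t).2 ^ 2) = 4 * u * p + D * ((z t).1 ^ 2 - (z t).2 ^ 2) := by
    rw [hN, hu, hDd, hp]
    apply Complex.ext
    · simp [stokesN, stokesU, stokesD, Complex.normSq_apply, sq]; ring
    · simp [stokesN, stokesU, stokesD, Complex.normSq_apply, sq]; ring
  have e3 : (N : ℂ) ^ 2 = D ^ 2 + 4 * r ^ 2 := by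
    have : N ^ 2 = D ^ 2 + 4 * r ^ 2 := by rw [hr2]; exact hid
    exact_mod_cast this
  refine ⟨((κ / (2 * r ^ 3 * N) : ℝ) : ℂ) * (((D * r ^ 2 : ℝ) : ℂ) * ((z t).1 ^ 2 - (z t).2 ^ 2)
    - ((u * D ^ 2 : ℝ) : ℂ) * p), ?_, ?_⟩
  · refine (HasDerivWithinAt.congr h4 (fun s _ => ?_) ?_).congr_deriv ?_
    · simp [meanPhaseFactor, ← norm_mul_norm_eq]
    · simp [meanPhaseFactor, ← norm_mul_norm_eq]
    · simp only [Pi.mul_apply, ← hu, ← hv, ← hr, ← hp]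
      rw [e1]
      push_cast
      field_simp
      linear_combination (κ * r ^ 2) * e2 + (-κ * u * p) * e3
  · have n1 : ‖(z t).1 ^ 2 - (z t).2 ^ 2‖ ≤ N := by
      refine (norm_sub_le _ _).trans ?_
      rw [norm_pow, norm_pow, hN, stokesN_eq]
    have n2 : ‖p‖ = r := by rw [hp, norm_mul, norm_mul_norm_eq]
    have n3 : |u| ≤ r := abs_le_of_sq_le_sq (by nlinarith [sq_nonneg v]) hrp.le
    have n4 : |D| ≤ N := by linarith
    have hc : 0 ≤ κ / (2 * r ^ 3 * N) := by positivity
    rw [norm_mul, Complex.norm_real, Real.norm_of_nonneg hc]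
    have n5 : ‖((D * r ^ 2 : ℝ) : ℂ) * ((z t).1 ^ 2 - (z t).2 ^ 2) - ((u * D ^ 2 : ℝ) : ℂ) * p‖
        ≤ 2 * |D| * r ^ 2 * N := by
      refine (norm_sub_le _ _).trans ?_
      rw [norm_mul, norm_mul, Complex.norm_real, Complex.norm_real, Real.norm_eq_abs,
        Real.norm_eq_abs, abs_mul, abs_mul, n2, abs_of_nonneg (sq_nonneg r), abs_of_nonneg (sq_nonneg D),
        ← sq_abs D]
      have a1 : |D| * r ^ 2 * ‖(z t).1 ^ 2 - (z t).2 ^ 2‖ ≤ |D| * r ^ 2 * N := by gcongr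
      have a2 : |u| * |D| ^ 2 * r ≤ r * (|D| * N) * r := by
        rw [sq]; gcongr
      linarith
    refine (mul_le_mul_of_nonneg_left n5 hc).trans ?_
    have : κ / (2 * r ^ 3 * N) * (2 * |D| * r ^ 2 * N) = κ * |D| / r := by field_simp
    rw [this, ← mul_div_assoc, div_le_div_iff₀ hrp h0]
    have : κ * |D| * N ≤ κ * |D| * (4 * r) := by gcongr; linarith
    linarith

/-- On the manifold the mean phase is constant. -/
theorem meanPhase_const {α κ ω : ℝ} (hκ : 0 < κ) {z : ℝ → ℂ × ℂ} (hz : IsSolution α κ ω z)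
    (h0 : z 0 ∈ manifoldM) {t : ℝ} (ht : 0 ≤ t) : meanPhaseFactor (z t) = meanPhaseFactor (z 0) := by
  have hM : ∀ s, 0 ≤ s → z s ∈ manifoldM := fun s hs => invariance ordConnected_Ici hz self_mem_Ici h0 hs
  have hd : ∀ s, 0 ≤ s → HasDerivWithinAt (fun s => meanPhaseFactor (z s)) 0 (Ici 0) s := by
    intro s hs
    obtain ⟨h1, h2⟩ := mem_manifoldM_iff.1 (hM s hs)
    obtain ⟨m, hm, hm'⟩ := meanPhase_deriv hκ hz hs h2 (by rw [h1, abs_zero]; positivity)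
    rw [h1, abs_zero, zero_div, mul_zero] at hm'
    rwa [norm_le_zero_iff.1 hm'] at hm
  refine constant_of_has_deriv_right_zero (a := 0) (b := t)
    (fun s hs => (hd s hs.1).continuousWithinAt.mono Icc_subset_Ici_self)
    (fun s hs => (hd s hs.1).mono (Ici_subset_Ici.2 hs.1)) t (right_mem_Icc.2 ht)

/-! ### The periodic phase orbit -/

/-- A phase lift on the manifold. -/
theorem exists_lift {α κ ω γ : ℝ} (hκ : 0 < κ) (hγ : γ = 2 * ω) {z : ℝ → ℂ × ℂ}
    (hz : IsSolution α κ ω z) (h0 : z 0 ∈ manifoldM) :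
    ∃ Φ : ℝ → ℝ, DerivOn Φ (fun t => γ - κ * Real.sin (Φ t)) (Ici 0) ∧
      ∀ t, 0 ≤ t → phaseFactor (z t) = unitAt (Φ t) := by
  have hM : ∀ s, 0 ≤ s → z s ∈ manifoldM := fun s hs => invariance ordConnected_Ici hz self_mem_Ici h0 hs
  have O := hz.orbit hγ
  have hN0 := (mem_manifoldM_iff.1 h0).2
  have hD0 := (mem_manifoldM_iff.1 h0).1
  set N := fun t => stokesN (z t) with hNd
  set D := fun t => stokesD (z t)
  set u := fun t => stokesU (z t) with hud
  set v := fun t => stokesV (z t) with hvd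
  have hNp : ∀ t, 0 ≤ t → N t ≠ 0 := fun t ht => (O.N_pos hκ hN0 ht).ne'
  set X := fun t => 2 * u t / N t with hX
  set Y := fun t => 2 * v t / N t with hY
  have hXY : ∀ t, 0 ≤ t → X t ^ 2 + Y t ^ 2 = 1 := by
    intro t ht
    have h1 := hNp t ht
    have h2 := O.ident t
    rw [O.D_eq_zero hκ hD0 ht] at h2
    simp only [hX, hY]
    field_simp
    linarith
  have dX : DerivOn X (fun t => -(Y t * (γ - κ * Y t))) (Ici 0) := by
    refine ((O.hu.const_mul 2).div O.hN hNp).congr fun t ht => ?_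
    have h1 := hNp t ht
    have h2 := O.ident t
    rw [O.D_eq_zero hκ hD0 ht] at h2 ⊢
    simp only [hY]
    field_simp
    linear_combination κ * h2
  have dY : DerivOn Y (fun t => X t * (γ - κ * Y t)) (Ici 0) := by
    refine ((O.hv.const_mul 2).div O.hN hNp).congr fun t ht => ?_
    have h1 := hNp t ht
    rw [O.D_eq_zero hκ hD0 ht]
    simp only [hX, hY]
    field_simp
    ring
  -- Freezing `Y` for negative times makes the angular velocity continuous on the whole line, so
  -- that its integral is differentiable at `0` as well.
  set f : ℝ → ℝ := fun t => γ - κ * Y (max t 0) with hf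
  have hfc : Continuous f := by
    have : Continuous fun t : ℝ => Y (max t 0) :=
      dY.continuousOn.comp_continuous (by fun_prop) (fun t => mem_Ici.2 (le_max_right _ _))
    exact continuous_const.sub (this.const_mul κ)
  obtain ⟨Φ₀, hc0, hs0⟩ : ∃ Φ₀ : ℝ, Real.cos Φ₀ = X 0 ∧ Real.sin Φ₀ = Y 0 := by
    set w : ℂ := ⟨X 0, Y 0⟩
    have hw : ‖w‖ = 1 := by
      rw [Complex.norm_def, Complex.normSq_mk, ← sq, ← sq, hXY 0 le_rfl, Real.sqrt_one]
    refine ⟨Complex.arg w, ?_, ?_⟩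
    · rw [Complex.cos_arg (norm_pos_iff.1 (by rw [hw]; exact one_pos)), hw, div_one]
    · rw [Complex.sin_arg, hw, div_one]
  set Φ : ℝ → ℝ := fun t => Φ₀ + ∫ s in (0 : ℝ)..t, f s with hΦ
  have dΦ : ∀ t, HasDerivAt Φ (f t) t := fun t =>
    (intervalIntegral.integral_hasDerivAt_right (hfc.intervalIntegrable _ _)
      (hfc.stronglyMeasurableAtFilter _ _) hfc.continuousAt).const_add Φ₀
  have hft : ∀ t, 0 ≤ t → f t = γ - κ * Y t := fun t ht => by simp only [hf, max_eq_left ht]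
  have dc : DerivOn (fun t => Real.cos (Φ t)) (fun t => -Real.sin (Φ t) * f t) (Ici 0) :=
    fun t _ => ((dΦ t).cos).hasDerivWithinAt
  have ds : DerivOn (fun t => Real.sin (Φ t)) (fun t => Real.cos (Φ t) * f t) (Ici 0) :=
    fun t _ => ((dΦ t).sin).hasDerivWithinAt
  -- The inner product of the unit vectors `(X, Y)` and `(cos Φ, sin Φ)` has zero derivative and
  -- starts at `1`, hence the vectors coincide.
  have dA := (dX.mul dc).add (dY.mul ds)
  have hA' : ∀ t ∈ Ici (0 : ℝ), -(Y t * (γ - κ * Y t)) * Real.cos (Φ t)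
      + X t * (-Real.sin (Φ t) * f t) + (X t * (γ - κ * Y t) * Real.sin (Φ t)
      + Y t * (Real.cos (Φ t) * f t)) = 0 := by
    intro t ht
    rw [hft t ht]; ring
  have hΦ0 : Φ 0 = Φ₀ := by simp [hΦ]
  have hA : ∀ t, 0 ≤ t → X t * Real.cos (Φ t) + Y t * Real.sin (Φ t) = 1 := by
    intro t ht
    have h1 := le_antisymm
      (dA.antitoneOn (convex_Ici 0) (fun s hs => (hA' s hs).le) self_mem_Ici ht ht)
      (dA.monotoneOn (convex_Ici 0) (fun s hs => (hA' s hs).ge) self_mem_Ici ht ht)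
    simp only at h1
    rw [h1, hΦ0, hc0, hs0, ← sq, ← sq, hXY 0 le_rfl]
  have hcs : ∀ t, 0 ≤ t → X t = Real.cos (Φ t) ∧ Y t = Real.sin (Φ t) := by
    intro t ht
    have h1 := hA t ht
    have h2 := hXY t ht
    have h3 := Real.cos_sq_add_sin_sq (Φ t)
    have h4 : (X t - Real.cos (Φ t)) ^ 2 + (Y t - Real.sin (Φ t)) ^ 2 = 0 := by
      linear_combination h2 + h3 - 2 * h1
    constructor
    · nlinarith [sq_nonneg (X t - Real.cos (Φ t)), sq_nonneg (Y t - Real.sin (Φ t))]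
    · nlinarith [sq_nonneg (X t - Real.cos (Φ t)), sq_nonneg (Y t - Real.sin (Φ t))]
  refine ⟨Φ, fun t ht => ?_, fun t ht => ?_⟩
  · show HasDerivWithinAt Φ (γ - κ * Real.sin (Φ t)) (Ici 0) t
    rw [← (hcs t ht).2, ← hft t ht]
    exact (dΦ t).hasDerivWithinAt
  · rw [phaseFactor_eq_of_mem (hM t ht), unitAt_eq_mk, ← (hcs t ht).1, ← (hcs t ht).2]

theorem periodicPhase {α κ ω γ : ℝ} (hκ : 0 < κ) (hγ : γ = 2 * ω) (h : κ < γ) {z : ℝ → ℂ × ℂ}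
    (hz : IsSolution α κ ω z) (h0 : z 0 ∈ manifoldM) : PeriodicPhase z := by
  have hM : ∀ s, 0 ≤ s → z s ∈ manifoldM := fun s hs => invariance ordConnected_Ici hz self_mem_Ici h0 hs
  obtain ⟨Φ, dΦ, hΦ⟩ := exists_lift hκ hγ hz h0
  have hpos : ∀ x : ℝ, γ - κ ≤ γ - κ * Real.sin x := fun x => by
    nlinarith [Real.sin_le_one x]
  refine ⟨fun t ht => ?_, fun t ht => meanPhase_const hκ hz h0 ht, ⟨Φ, fun t ht => ⟨hΦ t ht, _,
    lt_of_lt_of_le (by linarith) (hpos (Φ t)), dΦ t ht⟩⟩, ?_⟩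
  · have h1 := mem_manifoldM_iff.1 (hM t ht)
    constructor
    · intro h2
      have e1 := norm_sq_fst (z t)
      rw [h2, h1.1] at e1
      simp at e1
      linarith [h1.2]
    · intro h2
      have e1 := norm_sq_snd (z t)
      rw [h2, h1.1] at e1
      simp at e1
      linarith [h1.2]
  · have hg : 0 < γ - κ := by linarith
    set S : ℝ := 2 * Real.pi / (γ - κ) with hS
    have hS0 : 0 < S := by have := Real.pi_pos; positivity
    have h1 : Φ 0 + 2 * Real.pi ≤ Φ S := by
      have := (dΦ.sub (DerivOn.affine 0 (γ - κ) 0 _)).monotoneOn (convex_Ici 0)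
        (fun t _ => by linarith [hpos (Φ t)]) self_mem_Ici hS0.le hS0.le
      simp only [sub_zero, mul_zero, zero_add] at this
      have e : (γ - κ) * S = 2 * Real.pi := by rw [hS]; field_simp
      linarith
    obtain ⟨T, hT, hTe⟩ := intermediate_value_Icc hS0.le (dΦ.continuousOn.mono Icc_subset_Ici_self)
      (show Φ 0 + 2 * Real.pi ∈ Icc (Φ 0) (Φ S) from ⟨by linarith [Real.pi_pos], h1⟩)
    have hT0 : 0 < T := by
      rcases hT.1.lt_or_eq with h2 | h2
      · exact h2
      · rw [← h2] at hTe; linarith [Real.pi_pos]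
    refine ⟨T, hT0, fun t ht => ?_⟩
    -- The difference `Φ(t + T) - Φ(t) - 2π` vanishes at `0`, and its derivative is at most `κ`
    -- times its modulus, so it vanishes identically.
    have h2 := ((dΦ.shift hT0.le).sub dΦ).sub
      (fun t _ => hasDerivWithinAt_const t (Ici (0 : ℝ)) (2 * Real.pi))
    have h3 := (h2.mono (Icc_subset_Ici_self : Icc 0 t ⊆ Ici 0)).two_sided (K := κ) ht
      (fun s _ => ?_)
    · have h4 := h3.1 (by simp [hTe])
      rw [hΦ _ (add_nonneg ht hT0.le), hΦ t ht, unitAt_eq_mk, unitAt_eq_mk]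
      have h5 : Φ (t + T) = Φ t + 2 * Real.pi := by linarith
      rw [h5, Real.cos_add_two_pi, Real.sin_add_two_pi]
    · have e : γ - κ * Real.sin (Φ (s + T)) - (γ - κ * Real.sin (Φ s)) - 0
          = κ * (Real.sin (Φ s) - Real.sin (Φ (s + T) - 2 * Real.pi)) := by
        rw [Real.sin_sub_two_pi]; ring
      rw [e, abs_mul, abs_of_pos hκ]
      refine mul_le_mul_of_nonneg_left ?_ hκ.le
      refine (Real.abs_sin_sub_sin_le _ _).trans (le_of_eq ?_)
      rw [abs_sub_comm]
      congr 1
      ring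

/-! ### Asymptotic states on the manifold -/

/-- Lower bound for the energy when the detuning exceeds the coupling and `κ < 2α`. -/
theorem exists_lower_bound_of_lt {α κ γ : ℝ} (hκ : 0 < κ) (h : κ < γ) (hα : κ < 2 * α) :
    ∃ c c' : ℝ, 0 < c ∧ 0 < c' ∧ ∀ N D u v : ℝ → ℝ, Orbit α κ γ N D u v → ∀ t, 0 ≤ t →
      min (c * N 0) c' ≤ N t := by
  have hg : 0 < γ - κ := by linarith
  have hg' : 0 < γ + κ := by linarith
  have hγ : 0 < γ := by linarith
  -- From `|D| ≤ N ≤ W/(γ - κ)` follows `N W + γD² ≤ kW²`, so `W` cannot decrease while `W < (2α -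
  -- κ)/k`.
  set k := 1 / (γ - κ) + γ / (γ - κ) ^ 2 with hk
  have hk0 : 0 < k := by positivity
  have hβ : 0 < 2 * α - κ := by linarith
  refine ⟨(γ - κ) / (γ + κ), (2 * α - κ) / k / (γ + κ), by positivity, by positivity,
    fun N D u v O t ht => ?_⟩
  have h1 : min ((γ - κ) * N 0) ((2 * α - κ) / k) ≤ γ * N t - 2 * κ * v t := by
    refine O.hW.ge_barrier ((min_le_left _ _).trans (O.le_W hκ 0)) (fun s hs h2 => ?_) ht
    have h3 := h2.trans_le (min_le_right _ _)
    rw [lt_div_iff₀ hk0] at h3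
    have h4 := O.le_W hκ s
    set W := γ * N s - 2 * κ * v s
    have hN := O.nonneg s
    have hW : 0 ≤ W := (mul_nonneg hg.le hN).trans h4
    have h5 : N s ≤ W / (γ - κ) := by rw [le_div_iff₀ hg]; linarith
    have h6 : D s ^ 2 ≤ W * (W / (γ - κ) ^ 2) := by
      have h7 := O.abs_D_le s
      have h8 : D s ^ 2 ≤ (W / (γ - κ)) ^ 2 := by
        rw [← sq_abs (D s)]; exact pow_le_pow_left₀ (abs_nonneg _) (h7.trans h5) 2
      have e : W * (W / (γ - κ) ^ 2) = (W / (γ - κ)) ^ 2 := by field_simp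
      rw [e]; exact h8
    have h9 : W * k = W / (γ - κ) + γ * (W / (γ - κ) ^ 2) := by rw [hk]; field_simp
    have h10 : γ * D s ^ 2 ≤ W * (γ * (W / (γ - κ) ^ 2)) := by nlinarith
    nlinarith
  have h2 := O.W_le hκ t
  rw [div_mul_eq_mul_div, min_div_div_right hg'.le, div_le_iff₀ hg']
  linarith

theorem deathRegime_of_kappaStar {α κ γ : ℝ} (h : γ ≤ κ)
    (hα : α ≤ 0 ∨ (2 * α ≤ κ ∧ κ ≤ kappaStar α γ)) : DeathRegime α κ γ := by
  by_cases h0 : α ≤ 0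
  · exact Or.inl h0
  · push Not at h0
    obtain ⟨h1, h2⟩ := hα.resolve_left (not_le.2 h0)
    rw [kappaStar, le_div_iff₀ (by positivity)] at h2
    refine Or.inr (Or.inr ⟨h, ?_⟩)
    have : √(κ ^ 2 - γ ^ 2) ≤ κ - 2 * α := Real.sqrt_le_iff.2 ⟨by linarith, by nlinarith⟩
    linarith

/-- Above `2α`, the curve `κ = κ*(γ)` is where `(κ - 2α)² = κ² - γ²`, that is, where the growth rate
`2α - κ + √(κ² - γ²)` of the locked state changes sign. Below `2α` this rate is positive anyway. -/
theorem active_condition {α κ γ : ℝ} (hκ : 0 < κ) (h0 : 0 ≤ γ) (h : γ ≤ κ) (hα : 0 < α)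
    (hc : γ < 2 * α ∨ kappaStar α γ < κ) : 0 < 2 * α - κ + √(κ ^ 2 - γ ^ 2) := by
  by_cases h1 : κ < 2 * α
  · have := Real.sqrt_nonneg (κ ^ 2 - γ ^ 2)
    linarith
  · push Not at h1
    have h2 : 4 * α ^ 2 + γ ^ 2 < κ * (4 * α) := by
      rcases hc with hc | hc
      · nlinarith
      · rwa [kappaStar, div_lt_iff₀ (by positivity)] at hc
    have : κ - 2 * α < √(κ ^ 2 - γ ^ 2) := Real.lt_sqrt_of_sq_lt (by nlinarith)
    linarith

theorem lockedAmplitudeSq_eq (α κ γ : ℝ) :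
    lockedAmplitudeSq α κ γ = (2 * α - κ + √(κ ^ 2 - γ ^ 2)) / 2 := by
  rw [lockedAmplitudeSq]; ring

section Manifold

variable {α κ ω γ : ℝ} {z : ℝ → ℂ × ℂ}

theorem mem_manifoldM_of_solution (hz : IsSolution α κ ω z) (h0 : z 0 ∈ manifoldM) {t : ℝ}
    (ht : 0 ≤ t) : z t ∈ manifoldM :=
  invariance ordConnected_Ici hz self_mem_Ici h0 ht

/-- The consequences of locking at the angle with cosine `a`. -/
theorem locked_consequences (hκ : 0 < κ) (hγ : γ = 2 * ω) (hz : IsSolution α κ ω z)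
    (h0 : 0 < stokesN (z 0)) {a b : ℝ} (hab : a ^ 2 + b ^ 2 = 1)
    (hX : Tendsto (fun t => 2 * stokesU (z t) / stokesN (z t)) atTop (𝓝 a))
    (hY : Tendsto (fun t => 2 * stokesV (z t) / stokesN (z t)) atTop (𝓝 b)) :
    Tendsto (fun t => phaseFactor (z t)) atTop (𝓝 (⟨a, b⟩ : ℂ)) ∧
    Tendsto (fun t => ratio (z t)) atTop (𝓝 1) ∧
    Tendsto (fun t => ‖(z t).1‖ ^ 2) atTop (𝓝 (max (2 * α - κ + κ * a) 0 / 2)) ∧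
    Tendsto (fun t => ‖(z t).2‖ ^ 2) atTop (𝓝 (max (2 * α - κ + κ * a) 0 / 2)) ∧
    Tendsto (fun t => ‖(z t).1‖) atTop (𝓝 √(max (2 * α - κ + κ * a) 0 / 2)) ∧
    Tendsto (fun t => ‖(z t).2‖) atTop (𝓝 √(max (2 * α - κ + κ * a) 0 / 2)) := by
  have O := hz.orbit hγ
  have hpos : ∀ᶠ t in atTop, 0 < stokesN (z t) := by
    filter_upwards [eventually_ge_atTop 0] with t ht using O.N_pos hκ h0 ht
  obtain ⟨h1, h2, h3⟩ := tendsto_of_locked hab hpos hX hY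
  have h4 := O.tendsto_amplitude hκ h0 hX h2
  have h5 : Tendsto (fun t => stokesD (z t)) atTop (𝓝 0) := by
    have := h2.mul h4
    rw [zero_mul] at this
    refine this.congr' ?_
    filter_upwards [hpos] with t ht
    exact div_mul_cancel₀ _ ht.ne'
  exact ⟨h1, h3, tendsto_amplitudes h4 h5⟩

theorem active_of_sq_tendsto {L : ℝ} (hL : 0 < L)
    (h1 : Tendsto (fun t => ‖(z t).1‖ ^ 2) atTop (𝓝 L))
    (h2 : Tendsto (fun t => ‖(z t).2‖ ^ 2) atTop (𝓝 L)) : Active z := by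
  constructor
  · intro h
    have := tendsto_nhds_unique h1 (h.pow 2)
    simp at this
    exact hL.ne' this
  · intro h
    have := tendsto_nhds_unique h2 (h.pow 2)
    simp at this
    exact hL.ne' this

theorem P_zero_iff_phaseFactor {a b : ℝ} (hab : a ^ 2 + b ^ 2 = 1) {w : ℂ × ℂ}
    (hw : w ∈ manifoldM) :
    stokesN w + 2 * a * stokesU w - 2 * b * stokesV w = 0 ↔ phaseFactor w = ⟨-a, b⟩ := by
  obtain ⟨h1, h2⟩ := mem_manifoldM_iff.1 hw
  have hid := stokes_identity w
  rw [phaseFactor_eq_of_mem hw, Complex.ext_iff]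
  simp only
  set N := stokesN w
  set u := stokesU w
  set v := stokesV w
  rw [h1] at hid
  constructor
  · intro h
    have h3 : (2 * u + a * N) ^ 2 + (2 * v - b * N) ^ 2 = 0 := by
      linear_combination 2 * N * h - hid + N ^ 2 * hab
    have h4 : 2 * u + a * N = 0 := by
      nlinarith [sq_nonneg (2 * u + a * N), sq_nonneg (2 * v - b * N)]
    have h5 : 2 * v - b * N = 0 := by
      nlinarith [sq_nonneg (2 * u + a * N), sq_nonneg (2 * v - b * N)]
    exact ⟨by rw [div_eq_iff h2.ne']; linarith, by rw [div_eq_iff h2.ne']; linarith⟩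
  · rintro ⟨h3, h4⟩
    rw [div_eq_iff h2.ne'] at h3 h4
    linear_combination N * (-hab) + a * h3 - b * h4

theorem tendsto_of_sq_add_sq {f g : ℝ → ℝ} {e : ℝ → ℝ} {a b : ℝ}
    (h : ∀ᶠ t in atTop, (f t - a) ^ 2 + (g t - b) ^ 2 ≤ e t) (he : Tendsto e atTop (𝓝 0)) :
    Tendsto f atTop (𝓝 a) ∧ Tendsto g atTop (𝓝 b) := by
  have key : ∀ (f : ℝ → ℝ) (a : ℝ), (∀ᶠ t in atTop, (f t - a) ^ 2 ≤ e t) → Tendsto f atTop (𝓝 a) := by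
    intro f a h
    have h1 : Tendsto (fun t => (f t - a) ^ 2) atTop (𝓝 0) :=
      squeeze_zero' (Eventually.of_forall fun t => sq_nonneg _) h he
    have h2 := h1.sqrt
    simp only [Real.sqrt_sq_eq_abs, Real.sqrt_zero] at h2
    rw [tendsto_iff_norm_sub_tendsto_zero]
    exact h2
  constructor
  · refine key f a ?_
    filter_upwards [h] with t ht
    linarith [sq_nonneg (g t - b)]
  · refine key g b ?_
    filter_upwards [h] with t ht
    linarith [sq_nonneg (f t - a)]

/-- Locking on the manifold away from the exceptional phase. -/
theorem manifold_lock (hκ : 0 < κ) (hγ : γ = 2 * ω) (hz : IsSolution α κ ω z)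
    (h0 : z 0 ∈ manifoldM) {a b : ℝ} (hab : a ^ 2 + b ^ 2 = 1) (hb : γ = κ * b) (ha : 0 ≤ a)
    (hb0 : 0 ≤ b) (hne : 0 < a → phaseFactor (z 0) ≠ ⟨-a, b⟩) :
    Tendsto (fun t => 2 * stokesU (z t) / stokesN (z t)) atTop (𝓝 a) ∧
    Tendsto (fun t => 2 * stokesV (z t) / stokesN (z t)) atTop (𝓝 b) := by
  have O := hz.orbit hγ
  obtain ⟨hD, hN⟩ := mem_manifoldM_iff.1 h0
  rcases ha.lt_or_eq with ha | ha
  · obtain ⟨C, hC⟩ := O.manifold_exp_lock hκ hab hb hD hN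
      (fun h => hne ha ((P_zero_iff_phaseFactor hab h0).1 h))
    refine tendsto_of_sq_add_sq (e := fun t => C * Real.exp (-(2 * (κ * a) * t))) ?_ ?_
    · filter_upwards [eventually_ge_atTop 0] with t ht using hC t ht
    · have : Tendsto (fun t : ℝ => 2 * (κ * a) * t) atTop atTop :=
        tendsto_id.const_mul_atTop (by positivity)
      simpa using (Real.tendsto_exp_neg_atTop_nhds_zero.comp this).const_mul C
  · subst ha
    have hb1 : b = 1 := by nlinarith
    subst hb1
    -- For `a = 0` the two equilibria of the phase merge. The solution starting there stays there
    -- and has the same limit, so no datum needs to be excluded.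
    by_cases hP : stokesN (z 0) - 2 * stokesV (z 0) = 0
    · refine tendsto_of_sq_add_sq (e := fun _ => 0) ?_ tendsto_const_nhds
      filter_upwards [eventually_ge_atTop 0] with t ht
      have h1 := (O.P_zero_of_manifold hκ hab hb hD ht).1 (by simpa using hP)
      have h2 := (O.P_ne_zero_iff hab (O.N_pos hκ hN ht) (O.D_eq_zero hκ hD ht)).1 h1
      rw [h2.1, h2.2]
      simp
    · refine tendsto_of_sq_add_sq (e := fun t =>
        4 / (4 * (stokesU (z 0) / (stokesN (z 0) - 2 * stokesV (z 0)) + κ / 2 * t) ^ 2 + 1)) ?_ ?_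
      · filter_upwards [eventually_ge_atTop 0] with t ht
        have := O.manifold_algebraic_lock hκ (by linarith) hD hN hP ht
        simp only [sub_zero] at this ⊢
        exact this.le
      · refine Tendsto.const_div_atTop ?_ 4
        refine tendsto_atTop_add_const_right _ _ (Tendsto.const_mul_atTop (by norm_num) ?_)
        refine (tendsto_pow_atTop two_ne_zero).comp (tendsto_atTop_add_const_left _ _ ?_)
        exact tendsto_id.const_mul_atTop (by positivity)

/-- The exceptional solutions on the manifold. -/
theorem manifold_exceptional (hκ : 0 < κ) (hγ : γ = 2 * ω) (hz : IsSolution α κ ω z)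
    (h0 : z 0 ∈ manifoldM) {a b : ℝ} (hab : a ^ 2 + b ^ 2 = 1) (hb : γ = κ * b)
    (he : phaseFactor (z 0) = ⟨-a, b⟩) :
    Tendsto (fun t => 2 * stokesU (z t) / stokesN (z t)) atTop (𝓝 (-a)) ∧
    Tendsto (fun t => 2 * stokesV (z t) / stokesN (z t)) atTop (𝓝 b) := by
  have O := hz.orbit hγ
  obtain ⟨hD, hN⟩ := mem_manifoldM_iff.1 h0
  refine tendsto_of_sq_add_sq (e := fun _ => 0) ?_ tendsto_const_nhds
  filter_upwards [eventually_ge_atTop 0] with t ht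
  have h1 := (O.P_zero_of_manifold hκ hab hb hD ht).1 ((P_zero_iff_phaseFactor hab h0).2 he)
  have h2 := (O.P_ne_zero_iff hab (O.N_pos hκ hN ht) (O.D_eq_zero hκ hD ht)).1 h1
  rw [h2.1, h2.2]
  simp

theorem incoherent_on_manifold (hκ : 0 < κ) (hγ : γ = 2 * ω) (hz : IsSolution α κ ω z)
    (h0 : z 0 ∈ manifoldM) (h : κ < γ) : Incoherent z := by
  refine incoherent_of_near hκ hγ h hz ?_
  filter_upwards [eventually_ge_atTop 0] with t ht
  obtain ⟨h1, h2⟩ := mem_manifoldM_iff.1 (mem_manifoldM_of_solution hz h0 ht)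
  refine ⟨h2, ?_⟩
  rw [h1]
  have : 0 ≤ (γ + κ) ^ 2 - 4 * κ ^ 2 := by nlinarith
  simp only [ne_eq, OfNat.ofNat_ne_zero, not_false_eq_true, zero_pow, mul_zero]
  positivity

theorem norm_mk_sub_sq (x y a b : ℝ) : ‖(⟨x, y⟩ : ℂ) - ⟨a, b⟩‖ ^ 2 = (x - a) ^ 2 + (y - b) ^ 2 := by
  rw [← Complex.normSq_eq_norm_sq, Complex.normSq_apply]
  simp
  ring

/-- The list of asymptotic states on the manifold. -/
theorem manifold_asymptotics (hκ : 0 < κ) (hω : 0 ≤ ω) (hγ : γ = 2 * ω) (hz : IsSolution α κ ω z)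
    (h0 : z 0 ∈ manifoldM) :
    (κ < γ → κ < 2 * α → Active z ∧ Incoherent z ∧ PeriodicPhase z) ∧
    (κ < γ → 2 * α ≤ κ → AmplitudeDeath z ∧ Incoherent z ∧ PeriodicPhase z) ∧
    (γ ≤ κ → (α ≤ 0 ∨ (2 * α ≤ γ ∧ κ ≤ kappaStar α γ)) → AmplitudeDeath z ∧ PhaseLocked z) ∧
    (γ ≤ κ → 0 < α → (γ < 2 * α ∨ kappaStar α γ < κ) →
      PhaseLocked z ∧
      ((γ < κ → phaseFactor (z 0) ≠ unitAt (unstableAngle κ γ)) →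
        Active z ∧
        Tendsto (fun t => ‖(z t).1‖ ^ 2) atTop (𝓝 (lockedAmplitudeSq α κ γ)) ∧
        Tendsto (fun t => ‖(z t).2‖ ^ 2) atTop (𝓝 (lockedAmplitudeSq α κ γ)))) ∧
    (γ < κ → phaseFactor (z 0) ≠ unitAt (unstableAngle κ γ) →
      PhaseLockedAt z (lockAngle κ γ) ∧
      ∃ C : ℝ, ∀ t, 0 ≤ t → ‖phaseFactor (z t) - unitAt (lockAngle κ γ)‖
        ≤ C * Real.exp (-(Real.sqrt (κ ^ 2 - γ ^ 2) * t))) ∧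
    (γ = κ → PhaseLockedAt z (lockAngle κ γ) ∧
      (phaseFactor (z 0) ≠ unitAt (lockAngle κ γ) →
        (fun t => ‖phaseFactor (z t) - unitAt (lockAngle κ γ)‖) =Θ[atTop]
          (fun t : ℝ => t⁻¹))) := by
  have O := hz.orbit hγ
  obtain ⟨hD, hN⟩ := mem_manifoldM_iff.1 h0
  have hγ0 : 0 ≤ γ := by linarith
  have hlocked : ∀ h : γ ≤ κ, PhaseLocked z := by
    intro h
    obtain ⟨a, b, hae, hbe, ha, hb0, hb1, hab, hb, hs, hlt, heq⟩ := lock_params hκ hγ0 h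
    obtain ⟨e1, e2⟩ := unitAt_lockAngle hκ hγ0 h
    rw [← hae, ← hbe] at e1 e2
    by_cases he : 0 < a ∧ phaseFactor (z 0) = ⟨-a, b⟩
    · obtain ⟨hX, hY⟩ := manifold_exceptional hκ hγ hz h0 hab hb he.2
      refine ⟨unstableAngle κ γ, ?_⟩
      rw [PhaseLockedAt, e2]
      exact (locked_consequences hκ hγ hz hN (by linarith [neg_sq a]) hX hY).1
    · obtain ⟨hX, hY⟩ := manifold_lock hκ hγ hz h0 hab hb ha hb0 (fun h1 h2 => he ⟨h1, h2⟩)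
      refine ⟨lockAngle κ γ, ?_⟩
      rw [PhaseLockedAt, e1]
      exact (locked_consequences hκ hγ hz hN hab hX hY).1
  refine ⟨fun h hα => ⟨?_, incoherent_on_manifold hκ hγ hz h0 h, periodicPhase hκ hγ h hz h0⟩,
    fun h hα => ⟨?_, incoherent_on_manifold hκ hγ hz h0 h, periodicPhase hκ hγ h hz h0⟩,
    fun h hα => ⟨?_, hlocked h⟩, fun h hα hc => ⟨hlocked h, fun hne => ?_⟩, fun h hne => ?_,
    fun h => ?_⟩
  · obtain ⟨c, c', hc, hc', H⟩ := exists_lower_bound_of_lt hκ h hα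
    refine active_of_bound (m := min (c * stokesN (z 0)) c') (lt_min (by positivity) hc') ?_ ?_
    · filter_upwards [eventually_ge_atTop 0] with t ht using H _ _ _ _ O t ht
    · filter_upwards [eventually_ge_atTop 0] with t ht
      obtain ⟨h1, h2⟩ := mem_manifoldM_iff.1 (mem_manifoldM_of_solution hz h0 ht)
      rw [h1, abs_zero]
      positivity
  · exact amplitudeDeath_of_tendsto (O.tendsto_zero hκ hγ0 (Or.inr (Or.inl ⟨h, hα⟩)))
  · exact amplitudeDeath_of_tendsto (O.tendsto_zero hκ hγ0 (deathRegime_of_kappaStar h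
      (hα.imp_right fun h1 => ⟨h1.1.trans h, h1.2⟩)))
  · obtain ⟨a, b, hae, hbe, ha, hb0, hb1, hab, hb, hs, hlt, heq⟩ := lock_params hκ hγ0 h
    obtain ⟨e1, e2⟩ := unitAt_lockAngle hκ hγ0 h
    rw [← hae, ← hbe] at e1 e2
    have hpos := active_condition hκ hγ0 h hα hc
    obtain ⟨hX, hY⟩ := manifold_lock hκ hγ hz h0 hab hb ha hb0 (fun h1 => by
      rw [← e2]
      refine hne (lt_of_le_of_ne h fun h2 => ?_)
      exact h1.ne' (heq h2).1)
    obtain ⟨-, -, h1, h2, -⟩ := locked_consequences hκ hγ hz hN hab hX hY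
    rw [hs, max_eq_left hpos.le, ← lockedAmplitudeSq_eq] at h1 h2
    exact ⟨active_of_sq_tendsto (by rw [lockedAmplitudeSq_eq]; positivity) h1 h2, h1, h2⟩
  · obtain ⟨a, b, hae, hbe, ha, hb0, hb1, hab, hb, hs, hlt, heq⟩ := lock_params hκ hγ0 h.le
    obtain ⟨e1, e2⟩ := unitAt_lockAngle hκ hγ0 h.le
    rw [← hae, ← hbe] at e1 e2
    rw [e2] at hne
    obtain ⟨hX, hY⟩ := manifold_lock hκ hγ hz h0 hab hb ha hb0 (fun _ => hne)
    rw [PhaseLockedAt, e1]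
    refine ⟨(locked_consequences hκ hγ hz hN hab hX hY).1, ?_⟩
    obtain ⟨C, hC⟩ := O.manifold_exp_lock hκ hab hb hD hN
      (fun h => hne ((P_zero_iff_phaseFactor hab h0).1 h))
    have hC0 : 0 ≤ C := by
      have := hC 0 le_rfl
      simp only [mul_zero, neg_zero, Real.exp_zero, mul_one] at this
      exact le_trans (by positivity) this
    refine ⟨√C, fun t ht => ?_⟩
    refine le_of_sq_le_sq ?_ (by positivity)
    rw [phaseFactor_eq_of_mem (mem_manifoldM_of_solution hz h0 ht), norm_mk_sub_sq]
    refine (hC t ht).trans (le_of_eq ?_)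
    rw [mul_pow, Real.sq_sqrt hC0, ← Real.exp_nat_mul, ← hs]
    congr 2
    push_cast
    ring
  · obtain ⟨a, b, hae, hbe, ha, hb0, hb1, hab, hb, hs, hlt, heq⟩ := lock_params hκ hγ0 h.le
    obtain ⟨e1, e2⟩ := unitAt_lockAngle hκ hγ0 h.le
    rw [← hae, ← hbe] at e1 e2
    obtain ⟨ha0, hb1⟩ := heq h
    obtain ⟨hX, hY⟩ := manifold_lock hκ hγ hz h0 hab hb ha hb0 (fun h1 => absurd ha0 h1.ne')
    rw [PhaseLockedAt, e1]
    refine ⟨(locked_consequences hκ hγ hz hN hab hX hY).1, fun hne => ?_⟩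
    subst ha0 hb1
    have hP : stokesN (z 0) - 2 * stokesV (z 0) ≠ 0 := fun h1 => hne (by
      have := (P_zero_iff_phaseFactor hab h0).1 (by simpa using h1)
      simpa using this)
    set τ := stokesU (z 0) / (stokesN (z 0) - 2 * stokesV (z 0))
    have key : ∀ t, 0 ≤ t → ‖phaseFactor (z t) - ⟨0, 1⟩‖ = √(4 / (4 * (τ + κ / 2 * t) ^ 2 + 1)) := by
      intro t ht
      rw [phaseFactor_eq_of_mem (mem_manifoldM_of_solution hz h0 ht), eq_comm,
        Real.sqrt_eq_iff_eq_sq (by positivity) (norm_nonneg _), norm_mk_sub_sq, sub_zero]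
      exact (O.manifold_algebraic_lock hκ h hD hN hP ht).symm
    -- By the explicit formula the distance times `t` has the nonzero limit `2/κ`, which gives both
    -- halves of the exact order.
    have hlim : Tendsto (fun t : ℝ => ‖phaseFactor (z t) - ⟨0, 1⟩‖ / t⁻¹) atTop
        (𝓝 √(4 / (4 * (0 + κ / 2) ^ 2 + 0))) := by
      have h1 : Tendsto (fun t : ℝ => √(4 / (4 * (τ * t⁻¹ + κ / 2) ^ 2 + t⁻¹ ^ 2))) atTop
          (𝓝 √(4 / (4 * (0 + κ / 2) ^ 2 + 0))) := by
        have h2 : Tendsto (fun t : ℝ => t⁻¹) atTop (𝓝 0) := tendsto_inv_atTop_zero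
        have h3 : Tendsto (fun t : ℝ => 4 * (τ * t⁻¹ + κ / 2) ^ 2 + t⁻¹ ^ 2) atTop
            (𝓝 (4 * (0 + κ / 2) ^ 2 + 0)) := by
          have h4 := ((((h2.const_mul τ).add_const (κ / 2)).pow 2).const_mul 4).add (h2.pow 2)
          simpa using h4
        exact ((tendsto_const_nhds (x := (4 : ℝ))).div h3 (by positivity)).sqrt
      refine h1.congr' ?_
      filter_upwards [eventually_gt_atTop 0] with t ht
      rw [key t ht.le, div_inv_eq_mul]
      nth_rewrite 4 [← Real.sqrt_sq ht.le]
      rw [← Real.sqrt_mul (by positivity)]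
      congr 1
      field_simp
    exact (isTheta_of_div_tendsto_nhds_ne_zero hlim (Real.sqrt_pos.2 (by positivity)).ne').symm

end Manifold

/-! ### Rates of amplitude death -/

theorem norm_fst_le_sqrt (w : ℂ × ℂ) : ‖w.1‖ ≤ √(stokesN w) := (norm_fst_le w).trans (norm_le_sqrt_stokesN w)

theorem norm_snd_le_sqrt (w : ℂ × ℂ) : ‖w.2‖ ≤ √(stokesN w) := (norm_snd_le w).trans (norm_le_sqrt_stokesN w)

section Rates

variable {α κ ω γ : ℝ} {z : ℝ → ℂ × ℂ}

theorem exp_rate_of_stokesN {c C : ℝ} (hC : 0 ≤ C)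
    (h : ∀ t, 0 ≤ t → stokesN (z t) ≤ C * Real.exp (-(c * t))) :
    ∃ C : ℝ, ∀ t, 0 ≤ t → ‖(z t).1‖ ≤ C * Real.exp (-(c / 2 * t)) ∧
      ‖(z t).2‖ ≤ C * Real.exp (-(c / 2 * t)) := by
  refine ⟨√C, fun t ht => ?_⟩
  have h1 : √(stokesN (z t)) ≤ √C * Real.exp (-(c / 2 * t)) := by
    refine Real.sqrt_le_iff.2 ⟨by positivity, (h t ht).trans (le_of_eq ?_)⟩
    rw [mul_pow, Real.sq_sqrt hC, ← Real.exp_nat_mul]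
    congr 2
    push_cast
    ring
  exact ⟨(norm_fst_le_sqrt _).trans h1, (norm_snd_le_sqrt _).trans h1⟩

theorem death_rate_neg (hκ : 0 < κ) (hα : α < 0) :
    ∃ c > 0, ∀ z : ℝ → ℂ × ℂ, IsSolution α κ ω z →
      ∃ C : ℝ, ∀ t, 0 ≤ t → ‖(z t).1‖ ≤ C * Real.exp (-(c * t)) ∧
        ‖(z t).2‖ ≤ C * Real.exp (-(c * t)) := by
  refine ⟨-(2 * α) / 2, by linarith, fun z hz => ?_⟩
  have O := hz.orbit rfl
  refine exp_rate_of_stokesN (c := -(2 * α)) (O.nonneg 0) fun t ht => ?_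
  have := O.hN.le_mul_exp (c := 2 * α) (fun s _ => by
    have := O.rate_le hκ s
    linarith [sq_nonneg (stokesN (z s))]) ht
  simpa using this

theorem death_rate_zero (hκ : 0 < κ) (hα : α = 0) (hz : IsSolution α κ ω z) :
    ∃ C : ℝ, ∀ t, 0 ≤ t → ‖(z t).1‖ ≤ C * (1 + t) ^ (-(1 / 2 : ℝ)) ∧
      ‖(z t).2‖ ≤ C * (1 + t) ^ (-(1 / 2 : ℝ)) := by
  have O := hz.orbit rfl
  have hN0 := O.nonneg 0
  set K := stokesN (z 0) + 1 with hK
  have hK0 : 1 ≤ K := by linarith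
  refine ⟨√K, fun t ht => ?_⟩
  have h1 := O.mul_time_le_one hκ hα.le (k := 1 / K) (by positivity)
    (by rw [mul_one_div, div_le_one (by positivity)]; linarith) ht
  have h2 : stokesN (z t) ≤ K * (1 + t)⁻¹ := by
    rw [← div_eq_mul_inv, le_div_iff₀ (by positivity)]
    have h3 : (1 + t) / K ≤ 1 / K + t := by
      rw [add_div]
      gcongr
      exact div_le_self ht hK0
    have h4 := (mul_le_mul_of_nonneg_left h3 (O.nonneg t)).trans h1
    rw [← mul_div_assoc, div_le_one (by positivity)] at h4
    exact h4
  have h3 : √(stokesN (z t)) ≤ √K * (1 + t) ^ (-(1 / 2 : ℝ)) := by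
    rw [Real.rpow_neg (by positivity), ← Real.sqrt_eq_rpow, ← Real.sqrt_inv,
      ← Real.sqrt_mul (by positivity)]
    exact Real.sqrt_le_sqrt h2
  exact ⟨(norm_fst_le_sqrt _).trans h3, (norm_snd_le_sqrt _).trans h3⟩

theorem isTheta_rpow_neg_half {f g : ℝ → ℝ} {c C k : ℝ} (hc : 0 < c) (hf : ∀ t, 0 ≤ f t)
    (hg : ∀ᶠ t in atTop, f t ^ 2 = g t) (h1 : ∀ᶠ t in atTop, g t * t ≤ C)
    (h2 : ∀ᶠ t in atTop, c ≤ g t * (k + t)) :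
    f =Θ[atTop] (fun t : ℝ => t ^ (-(1 / 2 : ℝ))) := by
  have e : ∀ t : ℝ, 0 < t → (t ^ (-(1 / 2 : ℝ))) ^ 2 = t⁻¹ := by
    intro t ht
    rw [Real.rpow_neg ht.le, inv_pow, ← Real.sqrt_eq_rpow, Real.sq_sqrt ht.le]
  constructor
  · refine IsBigO.of_bound (√C) ?_
    filter_upwards [hg, h1, eventually_gt_atTop 0] with t h3 h4 ht
    have hp : 0 ≤ t ^ (-(1 / 2 : ℝ)) := Real.rpow_nonneg ht.le _
    rw [Real.norm_of_nonneg (hf t), Real.norm_of_nonneg hp]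
    have hC : 0 ≤ C := by
      refine le_trans ?_ h4
      rw [← h3]; positivity
    refine le_of_sq_le_sq ?_ (by positivity)
    rw [mul_pow, Real.sq_sqrt hC, e t ht, h3, ← div_eq_mul_inv, le_div_iff₀ ht]
    exact h4
  · refine IsBigO.of_bound (√(2 / c)) ?_
    filter_upwards [hg, h2, eventually_gt_atTop 0, eventually_ge_atTop k] with t h3 h4 ht hk
    have hp : 0 ≤ t ^ (-(1 / 2 : ℝ)) := Real.rpow_nonneg ht.le _
    rw [Real.norm_of_nonneg (hf t), Real.norm_of_nonneg hp]
    refine le_of_sq_le_sq ?_ (mul_nonneg (Real.sqrt_nonneg _) (hf t))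
    rw [mul_pow, Real.sq_sqrt (by positivity), e t ht, h3, inv_le_iff_one_le_mul₀ ht]
    have h5 : 0 ≤ g t := by rw [← h3]; positivity
    have h6 : c ≤ g t * (2 * t) := h4.trans (mul_le_mul_of_nonneg_left (by linarith) h5)
    have e2 : 2 / c * g t * t = g t * (2 * t) / c := by ring
    rw [e2, le_div_iff₀ hc]
    linarith

theorem death_exact_rate (hκ : 0 < κ) (hγ : γ = 2 * ω) (hα : α = 0) (hγ0 : γ = 0)
    (hz : IsSolution α κ ω z) (h0 : z 0 ∈ manifoldM)
    (hne : phaseFactor (z 0) ≠ unitAt (unstableAngle κ γ)) :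
    (fun t => ‖(z t).1‖) =Θ[atTop] (fun t : ℝ => t ^ (-(1 / 2 : ℝ))) ∧
      (fun t => ‖(z t).2‖) =Θ[atTop] (fun t : ℝ => t ^ (-(1 / 2 : ℝ))) := by
  have O := hz.orbit hγ
  obtain ⟨hD, hN⟩ := mem_manifoldM_iff.1 h0
  have hab : (1 : ℝ) ^ 2 + 0 ^ 2 = 1 := by norm_num
  have hb : γ = κ * 0 := by rw [hγ0, mul_zero]
  have e2 := (unitAt_lockAngle hκ hγ0.ge (hγ0.le.trans hκ.le)).2
  have hX := (manifold_lock hκ hγ hz h0 hab hb zero_le_one le_rfl (fun _ h => hne (by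
    rw [e2, h, hγ0]
    simp [Real.sqrt_sq hκ.le, hκ.ne']))).1
  obtain ⟨T₁, hT₁⟩ := eventually_atTop.1 (hX.eventually_const_lt (show (0 : ℝ) < 1 by norm_num))
  set T := max T₁ 0
  have hT0 : 0 ≤ T := le_max_right _ _
  have hP := (O.hP hab hb).Ici_of_le hT0
  have hNp : ∀ t, T ≤ t → 0 < stokesN (z t) := fun t ht => O.N_pos hκ hN (hT0.trans ht)
  have hu : ∀ t, T ≤ t → 0 < stokesU (z t) := by
    intro t ht
    have h1 := hT₁ t ((le_max_left _ _).trans ht)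
    rw [lt_div_iff₀ (hNp t ht)] at h1
    linarith
  -- For `γ = 0` the form is `P = N + 2u` and `P' = -NP`. Once `u > 0`, `N ≤ P` yields `P' ≥ -P²`;
  -- then `P ≤ 2N` transfers the lower bound to `N`.
  have h1 : ∀ t, T ≤ t → 1 ≤ (stokesN (z t) + 2 * 1 * stokesU (z t) - 2 * 0 * stokesV (z t))
      * (1 / (stokesN (z T) + 2 * 1 * stokesU (z T) - 2 * 0 * stokesV (z T)) + 1 * (t - T)) := by
    intro t ht
    have hp : 0 < stokesN (z T) + 2 * 1 * stokesU (z T) - 2 * 0 * stokesV (z T) := by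
      linarith [hNp T le_rfl, hu T le_rfl]
    refine hP.one_le_mul_affine (fun s hs => ?_) (fun s hs => O.P_nonneg hab s) zero_le_one
      (by positivity) (by rw [mul_one_div, div_self hp.ne']) ht
    rw [O.D_eq_zero hκ hD (hT0.trans hs), hα]
    nlinarith [hNp s hs, hu s hs]
  set k := 1 / (stokesN (z T) + 2 * 1 * stokesU (z T) - 2 * 0 * stokesV (z T)) - T
  have h2 : ∀ᶠ t in atTop, 1 / 4 ≤ stokesN (z t) / 2 * (k + t) := by
    filter_upwards [eventually_ge_atTop T, eventually_ge_atTop (-k)] with t ht hk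
    have h3 := h1 t ht
    have h4 := O.P_le hab t
    have h5 : 0 ≤ k + t := by linarith
    have h6 := mul_le_mul_of_nonneg_right h4 h5
    have e : 1 / (stokesN (z T) + 2 * 1 * stokesU (z T) - 2 * 0 * stokesV (z T)) + 1 * (t - T)
      = k + t := by simp only [k]; ring
    rw [e] at h3
    linarith
  have h3 : ∀ᶠ t in atTop, stokesN (z t) / 2 * t ≤ 1 / 2 := by
    filter_upwards [eventually_ge_atTop 0] with t ht
    have := O.mul_time_le_one hκ hα.le le_rfl (by simp) ht
    simp only [zero_add] at this
    linarith
  constructor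
  · refine isTheta_rpow_neg_half (by norm_num) (fun t => norm_nonneg _) ?_ h3 h2
    filter_upwards [eventually_ge_atTop 0] with t ht
    rw [norm_sq_fst, O.D_eq_zero hκ hD ht, add_zero]
  · refine isTheta_rpow_neg_half (by norm_num) (fun t => norm_nonneg _) ?_ h3 h2
    filter_upwards [eventually_ge_atTop 0] with t ht
    rw [norm_sq_snd, O.D_eq_zero hκ hD ht, sub_zero]

theorem death_exp_rate (hκ : 0 < κ) (hγ : γ = 2 * ω) (hα : α = 0) (hγ0 : 0 < γ) :
    ∃ c > 0, ∀ z : ℝ → ℂ × ℂ, IsSolution α κ ω z → z 0 ∈ manifoldM →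
      ∃ C : ℝ, ∀ t, 0 ≤ t → ‖(z t).1‖ ≤ C * Real.exp (-(c * t)) ∧
        ‖(z t).2‖ ≤ C * Real.exp (-(c * t)) := by
  rcases lt_or_ge κ γ with h | h
  · refine ⟨κ / 2, by positivity, fun z hz h0 => ?_⟩
    have O := hz.orbit hγ
    obtain ⟨hD, hN⟩ := mem_manifoldM_iff.1 h0
    have hg : 0 < γ - κ := by linarith
    have hW0 : 0 ≤ γ * stokesN (z 0) - 2 * κ * stokesV (z 0) := by nlinarith [O.le_W hκ 0]
    refine exp_rate_of_stokesN (c := κ)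
      (C := (γ * stokesN (z 0) - 2 * κ * stokesV (z 0)) / (γ - κ)) (by positivity)
      fun t ht => ?_
    have h1 := O.hW.le_mul_exp (c := -κ) (fun s hs => by
      have h2 : 0 ≤ γ * stokesN (z s) - 2 * κ * stokesV (z s) := by
        nlinarith [O.le_W hκ s, O.nonneg s]
      rw [hα]
      nlinarith [mul_nonneg (O.nonneg s) h2, mul_nonneg hγ0.le (sq_nonneg (stokesD (z s)))]) ht
    rw [div_mul_eq_mul_div, le_div_iff₀ hg]
    have e : -κ * (t - 0) = -(κ * t) := by ring
    rw [e] at h1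
    linarith [O.le_W hκ t]
  · obtain ⟨a, b, hae, hbe, ha, hb0, hb1, hab, hb, hs, hlt, heq⟩ := lock_params hκ hγ0.le h
    have hbp : 0 < b := by rw [hbe]; positivity
    have ha1 : a < 1 := by nlinarith
    have hc : 0 < κ * (1 - a) / 2 := by
      have : 0 < 1 - a := by linarith
      positivity
    refine ⟨κ * (1 - a) / 2 / 2, by positivity, fun z hz h0 => ?_⟩
    have O := hz.orbit hγ
    obtain ⟨hD, hN⟩ := mem_manifoldM_iff.1 h0
    -- For `γ > 0` one has `a < 1`, and both possible limits `±a` lie below `(1 + a)/2`. Eventually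
    -- `N' ≤ -(κ(1 - a)/2)N`, with a rate common to exceptional and ordinary solutions.
    have hX : ∀ᶠ t in atTop, 2 * stokesU (z t) / stokesN (z t) < (1 + a) / 2 := by
      by_cases he : 0 < a ∧ phaseFactor (z 0) = ⟨-a, b⟩
      · exact (manifold_exceptional hκ hγ hz h0 hab hb he.2).1.eventually_lt_const (by linarith)
      · exact (manifold_lock hκ hγ hz h0 hab hb ha hb0
          (fun h1 h2 => he ⟨h1, h2⟩)).1.eventually_lt_const (by linarith)
    obtain ⟨C, hC0, hC⟩ := exists_exp_bound (c := κ * (1 - a) / 2) O.hN (fun t _ => O.nonneg t) (by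
      filter_upwards [hX, eventually_ge_atTop 0] with t h1 ht
      rw [div_lt_iff₀ (O.N_pos hκ hN ht)] at h1
      rw [hα]
      nlinarith [sq_nonneg (stokesN (z t)), sq_nonneg (stokesD (z t))])
    exact exp_rate_of_stokesN hC0 hC

end Rates

/-! ### Global stability of the manifold -/

theorem exists_unit (x : ℂ) : ∃ e : ℂ, ‖e‖ = 1 ∧ x = (‖x‖ : ℂ) * e := by
  refine ⟨Complex.exp (Complex.arg x * Complex.I), Complex.norm_exp_ofReal_mul_I _, ?_⟩
  rw [Complex.norm_mul_exp_arg_mul_I]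

/-- One component is moved radially until the moduli agree. The origin does not lie in the set, but
it is a limit of the points `(ε, ε)`. -/
theorem infDist_manifoldM_le (w : ℂ × ℂ) : Metric.infDist w manifoldM ≤ |‖w.1‖ - ‖w.2‖| := by
  have hmem : ∀ m : ℂ × ℂ, ‖m.1‖ = ‖m.2‖ → ‖m.2‖ ≠ 0 → m ∈ manifoldM := by
    intro m h1 h2
    show ‖m.1‖ / ‖m.2‖ = 1
    rw [h1, div_self h2]
  obtain ⟨e, he, h1⟩ := exists_unit w.1
  obtain ⟨f, hf, h2⟩ := exists_unit w.2
  by_cases hw2 : ‖w.2‖ = 0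
  · by_cases hw1 : ‖w.1‖ = 0
    · have hw : w = 0 := Prod.ext (norm_eq_zero.1 hw1) (norm_eq_zero.1 hw2)
      rw [hw1, hw2, sub_zero, abs_zero, hw]
      refine le_of_forall_pos_le_add fun ε hε => ?_
      have hm : ((ε : ℂ), (ε : ℂ)) ∈ manifoldM := hmem _ rfl (by simpa using hε.ne')
      refine (Metric.infDist_le_dist_of_mem hm).trans (le_of_eq ?_)
      simp [Prod.dist_eq, abs_of_pos hε]
    · have hm : (w.1, (‖w.1‖ : ℂ) * f) ∈ manifoldM := hmem _ (by simp [hf]) (by simpa [hf] using hw1)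
      refine (Metric.infDist_le_dist_of_mem hm).trans (le_of_eq ?_)
      have : w.2 = 0 := norm_eq_zero.1 hw2
      simp [Prod.dist_eq, this, hf]
  · have hm : ((‖w.2‖ : ℂ) * e, w.2) ∈ manifoldM := hmem _ (by simp [he]) hw2
    refine (Metric.infDist_le_dist_of_mem hm).trans (le_of_eq ?_)
    have : dist w.1 ((‖w.2‖ : ℂ) * e) = |‖w.1‖ - ‖w.2‖| := by
      rw [dist_eq_norm]
      nth_rewrite 1 [h1]
      rw [← sub_mul, norm_mul, he, mul_one, ← Complex.ofReal_sub, Complex.norm_real, Real.norm_eq_abs]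
    rw [Prod.dist_eq]
    simp [this]

theorem abs_sub_lt_of_infDist {w : ℂ × ℂ} {δ : ℝ} (h : Metric.infDist w manifoldM < δ) :
    |‖w.1‖ - ‖w.2‖| < 2 * δ := by
  have hne : manifoldM.Nonempty := ⟨(1, 1), by simp [manifoldM, ratio]⟩
  obtain ⟨m, hm, hd⟩ := (Metric.infDist_lt_iff hne).1 h
  have h0 : ‖m.1‖ = ‖m.2‖ := by
    have h1 := (mem_manifoldM_iff.1 hm).1
    rw [stokesD_eq] at h1
    exact (sq_eq_sq₀ (norm_nonneg _) (norm_nonneg _)).1 (by linarith)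
  have h1 : |‖w.1‖ - ‖m.1‖| ≤ dist w m :=
    (abs_norm_sub_norm_le _ _).trans (by rw [← dist_eq_norm]; exact le_max_left _ _)
  have h2 : |‖w.2‖ - ‖m.2‖| ≤ dist w m :=
    (abs_norm_sub_norm_le _ _).trans (by rw [← dist_eq_norm]; exact le_max_right _ _)
  have e : ‖w.1‖ - ‖w.2‖ = (‖w.1‖ - ‖m.1‖) - (‖w.2‖ - ‖m.2‖) := by rw [h0]; ring
  rw [e]
  refine (abs_sub _ _).trans_lt ?_
  linarith

theorem sq_abs_sub_le (w : ℂ × ℂ) : (‖w.1‖ - ‖w.2‖) ^ 2 ≤ |stokesD w| := by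
  rw [stokesD_eq]
  have h1 := norm_nonneg w.1
  have h2 := norm_nonneg w.2
  have e : ‖w.1‖ ^ 2 - ‖w.2‖ ^ 2 = (‖w.1‖ - ‖w.2‖) * (‖w.1‖ + ‖w.2‖) := by ring
  rw [e, abs_mul, abs_of_nonneg (add_nonneg h1 h2), ← sq_abs, sq]
  gcongr
  exact abs_le.2 ⟨by linarith, by linarith⟩

/-- Since `N ≥ |D|`, the inequality `2α ≤ κ` gives `(D²)' ≤ -4|D|³`. -/
theorem Orbit.tendsto_D {α κ γ : ℝ} {N D u v : ℝ → ℝ} (O : Orbit α κ γ N D u v)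
    (h : 2 * α ≤ κ) : Tendsto D atTop (𝓝 0) := by
  have key : Tendsto (fun t => D t ^ 2) atTop (𝓝 0) := by
    rw [tendsto_order]
    refine ⟨fun m hm => Eventually.of_forall fun t => hm.trans_le (sq_nonneg _), fun m hm => ?_⟩
    have := O.hD.sq.eventually_le_of_speed (M := m / 2) (c := 4 * √(m / 2) * (m / 2))
      (fun t _ h1 => ?_) (by positivity)
    · filter_upwards [this] with t ht
      linarith
    · have h2 : √(m / 2) ≤ N t := by
        refine le_trans ?_ (O.abs_D_le t)
        rw [← Real.sqrt_sq_eq_abs]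
        exact Real.sqrt_le_sqrt h1.le
      have h3 : √(m / 2) * (m / 2) ≤ N t * D t ^ 2 :=
        mul_le_mul h2 h1.le (by positivity) (O.nonneg t)
      nlinarith [sq_nonneg (D t)]
  have := key.sqrt
  simp only [Real.sqrt_sq_eq_abs, Real.sqrt_zero] at this
  exact (tendsto_zero_iff_abs_tendsto_zero _).2 this

theorem globallyAsymptoticallyStable {α κ ω : ℝ} (hκ : 0 < κ) (h : 2 * α ≤ κ) :
    GloballyAsymptoticallyStable α κ ω manifoldM := by
  constructor
  · intro ε hε
    -- The Lyapunov function is `D²/(N + κ/2)`. For large `N` it is comparable with `(|z₁| -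
    -- |z₂|)²`, which makes `δ` independent of the initial point. If `(|z₁| - |z₂|)² ≥ ε²`, then
    -- also `N ≥ ε²`, and the two entries of the minimum exclude this.
    set V₀ := min (ε ^ 2 / 2) (ε ^ 4 / κ) / 2 with hV₀
    have hV₀p : 0 < V₀ := by positivity
    refine ⟨√(V₀ / 8), by positivity, fun w hw hd t ht => ?_⟩
    have O := hw.orbit rfl
    have h1 := abs_sub_lt_of_infDist hd
    refine (infDist_manifoldM_le _).trans_lt (abs_lt_of_sq_lt_sq ?_ hε.le)
    have hden : ∀ s ∈ Ici (0 : ℝ), stokesN (w s) + (κ / 2 + 0 * (s - 0)) ≠ 0 := fun s _ => by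
      have := O.nonneg s
      have : 0 < stokesN (w s) + (κ / 2 + 0 * (s - 0)) := by simp; positivity
      exact this.ne'
    have hV := (O.hD.sq.div (O.hN.add (DerivOn.affine (κ / 2) 0 0 _)) hden).antitoneOn
      (convex_Ici 0) (fun s hs => ?_) self_mem_Ici ht ht
    · simp only [zero_mul, add_zero] at hV
      have hN0 := O.nonneg 0
      have hNt := O.nonneg t
      have id : ∀ s, stokesD (w s) ^ 2 = (‖(w s).1‖ - ‖(w s).2‖) ^ 2 * (‖(w s).1‖ + ‖(w s).2‖) ^ 2 := by
        intro s; rw [stokesD_eq]; ring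
      have b1 : ∀ s, stokesN (w s) ≤ (‖(w s).1‖ + ‖(w s).2‖) ^ 2 ∧
          (‖(w s).1‖ + ‖(w s).2‖) ^ 2 ≤ 2 * stokesN (w s) ∧
          (‖(w s).1‖ - ‖(w s).2‖) ^ 2 ≤ stokesN (w s) := by
        intro s
        have h1 := norm_nonneg (w s).1
        have h2 := norm_nonneg (w s).2
        rw [stokesN_eq]
        refine ⟨by nlinarith, by nlinarith [sq_nonneg (‖(w s).1‖ - ‖(w s).2‖)], by nlinarith⟩
      set V := stokesD (w t) ^ 2 / (stokesN (w t) + κ / 2) with hVd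
      have hVt : V < 2 * V₀ := by
        refine hV.trans_lt ?_
        rw [div_lt_iff₀ (by positivity), id]
        have h2 : (‖(w 0).1‖ - ‖(w 0).2‖) ^ 2 < V₀ / 2 := by
          rw [← sq_abs]
          calc |‖(w 0).1‖ - ‖(w 0).2‖| ^ 2 < (2 * √(V₀ / 8)) ^ 2 := by gcongr
            _ = V₀ / 2 := by rw [mul_pow, Real.sq_sqrt (by positivity)]; ring
        have h3 := (b1 0).2.1
        have h4 : (‖(w 0).1‖ - ‖(w 0).2‖) ^ 2 * (‖(w 0).1‖ + ‖(w 0).2‖) ^ 2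
            ≤ V₀ / 2 * (2 * stokesN (w 0)) := mul_le_mul h2.le h3 (sq_nonneg _) (by positivity)
        nlinarith
      have hV0 : 0 ≤ V := by positivity
      have hV1 : V < ε ^ 2 / 2 := hVt.trans_le (by
        rw [hV₀]; linarith [min_le_left (ε ^ 2 / 2) (ε ^ 4 / κ)])
      have hV2 : V * κ < ε ^ 4 := by
        have : V < ε ^ 4 / κ := hVt.trans_le (by
          rw [hV₀]; linarith [min_le_right (ε ^ 2 / 2) (ε ^ 4 / κ)])
        rwa [lt_div_iff₀ hκ] at this
      set ρ := (‖(w t).1‖ - ‖(w t).2‖) ^ 2 with hρ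
      have h5 : V * (stokesN (w t) + κ / 2) = stokesD (w t) ^ 2 := by
        rw [hVd]; field_simp
      rw [id] at h5
      have h6 := b1 t
      have hρ0 : 0 ≤ ρ := sq_nonneg _
      have h7 : ρ * stokesN (w t) ≤ V * (stokesN (w t) + κ / 2) := by
        rw [h5]; exact mul_le_mul_of_nonneg_left h6.1 hρ0
      by_contra hc
      push Not at hc
      have h8 : ε ^ 2 / 2 ≤ ρ - V := by linarith
      have h9 : (ρ - V) * stokesN (w t) ≤ V * (κ / 2) := by linarith
      have h10 : ε ^ 2 / 2 * ε ^ 2 ≤ (ρ - V) * stokesN (w t) :=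
        mul_le_mul h8 (hc.trans h6.2.2) (by positivity) (by linarith [sq_nonneg ε])
      nlinarith
    · have hN := O.nonneg s
      have hp : 0 < stokesN (w s) + κ / 2 := by
        positivity
      simp only [zero_mul, add_zero]
      refine div_nonpos_of_nonpos_of_nonneg ?_ (sq_nonneg _)
      have hu := O.neg_u_le s
      have hu' := O.u_le s
      have hdd := O.ident s
      have h2 : stokesD (w s) ^ 2 ≤ stokesN (w s) ^ 2 := by
        nlinarith [sq_nonneg (stokesU (w s)), sq_nonneg (stokesV (w s))]
      set n := stokesN (w s)
      set d := stokesD (w s)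
      set q := stokesU (w s)
      have e : 2 * d * ((2 * α - κ - 2 * n) * d) * (n + κ / 2)
          - d ^ 2 * ((2 * α - κ) * n - n ^ 2 - d ^ 2 + 2 * κ * q)
          = d ^ 2 * (2 * (2 * α - κ - 2 * n) * (n + κ / 2)
            - ((2 * α - κ) * n - n ^ 2 - d ^ 2 + 2 * κ * q)) := by ring
      rw [e]
      refine mul_nonpos_of_nonneg_of_nonpos (sq_nonneg _) ?_
      nlinarith [mul_nonneg (sub_nonneg.2 h) hN]
  · intro w hw
    have O := hw.orbit rfl
    have h1 := (O.tendsto_D h).abs.sqrt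
    simp only [abs_zero, Real.sqrt_zero] at h1
    refine squeeze_zero (fun t => Metric.infDist_nonneg) (fun t => ?_) h1
    refine (infDist_manifoldM_le _).trans (Real.le_sqrt_of_sq_le ?_)
    rw [sq_abs]
    exact sq_abs_sub_le _

/-! ### Stability of the origin -/

theorem origin_regime {α κ γ : ℝ} (hα : α ≤ 0 ∨ (2 * α < κ ∧ κ < kappaStar α γ)) :
    DeathRegime α κ γ ∧ (α ≤ 0 ∨ 2 * α < κ) := by
  refine ⟨?_, hα.imp_right fun h => h.1⟩
  rcases lt_or_ge κ γ with h | h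
  · rcases hα with hα | hα
    · exact Or.inl hα
    · exact Or.inr (Or.inl ⟨h, hα.1.le⟩)
  · exact deathRegime_of_kappaStar h (hα.imp_right fun h1 => ⟨h1.1.le, h1.2.le⟩)

theorem origin_stable {α κ ω γ : ℝ} (hκ : 0 < κ) (hω : 0 ≤ ω) (hγ : γ = 2 * ω)
    (hα : α ≤ 0 ∨ (2 * α < κ ∧ κ < kappaStar α γ)) :
    LyapunovStable α κ ω (fun _ => 0) ∧
      ∀ z : ℝ → ℂ × ℂ, IsSolution α κ ω z → AmplitudeDeath z := by
  obtain ⟨h1, h2⟩ := origin_regime hα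
  have hγ0 : 0 ≤ γ := by linarith
  refine ⟨fun ε hε => ?_, fun z hz => amplitudeDeath_of_tendsto
    ((hz.orbit hγ).tendsto_zero hκ hγ0 h1)⟩
  obtain ⟨C, hC, H⟩ := exists_linear_bound hκ hγ0 h1 h2
  refine ⟨ε / √(2 * C), by positivity, fun w hw hd t ht => ?_⟩
  rw [dist_zero_right] at hd ⊢
  have h3 := H _ _ _ _ (hw.orbit hγ) t ht
  rw [lt_div_iff₀ (by positivity)] at hd
  refine (norm_le_sqrt_stokesN _).trans_lt ?_
  refine lt_of_le_of_lt (Real.sqrt_le_iff.2 ⟨by positivity, ?_⟩) hd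
  rw [mul_pow, Real.sq_sqrt (by positivity)]
  have := stokesN_le_norm (w 0)
  nlinarith

/-- The differential inequality is needed only where `f > 0`, so a barrier argument is applied to
`f(t) exp(-c(t - a))`. -/
theorem DerivOn.nonpos_of_le_mul {f f' : ℝ → ℝ} {a c : ℝ} (h : DerivOn f f' (Ici a))
    (hf : ∀ t, a ≤ t → 0 < f t → f' t ≤ c * f t) (ha : f a ≤ 0) {t : ℝ} (ht : a ≤ t) :
    f t ≤ 0 := by
  have h1 := (h.mul (DerivOn.exp_affine (-c) a (Ici a))).le_barrier (M := 0) (by simpa using ha)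
    (fun s hs hp => ?_) ht
  · by_contra hc
    exact absurd h1 (not_le.2 (mul_pos (not_le.1 hc) (Real.exp_pos _)))
  · have hp' : 0 < f s := pos_of_mul_pos_left hp (Real.exp_pos _).le
    have h2 := hf s hs hp'
    have e : f' s * Real.exp (-c * (s - a)) + f s * (Real.exp (-c * (s - a)) * -c)
        = Real.exp (-c * (s - a)) * (f' s - c * f s) := by ring
    rw [e]
    exact mul_nonpos_of_nonneg_of_nonpos (Real.exp_pos _).le (by linarith)

/-! ### Phase-locking off the manifold. -/

namespace Orbit

variable {α κ γ : ℝ} {N D u v : ℝ → ℝ} (O : Orbit α κ γ N D u v)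
include O

/-- With `q = 2au - 2bv` one has `D² ≤ N² - q² = (2N - P)P`. The term `-D²` in the equation for `P`
is thus a bounded multiple of `P`. -/
theorem D_sq_le_P {a b : ℝ} (hab : a ^ 2 + b ^ 2 = 1) (t : ℝ) :
    D t ^ 2 ≤ 2 * N t * (N t + 2 * a * u t - 2 * b * v t) := by
  have h1 : (2 * a * u t - 2 * b * v t) ^ 2 ≤ 4 * (u t ^ 2 + v t ^ 2) := by
    have e : 4 * (u t ^ 2 + v t ^ 2) = (a ^ 2 + b ^ 2) * (4 * (u t ^ 2 + v t ^ 2)) := by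
      rw [hab, one_mul]
    rw [e]
    nlinarith [sq_nonneg (b * u t + a * v t)]
  nlinarith [O.ident t, sq_nonneg (N t + 2 * a * u t - 2 * b * v t)]

theorem P_pos (hκ : 0 < κ) {a b : ℝ} (hab : a ^ 2 + b ^ 2 = 1) (hb : γ = κ * b)
    (h0 : 0 < N 0 + 2 * a * u 0 - 2 * b * v 0) {t : ℝ} (ht : 0 ≤ t) :
    0 < N t + 2 * a * u t - 2 * b * v t := by
  obtain ⟨M, hM, hMN⟩ := O.exists_bound hκ
  refine (O.hP hab hb).pos_of_ge (c := 2 * α - κ + κ * a - 3 * M) (fun s hs => ?_) h0 ht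
  have h1 := O.D_sq_le_P hab s
  have h2 := O.P_nonneg hab s
  nlinarith [mul_nonneg (sub_nonneg.2 (hMN s hs)) h2]

/-- Where `u = 0`, the derivative of `u` is `κ(N/2 - bv) ≥ 0`. -/
theorem u_nonneg {b : ℝ} (hκ : 0 < κ) (hb : γ = κ * b) (hb0 : 0 ≤ b) (hb1 : b ≤ 1)
    (h0 : 0 ≤ u 0) {t : ℝ} (ht : 0 ≤ t) : 0 ≤ u t := by
  have := O.hu.neg.nonpos_of_le_mul (c := |2 * α - κ|) (fun s hs hp => ?_) (by linarith) ht
  · linarith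
  · have h1 := O.v_le s
    have h2 := O.nonneg s
    have h3 : b * (2 * v s) ≤ 1 * N s :=
      (mul_le_mul_of_nonneg_left h1 hb0).trans (mul_le_mul_of_nonneg_right hb1 h2)
    have h4 : (2 * α - κ) * (-u s) ≤ |2 * α - κ| * (-u s) :=
      mul_le_mul_of_nonneg_right (le_abs_self _) hp.le
    have h5 : 0 ≤ N s * (-u s) := mul_nonneg h2 hp.le
    rw [hb]
    nlinarith

/-- Off the manifold the derivative of `P₋/P₊` has the additional term `-4auD²/P₊²`, which is
harmless as long as `u ≥ 0`. The same sign makes the quotient at most `1` initially, so the bound is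
uniform over all such orbits. -/
theorem exp_lock {a b : ℝ} (hκ : 0 < κ) (hab : a ^ 2 + b ^ 2 = 1) (hb : γ = κ * b) (ha : 0 < a)
    (hb0 : 0 ≤ b) (hN : 0 < N 0) (h0 : 0 ≤ u 0) {t : ℝ} (ht : 0 ≤ t) :
    (2 * u t / N t - a) ^ 2 + (2 * v t / N t - b) ^ 2 ≤ 4 * Real.exp (-(2 * (κ * a)) * t) := by
  have hb1 : b < 1 := by nlinarith [sq_nonneg (b - 1), mul_pos ha ha]
  have hPp : ∀ s, 0 ≤ s → 0 < N s + 2 * a * u s - 2 * b * v s := fun s hs => by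
    have h1 := O.N_pos hκ hN hs
    have h2 := mul_nonneg ha.le (O.u_nonneg hκ hb hb0 hb1.le h0 hs)
    have h3 := mul_le_mul_of_nonneg_left (O.v_le s) hb0
    nlinarith
  have hm : (-a) ^ 2 + b ^ 2 = 1 := by rw [neg_sq, hab]
  have key := ((O.hP hm hb).div (O.hP hab hb) (fun s hs => (hPp s hs).ne')).le_mul_exp
    (c := -(2 * (κ * a))) (fun s hs => ?_) ht
  · have hNt := O.N_pos hκ hN ht
    refine (O.dist_sq_le hab hNt).trans ?_
    have h00 : (N 0 + 2 * -a * u 0 - 2 * b * v 0) / (N 0 + 2 * a * u 0 - 2 * b * v 0) ≤ 1 := by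
      rw [div_le_one (hPp 0 le_rfl)]
      nlinarith [mul_nonneg ha.le h0]
    have h1 : (N t + 2 * -a * u t - 2 * b * v t) / (N t + 2 * a * u t - 2 * b * v t)
        ≤ Real.exp (-(2 * (κ * a)) * t) := by
      refine key.trans ?_
      rw [sub_zero]
      exact mul_le_of_le_one_left (Real.exp_pos _).le h00
    rw [div_le_iff₀ (hPp t ht)] at h1
    rw [div_le_iff₀ hNt]
    have h2 := mul_le_mul_of_nonneg_left (O.P_le hab t) (Real.exp_pos (-(2 * (κ * a)) * t)).le
    linarith
  · have hp := hPp s hs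
    have hu := O.u_nonneg hκ hb hb0 hb1.le h0 hs
    rw [div_le_iff₀ (by positivity)]
    have e : ∀ x y : ℝ, 0 < x → -(2 * (κ * a)) * (y / x) * x ^ 2 = -(2 * (κ * a)) * (y * x) := by
      intro x y hx; field_simp
    rw [e _ _ hp]
    nlinarith [mul_nonneg (mul_nonneg ha.le hu) (sq_nonneg (D s))]

/-- For `u ≥ 0` the `D²` term in the derivative of `u/P` is nonnegative, hence `u/P ≥ κt/2`.
Combined with `4u² ≤ 2NP` this gives `2P/N ≤ 4/(κt)²`. -/
theorem algebraic_lock (hκ : 0 < κ) (hγ : γ = κ) (h0 : 0 < u 0) {t : ℝ} (ht : 0 < t) :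
    (2 * u t / N t - 0) ^ 2 + (2 * v t / N t - 1) ^ 2 ≤ 4 / (κ * t) ^ 2 := by
  have hab : (0 : ℝ) ^ 2 + 1 ^ 2 = 1 := by norm_num
  have hb : γ = κ * 1 := by rw [hγ, mul_one]
  have hN : 0 < N 0 := by linarith [O.u_le 0]
  have hP0 : 0 < N 0 + 2 * 0 * u 0 - 2 * 1 * v 0 := by
    have h1 := O.u_sq_le 0
    by_contra hc
    nlinarith [mul_pos h0 h0, mul_nonneg hN.le (sub_nonneg.2 (not_lt.1 hc))]
  have hPp : ∀ s, 0 ≤ s → 0 < N s + 2 * 0 * u s - 2 * 1 * v s := fun s hs => O.P_pos hκ hab hb hP0 hs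
  have hu : ∀ s, 0 ≤ s → 0 ≤ u s := fun s hs => O.u_nonneg hκ hb zero_le_one le_rfl h0.le hs
  have key := ((O.hu.div (O.hP hab hb) (fun s hs => (hPp s hs).ne')).sub
    (DerivOn.affine 0 (κ / 2) 0 _)).monotoneOn (convex_Ici 0) (fun s hs => ?_) self_mem_Ici ht.le ht.le
  · have hNt := O.N_pos hκ hN ht.le
    refine (O.dist_sq_le hab hNt).trans ?_
    have hp := hPp t ht.le
    have h1 : κ / 2 * t ≤ u t / (N t + 2 * 0 * u t - 2 * 1 * v t) := by
      have : 0 ≤ u 0 / (N 0 + 2 * 0 * u 0 - 2 * 1 * v 0) := div_nonneg h0.le hP0.le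
      simp only [sub_zero, zero_add, mul_zero] at key this ⊢
      linarith
    rw [le_div_iff₀ hp] at h1
    have h2 := O.u_sq_le t
    have h3 : (κ / 2 * t * (N t + 2 * 0 * u t - 2 * 1 * v t)) ^ 2 ≤ u t ^ 2 := by
      have := hp.le
      gcongr
    have e : N t + 2 * -0 * u t - 2 * 1 * v t = N t + 2 * 0 * u t - 2 * 1 * v t := by ring
    rw [e, div_le_div_iff₀ hNt (by positivity)]
    set P := N t + 2 * 0 * u t - 2 * 1 * v t with hP
    have h4 : N t - 2 * v t = P := by rw [hP]; ring
    rw [h4] at h2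
    have h5 : (κ * t) ^ 2 * P * P ≤ 2 * N t * P := by nlinarith
    have := le_of_mul_le_mul_right h5 hp
    nlinarith
  · have hp := hPp s hs
    rw [sub_nonneg, le_div_iff₀ (by positivity)]
    subst hγ
    nlinarith [mul_nonneg (hu s hs) (sq_nonneg (D s))]

end Orbit

/-- Locking, uniform over all orbits with positive `u`. -/
theorem uniform_lock {κ γ : ℝ} (hκ : 0 < κ) {a b : ℝ} (hab : a ^ 2 + b ^ 2 = 1)
    (hb : γ = κ * b) (ha : 0 ≤ a) (hb0 : 0 ≤ b) :
    ∃ e : ℝ → ℝ, Tendsto e atTop (𝓝 0) ∧ ∀ (α : ℝ) (N D u v : ℝ → ℝ), Orbit α κ γ N D u v →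
      0 < u 0 → ∀ t, 0 < t →
        (2 * u t / N t - a) ^ 2 + (2 * v t / N t - b) ^ 2 ≤ e t := by
  rcases ha.eq_or_lt with rfl | ha
  · have hb1 : b = 1 := by nlinarith [sq_nonneg (b - 1)]
    subst hb1
    refine ⟨fun t => 4 / (κ * t) ^ 2, ?_, fun α N D u v O h0 t ht =>
      O.algebraic_lock hκ (by rw [hb, mul_one]) h0 ht⟩
    refine Tendsto.div_atTop tendsto_const_nhds ?_
    exact (tendsto_pow_atTop two_ne_zero).comp (tendsto_id.const_mul_atTop hκ)
  · refine ⟨fun t => 4 * Real.exp (-(2 * (κ * a)) * t), ?_, fun α N D u v O h0 t ht =>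
      O.exp_lock hκ hab hb ha hb0 (by linarith [O.u_le 0]) h0.le ht.le⟩
    have : Tendsto (fun t : ℝ => -(2 * (κ * a)) * t) atTop atBot :=
      tendsto_id.const_mul_atTop_of_neg (by nlinarith [mul_pos hκ ha])
    simpa using (Real.tendsto_exp_atBot.comp this).const_mul 4

/-- The property `Q` holds for all forward solutions starting sufficiently close to `p`. -/
def NearSolutions (α κ ω : ℝ) (p : ℂ × ℂ) (Q : (ℝ → ℂ × ℂ) → Prop) : Prop :=
  ∀ᶠ q in 𝓝 p, ∀ w : ℝ → ℂ × ℂ, IsSolution α κ ω w → w 0 = q → Q w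

namespace NearSolutions

variable {α κ ω γ : ℝ} {p : ℂ × ℂ} {Q R : (ℝ → ℂ × ℂ) → Prop}

theorem exists_ball (h : NearSolutions α κ ω p Q) :
    ∃ δ > 0, ∀ w : ℝ → ℂ × ℂ, IsSolution α κ ω w → dist (w 0) p < δ → Q w := by
  obtain ⟨δ, hδ, h⟩ := Metric.eventually_nhds_iff.1 h
  exact ⟨δ, hδ, fun w hw hd => h hd w hw rfl⟩

theorem of_ball {δ : ℝ} (hδ : 0 < δ)
    (h : ∀ w : ℝ → ℂ × ℂ, IsSolution α κ ω w → dist (w 0) p < δ → Q w) :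
    NearSolutions α κ ω p Q :=
  Metric.eventually_nhds_iff.2 ⟨δ, hδ, fun q hq w hw h0 => h w hw (by rwa [h0])⟩

theorem mono (h : NearSolutions α κ ω p Q) (hQR : ∀ w, IsSolution α κ ω w → Q w → R w) :
    NearSolutions α κ ω p R := by
  filter_upwards [h] with q hq w hw h0
  exact hQR w hw (hq w hw h0)

theorem and (hQ : NearSolutions α κ ω p Q) (hR : NearSolutions α κ ω p R) :
    NearSolutions α κ ω p (fun w => Q w ∧ R w) := by
  filter_upwards [hQ, hR] with q h1 h2 w hw h0
  exact ⟨h1 w hw h0, h2 w hw h0⟩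

theorem initial {B : ℂ × ℂ → Prop} (h : ∀ᶠ q in 𝓝 p, B q) :
    NearSolutions α κ ω p (fun w => B (w 0)) := by
  filter_upwards [h] with q hq w _ h0
  rwa [h0]

theorem at_time (hκ : 0 < κ) {z : ℝ → ℂ × ℂ} (hz : IsSolution α κ ω z) {T : ℝ} (hT : 0 ≤ T)
    {B : ℂ × ℂ → Prop} (h : ∀ᶠ q in 𝓝 (z T), B q) :
    NearSolutions α κ ω (z 0) (fun w => B (w T)) := by
  obtain ⟨ε, hε, h⟩ := Metric.eventually_nhds_iff.1 h
  obtain ⟨δ, hδ, hd⟩ := continuous_dependence hκ hz T hε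
  exact of_ball hδ fun w hw h0 => h (hd w hw h0 T hT le_rfl)

theorem pos (hp : p ∈ manifoldM) : NearSolutions α κ ω p (fun w => 0 < stokesN (w 0)) :=
  initial (continuous_stokesN.continuousAt.eventually (lt_mem_nhds (mem_manifoldM_iff.1 hp).2))

end NearSolutions

/-- The logarithmic derivative of `D/N` is `-N + D²/N - 2κu/N`, which is at most `κ` because `|D|`
and `2|u|` are at most `N`. -/
theorem Orbit.D_div_N_le {α κ γ : ℝ} {N D u v : ℝ → ℝ} (O : Orbit α κ γ N D u v) (hκ : 0 < κ)
    (hN : 0 < N 0) {t : ℝ} (ht : 0 ≤ t) :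
    D t ^ 2 / N t ^ 2 ≤ D 0 ^ 2 / N 0 ^ 2 * Real.exp (2 * κ * t) := by
  have hp : ∀ s, 0 ≤ s → 0 < N s := fun s hs => O.N_pos hκ hN hs
  have := (O.hD.sq.div O.hN.sq fun s hs => by have := hp s hs; positivity).le_mul_exp
    (c := 2 * κ) (fun s hs => ?_) ht
  · rwa [sub_zero] at this
  · have h1 := hp s hs
    have h2 := O.neg_u_le s
    have h3 : D s ^ 2 ≤ N s ^ 2 := sq_le_sq.2 ((O.abs_D_le s).trans (le_abs_self _))
    rw [div_le_iff₀ (by positivity)]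
    have e : 2 * κ * (D s ^ 2 / N s ^ 2) * (N s ^ 2) ^ 2 = 2 * κ * D s ^ 2 * N s ^ 2 := by
      field_simp
    rw [e]
    have h4 : 0 ≤ D s ^ 2 * N s * (κ * (N s + 2 * u s) + (N s ^ 2 - D s ^ 2)) := by
      have := sq_nonneg (D s)
      have h5 : 0 ≤ κ * (N s + 2 * u s) := mul_nonneg hκ.le (by linarith)
      exact mul_nonneg (mul_nonneg this h1.le) (by linarith)
    nlinarith

/-! ### Stability of the amplitude ratio and of phase-locked asymptotic states. -/

section Manifold

variable {α κ ω γ : ℝ} {z : ℝ → ℂ × ℂ} {p : ℂ × ℂ}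

theorem near_D_le (hκ : 0 < κ) (hp : p ∈ manifoldM) (T : ℝ) {η : ℝ} (hη : 0 < η) :
    NearSolutions α κ ω p (fun w => ∀ t, 0 ≤ t → t ≤ T →
      stokesD (w t) ^ 2 ≤ η * stokesN (w t) ^ 2) := by
  have h1 : ∀ᶠ q in 𝓝 p, stokesD q ^ 2 < η * Real.exp (-(2 * κ * T)) * stokesN q ^ 2 := by
    have hc : Continuous fun q => η * Real.exp (-(2 * κ * T)) * stokesN q ^ 2 - stokesD q ^ 2 := by
      have := continuous_stokesN
      have := continuous_stokesD
      fun_prop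
    have hpos : 0 < η * Real.exp (-(2 * κ * T)) * stokesN p ^ 2 - stokesD p ^ 2 := by
      obtain ⟨hD, hN⟩ := mem_manifoldM_iff.1 hp
      rw [hD]
      have := Real.exp_pos (-(2 * κ * T))
      simp only [ne_eq, OfNat.ofNat_ne_zero, not_false_eq_true, zero_pow, sub_zero]
      positivity
    filter_upwards [hc.continuousAt.eventually (lt_mem_nhds hpos)] with q hq
    linarith
  refine ((NearSolutions.initial h1).and (NearSolutions.pos hp)).mono fun w hw h t ht htT => ?_
  have O := hw.orbit rfl
  have h2 := O.D_div_N_le hκ h.2 ht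
  have hNt := O.N_pos hκ h.2 ht
  have hN0 := h.2
  rw [div_le_iff₀ (by positivity)] at h2
  refine h2.trans (mul_le_mul_of_nonneg_right ?_ (by positivity))
  have h3 : stokesD (w 0) ^ 2 / stokesN (w 0) ^ 2 ≤ η * Real.exp (-(2 * κ * T)) := by
    rw [div_le_iff₀ (by positivity)]
    exact h.1.le
  calc _ ≤ η * Real.exp (-(2 * κ * T)) * Real.exp (2 * κ * T) := by gcongr
    _ = η := by rw [mul_assoc, ← Real.exp_add]; simp

theorem abs_ratio_sub_one_lt {w : ℂ × ℂ} {ε : ℝ} (hε : 0 < ε) (h0 : 0 < stokesN w)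
    (h : stokesD w ^ 2 ≤ min (1 / 4) (ε ^ 2 / 25) * stokesN w ^ 2) : |ratio w - 1| < ε := by
  have h1 : |stokesD w| ≤ stokesN w / 2 := by
    refine abs_le_of_sq_le_sq ?_ (by linarith)
    nlinarith [mul_le_mul_of_nonneg_right (min_le_left (1 / 4 : ℝ) (ε ^ 2 / 25)) (sq_nonneg (stokesN w))]
  have h2 : |stokesD w| ≤ ε / 5 * stokesN w := by
    refine abs_le_of_sq_le_sq ?_ (by positivity)
    nlinarith [mul_le_mul_of_nonneg_right (min_le_right (1 / 4 : ℝ) (ε ^ 2 / 25)) (sq_nonneg (stokesN w))]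
  refine (abs_ratio_sub_one_le h0 h1).trans_lt ?_
  have h3 : |stokesD w| / stokesN w ≤ ε / 5 := by rwa [div_le_iff₀ h0]
  linarith

/-- Only late times need an argument specific to the regime: on a finite time interval `D/N` grows
by a bounded factor (`near_D_le`). -/
theorem ratioStableAt_of_near (hκ : 0 < κ) (hp : p ∈ manifoldM)
    (h : ∀ η > 0, ∃ T, NearSolutions α κ ω p (fun w => ∀ t, 0 ≤ t → T < t →
      stokesD (w t) ^ 2 ≤ η * stokesN (w t) ^ 2)) : RatioStableAt α κ ω p := by
  intro ε hε
  have hη : 0 < min (1 / 4) (ε ^ 2 / 25) := by positivity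
  obtain ⟨T, hT⟩ := h _ hη
  refine ((hT.and (near_D_le hκ hp T hη)).and (NearSolutions.pos hp)).exists_ball.imp
    fun δ hδ => ⟨hδ.1, fun w hw hd t ht => ?_⟩
  obtain ⟨⟨h1, h2⟩, h3⟩ := hδ.2 w hw hd
  have hN := (hw.orbit rfl).N_pos hκ h3 ht
  rcases le_or_gt t T with htT | htT
  · exact abs_ratio_sub_one_lt hε hN (h2 t ht htT)
  · exact abs_ratio_sub_one_lt hε hN (h1 t ht htT)

theorem tendsto_ratio (h0 : ∀ᶠ t in atTop, 0 < stokesN (z t)) {e : ℝ → ℝ}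
    (he : Tendsto e atTop (𝓝 0))
    (h : ∀ᶠ t in atTop, stokesD (z t) ^ 2 ≤ e t * stokesN (z t) ^ 2) :
    Tendsto (fun t => ratio (z t)) atTop (𝓝 1) := by
  rw [Metric.tendsto_nhds]
  intro ε hε
  have hη : 0 < min (1 / 4) (ε ^ 2 / 25) := by positivity
  filter_upwards [h0, h, he.eventually (gt_mem_nhds hη)] with t h1 h2 h3
  rw [Real.dist_eq]
  exact abs_ratio_sub_one_lt hε h1 (h2.trans (by gcongr))

/-- One has `(D/N)² = 1 - X² - Y²`. Since `(a, b)` has norm one, this is at most `2|X - a| + 2|Y -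
b|`. -/
theorem Orbit.D_sq_le_of_dist {N D u v : ℝ → ℝ} (O : Orbit α κ γ N D u v) {a b η t : ℝ}
    (hab : a ^ 2 + b ^ 2 = 1) (hN : 0 < N t)
    (h : (2 * u t / N t - a) ^ 2 + (2 * v t / N t - b) ^ 2 ≤ η) :
    D t ^ 2 ≤ 4 * √η * N t ^ 2 := by
  set X := 2 * u t / N t with hX
  set Y := 2 * v t / N t with hY
  have h1 : D t ^ 2 = (1 - X ^ 2 - Y ^ 2) * N t ^ 2 := by
    have e1 : X * N t = 2 * u t := div_mul_cancel₀ _ hN.ne'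
    have e2 : Y * N t = 2 * v t := div_mul_cancel₀ _ hN.ne'
    have := O.ident t
    linear_combination (X * N t + 2 * u t) * e1 + (Y * N t + 2 * v t) * e2 - this
  rw [h1]
  refine mul_le_mul_of_nonneg_right ?_ (sq_nonneg _)
  have h2 : |X - a| ≤ √η := Real.abs_le_sqrt (by nlinarith [sq_nonneg (Y - b)])
  have h3 : |Y - b| ≤ √η := Real.abs_le_sqrt (by nlinarith [sq_nonneg (X - a)])
  have ha : |a| ≤ 1 := abs_le_one_iff_mul_self_le_one.2 (by nlinarith [sq_nonneg b])
  have hb : |b| ≤ 1 := abs_le_one_iff_mul_self_le_one.2 (by nlinarith [sq_nonneg a])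
  have h4 : -(a * (X - a)) ≤ √η := by
    refine (neg_le_abs _).trans ?_
    rw [abs_mul]
    exact (mul_le_of_le_one_left (abs_nonneg _) ha).trans h2
  have h5 : -(b * (Y - b)) ≤ √η := by
    refine (neg_le_abs _).trans ?_
    rw [abs_mul]
    exact (mul_le_of_le_one_left (abs_nonneg _) hb).trans h3
  nlinarith [sq_nonneg (X - a), sq_nonneg (Y - b)]

/-- The condition `u > 0` at one time is open. It is therefore inherited by all nearby solutions, on
or off the manifold, and it starts the uniform locking. For `a > 0` it follows from the limit of
`2u/N`; for `a = 0` the quotient `u/P` grows with speed `κ/2`. -/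
theorem exists_u_pos (hκ : 0 < κ) (hγ : γ = 2 * ω) (hz : IsSolution α κ ω z)
    (h0 : z 0 ∈ manifoldM) {a b : ℝ} (hab : a ^ 2 + b ^ 2 = 1) (hb : γ = κ * b) (ha : 0 ≤ a)
    (hb0 : 0 ≤ b) (hne : phaseFactor (z 0) ≠ ⟨-a, b⟩) :
    ∃ T, 0 ≤ T ∧ 0 < stokesU (z T) := by
  have O := hz.orbit hγ
  obtain ⟨hD, hN⟩ := mem_manifoldM_iff.1 h0
  rcases ha.eq_or_lt with rfl | ha
  · have hP0 : 0 < stokesN (z 0) + 2 * 0 * stokesU (z 0) - 2 * b * stokesV (z 0) :=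
      lt_of_le_of_ne (O.P_nonneg hab 0) (Ne.symm (mt (P_zero_iff_phaseFactor hab h0).1 hne))
    have hPp : ∀ s, 0 ≤ s → 0 < stokesN (z s) + 2 * 0 * stokesU (z s) - 2 * b * stokesV (z s) :=
      fun s hs => O.P_pos hκ hab hb hP0 hs
    by_contra hc
    push Not at hc
    have := (O.hu.div (O.hP hab hb) (fun s hs => (hPp s hs).ne')).neg.eventually_le_of_speed
      (M := -1) (c := κ / 2) (fun s hs _ => ?_) (by positivity)
    · obtain ⟨t, ht, ht0⟩ := (this.and (eventually_ge_atTop 0)).exists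
      have h1 : stokesU (z t) / (stokesN (z t) + 2 * 0 * stokesU (z t) - 2 * b * stokesV (z t)) ≤ 0 :=
        div_nonpos_of_nonpos_of_nonneg (hc t ht0) (hPp t ht0).le
      linarith
    · have hp := hPp s hs
      have hDs : stokesD (z s) = 0 := O.D_eq_zero hκ hD hs
      have hb1 : b = 1 := by nlinarith [sq_nonneg (b - 1)]
      rw [neg_le_neg_iff, le_div_iff₀ (by positivity), hDs, hb, hb1]
      nlinarith
  · have h1 := (manifold_lock hκ hγ hz h0 hab hb ha.le hb0 (fun _ => hne)).1
    obtain ⟨t, ht, ht0⟩ := ((h1.eventually (lt_mem_nhds ha)).and (eventually_ge_atTop 0)).exists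
    refine ⟨t, ht0, ?_⟩
    have hNt := O.N_pos hκ hN ht0
    have := (div_pos_iff_of_pos_right hNt).1 ht
    linarith

theorem near_lock (hκ : 0 < κ) (hγ : γ = 2 * ω) (hz : IsSolution α κ ω z)
    (h0 : z 0 ∈ manifoldM) {a b : ℝ} (hab : a ^ 2 + b ^ 2 = 1) (hb : γ = κ * b) (ha : 0 ≤ a)
    (hb0 : 0 ≤ b) (hne : phaseFactor (z 0) ≠ ⟨-a, b⟩) :
    ∃ T, 0 ≤ T ∧ ∃ e : ℝ → ℝ, Tendsto e atTop (𝓝 0) ∧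
      NearSolutions α κ ω (z 0) (fun w => ∀ t, T < t →
        (2 * stokesU (w t) / stokesN (w t) - a) ^ 2
          + (2 * stokesV (w t) / stokesN (w t) - b) ^ 2 ≤ e t) := by
  obtain ⟨T, hT, hu⟩ := exists_u_pos hκ hγ hz h0 hab hb ha hb0 hne
  obtain ⟨e, he, hlock⟩ := uniform_lock hκ hab hb ha hb0
  refine ⟨T, hT, fun t => e (t - T), he.comp (tendsto_atTop_add_const_right _ (-T) tendsto_id), ?_⟩
  refine (NearSolutions.at_time hκ hz hT
    (continuous_stokesU.continuousAt.eventually (lt_mem_nhds hu))).mono fun w hw h t ht => ?_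
  have := hlock _ _ _ _ _ ((hw.orbit hγ).shift hT) (by simpa using h) (t - T) (by linarith)
  simpa using this

/-- If `z` and all solutions starting nearby lock to the same phase, then `z` has a stable
asymptotic state. -/
theorem asymptoticStateStable_of_lock (hκ : 0 < κ) (hγ : γ = 2 * ω) (hz : IsSolution α κ ω z)
    (h0 : z 0 ∈ manifoldM) {a b : ℝ} (hab : a ^ 2 + b ^ 2 = 1)
    (h : NearSolutions α κ ω (z 0) (fun w =>
      Tendsto (fun t => 2 * stokesU (w t) / stokesN (w t)) atTop (𝓝 a) ∧
      Tendsto (fun t => 2 * stokesV (w t) / stokesN (w t)) atTop (𝓝 b))) :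
    AsymptoticStateStable α κ ω z ∧ RatioAttractingAt α κ ω (z 0) := by
  obtain ⟨δ, hδ, hw⟩ := (h.and (NearSolutions.pos h0)).exists_ball
  have hz1 := hw z hz (by simpa using hδ)
  have cz := locked_consequences hκ hγ hz hz1.2 hab hz1.1.1 hz1.1.2
  refine ⟨⟨δ, hδ, fun w hw0 hd => ?_⟩, δ, hδ, fun w hw0 hd => ?_⟩
  · have hw1 := hw w hw0 hd
    have cw := locked_consequences hκ hγ hw0 hw1.2 hab hw1.1.1 hw1.1.2
    refine ⟨fun ρ₁ ρ₂ h1 h2 => ?_, fun θ hθ => ?_, fun hA => ?_, fun hI => ?_⟩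
    · rw [tendsto_nhds_unique h1 cz.2.2.2.2.1, tendsto_nhds_unique h2 cz.2.2.2.2.2]
      exact ⟨cw.2.2.2.2.1, cw.2.2.2.2.2⟩
    · have := tendsto_nhds_unique hθ cz.1
      unfold PhaseLockedAt
      rw [this]
      exact cw.1
    · refine ⟨fun hc => hA.1 ?_, fun hc => hA.2 ?_⟩
      · rw [tendsto_nhds_unique hc cw.2.2.2.2.1]
        exact cz.2.2.2.2.1
      · rw [tendsto_nhds_unique hc cw.2.2.2.2.2]
        exact cz.2.2.2.2.2
    · refine absurd ?_ hI
      refine ⟨Complex.arg ⟨a, b⟩, ?_⟩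
      have e : unitAt (Complex.arg ⟨a, b⟩) = ⟨a, b⟩ := by
        have hn : ‖(⟨a, b⟩ : ℂ)‖ = 1 := by
          rw [← sq_eq_sq₀ (norm_nonneg _) zero_le_one, Complex.sq_norm, Complex.normSq_mk]
          linarith
        have := Complex.norm_mul_exp_arg_mul_I (⟨a, b⟩ : ℂ)
        rwa [hn, Complex.ofReal_one, one_mul] at this
      unfold PhaseLockedAt
      rw [e]
      exact cz.1
  · have hw1 := hw w hw0 hd
    exact (locked_consequences hκ hγ hw0 hw1.2 hab hw1.1.1 hw1.1.2).2.1

theorem stability_of_lock (hκ : 0 < κ) (hγ : γ = 2 * ω) (hz : IsSolution α κ ω z)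
    (h0 : z 0 ∈ manifoldM) {a b : ℝ} (hab : a ^ 2 + b ^ 2 = 1) (hb : γ = κ * b) (ha : 0 ≤ a)
    (hb0 : 0 ≤ b) (hne : phaseFactor (z 0) ≠ ⟨-a, b⟩) :
    RatioStableAt α κ ω (z 0) ∧ AsymptoticStateStable α κ ω z ∧ RatioAttractingAt α κ ω (z 0) := by
  obtain ⟨T, hT, e, he, hnear⟩ := near_lock hκ hγ hz h0 hab hb ha hb0 hne
  refine ⟨ratioStableAt_of_near hκ h0 fun η hη => ?_,
    asymptoticStateStable_of_lock hκ hγ hz h0 hab (hnear.mono fun w _ h =>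
      tendsto_of_sq_add_sq ((eventually_gt_atTop T).mono h) he)⟩
  have hs : ∀ᶠ t in atTop, 4 * √(e t) < η := by
    have := he.sqrt.const_mul 4
    simp only [Real.sqrt_zero, mul_zero] at this
    exact this.eventually (gt_mem_nhds hη)
  obtain ⟨S, hS⟩ := eventually_atTop.1 hs
  refine ⟨max T S, (hnear.and (NearSolutions.pos h0)).mono fun w hw h t ht htT => ?_⟩
  have O := hw.orbit hγ
  have h1 := O.D_sq_le_of_dist hab (O.N_pos hκ h.2 ht) (h.1 t ((le_max_left _ _).trans_lt htT))
  refine h1.trans (mul_le_mul_of_nonneg_right ?_ (sq_nonneg _))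
  exact (hS t ((le_max_right _ _).trans htT.le)).le

end Manifold

/-! ### Detuning larger than the coupling -/

namespace Orbit

variable {α κ γ : ℝ} {N D u v : ℝ → ℝ} (O : Orbit α κ γ N D u v)
include O

/-- In the derivative of `D² - mW²` the damping of `D` is twice as strong as that of `W`. The bound
on `m` gives `mγW ≤ N`, which absorbs the remaining `D²` term, so this cone around the manifold is
forward invariant. -/
theorem D_sq_le_W {m : ℝ} (hκ : 0 < κ) (h : κ < γ) (hm : 0 ≤ m) (hm1 : m * (γ * (γ + κ)) ≤ 1)
    (h0 : D 0 ^ 2 ≤ m * (γ * N 0 - 2 * κ * v 0) ^ 2) {t : ℝ} (ht : 0 ≤ t) :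
    D t ^ 2 ≤ m * (γ * N t - 2 * κ * v t) ^ 2 := by
  have := (O.hD.sq.sub (O.hW.sq.const_mul m)).nonpos_of_le_mul (c := 2 * |2 * α - κ|)
    (fun s hs hp => ?_) (by linarith) ht
  · linarith
  · have h1 := O.W_le hκ s
    have hN := O.nonneg s
    set W := γ * N s - 2 * κ * v s
    have h2 : 0 ≤ D s ^ 2 := sq_nonneg _
    have h3 : m * γ * W ≤ N s := by
      have h4 : m * γ * W ≤ m * γ * ((γ + κ) * N s) :=
        mul_le_mul_of_nonneg_left h1 (mul_nonneg hm (by linarith))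
      nlinarith
    have h5 := mul_le_mul_of_nonneg_right h3 h2
    have h6 := mul_le_mul_of_nonneg_right (le_abs_self (2 * α - κ)) hp.le
    have h7 := mul_nonneg hN hp.le
    nlinarith

theorem W_pos (hκ : 0 < κ) (h : κ < γ) (h0 : 0 < N 0) {t : ℝ} (ht : 0 ≤ t) :
    0 < γ * N t - 2 * κ * v t :=
  (mul_pos (sub_pos.2 h) (O.N_pos hκ h0 ht)).trans_le (O.le_W hκ t)

/-- In a cone of half the admissible parameter, `γD² ≤ NW/2`, and `D²/W²` decays at least at the
rate `N ≥ n`. -/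
theorem D_decay_of_W {m : ℝ} (hκ : 0 < κ) (h : κ < γ) (hN0 : 0 < N 0)
    (hm1 : m * (γ * (γ + κ)) ≤ 1 / 2) (hm : 0 ≤ m)
    (hDW : ∀ t, 0 ≤ t → D t ^ 2 ≤ m * (γ * N t - 2 * κ * v t) ^ 2) {n : ℝ}
    (hn : ∀ t, 0 ≤ t → n ≤ N t) {t : ℝ} (ht : 0 ≤ t) :
    D t ^ 2 ≤ m * (γ + κ) ^ 2 * Real.exp (-n * t) * N t ^ 2 := by
  have hW : ∀ s, 0 ≤ s → 0 < γ * N s - 2 * κ * v s := fun s hs => O.W_pos hκ h hN0 hs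
  have key := (O.hD.sq.div O.hW.sq (fun s hs => (pow_pos (hW s hs) 2).ne')).le_mul_exp
    (c := -n) (fun s hs => ?_) ht
  · rw [sub_zero, div_le_iff₀ (pow_pos (hW t ht) 2)] at key
    refine key.trans ?_
    have h0 : D 0 ^ 2 / (γ * N 0 - 2 * κ * v 0) ^ 2 ≤ m := by
      rw [div_le_iff₀ (pow_pos (hW 0 le_rfl) 2)]
      exact hDW 0 le_rfl
    have h1 := O.W_le hκ t
    have h2 := (hW t ht).le
    have hg : 0 ≤ γ + κ := by linarith
    calc _ ≤ m * Real.exp (-n * t) * ((γ + κ) * N t) ^ 2 := by gcongr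
      _ = _ := by ring
  · have h1 := O.W_le hκ s
    have h2 := hW s hs
    have h3 := hDW s hs
    have h4 := hn s hs
    have hN := O.nonneg s
    set W := γ * N s - 2 * κ * v s
    rw [div_le_iff₀ (by positivity)]
    have e : -n * (D s ^ 2 / W ^ 2) * (W ^ 2) ^ 2 = -n * D s ^ 2 * W ^ 2 := by field_simp
    rw [e]
    have h5 : γ * D s ^ 2 ≤ N s * W / 2 := by
      have hγ : 0 ≤ γ := by linarith
      have a1 : γ * D s ^ 2 ≤ γ * (m * W ^ 2) := mul_le_mul_of_nonneg_left h3 hγ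
      have a2 : γ * m * W * W ≤ γ * m * W * ((γ + κ) * N s) :=
        mul_le_mul_of_nonneg_left h1 (by positivity)
      have a3 : m * (γ * (γ + κ)) * (W * N s) ≤ 1 / 2 * (W * N s) :=
        mul_le_mul_of_nonneg_right hm1 (by positivity)
      nlinarith
    have h6 : 0 ≤ 2 * D s ^ 2 * W * (N s * W / 2 - γ * D s ^ 2) :=
      mul_nonneg (by positivity) (by linarith)
    have h7 : 0 ≤ D s ^ 2 * W ^ 2 * (N s - n) := mul_nonneg (by positivity) (by linarith)
    nlinarith

/-- At `κ = 2α` the amplitude vanishes and no exponential rate is available. Comparing `D²` with a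
third power of `W` still gives `D²/N² = O(N)`, hence `R → 1`. -/
theorem D_sq_le_W_cube {m k : ℝ} (hκ : 0 < κ) (hακ : κ = 2 * α) (h : κ < γ) (hN0 : 0 < N 0)
    (hm1 : m * (γ * (γ + κ)) ≤ 1 / 3)
    (hDW : ∀ t, 0 ≤ t → D t ^ 2 ≤ m * (γ * N t - 2 * κ * v t) ^ 2)
    (h0 : D 0 ^ 2 ≤ k * (γ * N 0 - 2 * κ * v 0) ^ 3) {t : ℝ} (ht : 0 ≤ t) :
    D t ^ 2 ≤ k * (γ * N t - 2 * κ * v t) ^ 3 := by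
  have hder := O.hD.sq.sub ((O.hW.mul O.hW.sq).const_mul k)
  have := hder.le_barrier (M := 0) (by linarith) (fun s hs hp => ?_) ht
  · linarith
  · have h1 := O.W_le hκ s
    have h2 := O.W_pos hκ h hN0 hs
    have h3 := hDW s hs
    have hN := O.nonneg s
    set W := γ * N s - 2 * κ * v s
    have hγ : 0 ≤ γ := by linarith
    have e0 : 2 * α - κ = 0 := by linarith
    rw [e0]
    have h4 : k * W ^ 2 * W < D s ^ 2 := by linarith
    have h5 : k * W ^ 2 < m * W := by
      have : k * W ^ 2 * W < m * W * W := by linarith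
      exact lt_of_mul_lt_mul_right this h2.le
    have h6 : γ * (k * W ^ 2) ≤ N s / 3 := by
      have a1 : γ * (k * W ^ 2) ≤ γ * (m * W) := mul_le_mul_of_nonneg_left h5.le hγ
      by_cases hm : 0 ≤ m
      · have a2 : γ * m * W ≤ γ * m * ((γ + κ) * N s) :=
          mul_le_mul_of_nonneg_left h1 (by positivity)
        nlinarith
      · nlinarith [mul_nonneg hγ h2.le]
    have h7 := mul_nonneg (sub_nonneg.2 h6) (sq_nonneg (D s))
    have h8 := mul_nonneg hN (sub_nonneg.2 h4.le)
    nlinarith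

theorem exists_D_bound {m : ℝ} (hκ : 0 < κ) (h : κ < γ) (hα : κ ≤ 2 * α) (hN0 : 0 < N 0)
    (hm : 0 ≤ m) (hm1 : m * (γ * (γ + κ)) ≤ 1 / 3)
    (hDW : ∀ t, 0 ≤ t → D t ^ 2 ≤ m * (γ * N t - 2 * κ * v t) ^ 2) :
    ∃ e : ℝ → ℝ, Tendsto e atTop (𝓝 0) ∧ ∀ t, 0 ≤ t → D t ^ 2 ≤ e t * N t ^ 2 := by
  rcases hα.lt_or_eq with hα | hα
  · obtain ⟨c, c', hc, hc', hb⟩ := exists_lower_bound_of_lt hκ h hα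
    have hn : 0 < min (c * N 0) c' := by positivity
    refine ⟨fun t => m * (γ + κ) ^ 2 * Real.exp (-min (c * N 0) c' * t), ?_, fun t ht =>
      O.D_decay_of_W hκ h hN0 (by linarith) hm hDW (hb N D u v O) ht⟩
    have : Tendsto (fun t : ℝ => -min (c * N 0) c' * t) atTop atBot :=
      tendsto_id.const_mul_atTop_of_neg (by linarith)
    simpa using (Real.tendsto_exp_atBot.comp this).const_mul (m * (γ + κ) ^ 2)
  · have hW := fun t ht => O.W_pos hκ h hN0 (t := t) ht
    have hW0 := hW 0 le_rfl
    set k := D 0 ^ 2 / (γ * N 0 - 2 * κ * v 0) ^ 3 with hk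
    have hk0 : 0 ≤ k := by positivity
    have hNt := O.tendsto_zero hκ (by linarith) (Or.inr (Or.inl ⟨h, hα.ge⟩))
    refine ⟨fun t => k * ((γ + κ) * N t) * (γ + κ) ^ 2, ?_, fun t ht => ?_⟩
    · have := ((hNt.const_mul (γ + κ)).const_mul k).mul_const ((γ + κ) ^ 2)
      simpa using this
    · have h1 := O.D_sq_le_W_cube hκ hα h hN0 hm1 hDW (k := k)
        (by rw [hk]; field_simp; rfl) ht
      have h2 := O.W_le hκ t
      have h3 := (hW t ht).le
      calc _ ≤ k * (γ * N t - 2 * κ * v t) ^ 3 := h1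
        _ ≤ k * ((γ + κ) * N t) ^ 3 := by gcongr
        _ = _ := by ring

end Orbit

section Detuned

variable {α κ ω γ : ℝ} {z : ℝ → ℂ × ℂ} {p : ℂ × ℂ}

theorem near_D_sq_le_W (hκ : 0 < κ) (hγ : γ = 2 * ω) (h : κ < γ) (hp : p ∈ manifoldM) {m : ℝ}
    (hm : 0 < m) (hm1 : m * (γ * (γ + κ)) ≤ 1) :
    NearSolutions α κ ω p (fun w => 0 < stokesN (w 0) ∧ ∀ t, 0 ≤ t →
      stokesD (w t) ^ 2 ≤ m * (γ * stokesN (w t) - 2 * κ * stokesV (w t)) ^ 2 ∧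
      stokesD (w t) ^ 2 ≤ m * (γ + κ) ^ 2 * stokesN (w t) ^ 2) := by
  have h1 : ∀ᶠ q in 𝓝 p, stokesD q ^ 2 < m * (γ * stokesN q - 2 * κ * stokesV q) ^ 2 := by
    have hc : Continuous fun q => m * (γ * stokesN q - 2 * κ * stokesV q) ^ 2 - stokesD q ^ 2 := by
      have := continuous_stokesN
      have := continuous_stokesD
      have := continuous_stokesV
      fun_prop
    have hpos : 0 < m * (γ * stokesN p - 2 * κ * stokesV p) ^ 2 - stokesD p ^ 2 := by
      obtain ⟨hD, hN⟩ := mem_manifoldM_iff.1 hp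
      have h2 : 2 * stokesV p ≤ stokesN p := by
        have := stokes_identity p
        nlinarith [sq_nonneg (stokesU p), sq_nonneg (stokesD p)]
      have : 0 < γ * stokesN p - 2 * κ * stokesV p := by nlinarith
      rw [hD]
      simp only [ne_eq, OfNat.ofNat_ne_zero, not_false_eq_true, zero_pow, sub_zero]
      positivity
    filter_upwards [hc.continuousAt.eventually (lt_mem_nhds hpos)] with q hq
    linarith
  refine ((NearSolutions.initial h1).and (NearSolutions.pos hp)).mono fun w hw hq =>
    ⟨hq.2, fun t ht => ?_⟩
  have O := hw.orbit hγ
  have h2 := O.D_sq_le_W hκ h hm.le hm1 hq.1.le ht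
  refine ⟨h2, h2.trans ?_⟩
  have h3 := O.W_le hκ t
  have h4 := (O.W_pos hκ h hq.2 ht).le
  calc _ ≤ m * ((γ + κ) * stokesN (w t)) ^ 2 := by gcongr
    _ = _ := by ring

theorem near_D_sq_le_of_detuned (hκ : 0 < κ) (hγ : γ = 2 * ω) (h : κ < γ) (hp : p ∈ manifoldM)
    {η : ℝ} (hη : 0 < η) :
    NearSolutions α κ ω p (fun w => 0 < stokesN (w 0) ∧ ∀ t, 0 ≤ t →
      stokesD (w t) ^ 2 ≤ η * stokesN (w t) ^ 2) := by
  have hγ0 : 0 < γ := hκ.trans h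
  have hm : 0 < min (1 / (γ * (γ + κ))) (η / (γ + κ) ^ 2) := by positivity
  have hm1 : min (1 / (γ * (γ + κ))) (η / (γ + κ) ^ 2) * (γ * (γ + κ)) ≤ 1 := by
    rw [← le_div_iff₀ (by positivity)]
    exact min_le_left _ _
  refine (near_D_sq_le_W hκ hγ h hp hm hm1).mono fun w _ hq => ⟨hq.1, fun t ht => ?_⟩
  refine (hq.2 t ht).2.trans (mul_le_mul_of_nonneg_right ?_ (sq_nonneg _))
  rw [← le_div_iff₀ (by positivity)]
  exact min_le_right _ _

theorem ratioStableAt_of_detuned (hκ : 0 < κ) (hγ : γ = 2 * ω) (h : κ < γ) (hp : p ∈ manifoldM) :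
    RatioStableAt α κ ω p :=
  ratioStableAt_of_near hκ hp fun _ hη =>
    ⟨0, (near_D_sq_le_of_detuned hκ hγ h hp hη).mono fun _ _ hq t ht _ => hq.2 t ht⟩

theorem ratioAttractingAt_of_detuned (hκ : 0 < κ) (hγ : γ = 2 * ω) (h : κ < γ) (hα : κ ≤ 2 * α)
    (hp : p ∈ manifoldM) : RatioAttractingAt α κ ω p := by
  have hγ0 : 0 < γ := hκ.trans h
  have hm : 0 < 1 / (3 * (γ * (γ + κ))) := by positivity
  have hm1 : 1 / (3 * (γ * (γ + κ))) * (γ * (γ + κ)) = 1 / 3 := by field_simp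
  refine ((near_D_sq_le_W hκ hγ h hp hm (by linarith)).mono fun w hw hq => ?_).exists_ball
  have O := hw.orbit hγ
  obtain ⟨e, he, hb⟩ := O.exists_D_bound hκ h hα hq.1 hm.le hm1.le fun t ht => (hq.2 t ht).1
  have hev := eventually_ge_atTop (0 : ℝ)
  exact tendsto_ratio (hev.mono fun t ht => O.N_pos hκ hq.1 ht) he (hev.mono hb)

/-- Above the locking threshold and for `κ < 2α` the amplitudes do not converge on the manifold. -/
theorem not_tendsto_stokesN (hκ : 0 < κ) (hγ : γ = 2 * ω) (h : κ < γ) (hα : κ < 2 * α)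
    (hz : IsSolution α κ ω z) (h0 : z 0 ∈ manifoldM) (L : ℝ) :
    ¬ Tendsto (fun t => stokesN (z t)) atTop (𝓝 L) := by
  intro hL
  refine incoherent_on_manifold hκ hγ hz h0 h ?_
  have O := hz.orbit hγ
  obtain ⟨hD0, hN0⟩ := mem_manifoldM_iff.1 h0
  obtain ⟨c, c', hc, hc', hb⟩ := exists_lower_bound_of_lt hκ h hα
  have hLpos : 0 < L := (show 0 < min (c * stokesN (z 0)) c' by positivity).trans_le
    (ge_of_tendsto hL ((eventually_ge_atTop 0).mono fun t ht => hb _ _ _ _ O t ht))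
  obtain ⟨M, hM, hMN⟩ := O.exists_bound hκ
  set a := 2 * α - κ with ha
  have hD : ∀ t, 0 ≤ t → stokesD (z t) = 0 := fun t ht => O.D_eq_zero hκ hD0 ht
  have hN' : DerivOn (fun t => stokesN (z t))
      (fun t => a * stokesN (z t) - stokesN (z t) ^ 2 + 2 * κ * stokesU (z t)) (Ici 0) :=
    O.hN.congr fun t ht => by rw [hD t ht]; ring
  have bd : ∀ t, 0 ≤ t → |stokesN (z t)| ≤ M ∧ |stokesU (z t)| ≤ M ∧ |stokesV (z t)| ≤ M := by
    intro t ht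
    have h1 := O.nonneg t
    have h2 := hMN t ht
    have h3 := O.u_le t
    have h4 := O.neg_u_le t
    have h5 := O.v_le t
    have h6 := O.neg_v_le t
    exact ⟨abs_le.2 ⟨by linarith, h2⟩, abs_le.2 ⟨by linarith, by linarith⟩,
      abs_le.2 ⟨by linarith, by linarith⟩⟩
  have bN' : ∀ t, 0 ≤ t →
      |a * stokesN (z t) - stokesN (z t) ^ 2 + 2 * κ * stokesU (z t)|
        ≤ |a| * M + M ^ 2 + 2 * κ * M := by
    intro t ht
    obtain ⟨b1, b2, -⟩ := bd t ht
    refine (abs_add_le _ _).trans (add_le_add ((abs_sub _ _).trans (add_le_add ?_ ?_)) ?_)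
    · rw [abs_mul]; gcongr
    · rw [abs_pow]; gcongr
    · rw [abs_mul, abs_of_pos (by positivity : (0 : ℝ) < 2 * κ)]; gcongr
  have bu' : ∀ t, 0 ≤ t →
      |(a - stokesN (z t)) * stokesU (z t) - γ * stokesV (z t) + κ / 2 * stokesN (z t)|
        ≤ (|a| + M) * M + |γ| * M + κ / 2 * M := by
    intro t ht
    obtain ⟨b1, b2, b3⟩ := bd t ht
    refine (abs_add_le _ _).trans (add_le_add ((abs_sub _ _).trans (add_le_add ?_ ?_)) ?_)
    · rw [abs_mul]
      exact mul_le_mul ((abs_sub _ _).trans (by gcongr)) b2 (abs_nonneg _) (by positivity)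
    · rw [abs_mul]; gcongr
    · rw [abs_mul, abs_of_pos (by positivity : (0 : ℝ) < κ / 2)]; gcongr
  have hN'' := ((hN'.const_mul a).sub hN'.sq).add (O.hu.const_mul (2 * κ))
  set A := |a| * M + M ^ 2 + 2 * κ * M with hA
  set B := (|a| + M) * M + |γ| * M + κ / 2 * M with hB
  -- Barbalat's lemma is used twice. If `N` converges, then `N' → 0` and the equation for `N` makes
  -- `u` converge. Then `u' → 0` and, as `γ ≠ 0`, the equation for `u` makes `v` converge. Since the
  -- limit of `N` is positive, the phase would converge.
  have l1 := hN'.tendsto_deriv_zero (K := |a| * A + 2 * M * A + 2 * κ * B) hN'' (fun t ht => by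
    obtain ⟨b1, b2, b3⟩ := bd t ht
    have b4 := bN' t ht
    have b5 := bu' t ht
    refine (abs_add_le _ _).trans (add_le_add ((abs_sub _ _).trans (add_le_add ?_ ?_)) ?_)
    · rw [abs_mul]; gcongr
    · rw [abs_mul, abs_mul, abs_two]; gcongr
    · rw [abs_mul, abs_of_pos (by positivity : (0 : ℝ) < 2 * κ)]; gcongr) hL
  have hu : Tendsto (fun t => stokesU (z t)) atTop (𝓝 ((0 - (a * L - L ^ 2)) / (2 * κ))) := by
    refine ((l1.sub ((hL.const_mul a).sub (hL.pow 2))).div_const (2 * κ)).congr fun t => ?_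
    field_simp
    ring
  -- The constant `a` is written as an affine function of slope `0`, so that the product rule
  -- applies to `(a - N)u`.
  have hu'' := (((DerivOn.affine a 0 0 (Ici 0)).sub O.hN).mul O.hu).sub (O.hv.const_mul γ)
    |>.add (O.hN.const_mul (κ / 2))
  have hu' : DerivOn (fun t => stokesU (z t)) (fun t => (a + 0 * (t - 0) - stokesN (z t)) * stokesU (z t)
      - γ * stokesV (z t) + κ / 2 * stokesN (z t)) (Ici 0) :=
    O.hu.congr fun t _ => by rw [zero_mul, add_zero]
  have bv' : ∀ t, 0 ≤ t →
      |(a - stokesN (z t)) * stokesV (z t) + γ * stokesU (z t)| ≤ (|a| + M) * M + |γ| * M := by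
    intro t ht
    obtain ⟨b1, b2, b3⟩ := bd t ht
    refine (abs_add_le _ _).trans (add_le_add ?_ ?_)
    · rw [abs_mul]
      exact mul_le_mul ((abs_sub _ _).trans (by gcongr)) b3 (abs_nonneg _) (by positivity)
    · rw [abs_mul]; gcongr
  have l2 := hu'.tendsto_deriv_zero
    (K := A * M + (|a| + M) * B + |γ| * ((|a| + M) * M + |γ| * M) + κ / 2 * A) hu'' (fun t ht => by
    obtain ⟨b1, b2, b3⟩ := bd t ht
    have b4 := bN' t ht
    have b5 := bu' t ht
    have b6 := bv' t ht
    have b7 : |0 - ((2 * α - κ) * stokesN (z t) - stokesN (z t) ^ 2 - stokesD (z t) ^ 2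
        + 2 * κ * stokesU (z t))| ≤ A := by
      rw [hD t ht, zero_sub, abs_neg, ← ha]
      simpa using b4
    have b8 : |a + 0 * (t - 0) - stokesN (z t)| ≤ |a| + M := by
      rw [zero_mul, add_zero]
      exact (abs_sub _ _).trans (by gcongr)
    refine (abs_add_le _ _).trans (add_le_add ((abs_sub _ _).trans (add_le_add
      ((abs_add_le _ _).trans (add_le_add ?_ ?_)) ?_)) ?_)
    · rw [abs_mul]
      exact mul_le_mul b7 b2 (abs_nonneg _) (by positivity)
    · rw [abs_mul]
      exact mul_le_mul b8 b5 (abs_nonneg _) (by positivity)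
    · rw [abs_mul]; gcongr
    · rw [abs_mul, abs_of_pos (by positivity : (0 : ℝ) < κ / 2)]
      have : |(2 * α - κ) * stokesN (z t) - stokesN (z t) ^ 2 - stokesD (z t) ^ 2
        + 2 * κ * stokesU (z t)| ≤ A := by rwa [zero_sub, abs_neg] at b7
      gcongr) hu
  have hγ0 : γ ≠ 0 := (hκ.trans h).ne'
  set U := (0 - (a * L - L ^ 2)) / (2 * κ)
  have hv : Tendsto (fun t => stokesV (z t)) atTop (𝓝 (((a - L) * U + κ / 2 * L - 0) / γ)) := by
    refine (((((hL.const_sub a).mul hu).add (hL.const_mul (κ / 2))).sub l2).div_const γ).congr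
      fun t => ?_
    field_simp
    ring
  set V := ((a - L) * U + κ / 2 * L - 0) / γ
  have hphase : Tendsto (fun t => phaseFactor (z t)) atTop (𝓝 ⟨2 * U / L, 2 * V / L⟩) := by
    have h1 : Tendsto (fun t => ((2 * stokesU (z t) / stokesN (z t) : ℝ) : ℂ)
        + ((2 * stokesV (z t) / stokesN (z t) : ℝ) : ℂ) * Complex.I) atTop
        (𝓝 (((2 * U / L : ℝ) : ℂ) + ((2 * V / L : ℝ) : ℂ) * Complex.I)) :=
      ((Complex.continuous_ofReal.tendsto _).comp ((hu.const_mul 2).div hL hLpos.ne')).add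
        (((Complex.continuous_ofReal.tendsto _).comp ((hv.const_mul 2).div hL hLpos.ne')).mul_const _)
    rw [← Complex.mk_eq_add_mul_I] at h1
    refine h1.congr' ((eventually_ge_atTop 0).mono fun t ht => ?_)
    beta_reduce
    rw [phaseFactor_eq_of_mem (mem_manifoldM_of_solution hz h0 ht), Complex.mk_eq_add_mul_I]
  have hn : ‖(⟨2 * U / L, 2 * V / L⟩ : ℂ)‖ = 1 := by
    refine tendsto_nhds_unique hphase.norm (tendsto_const_nhds.congr'
      ((eventually_ge_atTop 0).mono fun t ht => ?_))
    obtain ⟨Φ, -, hΦ⟩ := exists_lift hκ hγ hz h0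
    beta_reduce
    rw [hΦ t ht, unitAt, Complex.norm_exp_ofReal_mul_I]
  refine ⟨Complex.arg ⟨2 * U / L, 2 * V / L⟩, ?_⟩
  have e : unitAt (Complex.arg ⟨2 * U / L, 2 * V / L⟩) = ⟨2 * U / L, 2 * V / L⟩ := by
    have := Complex.norm_mul_exp_arg_mul_I (⟨2 * U / L, 2 * V / L⟩ : ℂ)
    rwa [hn, Complex.ofReal_one, one_mul] at this
  unfold PhaseLockedAt
  rw [e]
  exact hphase

theorem asymptoticStateStable_of_detuned (hκ : 0 < κ) (hγ : γ = 2 * ω) (h : κ < γ)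
    (hz : IsSolution α κ ω z) (h0 : z 0 ∈ manifoldM) : AsymptoticStateStable α κ ω z := by
  have hγ0 : 0 < γ := hκ.trans h
  -- The first entry keeps both oscillators away from zero when `N` is; the second is the closeness
  -- required by `incoherent_of_near`.
  have hη : 0 < min (1 / 4) (((γ + κ) ^ 2 - 4 * κ ^ 2) / (γ + κ) ^ 2) :=
    lt_min (by norm_num) (div_pos (by nlinarith) (by positivity))
  obtain ⟨δ, hδ, hw⟩ := (near_D_sq_le_of_detuned hκ hγ h h0 hη).exists_ball
  refine ⟨δ, hδ, fun w hw0 hd => ?_⟩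
  obtain ⟨hN0, hDw⟩ := hw w hw0 hd
  have O := hw0.orbit hγ
  have hI : Incoherent w := by
    refine incoherent_of_near hκ hγ h hw0 ((eventually_ge_atTop 0).mono fun t ht =>
      ⟨O.N_pos hκ hN0 ht, ?_⟩)
    have h1 := (hDw t ht).trans (mul_le_mul_of_nonneg_right (min_le_right _ _) (sq_nonneg _))
    rw [div_mul_eq_mul_div, le_div_iff₀ (by positivity)] at h1
    linarith
  refine ⟨fun ρ₁ ρ₂ h1 h2 => ?_, fun θ hθ => absurd ⟨θ, hθ⟩ (incoherent_on_manifold hκ hγ hz h0 h),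
    fun hA => ?_, fun _ => hI⟩
  · rcases le_or_gt (2 * α) κ with hα | hα
    · have hreg : DeathRegime α κ γ := Or.inr (Or.inl ⟨h, hα⟩)
      have d1 := amplitudeDeath_of_tendsto ((hz.orbit hγ).tendsto_zero hκ hγ0.le hreg)
      have d2 := amplitudeDeath_of_tendsto (O.tendsto_zero hκ hγ0.le hreg)
      rw [tendsto_nhds_unique h1 d1.1, tendsto_nhds_unique h2 d1.2]
      exact d2
    · refine absurd ?_ (not_tendsto_stokesN hκ hγ h hα hz h0 (ρ₁ ^ 2 + ρ₂ ^ 2))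
      exact ((h1.pow 2).add (h2.pow 2)).congr fun t => (stokesN_eq _).symm
  · rcases le_or_gt (2 * α) κ with hα | hα
    · exact absurd (amplitudeDeath_of_tendsto ((hz.orbit hγ).tendsto_zero hκ hγ0.le
        (Or.inr (Or.inl ⟨h, hα⟩)))).1 hA.1
    · obtain ⟨c, c', hc, hc', hb⟩ := exists_lower_bound_of_lt hκ h hα
      refine active_of_bound (m := min (c * stokesN (w 0)) c') (by positivity)
        ((eventually_ge_atTop 0).mono fun t ht => hb _ _ _ _ O t ht)
        ((eventually_ge_atTop 0).mono fun t ht => ?_)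
      have h1 := (hDw t ht).trans (mul_le_mul_of_nonneg_right (min_le_left _ _) (sq_nonneg _))
      refine abs_le_of_sq_le_sq ?_ (by linarith [O.nonneg t])
      linarith

end Detuned

/-! ### Equal detuning and coupling, below `2α` -/

/-- Lower bound for the energy when the detuning equals the coupling and `κ < 2α`. -/
theorem exists_lower_bound_of_eq {α κ γ : ℝ} (hκ : 0 < κ) (h : γ = κ) (hα : κ < 2 * α) :
    ∃ c c' : ℝ, 0 < c ∧ 0 < c' ∧ ∀ N D u v : ℝ → ℝ, Orbit α κ γ N D u v → ∀ t, 0 ≤ t →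
      min (c * N 0) c' ≤ N t := by
  have hμ : 0 < 2 * α - κ := by linarith
  set μ := 2 * α - κ with hμd
  -- The form `Q = P + r²N` is monitored, because `P` alone vanishes at the locked phase. From
  -- `r|2u| ≤ Q` and this choice of `r`, the coupling term `2κr²u` costs at most half of the growth
  -- rate `μ`. The threshold on `Q` forces `N(3 + 2r²) ≤ μ/2`, which controls all other losses.
  set r := μ / (2 * κ) with hr
  have hr0 : 0 < r := by positivity
  have hκr : κ * r = μ / 2 := by rw [hr]; field_simp
  refine ⟨r ^ 2 / (2 + r ^ 2), r ^ 2 * (μ / 2 / (3 + 2 * r ^ 2)) / (2 + r ^ 2), by positivity,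
    by positivity, fun N D u v O t ht => ?_⟩
  have hb : γ = κ * 1 := by rw [h, mul_one]
  have hab : (0 : ℝ) ^ 2 + 1 ^ 2 = 1 := by norm_num
  have hle : ∀ s, r ^ 2 * N s ≤ N s + 2 * 0 * u s - 2 * 1 * v s + r ^ 2 * N s := fun s => by
    linarith [O.P_nonneg hab s]
  have h1 : min (r ^ 2 * N 0) (r ^ 2 * (μ / 2 / (3 + 2 * r ^ 2)))
      ≤ N t + 2 * 0 * u t - 2 * 1 * v t + r ^ 2 * N t := by
    refine ((O.hP hab hb).add (O.hN.const_mul (r ^ 2))).ge_barrier ((min_le_left _ _).trans (hle 0))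
      (fun s hs h2 => ?_) ht
    have h3 := h2.trans_le (min_le_right _ _)
    have hP := O.P_nonneg hab s
    have hN := O.nonneg s
    have hu := O.u_sq_le s
    have hD := O.D_sq_le_P hab s
    have hle := hle s
    set P := N s + 2 * 0 * u s - 2 * 1 * v s with hPd
    have hu' : 4 * u s ^ 2 ≤ 2 * N s * P := by
      have e : N s - 2 * v s = P := by rw [hPd]; ring
      rwa [e] at hu
    have h4 : N s ≤ μ / 2 / (3 + 2 * r ^ 2) := by
      have : r ^ 2 * N s ≤ r ^ 2 * (μ / 2 / (3 + 2 * r ^ 2)) := by linarith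
      exact le_of_mul_le_mul_left this (by positivity)
    rw [le_div_iff₀ (by positivity)] at h4
    set Q := P + r ^ 2 * N s with hQ
    have hQ0 : 0 ≤ Q := by positivity
    have h5 : -Q ≤ r * (2 * u s) := by
      refine neg_le_of_neg_le ((neg_le_abs _).trans (abs_le_of_sq_le_sq ?_ hQ0))
      have : r ^ 2 * (4 * u s ^ 2) ≤ r ^ 2 * (2 * N s * P) := by gcongr
      nlinarith [sq_nonneg (P - r ^ 2 * N s), mul_nonneg (mul_nonneg (sq_nonneg r) hN) hP]
    have h6 : -(μ / 2) * Q ≤ r ^ 2 * (2 * κ * u s) := by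
      have := mul_le_mul_of_nonneg_left h5 (mul_pos hκ hr0).le
      rw [hκr] at this
      have e : r ^ 2 * (2 * κ * u s) = κ * r * (r * (2 * u s)) := by ring
      rw [e, hκr]
      linarith
    have h7 : D s ^ 2 ≤ 2 * N s * Q := by
      have : 2 * N s * P ≤ 2 * N s * Q := by gcongr; rw [hQ]; nlinarith [sq_nonneg r]
      linarith
    have h8 : (1 + r ^ 2) * D s ^ 2 ≤ (1 + r ^ 2) * (2 * N s * Q) := by gcongr
    have h9 : 0 ≤ Q * (μ / 2 - N s * (3 + 2 * r ^ 2)) := mul_nonneg hQ0 (by linarith)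
    have e : (μ + κ * 0 - N s) * P - D s ^ 2 + r ^ 2 * (μ * N s - N s ^ 2 - D s ^ 2 + 2 * κ * u s)
        = (μ - N s) * Q - (1 + r ^ 2) * D s ^ 2 + r ^ 2 * (2 * κ * u s) := by rw [hQ]; ring
    rw [e]
    nlinarith
  have h2 : N t + 2 * 0 * u t - 2 * 1 * v t + r ^ 2 * N t ≤ N t * (2 + r ^ 2) := by
    nlinarith [O.neg_v_le t]
  have e : r ^ 2 / (2 + r ^ 2) * N 0 = r ^ 2 * N 0 / (2 + r ^ 2) := by ring
  rw [e, min_div_div_right (by positivity), div_le_iff₀ (by positivity)]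
  exact h1.trans h2

namespace Orbit

variable {α κ γ : ℝ} {N D u v : ℝ → ℝ} (O : Orbit α κ γ N D u v)
include O

/-- At `γ = κ` the form `W = κP` is no longer definite, and `Q = P + r²N` replaces it. The price is
the term `2κr²u`, which is small compared with `NQ` when `r` is small relative to the lower bound
`n` for `N`. -/
theorem Q_estimates {r n m : ℝ} (hr : 0 < r) (hκ : 0 < κ) (hκr : κ * r ≤ n / 4)
    {s : ℝ} (hn : n ≤ N s) (hm : 0 ≤ m) (hm1 : (1 + r ^ 2) * (2 + r ^ 2) * m ≤ 1 / 4) :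
    0 ≤ N s - 2 * v s + r ^ 2 * N s ∧
    -(r ^ 2 * (2 * κ * u s)) ≤ N s / 4 * (N s - 2 * v s + r ^ 2 * N s) ∧
    (1 + r ^ 2) * m * (N s - 2 * v s + r ^ 2 * N s) ≤ N s / 4 := by
  have hN := O.nonneg s
  have hP : 0 ≤ N s - 2 * v s := by linarith [O.v_le s]
  have hu := O.u_sq_le s
  have hQN : N s - 2 * v s + r ^ 2 * N s ≤ (2 + r ^ 2) * N s := by nlinarith [O.neg_v_le s]
  set P := N s - 2 * v s
  set Q := P + r ^ 2 * N s with hQ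
  have hQ0 : 0 ≤ Q := by positivity
  refine ⟨hQ0, ?_, ?_⟩
  · have h5 : -(r * (2 * u s)) ≤ Q := by
      refine (neg_le_abs _).trans (abs_le_of_sq_le_sq ?_ hQ0)
      have : r ^ 2 * (4 * u s ^ 2) ≤ r ^ 2 * (2 * N s * P) := by gcongr
      nlinarith [sq_nonneg (P - r ^ 2 * N s), mul_nonneg (mul_nonneg (sq_nonneg r) hN) hP]
    have e : -(r ^ 2 * (2 * κ * u s)) = κ * r * (-(r * (2 * u s))) := by ring
    rw [e]
    calc _ ≤ κ * r * Q := by gcongr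
      _ ≤ N s / 4 * Q := by gcongr; linarith
  · calc (1 + r ^ 2) * m * Q ≤ (1 + r ^ 2) * m * ((2 + r ^ 2) * N s) := by gcongr
      _ = (1 + r ^ 2) * (2 + r ^ 2) * m * N s := by ring
      _ ≤ 1 / 4 * N s := by gcongr
      _ = _ := by ring

theorem hQ (h : γ = κ) (r : ℝ) : DerivOn (fun t => N t - 2 * v t + r ^ 2 * N t)
    (fun t => (2 * α - κ - N t) * (N t - 2 * v t + r ^ 2 * N t) - (1 + r ^ 2) * D t ^ 2
      + r ^ 2 * (2 * κ * u t)) (Ici 0) :=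
  ((O.hN.sub (O.hv.const_mul 2)).add (O.hN.const_mul (r ^ 2))).congr fun t _ => by
    rw [h]; ring

/-- The counterpart of `D_sq_le_W` for the form `Q`: by `Q_estimates` the terms with `D²` and with
`u` are absorbed by the difference of the dampings of `D` and `Q`. -/
theorem D_sq_le_Q {r n m : ℝ} (hr : 0 < r) (hκ : 0 < κ) (h : γ = κ) (hκr : κ * r ≤ n / 4)
    (hn : ∀ t, 0 ≤ t → n ≤ N t) (hm : 0 ≤ m) (hm1 : (1 + r ^ 2) * (2 + r ^ 2) * m ≤ 1 / 4)
    (h0 : D 0 ^ 2 ≤ m * (N 0 - 2 * v 0 + r ^ 2 * N 0) ^ 2) {t : ℝ} (ht : 0 ≤ t) :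
    D t ^ 2 ≤ m * (N t - 2 * v t + r ^ 2 * N t) ^ 2 := by
  have := (O.hD.sq.sub ((O.hQ h r).sq.const_mul m)).nonpos_of_le_mul (c := 2 * |2 * α - κ|)
    (fun s hs hp => ?_) (by linarith) ht
  · linarith
  · obtain ⟨hQ0, h1, h2⟩ := O.Q_estimates hr hκ hκr (hn s hs) hm hm1
    have hN := O.nonneg s
    set Q := N s - 2 * v s + r ^ 2 * N s
    have h3 := mul_le_mul_of_nonneg_right h2 (sq_nonneg (D s))
    have h4 : m * Q * -(r ^ 2 * (2 * κ * u s)) ≤ m * Q * (N s / 4 * Q) :=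
      mul_le_mul_of_nonneg_left h1 (by positivity)
    have h6 := mul_le_mul_of_nonneg_right (le_abs_self (2 * α - κ)) hp.le
    have h7 := mul_nonneg hN hp.le
    have h8 := mul_nonneg hN (sq_nonneg (D s))
    nlinarith

theorem D_decay_of_Q {r n m : ℝ} (hr : 0 < r) (hκ : 0 < κ) (h : γ = κ) (hκr : κ * r ≤ n / 4)
    (hn0 : 0 < n) (hn : ∀ t, 0 ≤ t → n ≤ N t) (hm : 0 ≤ m)
    (hm1 : (1 + r ^ 2) * (2 + r ^ 2) * m ≤ 1 / 4)
    (h0 : D 0 ^ 2 ≤ m * (N 0 - 2 * v 0 + r ^ 2 * N 0) ^ 2) {t : ℝ} (ht : 0 ≤ t) :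
    D t ^ 2 ≤ m * (2 + r ^ 2) ^ 2 * Real.exp (-n * t) * N t ^ 2 := by
  have hQp : ∀ s, 0 ≤ s → 0 < N s - 2 * v s + r ^ 2 * N s := fun s hs => by
    have h1 : 0 < r ^ 2 * N s := mul_pos (by positivity) (hn0.trans_le (hn s hs))
    linarith [O.v_le s]
  have key := (O.hD.sq.div (O.hQ h r).sq (fun s hs => (pow_pos (hQp s hs) 2).ne')).le_mul_exp
    (c := -n) (fun s hs => ?_) ht
  · rw [sub_zero, div_le_iff₀ (pow_pos (hQp t ht) 2)] at key
    refine key.trans ?_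
    have h0' : D 0 ^ 2 / (N 0 - 2 * v 0 + r ^ 2 * N 0) ^ 2 ≤ m := by
      rwa [div_le_iff₀ (pow_pos (hQp 0 le_rfl) 2)]
    have h1 : N t - 2 * v t + r ^ 2 * N t ≤ (2 + r ^ 2) * N t := by nlinarith [O.neg_v_le t]
    have h2 := (hQp t ht).le
    calc _ ≤ m * Real.exp (-n * t) * ((2 + r ^ 2) * N t) ^ 2 := by gcongr
      _ = _ := by ring
  · obtain ⟨hQ0, h1, h2⟩ := O.Q_estimates hr hκ hκr (hn s hs) hm hm1
    have hd := O.D_sq_le_Q hr hκ h hκr hn hm hm1 h0 hs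
    have hq := hQp s hs
    have hns := hn s hs
    set Q := N s - 2 * v s + r ^ 2 * N s
    rw [div_le_iff₀ (by positivity)]
    have e : -n * (D s ^ 2 / Q ^ 2) * (Q ^ 2) ^ 2 = -n * D s ^ 2 * Q ^ 2 := by field_simp
    rw [e]
    have h3 : (1 + r ^ 2) * D s ^ 2 ≤ N s / 4 * Q := by
      calc (1 + r ^ 2) * D s ^ 2 ≤ (1 + r ^ 2) * (m * Q ^ 2) := by gcongr
        _ = (1 + r ^ 2) * m * Q * Q := by ring
        _ ≤ _ := by gcongr
    have h6 : 0 ≤ 2 * D s ^ 2 * Q * (N s / 2 * Q - ((1 + r ^ 2) * D s ^ 2 - r ^ 2 * (2 * κ * u s))) :=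
      mul_nonneg (by positivity) (by linarith)
    have h7 : 0 ≤ D s ^ 2 * Q ^ 2 * (N s - n) := mul_nonneg (by positivity) (by linarith)
    nlinarith

/-- For equal detuning and coupling, an orbit staying away from `0` along which the amplitudes
become exponentially close locks its phase. -/
theorem lock_of_D_decay (hκ : 0 < κ) (h : γ = κ) {n C : ℝ} (hn0 : 0 < n) (hC : 0 ≤ C)
    (hn : ∀ t, 0 ≤ t → n ≤ N t)
    (hD : ∀ t, 0 ≤ t → D t ^ 2 ≤ C * Real.exp (-n * t) * N t ^ 2) :
    Tendsto (fun t => 2 * u t / N t) atTop (𝓝 0) ∧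
      Tendsto (fun t => 2 * v t / N t) atTop (𝓝 1) := by
  have hab : (0 : ℝ) ^ 2 + 1 ^ 2 = 1 := by norm_num
  have hb : γ = κ * 1 := by rw [h, mul_one]
  by_cases hu : ∃ T, 0 ≤ T ∧ 0 < u T
  · obtain ⟨T, hT, hu⟩ := hu
    obtain ⟨e, he, hl⟩ := uniform_lock hκ hab hb le_rfl zero_le_one
    refine tendsto_of_sq_add_sq ((eventually_gt_atTop T).mono fun t ht => ?_)
      (he.comp (tendsto_atTop_add_const_right _ (-T) tendsto_id))
    have := hl _ _ _ _ _ (O.shift hT) (by simpa using hu) (t - T) (by linarith)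
    simpa [sub_eq_add_neg] using this
  push Not at hu
  have hNp : ∀ t, 0 ≤ t → 0 < N t := fun t ht => hn0.trans_le (hn t ht)
  obtain ⟨M, hM, hMN⟩ := O.exists_bound hκ
  set L : ℝ → ℝ := fun t => (N t - 2 * v t) / N t with hL
  have hL0 : ∀ t, 0 ≤ t → 0 ≤ L t := fun t ht =>
    div_nonneg (by linarith [O.v_le t]) (hNp t ht).le
  have hexp0 : Tendsto (fun t : ℝ => Real.exp (-n * t)) atTop (𝓝 0) :=
    Real.tendsto_exp_atBot.comp (tendsto_id.const_mul_atTop_of_neg (by linarith))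
  suffices hL0' : Tendsto L atTop (𝓝 0) by
    refine tendsto_of_sq_add_sq (e := fun t => 2 * L t) ((eventually_ge_atTop 0).mono fun t ht => ?_)
      (by simpa using hL0'.const_mul 2)
    refine (O.dist_sq_le hab (hNp t ht)).trans (le_of_eq ?_)
    rw [hL]
    ring
  -- The derivative of `L` is `-2κu(N - 2v)/N² - 2vD²/N²`. The first term is nonnegative as long as
  -- `u ≤ 0`, and the second is bounded by `CM exp(-nt)`. Hence `L` is monotone up to an integrable
  -- error and, unless it tends to `0`, it stays bounded below.
  have hmono : ∀ s t, 0 ≤ s → s ≤ t → L s - C * M / n * Real.exp (-n * s) ≤ L t := by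
    intro s t hs hst
    have := (((O.hN.sub (O.hv.const_mul 2)).div O.hN (fun s hs => (hNp s hs).ne')).sub
      ((DerivOn.exp_affine (-n) 0 _).const_mul (C * M / n))).monotoneOn (convex_Ici 0)
      (fun x hx => ?_) hs (hs.trans hst) hst
    · simp only [sub_zero] at this
      have h1 : 0 ≤ C * M / n * Real.exp (-n * t) := by positivity
      simp only [hL]
      linarith
    · have hx0 := hNp x hx
      have hux := hu x hx
      have h1 := hD x hx
      have h2 := hMN x hx
      have hP : 0 ≤ N x - 2 * v x := by linarith [O.v_le x]
      simp only [sub_zero]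
      have e1 : C * M / n * (Real.exp (-n * x) * -n) = -(C * M * Real.exp (-n * x)) := by
        field_simp
      rw [e1, sub_neg_eq_add, ← neg_le_iff_add_nonneg, neg_le_iff_add_nonneg', ← neg_le_iff_add_nonneg',
        le_div_iff₀ (by positivity), h]
      have h3 : C * Real.exp (-n * x) * N x ^ 2 * N x ≤ C * Real.exp (-n * x) * N x ^ 2 * M := by
        gcongr
      have h4 := mul_le_mul_of_nonneg_right h1 hx0.le
      have h5 : 0 ≤ -(2 * κ * u x * (N x - 2 * v x)) := by
        have : 0 ≤ κ * (-u x) * (N x - 2 * v x) :=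
          mul_nonneg (mul_nonneg hκ.le (by linarith)) hP
        linarith
      have h6 := mul_nonneg (sub_nonneg.2 (O.v_le x)) (sq_nonneg (D x))
      have h7 : D x ^ 2 * (2 * v x) ≤ D x ^ 2 * N x :=
        mul_le_mul_of_nonneg_left (O.v_le x) (sq_nonneg _)
      nlinarith
  rw [tendsto_order]
  refine ⟨fun a ha => (eventually_ge_atTop 0).mono fun t ht => ha.trans_le (hL0 t ht), fun a ha => ?_⟩
  by_contra hc
  have hev : ∀ᶠ t in atTop, C * M / n * Real.exp (-n * t) < a / 2 := by
    have := hexp0.const_mul (C * M / n)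
    rw [mul_zero] at this
    exact this.eventually (gt_mem_nhds (by linarith))
  obtain ⟨t₁, h1, h2, h3⟩ := ((Filter.not_eventually.1 hc).and_eventually
    (hev.and (eventually_ge_atTop 0))).exists
  have hLb : ∀ t, t₁ ≤ t → a / 2 ≤ L t := fun t ht => by
    have := hmono t₁ t h3 ht
    linarith
  have hev2 : ∀ᶠ t in atTop, C * Real.exp (-n * t) * (M / (2 * (a / 2) ^ 2)) < κ / 4 := by
    have := (hexp0.const_mul C).mul_const (M / (2 * (a / 2) ^ 2))
    rw [mul_zero, zero_mul] at this
    exact this.eventually (gt_mem_nhds (by linarith))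
  obtain ⟨t₂, ht₂⟩ := eventually_atTop.1 hev2
  set T := max t₁ t₂ with hT
  have hT0 : 0 ≤ T := h3.trans (le_max_left _ _)
  have hPb : ∀ t, T ≤ t → a / 2 * N t ≤ N t - 2 * v t := fun t ht => by
    have := hLb t ((le_max_left _ _).trans ht)
    rwa [hL, le_div_iff₀ (hNp t (hT0.trans ht))] at this
  have hPp : ∀ t, T ≤ t → 0 < N t - 2 * v t := fun t ht =>
    (mul_pos (by linarith) (hNp t (hT0.trans ht))).trans_le (hPb t ht)
  -- With `L ≥ a/2` the perturbation `D²u/(N - 2v)²` is eventually below `κ/4`, so `u/(N - 2v)`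
  -- grows with speed at least `κ/4` and becomes positive, contrary to `u ≤ 0`.
  have := (((O.hu.Ici_of_le hT0).div ((O.hN.sub (O.hv.const_mul 2)).Ici_of_le hT0)
    (fun s hs => (hPp s hs).ne')).neg).eventually_le_of_speed (M := -1) (c := κ / 4)
    (fun s hs _ => ?_) (by linarith)
  · obtain ⟨t, ht, ht0⟩ := (this.and (eventually_ge_atTop T)).exists
    have : u t / (N t - 2 * v t) ≤ 0 :=
      div_nonpos_of_nonpos_of_nonneg (hu t (hT0.trans ht0)) (hPp t ht0).le
    linarith
  · have hs0 : 0 ≤ s := hT0.trans hs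
    have hp := hPp s hs
    have hpb := hPb s hs
    have hNs := hNp s hs0
    have hd := hD s hs0
    have hk := (ht₂ s ((le_max_right _ _).trans hs)).le
    have hun := O.neg_u_le s
    rw [neg_le_neg_iff, le_div_iff₀ (by positivity), h]
    set P := N s - 2 * v s
    have h4 : (a / 2) ^ 2 * N s ^ 2 ≤ P ^ 2 := by
      rw [← mul_pow]
      have := hpb
      gcongr
    have h5 : D s ^ 2 * (N s / 2) ≤ κ / 4 * P ^ 2 := by
      calc D s ^ 2 * (N s / 2) ≤ C * Real.exp (-n * s) * N s ^ 2 * (M / 2) := by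
            have := hMN s hs0
            gcongr
        _ = C * Real.exp (-n * s) * (M / (2 * (a / 2) ^ 2)) * ((a / 2) ^ 2 * N s ^ 2) := by
            field_simp
        _ ≤ κ / 4 * P ^ 2 := by gcongr
    have h6 : -(D s ^ 2 * (N s / 2)) ≤ D s ^ 2 * u s := by
      nlinarith [mul_le_mul_of_nonneg_left hun (sq_nonneg (D s))]
    nlinarith

end Orbit

section Critical

variable {α κ ω γ : ℝ} {z : ℝ → ℂ × ℂ} {p : ℂ × ℂ}

/-- The merged equilibrium of the phase is only semistable, so solutions near it may pass it and
turn once more before locking. What survives is a lower bound for `N` and the exponential decay of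
`D/N`, and `Orbit.lock_of_D_decay` turns these into locking. -/
theorem near_lock_critical (hκ : 0 < κ) (hγ : γ = 2 * ω) (h : γ = κ) (hα : κ < 2 * α)
    (hp : p ∈ manifoldM) {η : ℝ} (hη : 0 < η) :
    NearSolutions α κ ω p (fun w =>
      (∀ t, 0 ≤ t → stokesD (w t) ^ 2 ≤ η * stokesN (w t) ^ 2) ∧
      Tendsto (fun t => 2 * stokesU (w t) / stokesN (w t)) atTop (𝓝 0) ∧
      Tendsto (fun t => 2 * stokesV (w t) / stokesN (w t)) atTop (𝓝 1)) := by
  obtain ⟨hD, hN⟩ := mem_manifoldM_iff.1 hp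
  obtain ⟨c, c', hc, hc', hb⟩ := exists_lower_bound_of_eq hκ h hα
  set n := min (c * (stokesN p / 2)) c' with hn
  have hn0 : 0 < n := by positivity
  set r := n / (4 * κ) with hr
  have hr0 : 0 < r := by positivity
  have hκr : κ * r ≤ n / 4 := by rw [hr]; field_simp; rfl
  -- The first entry is the smallness needed for an invariant cone; the second makes the cone narrow
  -- enough for `D² ≤ ηN²`.
  set m := min (1 / (4 * ((1 + r ^ 2) * (2 + r ^ 2)))) (η / (2 + r ^ 2) ^ 2) with hm
  have hm0 : 0 < m := by positivity
  have hm1 : (1 + r ^ 2) * (2 + r ^ 2) * m ≤ 1 / 4 := by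
    calc _ ≤ (1 + r ^ 2) * (2 + r ^ 2) * (1 / (4 * ((1 + r ^ 2) * (2 + r ^ 2)))) := by
          gcongr; exact min_le_left _ _
      _ = 1 / 4 := by field_simp
  have hm2 : m * (2 + r ^ 2) ^ 2 ≤ η := by
    rw [← le_div_iff₀ (by positivity)]; exact min_le_right _ _
  have h1 : ∀ᶠ q in 𝓝 p, 0 < m * (stokesN q - 2 * stokesV q + r ^ 2 * stokesN q) ^ 2
      - stokesD q ^ 2 := by
    have hc : Continuous fun q => m * (stokesN q - 2 * stokesV q + r ^ 2 * stokesN q) ^ 2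
        - stokesD q ^ 2 := by
      have := continuous_stokesN
      have := continuous_stokesD
      have := continuous_stokesV
      fun_prop
    refine hc.continuousAt.eventually (lt_mem_nhds ?_)
    have h2 : 2 * stokesV p ≤ stokesN p := by
      have := stokes_identity p
      nlinarith [sq_nonneg (stokesU p), sq_nonneg (stokesD p)]
    have : 0 < stokesN p - 2 * stokesV p + r ^ 2 * stokesN p := by
      have : 0 < r ^ 2 * stokesN p := by positivity
      linarith
    beta_reduce
    rw [hD]
    simp only [ne_eq, OfNat.ofNat_ne_zero, not_false_eq_true, zero_pow, sub_zero]
    positivity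
  have h2 : ∀ᶠ q in 𝓝 p, stokesN p / 2 < stokesN q :=
    continuous_stokesN.continuousAt.eventually (lt_mem_nhds (by linarith))
  refine ((NearSolutions.initial h1).and (NearSolutions.initial h2)).mono fun w hw hq => ?_
  have O := hw.orbit hγ
  have hnN : ∀ t, 0 ≤ t → n ≤ stokesN (w t) := fun t ht => by
    refine le_trans ?_ (hb _ _ _ _ O t ht)
    have := hq.2.le
    rw [hn]
    gcongr
  have hdec : ∀ t, 0 ≤ t → stokesD (w t) ^ 2
      ≤ m * (2 + r ^ 2) ^ 2 * Real.exp (-n * t) * stokesN (w t) ^ 2 := fun t ht =>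
    O.D_decay_of_Q hr0 hκ h hκr hn0 hnN hm0.le hm1 (by linarith [hq.1]) ht
  refine ⟨fun t ht => (hdec t ht).trans ?_, O.lock_of_D_decay hκ h hn0 (by positivity) hnN hdec⟩
  have h3 : Real.exp (-n * t) ≤ 1 := Real.exp_le_one_iff.2 (by nlinarith)
  calc _ ≤ m * (2 + r ^ 2) ^ 2 * 1 * stokesN (w t) ^ 2 := by gcongr
    _ ≤ _ := by rw [mul_one]; gcongr

theorem stability_of_critical (hκ : 0 < κ) (hγ : γ = 2 * ω) (h : γ = κ) (hα : κ < 2 * α)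
    (hz : IsSolution α κ ω z) (h0 : z 0 ∈ manifoldM) :
    RatioStableAt α κ ω (z 0) ∧ AsymptoticStateStable α κ ω z ∧ RatioAttractingAt α κ ω (z 0) :=
  ⟨ratioStableAt_of_near hκ h0 fun _ hη =>
    ⟨0, (near_lock_critical hκ hγ h hα h0 hη).mono fun _ _ hq t ht _ => hq.1 t ht⟩,
    asymptoticStateStable_of_lock hκ hγ hz h0 (by norm_num)
      ((near_lock_critical hκ hγ h hα h0 one_pos).mono fun _ _ hq => hq.2)⟩

theorem ratio_stability (hκ : 0 < κ) (hω : 0 ≤ ω) (hγ : γ = 2 * ω) (hz : IsSolution α κ ω z)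
    (h0 : z 0 ∈ manifoldM)
    (h : κ < γ ∨ (κ = γ ∧ κ < 2 * α) ∨ phaseFactor (z 0) ≠ unitAt (unstableAngle κ γ)) :
    RatioStableAt α κ ω (z 0) ∧ (γ ≤ κ ∨ κ ≤ 2 * α → RatioAttractingAt α κ ω (z 0)) ∧
      AsymptoticStateStable α κ ω z := by
  rcases lt_or_ge κ γ with hlt | hle
  · exact ⟨ratioStableAt_of_detuned hκ hγ hlt h0, fun h' =>
      ratioAttractingAt_of_detuned hκ hγ hlt (h'.resolve_left (not_le.2 hlt)) h0,
      asymptoticStateStable_of_detuned hκ hγ hlt hz h0⟩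
  have hγ0 : 0 ≤ γ := by linarith
  rcases h with h | ⟨h1, h2⟩ | h
  · exact absurd h (not_lt.2 hle)
  · obtain ⟨h3, h4, h5⟩ := stability_of_critical hκ hγ h1.symm h2 hz h0
    exact ⟨h3, fun _ => h5, h4⟩
  · obtain ⟨a, b, ha, hb, ha0, hb0, hb1, hab, hγb, -⟩ := lock_params hκ hγ0 hle
    rw [(unitAt_lockAngle hκ hγ0 hle).2, ← ha, ← hb] at h
    obtain ⟨h3, h4, h5⟩ := stability_of_lock hκ hγ hz h0 hab hγb ha0 hb0 h
    exact ⟨h3, fun _ => h5, h4⟩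

end Critical

/-! ### Lyapunov stability of the motions on the manifold: phase-locked states -/

theorem norm_sub_le_of_exp_deriv {E : Type*} [NormedAddCommGroup E] [NormedSpace ℝ E]
    {f f' : ℝ → E} {T c K : ℝ} (h : DerivOn f f' (Ici T)) (hc : 0 < c) (hK : 0 ≤ K)
    (hb : ∀ t, T ≤ t → ‖f' t‖ ≤ K * Real.exp (-c * (t - T))) {t : ℝ} (ht : T ≤ t) :
    ‖f t - f T‖ ≤ K / c := by
  have hB : ∀ x, HasDerivAt (fun s => K / c * (1 - Real.exp (-c * (s - T))))
      (K * Real.exp (-c * (x - T))) x := fun x => by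
    have h1 : HasDerivAt (fun s => Real.exp (-c * (s - T))) (Real.exp (-c * (x - T)) * (-c * 1)) x :=
      (((hasDerivAt_id x).sub_const T).const_mul (-c)).exp
    refine ((h1.const_sub 1).const_mul (K / c)).congr_deriv ?_
    field_simp
  have key := image_norm_le_of_norm_deriv_right_le_deriv_boundary (a := T) (b := t)
    (f := fun s => f s - f T) (f' := f')
    ((h.continuousOn.mono Icc_subset_Ici_self).sub continuousOn_const)
    (fun x hx => ((h x hx.1).mono (Ici_subset_Ici.2 hx.1)).sub_const _)
    (by simp) hB (fun x hx => hb x hx.1) (right_mem_Icc.2 ht)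
  refine key.trans ?_
  have := Real.exp_pos (-c * (t - T))
  exact mul_le_of_le_one_right (by positivity) (by linarith)

/-- Closeness of squares determines a complex number only up to sign. By continuity the sign chosen
at time `T` persists, because `|f - g|` cannot cross the level `r`. -/
theorem norm_sub_le_of_sq {f g : ℝ → ℂ} {T r η : ℝ} (hf : ContinuousOn f (Ici T))
    (hg : ContinuousOn g (Ici T)) (hr : 0 < r) (hrg : ∀ t, T ≤ t → r ≤ ‖g t‖)
    (hsq : ∀ t, T ≤ t → ‖f t ^ 2 - g t ^ 2‖ ≤ η) (hη : η < r ^ 2) (h0 : ‖f T - g T‖ < r) {t : ℝ}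
    (ht : T ≤ t) : ‖f t - g t‖ ≤ η / r := by
  have key : ∀ s, T ≤ s → ‖f s - g s‖ ≤ r → ‖f s - g s‖ * r ≤ η := fun s hs h1 => by
    have h2 : r ≤ ‖f s + g s‖ := by
      have e : 2 * g s = (f s + g s) - (f s - g s) := by ring
      have h3 : ‖2 * g s‖ ≤ ‖f s + g s‖ + ‖f s - g s‖ := by rw [e]; exact norm_sub_le _ _
      rw [norm_mul, Complex.norm_two] at h3
      linarith [hrg s hs]
    calc ‖f s - g s‖ * r ≤ ‖f s - g s‖ * ‖f s + g s‖ := by gcongr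
      _ = ‖f s ^ 2 - g s ^ 2‖ := by rw [← norm_mul]; congr 1; ring
      _ ≤ η := hsq s hs
  have hlt : ‖f t - g t‖ < r := by
    by_contra hc
    obtain ⟨s, hs, h1⟩ := intermediate_value_Icc ht
      ((hf.sub hg).norm.mono Icc_subset_Ici_self) ⟨h0.le, not_lt.1 hc⟩
    have := key s hs.1 h1.le
    simp only at h1
    change ‖f s - g s‖ = r at h1
    rw [h1] at this
    nlinarith
  rw [le_div_iff₀ hr]
  exact key t ht hlt.le

theorem norm_fst_sub_mul_snd_sq (a b : ℝ) (hab : a ^ 2 + b ^ 2 = 1) (w : ℂ × ℂ) :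
    ‖w.1 - ⟨a, b⟩ * w.2‖ ^ 2 = stokesN w - 2 * (a * stokesU w + b * stokesV w) := by
  rw [Complex.sq_norm, Complex.normSq_apply, stokesN, stokesU, stokesV, Complex.normSq_apply,
    Complex.normSq_apply]
  simp only [Complex.sub_re, Complex.sub_im, Complex.mul_re, Complex.mul_im]
  linear_combination (w.2.re ^ 2 + w.2.im ^ 2) * hab

/-- In the locked state `z₁ ≈ e^{iΦ}z₂` and `|z₁|² ≈ L/2`, so `z₁² ≈ e^{iΦ}e^{2iΨ}L/2`. The whole
state is thus determined by the mean phase, up to a sign. -/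
theorem norm_sq_sub_meanPhase_le {a b L η : ℝ} (hab : a ^ 2 + b ^ 2 = 1) {w : ℂ × ℂ} (hL : 0 < L)
    (hη0 : 0 ≤ η) (hη : η ≤ 1) (hN : |stokesN w - L| ≤ η)
    (he : stokesN w - 2 * (a * stokesU w + b * stokesV w) ≤ η ^ 2) :
    ‖w.1 - ⟨a, b⟩ * w.2‖ ≤ η ∧
    ‖w.1 ^ 2 - ⟨a, b⟩ * meanPhaseFactor w * (L / 2 : ℝ)‖ ≤ η * (L + 3) := by
  have h1 : ‖w.1 - ⟨a, b⟩ * w.2‖ ≤ η := by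
    refine (sq_le_sq₀ (norm_nonneg _) hη0).1 ?_
    rwa [norm_fst_sub_mul_snd_sq a b hab]
  have hc : ‖(⟨a, b⟩ : ℂ)‖ = 1 := by
    rw [← sq_eq_sq₀ (norm_nonneg _) zero_le_one, Complex.sq_norm, Complex.normSq_mk]
    linarith
  have hm : w.1 * w.2 = meanPhaseFactor w * (‖w.1‖ * ‖w.2‖ : ℝ) := by
    unfold meanPhaseFactor
    by_cases h : ((‖w.1‖ : ℂ) * (‖w.2‖ : ℂ)) = 0
    · have : w.1 * w.2 = 0 := by
        rw [mul_eq_zero, Complex.ofReal_eq_zero, Complex.ofReal_eq_zero, norm_eq_zero,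
          norm_eq_zero] at h
        exact mul_eq_zero.2 h
      rw [this, zero_div, zero_mul]
    · rw [Complex.ofReal_mul, div_mul_cancel₀ _ h]
  have hm1 : ‖meanPhaseFactor w‖ ≤ 1 := by
    unfold meanPhaseFactor
    rw [norm_div, norm_mul, norm_mul, Complex.norm_real, Complex.norm_real, norm_norm, norm_norm]
    exact div_self_le_one _
  refine ⟨h1, ?_⟩
  have e : w.1 ^ 2 - ⟨a, b⟩ * meanPhaseFactor w * (L / 2 : ℝ)
      = (w.1 - ⟨a, b⟩ * w.2) * w.1
        + ⟨a, b⟩ * meanPhaseFactor w * ((‖w.1‖ * ‖w.2‖ - L / 2 : ℝ) : ℂ) := by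
    rw [Complex.ofReal_sub]
    linear_combination ⟨a, b⟩ * hm
  rw [e]
  obtain ⟨hN1, hN2⟩ := abs_le.1 hN
  have hn := stokesN_eq w
  have h2 : ‖w.1‖ ≤ L + 2 := by
    nlinarith [sq_nonneg ‖w.2‖, norm_nonneg w.1, sq_nonneg (‖w.1‖ - 1)]
  have h3 : (‖w.1‖ - ‖w.2‖) ^ 2 ≤ η ^ 2 := by
    rw [← sq_abs]
    have : |‖w.1‖ - ‖w.2‖| ≤ η := by
      have h4 := abs_norm_sub_norm_le w.1 (⟨a, b⟩ * w.2)
      rw [norm_mul, hc, one_mul] at h4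
      exact h4.trans h1
    gcongr
  have h4 : |‖w.1‖ * ‖w.2‖ - L / 2| ≤ η := by
    rw [abs_le]
    constructor <;> nlinarith [sq_nonneg (‖w.1‖ - ‖w.2‖)]
  refine (norm_add_le _ _).trans ?_
  rw [norm_mul, norm_mul, norm_mul, hc, one_mul, Complex.norm_real, Real.norm_eq_abs]
  calc _ ≤ η * (L + 2) + 1 * η := by gcongr
    _ = _ := by ring

namespace Orbit

variable {α κ γ : ℝ} {N D u v : ℝ → ℝ} (O : Orbit α κ γ N D u v)
include O

/-- The logistic form of the equation for `N` makes `L ± η` barriers once the phase is within `ρ` of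
its limit. Then `N ≥ 3L/4` and `2α - κ ≤ L`, so `D` decays at least at the rate `L/2`. -/
theorem locked_late {a b L T η ρ : ℝ} (hκ : 0 < κ) (hab : a ^ 2 + b ^ 2 = 1) (ha : 0 ≤ a)
    (hb0 : 0 ≤ b) (hLd : L = 2 * α - κ + κ * a) (hηL : η ≤ L / 4) (hη : 0 < η) (hρ0 : 0 < ρ)
    (r2 : ρ * (κ + 4 * L) ≤ η / 2) (r3 : ρ * (4 * L) ≤ η ^ 2) (hT0 : 0 ≤ T)
    (hNp : ∀ t, T ≤ t → 0 < N t) (hq4 : -η < N T - L) (hq5 : N T - L < η)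
    (hdist : ∀ t, T ≤ t → (2 * u t / N t - a) ^ 2 + (2 * v t / N t - b) ^ 2 ≤ ρ ^ 2) :
    ∀ t, T ≤ t → |N t - L| ≤ η ∧ N t - 2 * (a * u t + b * v t) ≤ η ^ 2 ∧
      D t ^ 2 ≤ 4 * ρ * N t ^ 2 ∧ |D t| ≤ |D T| * Real.exp (-(L / 2) * (t - T)) := by
  have hL : 0 < L := by linarith
  have hX : ∀ t, T ≤ t → |2 * u t / N t - a| ≤ ρ := fun t ht =>
    abs_le_of_sq_le_sq ((le_add_of_nonneg_right (sq_nonneg _)).trans (hdist t ht)) hρ0.le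
  have hY : ∀ t, T ≤ t → |2 * v t / N t - b| ≤ ρ := fun t ht =>
    abs_le_of_sq_le_sq ((le_add_of_nonneg_left (sq_nonneg _)).trans (hdist t ht)) hρ0.le
  have hD : ∀ t, T ≤ t → D t ^ 2 ≤ 4 * ρ * N t ^ 2 := fun t ht => by
    have := O.D_sq_le_of_dist hab (hNp t ht) (hdist t ht)
    rwa [Real.sqrt_sq hρ0.le] at this
  have hNT := O.hN.Ici_of_le hT0
  have hup : ∀ t, T ≤ t → N t ≤ L + η := fun t ht => by
    refine hNT.le_barrier (by linarith) (fun s hs h1 => ?_) ht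
    rw [amplitude_eq (hNp s hs)]
    refine mul_nonpos_of_nonneg_of_nonpos (hNp s hs).le ?_
    have h2 := (abs_le.1 (hX s hs)).2
    have h3 := mul_le_mul_of_nonneg_left h2 hκ.le
    have h4 : 0 ≤ N s * (D s / N s) ^ 2 :=
      mul_nonneg (hNp s hs).le (sq_nonneg _)
    nlinarith
  have hlo : ∀ t, T ≤ t → L - η ≤ N t := fun t ht => by
    refine hNT.ge_barrier (by linarith) (fun s hs h1 => ?_) ht
    rw [amplitude_eq (hNp s hs)]
    refine mul_nonneg (hNp s hs).le ?_
    have h2 := (abs_le.1 (hX s hs)).1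
    have h3 := mul_le_mul_of_nonneg_left h2 hκ.le
    have h4 : N s * (D s / N s) ^ 2 ≤ L * (4 * ρ) := by
      have hn := hNp s hs
      have h5 := hD s hs
      rw [← div_le_iff₀ (by positivity), ← div_pow] at h5
      gcongr
      linarith
    nlinarith
  have hDT : ∀ t, T ≤ t → |D t| ≤ |D T| * Real.exp (-(L / 2) * (t - T)) :=
    fun t ht => by
    have h1 := (O.hD.sq.Ici_of_le hT0).le_mul_exp (c := -L) (fun s hs => ?_) ht
    · refine abs_le_of_sq_le_sq (h1.trans (le_of_eq ?_)) (by positivity)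
      rw [mul_pow, sq_abs, sq (Real.exp _), ← Real.exp_add]
      congr 2
      ring
    · have h2 : 2 * α - κ ≤ L := by rw [hLd]; nlinarith [mul_nonneg hκ.le ha]
      have h3 := hlo s hs
      nlinarith [mul_nonneg (sub_nonneg.2 (show 2 * (2 * α - κ - 2 * N s) ≤ -L by linarith))
        (sq_nonneg (D s))]
  intro t ht
  refine ⟨abs_le.2 ⟨by linarith [hlo t ht], by linarith [hup t ht]⟩, ?_, hD t ht, hDT t ht⟩
  · have hn := hNp t ht
    set X := 2 * u t / N t with hXd
    set Y := 2 * v t / N t with hYd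
    have e1 : X * N t = 2 * u t := div_mul_cancel₀ _ hn.ne'
    have e2 : Y * N t = 2 * v t := div_mul_cancel₀ _ hn.ne'
    have h1 := (abs_le.1 (hX t ht)).1
    have h2 := (abs_le.1 (hY t ht)).1
    have ha1 : a ≤ 1 := by nlinarith [sq_nonneg b]
    have hb1 : b ≤ 1 := by nlinarith [sq_nonneg a]
    have h3 : 1 - a * X - b * Y ≤ 2 * ρ := by nlinarith
    have h4 : N t * (1 - a * X - b * Y) ≤ N t * (2 * ρ) :=
      mul_le_mul_of_nonneg_left h3 hn.le
    have h5 : N t * (2 * ρ) ≤ 2 * L * (2 * ρ) := by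
      have := hup t ht
      gcongr
      linarith
    calc _ = N t * (1 - a * X - b * Y) := by linear_combination a * e1 + b * e2
      _ ≤ η ^ 2 := by linarith

end Orbit

section Locked

variable {α κ ω γ : ℝ} {z : ℝ → ℂ × ℂ}

/-- The speed of the mean phase is at most `4κ|D|/N`, and this is integrable because `D` decays
exponentially. -/
theorem meanPhase_late (hκ : 0 < κ) (hw : IsSolution α κ ω z) {L T η ρ : ℝ} (hL : 0 < L)
    (hηL : η ≤ L / 4) (hρ0 : 0 < ρ) (r1 : ρ ≤ 1 / 16) (r4 : 64 * κ * √ρ ≤ η * L) (hT0 : 0 ≤ T)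
    (h : ∀ t, T ≤ t → |stokesN (z t) - L| ≤ η ∧ stokesD (z t) ^ 2 ≤ 4 * ρ * stokesN (z t) ^ 2 ∧
      |stokesD (z t)| ≤ |stokesD (z T)| * Real.exp (-(L / 2) * (t - T))) {t : ℝ} (ht : T ≤ t) :
    ‖meanPhaseFactor (z t) - meanPhaseFactor (z T)‖ ≤ η := by
  have hup : ∀ t, T ≤ t → stokesN (z t) ≤ L + η := fun t ht => by
    linarith [(abs_le.1 (h t ht).1).2]
  have hlo : ∀ t, T ≤ t → L - η ≤ stokesN (z t) := fun t ht => by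
    linarith [(abs_le.1 (h t ht).1).1]
  have hNp : ∀ t, T ≤ t → 0 < stokesN (z t) := fun t ht => by linarith [hlo t ht]
  have hD := fun t ht => (h t ht).2.1
  have hDT := fun t ht => (h t ht).2.2
  have hm : ∀ s ∈ Ici T, ∃ m : ℂ, HasDerivWithinAt (fun s => meanPhaseFactor (z s)) m (Ici T) s ∧
      ‖m‖ ≤ 32 * κ * √ρ * Real.exp (-(L / 2) * (s - T)) := fun s hs => by
    have hs' : T ≤ s := hs
    have hn := hNp s hs'
    have h1 : |stokesD (z s)| ≤ stokesN (z s) / 2 := by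
      refine abs_le_of_sq_le_sq ?_ (by linarith)
      nlinarith [hD s hs', mul_le_mul_of_nonneg_right r1 (sq_nonneg (stokesN (z s)))]
    obtain ⟨m, hm, hmb⟩ := meanPhase_deriv hκ hw (hT0.trans hs') hn h1
    refine ⟨m, hm.mono (Ici_subset_Ici.2 hT0), hmb.trans ?_⟩
    have h2 : |stokesD (z T)| ≤ 4 * L * √ρ := by
      have h3 : |stokesD (z T)| ≤ 2 * √ρ * stokesN (z T) := by
        refine abs_le_of_sq_le_sq ((hD T le_rfl).trans (le_of_eq ?_)) (by have := hNp T le_rfl; positivity)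
        rw [mul_pow, mul_pow, Real.sq_sqrt hρ0.le]; ring
      have h4 := hup T le_rfl
      have h5 : 2 * √ρ * stokesN (z T) ≤ 2 * √ρ * (2 * L) := by gcongr; linarith
      linarith
    have h3 : |stokesD (z s)| / stokesN (z s) ≤ 8 * √ρ * Real.exp (-(L / 2) * (s - T)) := by
      rw [div_le_iff₀ hn]
      have h4 : L / 2 ≤ stokesN (z s) := by linarith [hlo s hs']
      calc _ ≤ 4 * L * √ρ * Real.exp (-(L / 2) * (s - T)) := (hDT s hs').trans (by gcongr)
        _ = 8 * √ρ * Real.exp (-(L / 2) * (s - T)) * (L / 2) := by ring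
        _ ≤ _ := by gcongr
    calc _ ≤ 4 * κ * (8 * √ρ * Real.exp (-(L / 2) * (s - T))) := by gcongr
      _ = _ := by ring
  choose! m hm hmb using hm
  have := norm_sub_le_of_exp_deriv (f := fun s => meanPhaseFactor (z s)) (f' := m) hm
    (by positivity) (by positivity) hmb ht
  refine this.trans ?_
  rw [div_le_iff₀ (by positivity)]
  linarith

/-- Uniform estimates for all solutions close to an active phase-locked one, at late times. -/
theorem near_locked_late (hκ : 0 < κ) (hγ : γ = 2 * ω) (hz : IsSolution α κ ω z)
    (h0 : z 0 ∈ manifoldM) {a b : ℝ} (hab : a ^ 2 + b ^ 2 = 1) (hb : γ = κ * b) (ha : 0 ≤ a)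
    (hb0 : 0 ≤ b) (hne : phaseFactor (z 0) ≠ ⟨-a, b⟩) (hL : 0 < 2 * α - κ + κ * a) {η : ℝ}
    (hη : 0 < η) :
    ∃ T, 0 ≤ T ∧ NearSolutions α κ ω (z 0) (fun w => ∀ t, T ≤ t →
      |stokesN (w t) - (2 * α - κ + κ * a)| ≤ η ∧
      stokesN (w t) - 2 * (a * stokesU (w t) + b * stokesV (w t)) ≤ η ^ 2 ∧
      ‖meanPhaseFactor (w t) - meanPhaseFactor (w T)‖ ≤ η) := by
  set L := 2 * α - κ + κ * a with hLd
  wlog hηL : η ≤ L / 4 generalizing η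
  · obtain ⟨T, hT, hnear⟩ := this (η := L / 4) (by positivity) le_rfl
    refine ⟨T, hT, hnear.mono fun w _ hw t ht => ?_⟩
    obtain ⟨h1, h2, h3⟩ := hw t ht
    push Not at hηL
    exact ⟨h1.trans hηL.le, h2.trans (by gcongr), h3.trans hηL.le⟩
  obtain ⟨T₀, hT₀, e, he, hnear⟩ := near_lock hκ hγ hz h0 hab hb ha hb0 hne
  obtain ⟨hD0, hN0⟩ := mem_manifoldM_iff.1 h0
  have O := hz.orbit hγ
  have hNz : Tendsto (fun t => stokesN (z t)) atTop (𝓝 L) := by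
    have h1 := (manifold_lock hκ hγ hz h0 hab hb ha hb0 (fun _ => hne)).1
    have h2 := O.tendsto_amplitude hκ hN0 h1 (tendsto_const_nhds.congr'
      ((eventually_ge_atTop 0).mono fun t ht => by beta_reduce; rw [O.D_eq_zero hκ hD0 ht, zero_div]))
    rwa [max_eq_left hL.le] at h2
  -- The four entries serve, in this order, `|D| ≤ N/2`, the barriers `L ± η` for `N`, the distance
  -- `η` from the locked line `z₁ = (a + ib)z₂`, and the bound `η` for the drift of the mean phase.
  set ρ := min (min (1 / 16) (η / (2 * (κ + 4 * L)))) (min (η ^ 2 / (4 * L)) ((η * L / (64 * κ)) ^ 2))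
    with hρ
  have hρ0 : 0 < ρ := by positivity
  have r1 : ρ ≤ 1 / 16 := (min_le_left _ _).trans (min_le_left _ _)
  have r2 : ρ * (κ + 4 * L) ≤ η / 2 := by
    have : ρ ≤ η / (2 * (κ + 4 * L)) := (min_le_left _ _).trans (min_le_right _ _)
    rw [le_div_iff₀ (by positivity)] at this
    linarith
  have r3 : ρ * (4 * L) ≤ η ^ 2 := by
    rw [← le_div_iff₀ (by positivity)]
    exact (min_le_right _ _).trans (min_le_left _ _)
  have r4 : 64 * κ * √ρ ≤ η * L := by
    have : √ρ ≤ η * L / (64 * κ) :=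
      Real.sqrt_le_iff.2 ⟨by positivity, (min_le_right _ _).trans (min_le_right _ _)⟩
    rw [le_div_iff₀ (by positivity)] at this
    linarith
  obtain ⟨T₁, hT₁⟩ := eventually_atTop.1 (he.eventually (gt_mem_nhds (pow_pos hρ0 2)))
  obtain ⟨T, hTN, hTT₀, hTT₁⟩ := ((hNz.eventually (Metric.ball_mem_nhds L hη)).and
    ((eventually_gt_atTop T₀).and (eventually_ge_atTop T₁))).exists
  have hT0 : 0 ≤ T := hT₀.trans hTT₀.le
  refine ⟨T, hT0, ((hnear.and (NearSolutions.pos h0)).and (NearSolutions.at_time hκ hz hT0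
    (continuous_stokesN.continuousAt.eventually (Metric.isOpen_ball.mem_nhds hTN)))).mono
    fun w hw hq => ?_⟩
  obtain ⟨⟨hq1, hq2⟩, hq3⟩ := hq
  rw [Real.dist_eq] at hq3
  obtain ⟨hq4, hq5⟩ := abs_lt.1 hq3
  have Ow := hw.orbit hγ
  have hNp : ∀ t, T ≤ t → 0 < stokesN (w t) := fun t ht => Ow.N_pos hκ hq2 (hT0.trans ht)
  have hdist : ∀ t, T ≤ t → (2 * stokesU (w t) / stokesN (w t) - a) ^ 2
      + (2 * stokesV (w t) / stokesN (w t) - b) ^ 2 ≤ ρ ^ 2 := fun t ht =>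
    (hq1 t (hTT₀.trans_le ht)).trans (hT₁ t (hTT₁.trans ht)).le
  have h1 := Ow.locked_late hκ hab ha hb0 hLd hηL hη hρ0 r2 r3 hT0 hNp hq4 hq5 hdist
  exact fun t ht => ⟨(h1 t ht).1, (h1 t ht).2.1, meanPhase_late hκ hw hL hηL hρ0 r1 r4 hT0
    (fun s hs => ⟨(h1 s hs).1, (h1 s hs).2.2⟩) ht⟩

theorem continuousOn_solution (hz : IsSolution α κ ω z) : ContinuousOn z (Ici 0) :=
  fun t ht => (hz t ht).continuousWithinAt

theorem continuousAt_meanPhaseFactor {p : ℂ × ℂ} (hp : p ∈ manifoldM) :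
    ContinuousAt meanPhaseFactor p := by
  obtain ⟨hD, hN⟩ := mem_manifoldM_iff.1 hp
  have h1 : ‖p.1‖ ^ 2 = stokesN p / 2 := by rw [norm_sq_fst, hD, add_zero]
  have h2 : ‖p.2‖ ^ 2 = stokesN p / 2 := by rw [norm_sq_snd, hD, sub_zero]
  have h3 : ‖p.1‖ ≠ 0 := fun h => by rw [h] at h1; norm_num at h1; linarith
  have h4 : ‖p.2‖ ≠ 0 := fun h => by rw [h] at h2; norm_num at h2; linarith
  unfold meanPhaseFactor
  refine ContinuousAt.div (by fun_prop) (by fun_prop) ?_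
  exact mul_ne_zero (Complex.ofReal_ne_zero.2 h3) (Complex.ofReal_ne_zero.2 h4)

theorem lyapunovStable_of_lock (hκ : 0 < κ) (hγ : γ = 2 * ω) (hz : IsSolution α κ ω z)
    (h0 : z 0 ∈ manifoldM) {a b : ℝ} (hab : a ^ 2 + b ^ 2 = 1) (hb : γ = κ * b) (ha : 0 ≤ a)
    (hb0 : 0 ≤ b) (hne : phaseFactor (z 0) ≠ ⟨-a, b⟩) (hL : 0 < 2 * α - κ + κ * a) :
    LyapunovStable α κ ω z := by
  intro ε hε
  set L := 2 * α - κ + κ * a with hLd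
  set r := √(L / 4) with hr
  have hr0 : 0 < r := Real.sqrt_pos.2 (by positivity)
  have hr2 : r ^ 2 = L / 4 := Real.sq_sqrt (by positivity)
  -- The squares of the first components differ by at most `2η(L + 3)` from the two approximations
  -- plus `3ηL/2` from the mean phases, and `K` exceeds the sum of these factors.
  set K := 4 * L + 7 with hK
  have hK0 : 0 < K := by positivity
  set η := min (min 1 (L / 2)) (min (r ^ 2 / (2 * K)) (ε / (2 * (K / r + 2)))) with hη
  have hη0 : 0 < η := by positivity
  have g1 : η ≤ 1 := (min_le_left _ _).trans (min_le_left _ _)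
  have g2 : η ≤ L / 2 := (min_le_left _ _).trans (min_le_right _ _)
  have g3 : η * K < r ^ 2 := by
    have : η ≤ r ^ 2 / (2 * K) := (min_le_right _ _).trans (min_le_left _ _)
    rw [le_div_iff₀ (by positivity)] at this
    nlinarith [pow_pos hr0 2]
  have g4 : η * (K / r + 2) < ε := by
    have : η ≤ ε / (2 * (K / r + 2)) := (min_le_right _ _).trans (min_le_right _ _)
    rw [le_div_iff₀ (by positivity)] at this
    linarith
  obtain ⟨T, hT, hnear⟩ := near_locked_late hκ hγ hz h0 hab hb ha hb0 hne hL hη0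
  have hzM : ∀ t, 0 ≤ t → z t ∈ manifoldM := fun t ht => mem_manifoldM_of_solution hz h0 ht
  have c1 := NearSolutions.at_time hκ hz hT ((continuousAt_meanPhaseFactor (hzM T hT)).eventually
    (Metric.ball_mem_nhds _ hη0))
  have c2 := NearSolutions.at_time hκ hz hT (Metric.ball_mem_nhds (z T) hr0)
  obtain ⟨δ₁, hδ₁, hb1⟩ := ((hnear.and c1).and c2).exists_ball
  obtain ⟨δ₂, hδ₂, hb2⟩ := continuous_dependence hκ hz T hε
  refine ⟨min δ₁ δ₂, by positivity, fun w hw hd t ht => ?_⟩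
  rcases le_or_gt t T with htT | htT
  · exact hb2 w hw (hd.trans_le (min_le_right _ _)) t ht htT
  have hw1 := hb1 w hw (hd.trans_le (min_le_left _ _))
  have hz1 := (hb1 z hz (by simpa using hδ₁)).1.1
  obtain ⟨⟨hw1, hw2⟩, hw3⟩ := hw1
  have hc : ‖(⟨a, b⟩ : ℂ)‖ = 1 := by
    rw [← sq_eq_sq₀ (norm_nonneg _) zero_le_one, Complex.sq_norm, Complex.normSq_mk]
    linarith
  have hsq : ∀ s, T ≤ s → ‖(w s).1 ^ 2 - (z s).1 ^ 2‖ ≤ η * K := fun s hs => by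
    obtain ⟨a1, a2, a3⟩ := hw1 s hs
    obtain ⟨b1, b2, b3⟩ := hz1 s hs
    have d1 := (norm_sq_sub_meanPhase_le hab hL hη0.le g1 a1 a2).2
    have d2 := (norm_sq_sub_meanPhase_le hab hL hη0.le g1 b1 b2).2
    have d3 : ‖meanPhaseFactor (w s) - meanPhaseFactor (z s)‖ ≤ 3 * η := by
      have e : meanPhaseFactor (w s) - meanPhaseFactor (z s)
          = (meanPhaseFactor (w s) - meanPhaseFactor (w T))
            + (meanPhaseFactor (w T) - meanPhaseFactor (z T))
            - (meanPhaseFactor (z s) - meanPhaseFactor (z T)) := by ring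
      rw [dist_eq_norm] at hw2
      rw [e]
      exact (norm_sub_le _ _).trans ((add_le_add_left (norm_add_le _ _) _).trans (by linarith))
    have e : (w s).1 ^ 2 - (z s).1 ^ 2
        = ((w s).1 ^ 2 - ⟨a, b⟩ * meanPhaseFactor (w s) * (L / 2 : ℝ))
          - ((z s).1 ^ 2 - ⟨a, b⟩ * meanPhaseFactor (z s) * (L / 2 : ℝ))
          + ⟨a, b⟩ * (meanPhaseFactor (w s) - meanPhaseFactor (z s)) * (L / 2 : ℝ) := by ring
    rw [e]
    refine (norm_add_le _ _).trans ((add_le_add_left (norm_sub_le _ _) _).trans ?_)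
    rw [norm_mul, norm_mul, hc, one_mul, Complex.norm_real, Real.norm_eq_abs, abs_of_pos (by positivity)]
    have := mul_le_mul_of_nonneg_right d3 (by positivity : 0 ≤ L / 2)
    rw [hK]
    nlinarith
  have hzr : ∀ s, T ≤ s → r ≤ ‖(z s).1‖ := fun s hs => by
    have h1 := (mem_manifoldM_iff.1 (hzM s (hT.trans hs))).1
    have h2 := norm_sq_fst (z s)
    have h3 := (abs_le.1 (hz1 s hs).1).1
    refine (sq_le_sq₀ hr0.le (norm_nonneg _)).1 ?_
    rw [hr2, h2, h1]
    linarith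
  have hcw := (continuousOn_solution hw).mono (Ici_subset_Ici.2 hT)
  have hcz := (continuousOn_solution hz).mono (Ici_subset_Ici.2 hT)
  have hT3 : ‖(w T).1 - (z T).1‖ < r := by
    rw [Prod.dist_eq, max_lt_iff, dist_eq_norm] at hw3
    exact hw3.1
  have f1 := norm_sub_le_of_sq (f := fun s => (w s).1) (g := fun s => (z s).1) hcw.fst hcz.fst hr0
    hzr hsq g3 hT3 htT.le
  have a1 := (norm_sq_sub_meanPhase_le hab hL hη0.le g1 (hw1 t htT.le).1 (hw1 t htT.le).2.1).1
  have b1 := (norm_sq_sub_meanPhase_le hab hL hη0.le g1 (hz1 t htT.le).1 (hz1 t htT.le).2.1).1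
  have f2 : ‖(w t).2 - (z t).2‖ ≤ η * K / r + 2 * η := by
    have e : ⟨a, b⟩ * ((w t).2 - (z t).2) = ((w t).1 - (z t).1)
        - ((w t).1 - ⟨a, b⟩ * (w t).2) + ((z t).1 - ⟨a, b⟩ * (z t).2) := by ring
    have h1 : ‖⟨a, b⟩ * ((w t).2 - (z t).2)‖ = ‖(w t).2 - (z t).2‖ := by rw [norm_mul, hc, one_mul]
    rw [← h1, e]
    exact (norm_add_le _ _).trans ((add_le_add_left (norm_sub_le _ _) _).trans (by linarith))
  have e : η * K / r + 2 * η = η * (K / r + 2) := by ring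
  rw [Prod.dist_eq, dist_eq_norm, dist_eq_norm]
  exact max_lt (by linarith) (by linarith)

/-- Death is uniform for bounded initial data: after a common time both solutions are within `ε/3`
of the origin, and before that time continuous dependence suffices. -/
theorem lyapunovStable_of_death (hκ : 0 < κ) (hω : 0 ≤ ω) (hγ : γ = 2 * ω)
    (h : DeathRegime α κ γ) (hz : IsSolution α κ ω z) : LyapunovStable α κ ω z := by
  intro ε hε
  obtain ⟨T, hT, hd⟩ := uniform_death hκ (by linarith : 0 ≤ γ) h (stokesN (z 0) + 1)
    (η := (ε / 3) ^ 2) (by positivity)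
  obtain ⟨δ₁, hδ₁, hb1⟩ := (NearSolutions.initial (α := α) (κ := κ) (ω := ω) (p := z 0)
    (continuous_stokesN.continuousAt.eventually (gt_mem_nhds (lt_add_one (stokesN (z 0)))))).exists_ball
  obtain ⟨δ₂, hδ₂, hb2⟩ := continuous_dependence hκ hz T hε
  refine ⟨min δ₁ δ₂, by positivity, fun w hw hdist t ht => ?_⟩
  rcases le_or_gt t T with htT | htT
  · exact hb2 w hw (hdist.trans_le (min_le_right _ _)) t ht htT
  have key : ∀ x : ℂ × ℂ, stokesN x ≤ (ε / 3) ^ 2 → ‖x‖ ≤ ε / 3 := fun x hx =>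
    (norm_le_sqrt_stokesN x).trans (Real.sqrt_le_iff.2 ⟨by positivity, hx⟩)
  have h1 := key _ (hd _ _ _ _ (hw.orbit hγ) (hb1 w hw (hdist.trans_le (min_le_left _ _))).le t htT.le)
  have h2 := key _ (hd _ _ _ _ (hz.orbit hγ) (by linarith) t htT.le)
  rw [dist_eq_norm]
  exact (norm_sub_le _ _).trans_lt (by linarith)

end Locked

/-! ### The quadratic form conserved by the linear part above the locking threshold -/

/-- The symmetric bilinear form with quadratic form `γ (|z₁|² + |z₂|²) - 2 κ Im (z₁ conj z₂)`. -/
def detuningForm (κ γ : ℝ) (w z : ℂ × ℂ) : ℝ :=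
  γ * (w.1.re * z.1.re + w.1.im * z.1.im + w.2.re * z.2.re + w.2.im * z.2.im)
    - κ * (w.1.im * z.2.re - w.1.re * z.2.im + z.1.im * w.2.re - z.1.re * w.2.im)

/-- The reflection `(z₁, z₂) ↦ (z₁, -z₂)`. -/
def flipSnd (w : ℂ × ℂ) : ℂ × ℂ := (w.1, -w.2)

section Form

variable {α κ ω γ : ℝ}

theorem detuningForm_self (w : ℂ × ℂ) :
    detuningForm κ γ w w = γ * stokesN w - 2 * κ * stokesV w := by
  simp only [detuningForm, stokesN, stokesV, Complex.normSq_apply]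
  ring

theorem detuningForm_smul (a b : ℝ) (w z : ℂ × ℂ) :
    detuningForm κ γ (a • w) (b • z) = a * b * detuningForm κ γ w z := by
  simp only [detuningForm, Prod.smul_fst, Prod.smul_snd, Complex.smul_re, Complex.smul_im,
    smul_eq_mul]
  ring

theorem detuningForm_sub_self (w z : ℂ × ℂ) :
    detuningForm κ γ (w - z) (w - z)
      = detuningForm κ γ w w + detuningForm κ γ z z - 2 * detuningForm κ γ w z := by
  simp only [detuningForm, Prod.fst_sub, Prod.snd_sub, Complex.sub_re, Complex.sub_im]
  ring

theorem stokesN_smul (a : ℝ) (w : ℂ × ℂ) : stokesN (a • w) = a ^ 2 * stokesN w := by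
  simp only [stokesN, Prod.smul_fst, Prod.smul_snd, Complex.normSq_apply, Complex.smul_re,
    Complex.smul_im, smul_eq_mul]
  ring

theorem stokesN_flipSnd (w : ℂ × ℂ) : stokesN (flipSnd w) = stokesN w := by
  simp [stokesN, flipSnd]

theorem flipSnd_smul (a : ℝ) (w : ℂ × ℂ) : flipSnd (a • w) = a • flipSnd w := by
  simp [flipSnd]

theorem two_mul_stokesV_le (w : ℂ × ℂ) : |2 * stokesV w| ≤ stokesN w :=
  abs_le_of_sq_le_sq (by nlinarith [stokes_identity w, sq_nonneg (stokesD w), sq_nonneg (stokesU w)])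
    (stokesN_nonneg w)

theorem le_detuningForm_self (hκ : 0 < κ) (w : ℂ × ℂ) :
    (γ - κ) * stokesN w ≤ detuningForm κ γ w w := by
  rw [detuningForm_self]
  nlinarith [(abs_le.1 (two_mul_stokesV_le w)).2]

theorem detuningForm_self_le (hκ : 0 < κ) (w : ℂ × ℂ) :
    detuningForm κ γ w w ≤ (γ + κ) * stokesN w := by
  rw [detuningForm_self]
  nlinarith [(abs_le.1 (two_mul_stokesV_le w)).1]

theorem abs_detuningForm_le (hκ : 0 ≤ κ) (hγ : 0 ≤ γ) (w z : ℂ × ℂ) :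
    |detuningForm κ γ w z| ≤ (γ + κ) * ((stokesN w + stokesN z) / 2) := by
  have key : ∀ a b : ℝ, a * b ≤ (a ^ 2 + b ^ 2) / 2 ∧ -((a ^ 2 + b ^ 2) / 2) ≤ a * b := fun a b =>
    ⟨by nlinarith [sq_nonneg (a - b)], by nlinarith [sq_nonneg (a + b)]⟩
  have hA : |w.1.re * z.1.re + w.1.im * z.1.im + w.2.re * z.2.re + w.2.im * z.2.im|
      ≤ (stokesN w + stokesN z) / 2 := by
    simp only [stokesN, Complex.normSq_apply]
    have h1 := key w.1.re z.1.re
    have h2 := key w.1.im z.1.im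
    have h3 := key w.2.re z.2.re
    have h4 := key w.2.im z.2.im
    exact abs_le.2 ⟨by linarith [h1.2, h2.2, h3.2, h4.2], by linarith [h1.1, h2.1, h3.1, h4.1]⟩
  have hB : |w.1.im * z.2.re - w.1.re * z.2.im + z.1.im * w.2.re - z.1.re * w.2.im|
      ≤ (stokesN w + stokesN z) / 2 := by
    simp only [stokesN, Complex.normSq_apply]
    have h1 := key w.1.im z.2.re
    have h2 := key w.1.re z.2.im
    have h3 := key z.1.im w.2.re
    have h4 := key z.1.re w.2.im
    exact abs_le.2 ⟨by linarith [h1.2, h2.1, h3.2, h4.1], by linarith [h1.1, h2.2, h3.1, h4.2]⟩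
  unfold detuningForm
  refine (abs_sub _ _).trans ?_
  rw [abs_mul, abs_mul, abs_of_nonneg hκ, abs_of_nonneg hγ, add_mul]
  gcongr

/-- Bound for the form, and for the form twisted by the reflection, in terms of its diagonal. -/
theorem abs_detuningForm_le_mul (hκ : 0 < κ) (h : κ < γ) {w z : ℂ × ℂ} {S R : ℝ} (hS : 0 < S)
    (hR : 0 < R) (hw : detuningForm κ γ w w = S ^ 2) (hz : detuningForm κ γ z z = R ^ 2) :
    |detuningForm κ γ w z| ≤ (γ + κ) / (γ - κ) * (S * R) ∧
    |detuningForm κ γ (flipSnd w) z| ≤ (γ + κ) / (γ - κ) * (S * R) := by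
  have hg : 0 < γ - κ := sub_pos.2 h
  have hγ : 0 ≤ γ := by linarith
  -- Rescaling to `R • w` and `S • z` gives both vectors the same value `(SR)²` of the form, so the
  -- crude bound by the mean of the two energies becomes a Cauchy–Schwarz bound.
  have e1 : stokesN (R • w) ≤ (S * R) ^ 2 / (γ - κ) := by
    rw [le_div_iff₀ hg, mul_comm]
    refine (le_detuningForm_self hκ _).trans (le_of_eq ?_)
    rw [detuningForm_smul, hw]; ring
  have e2 : stokesN (S • z) ≤ (S * R) ^ 2 / (γ - κ) := by
    rw [le_div_iff₀ hg, mul_comm]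
    refine (le_detuningForm_self hκ _).trans (le_of_eq ?_)
    rw [detuningForm_smul, hz]; ring
  have hSR : 0 < S * R := mul_pos hS hR
  have key : ∀ x : ℝ, |R * S * x| ≤ (γ + κ) * ((S * R) ^ 2 / (γ - κ)) →
      |x| ≤ (γ + κ) / (γ - κ) * (S * R) := fun x hx => by
    rw [mul_comm R, abs_mul, abs_of_pos hSR] at hx
    refine le_of_mul_le_mul_left (hx.trans (le_of_eq ?_)) hSR
    field_simp
  constructor
  · refine key _ ?_
    rw [← detuningForm_smul]
    refine (abs_detuningForm_le hκ.le hγ _ _).trans ?_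
    exact mul_le_mul_of_nonneg_left (by linarith) (by linarith)
  · refine key _ ?_
    rw [← detuningForm_smul, ← flipSnd_smul]
    refine (abs_detuningForm_le hκ.le hγ _ _).trans ?_
    rw [stokesN_flipSnd]
    exact mul_le_mul_of_nonneg_left (by linarith) (by linarith)

theorem sq_stokes_sub_le (w z : ℂ × ℂ) :
    (stokesN w - stokesN z) ^ 2 ≤ stokesN (w - z) * (2 * (stokesN w + stokesN z)) ∧
    (stokesD w - stokesD z) ^ 2 ≤ stokesN (w - z) * (2 * (stokesN w + stokesN z)) := by
  have cs : ∀ a b c d p q r s : ℝ, (a * p + b * q + c * r + d * s) ^ 2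
      ≤ (a ^ 2 + b ^ 2 + c ^ 2 + d ^ 2)
        * (p ^ 2 + q ^ 2 + r ^ 2 + s ^ 2 + (a ^ 2 + b ^ 2 + c ^ 2 + d ^ 2)) := by
    intro a b c d p q r s
    have : (a ^ 2 + b ^ 2 + c ^ 2 + d ^ 2)
          * (p ^ 2 + q ^ 2 + r ^ 2 + s ^ 2 + (a ^ 2 + b ^ 2 + c ^ 2 + d ^ 2))
        = (a * p + b * q + c * r + d * s) ^ 2 + ((a * q - b * p) ^ 2 + (a * r - c * p) ^ 2
          + (a * s - d * p) ^ 2 + (b * r - c * q) ^ 2 + (b * s - d * q) ^ 2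
          + (c * s - d * r) ^ 2 + (a ^ 2 + b ^ 2 + c ^ 2 + d ^ 2) ^ 2) := by ring
    rw [this]
    exact le_add_of_nonneg_right (by positivity)
  simp only [stokesN, stokesD, Complex.normSq_apply, Prod.fst_sub, Prod.snd_sub, Complex.sub_re,
    Complex.sub_im]
  constructor
  · convert cs (w.1.re - z.1.re) (w.1.im - z.1.im) (w.2.re - z.2.re) (w.2.im - z.2.im)
      (w.1.re + z.1.re) (w.1.im + z.1.im) (w.2.re + z.2.re) (w.2.im + z.2.im) using 1 <;> ring
  · convert cs (w.1.re - z.1.re) (w.1.im - z.1.im) (w.2.re - z.2.re) (w.2.im - z.2.im)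
      (w.1.re + z.1.re) (w.1.im + z.1.im) (-(w.2.re + z.2.re)) (-(w.2.im + z.2.im)) using 1 <;> ring

/-- After rescaling to equal values of the form, the form of the difference is `2SR(SR - B)`, with
`B` the mixed value. So if the angle between `w` and `z` is small, the quotients of energy by form
of the two vectors are close. -/
theorem sq_stokesN_mul_sub_le (hκ : 0 < κ) (h : κ < γ) {w z : ℂ × ℂ} {S R : ℝ}
    (hw : detuningForm κ γ w w = S ^ 2) (hz : detuningForm κ γ z z = R ^ 2) :
    (stokesN w * R ^ 2 - stokesN z * S ^ 2) ^ 2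
      ≤ 8 * (S * R) ^ 3 * (S * R - detuningForm κ γ w z) / (γ - κ) ^ 2 := by
  have hg : 0 < γ - κ := sub_pos.2 h
  set x := R • w with hx
  set y := S • z with hy
  have hNx : stokesN x = R ^ 2 * stokesN w := stokesN_smul _ _
  have hNy : stokesN y = S ^ 2 * stokesN z := stokesN_smul _ _
  have hWx : detuningForm κ γ x x = (S * R) ^ 2 := by rw [hx, detuningForm_smul, hw]; ring
  have hWy : detuningForm κ γ y y = (S * R) ^ 2 := by rw [hy, detuningForm_smul, hz]; ring
  have hWxy : detuningForm κ γ x y = (S * R) * detuningForm κ γ w z := by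
    rw [hx, hy, detuningForm_smul]; ring
  have h1 := le_detuningForm_self hκ (γ := γ) x
  have h2 := le_detuningForm_self hκ (γ := γ) y
  have h3 := le_detuningForm_self hκ (γ := γ) (x - y)
  rw [detuningForm_sub_self, hWx, hWy, hWxy] at h3
  rw [hWx] at h1
  rw [hWy] at h2
  have hCS := (sq_stokes_sub_le x y).1
  have e3 : stokesN w * R ^ 2 - stokesN z * S ^ 2 = stokesN x - stokesN y := by
    rw [hNx, hNy]; ring
  rw [e3, le_div_iff₀ (by positivity)]
  have h4 : 2 * (stokesN x + stokesN y) * (γ - κ) ≤ 4 * (S * R) ^ 2 := by linarith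
  calc _ ≤ stokesN (x - y) * (2 * (stokesN x + stokesN y)) * (γ - κ) ^ 2 := by gcongr
    _ = ((γ - κ) * stokesN (x - y)) * (2 * (stokesN x + stokesN y) * (γ - κ)) := by ring
    _ ≤ ((γ - κ) * stokesN (x - y)) * (4 * (S * R) ^ 2) :=
      mul_le_mul_of_nonneg_left h4 (mul_nonneg hg.le (stokesN_nonneg _))
    _ ≤ ((S * R) ^ 2 + (S * R) ^ 2 - 2 * (S * R * detuningForm κ γ w z)) * (4 * (S * R) ^ 2) := by
      gcongr
    _ = _ := by ring

theorem normSq_eq_stokes (w : ℂ × ℂ) : Complex.normSq w.1 = (stokesN w + stokesD w) / 2 ∧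
    Complex.normSq w.2 = (stokesN w - stokesD w) / 2 := by
  unfold stokesN stokesD
  constructor <;> ring

/-- The linear part of the field is `(2α - κ)/2` plus a map that is skew for the form, so it
contributes only the scalar rate. The cubic part is `-N/2` plus `-D/2` times the reflection
`flipSnd`. -/
theorem derivOn_detuningForm (hγ : γ = 2 * ω) {w z : ℝ → ℂ × ℂ} (hw : IsSolution α κ ω w)
    (hz : IsSolution α κ ω z) :
    DerivOn (fun t => detuningForm κ γ (w t) (z t))
      (fun t => (2 * α - κ - (stokesN (w t) + stokesN (z t)) / 2) * detuningForm κ γ (w t) (z t)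
        - stokesD (w t) / 2 * detuningForm κ γ (flipSnd (w t)) (z t)
        - stokesD (z t) / 2 * detuningForm κ γ (w t) (flipSnd (z t))) (Ici 0) := by
  intro t ht
  obtain ⟨a1, a2, a3, a4⟩ := hasDerivWithinAt_coords (hw t ht)
  obtain ⟨b1, b2, b3, b4⟩ := hasDerivWithinAt_coords (hz t ht)
  have key := (((((a1.fun_mul b1).fun_add (a2.fun_mul b2)).fun_add (a3.fun_mul b3)).fun_add
    (a4.fun_mul b4)).const_mul γ).fun_sub
    (((((a2.fun_mul b3).fun_sub (a1.fun_mul b4)).fun_add (b2.fun_mul a3)).fun_sub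
      (b1.fun_mul a4)).const_mul κ)
  refine key.congr_deriv ?_
  beta_reduce
  obtain ⟨f1, f2, f3, f4⟩ := field_re_im α κ ω (w t)
  obtain ⟨g1, g2, g3, g4⟩ := field_re_im α κ ω (z t)
  rw [f1, f2, f3, f4, g1, g2, g3, g4, (normSq_eq_stokes (w t)).1, (normSq_eq_stokes (w t)).2,
    (normSq_eq_stokes (z t)).1, (normSq_eq_stokes (z t)).2, hγ]
  generalize stokesN (w t) = nw
  generalize stokesD (w t) = dw
  generalize stokesN (z t) = nz
  generalize stokesD (z t) = dz
  simp only [detuningForm, flipSnd, Complex.neg_re, Complex.neg_im]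
  ring

end Form

/-! ### Lyapunov stability of the motions on the manifold above the locking threshold -/

section Detuned

variable {α κ ω γ : ℝ} {z : ℝ → ℂ × ℂ}

/-- Derivative of the cosine of the angle, in the form `detuningForm`, between a solution on the
manifold and another solution. -/
theorem derivOn_cosine (hκ : 0 < κ) (hγ : γ = 2 * ω) (h : κ < γ) {w : ℝ → ℂ × ℂ}
    (hw : IsSolution α κ ω w) (hz : IsSolution α κ ω z) (hw0 : 0 < stokesN (w 0))
    (hz0 : z 0 ∈ manifoldM) :
    DerivOn (fun t => detuningForm κ γ (w t) (z t)
        / (√(detuningForm κ γ (w t) (w t)) * √(detuningForm κ γ (z t) (z t))))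
      (fun t => (-(stokesD (w t) / 2) * detuningForm κ γ (flipSnd (w t)) (z t)
          + detuningForm κ γ (w t) (z t) * (γ * stokesD (w t) ^ 2
            / (2 * detuningForm κ γ (w t) (w t))))
        / (√(detuningForm κ γ (w t) (w t)) * √(detuningForm κ γ (z t) (z t)))) (Ici 0) := by
  have Ow := hw.orbit hγ
  have Oz := hz.orbit hγ
  obtain ⟨hD, hN⟩ := mem_manifoldM_iff.1 hz0
  have pw : ∀ t ∈ Ici (0 : ℝ), 0 < detuningForm κ γ (w t) (w t) := fun t ht => by
    rw [detuningForm_self]; exact Ow.W_pos hκ h hw0 ht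
  have pz : ∀ t ∈ Ici (0 : ℝ), 0 < detuningForm κ γ (z t) (z t) := fun t ht => by
    rw [detuningForm_self]; exact Oz.W_pos hκ h hN ht
  have dw : DerivOn (fun t => detuningForm κ γ (w t) (w t)) (fun t => (2 * α - κ - stokesN (w t))
      * detuningForm κ γ (w t) (w t) - γ * stokesD (w t) ^ 2) (Ici 0) := by
    simp only [detuningForm_self]; exact Ow.hW
  have dz : DerivOn (fun t => detuningForm κ γ (z t) (z t)) (fun t => (2 * α - κ - stokesN (z t))
      * detuningForm κ γ (z t) (z t) - γ * stokesD (z t) ^ 2) (Ici 0) := by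
    simp only [detuningForm_self]; exact Oz.hW
  refine ((derivOn_detuningForm hγ hw hz).div ((dw.sqrt fun t ht => (pw t ht).ne').mul
    (dz.sqrt fun t ht => (pz t ht).ne')) fun t ht => ?_).congr fun t ht => ?_
  · exact (mul_pos (Real.sqrt_pos.2 (pw t ht)) (Real.sqrt_pos.2 (pz t ht))).ne'
  · have hDt : stokesD (z t) = 0 := Oz.D_eq_zero hκ hD ht
    have s1 := Real.sqrt_pos.2 (pw t ht)
    have s2 := Real.sqrt_pos.2 (pz t ht)
    have q1 := Real.sq_sqrt (pw t ht).le
    have q2 := Real.sq_sqrt (pz t ht).le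
    rw [hDt]
    generalize √(detuningForm κ γ (w t) (w t)) = S at *
    generalize √(detuningForm κ γ (z t) (z t)) = R at *
    rw [← q1, ← q2]
    field_simp
    ring

/-- The rate is proportional to `D` of the second solution, which decays exponentially near the
manifold when `κ < 2α`. -/
theorem cosine_rate_le (hκ : 0 < κ) (h : κ < γ) {w z : ℂ × ℂ}
    (hw : 0 < stokesN w) (hz : 0 < stokesN z) :
    |(-(stokesD w / 2) * detuningForm κ γ (flipSnd w) z
          + detuningForm κ γ w z * (γ * stokesD w ^ 2 / (2 * detuningForm κ γ w w)))
        / (√(detuningForm κ γ w w) * √(detuningForm κ γ z z))|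
      ≤ (γ + κ) / (γ - κ) * (1 + γ / (γ - κ)) * |stokesD w| := by
  have hg : 0 < γ - κ := sub_pos.2 h
  have hγ : 0 < γ := hκ.trans h
  have hWw : 0 < detuningForm κ γ w w := (mul_pos hg hw).trans_le (le_detuningForm_self hκ w)
  have hWz : 0 < detuningForm κ γ z z := (mul_pos hg hz).trans_le (le_detuningForm_self hκ z)
  have s1 := Real.sqrt_pos.2 hWw
  have s2 := Real.sqrt_pos.2 hWz
  obtain ⟨b1, b2⟩ := abs_detuningForm_le_mul hκ h s1 s2 (Real.sq_sqrt hWw.le).symm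
    (Real.sq_sqrt hWz.le).symm
  rw [abs_div, abs_of_pos (mul_pos s1 s2), div_le_iff₀ (mul_pos s1 s2)]
  set Q := √(detuningForm κ γ w w) * √(detuningForm κ γ z z)
  have hD : |stokesD w| ≤ stokesN w := abs_le_of_sq_le_sq (by
    nlinarith [stokes_identity w, sq_nonneg (stokesU w), sq_nonneg (stokesV w)]) hw.le
  have h1 : γ * stokesD w ^ 2 / (2 * detuningForm κ γ w w) ≤ γ / (γ - κ) * |stokesD w| := by
    rw [div_le_iff₀ (by positivity), ← sq_abs]
    have h2 : |stokesD w| * (γ - κ) ≤ detuningForm κ γ w w :=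
      (mul_le_mul_of_nonneg_right hD hg.le).trans
        ((mul_comm _ _).le.trans (le_detuningForm_self hκ w))
    have e : γ * |stokesD w| ^ 2 = γ / (γ - κ) * |stokesD w| * (|stokesD w| * (γ - κ)) := by
      field_simp
    rw [e]
    have : 0 ≤ γ / (γ - κ) * |stokesD w| := by positivity
    nlinarith
  refine (abs_add_le _ _).trans ?_
  rw [abs_mul, abs_mul, abs_neg, abs_div, abs_two,
    abs_of_nonneg (by positivity : 0 ≤ γ * stokesD w ^ 2 / (2 * detuningForm κ γ w w))]
  calc _ ≤ |stokesD w| / 2 * ((γ + κ) / (γ - κ) * Q)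
        + (γ + κ) / (γ - κ) * Q * (γ / (γ - κ) * |stokesD w|) := by gcongr
    _ ≤ |stokesD w| * ((γ + κ) / (γ - κ) * Q)
        + (γ + κ) / (γ - κ) * Q * (γ / (γ - κ) * |stokesD w|) := by
      gcongr; linarith [abs_nonneg (stokesD w)]
    _ = _ := by ring

/-- The cosine starts near `1`, and its rate of change has a small integral: the invariant cone
makes `D` small and `D_decay_of_W` makes it exponentially decaying. -/
theorem near_cosine (hκ : 0 < κ) (hγ : γ = 2 * ω) (h : κ < γ) (hα : κ < 2 * α)
    (hz : IsSolution α κ ω z) (h0 : z 0 ∈ manifoldM) {η : ℝ} (hη : 0 < η) :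
    NearSolutions α κ ω (z 0) (fun w => 0 < stokesN (w 0) ∧ ∀ t, 0 ≤ t →
      stokesD (w t) ^ 2 ≤ η * detuningForm κ γ (w t) (w t) ^ 2 ∧
      1 - detuningForm κ γ (w t) (z t)
        / (√(detuningForm κ γ (w t) (w t)) * √(detuningForm κ γ (z t) (z t))) ≤ η) := by
  have hg : 0 < γ - κ := sub_pos.2 h
  have hγ0 : 0 < γ := hκ.trans h
  obtain ⟨hD0, hN0⟩ := mem_manifoldM_iff.1 h0
  obtain ⟨c, c', hc, hc', hlow⟩ := exists_lower_bound_of_lt hκ h hα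
  set n := min (c * (stokesN (z 0) / 2)) c' with hn
  have hn0 : 0 < n := by positivity
  set M := max (2 * α) (stokesN (z 0) + 1) with hM
  have hM0 : 0 < M := lt_max_of_lt_right (by linarith)
  set K := (γ + κ) / (γ - κ) * (1 + γ / (γ - κ)) with hK
  have hK0 : 0 < K := by positivity
  set m := min (min η (1 / (2 * (γ * (γ + κ))))) ((η / 2 * (n / 2) / (K * ((γ + κ) * M))) ^ 2)
    with hm
  have hm0 : 0 < m := by positivity
  have m1 : m ≤ η := (min_le_left _ _).trans (min_le_left _ _)
  have m2 : m * (γ * (γ + κ)) ≤ 1 / 2 := by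
    have : m ≤ 1 / (2 * (γ * (γ + κ))) := (min_le_left _ _).trans (min_le_right _ _)
    rw [le_div_iff₀ (by positivity)] at this
    linarith
  have m3 : K * (√m * (γ + κ) * M) / (n / 2) ≤ η / 2 := by
    have : √m ≤ η / 2 * (n / 2) / (K * ((γ + κ) * M)) :=
      Real.sqrt_le_iff.2 ⟨by positivity, min_le_right _ _⟩
    rw [le_div_iff₀ (by positivity)] at this
    rw [div_le_iff₀ (by positivity)]
    linarith
  have hWz0 : 0 < detuningForm κ γ (z 0) (z 0) :=
    (mul_pos hg hN0).trans_le (le_detuningForm_self hκ _)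
  have hcos : ∀ᶠ q in 𝓝 (z 0), 1 - η / 2 < detuningForm κ γ q (z 0)
      / (√(detuningForm κ γ q q) * √(detuningForm κ γ (z 0) (z 0))) := by
    have h1 : ContinuousAt (fun q => detuningForm κ γ q (z 0)
      / (√(detuningForm κ γ q q) * √(detuningForm κ γ (z 0) (z 0)))) (z 0) := by
      refine ContinuousAt.div ?_ ?_ ?_
      · unfold detuningForm; fun_prop
      · unfold detuningForm; fun_prop
      · exact (mul_pos (Real.sqrt_pos.2 hWz0) (Real.sqrt_pos.2 hWz0)).ne'
    refine h1.eventually (lt_mem_nhds ?_)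
    beta_reduce
    rw [Real.mul_self_sqrt hWz0.le, div_self hWz0.ne']
    linarith
  have hNq : ∀ᶠ q in 𝓝 (z 0), stokesN (z 0) / 2 < stokesN q ∧ stokesN q < stokesN (z 0) + 1 :=
    (continuous_stokesN.continuousAt.eventually (lt_mem_nhds (by linarith))).and
      (continuous_stokesN.continuousAt.eventually (gt_mem_nhds (by linarith)))
  refine (((near_D_sq_le_W hκ hγ h h0 hm0 (by linarith)).and (NearSolutions.initial hcos)).and
    (NearSolutions.initial hNq)).mono fun w hw hq => ?_
  obtain ⟨⟨⟨q1, q2⟩, q3⟩, q4, q5⟩ := hq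
  refine ⟨q1, fun t ht => ⟨?_, ?_⟩⟩
  · rw [detuningForm_self]
    exact (q2 t ht).1.trans (mul_le_mul_of_nonneg_right m1 (sq_nonneg _))
  have Ow := hw.orbit hγ
  have hlow' : ∀ t, 0 ≤ t → n ≤ stokesN (w t) := fun t ht => by
    refine le_trans ?_ (hlow _ _ _ _ Ow t ht)
    have := q4.le
    rw [hn]
    gcongr
  have hup : ∀ t, 0 ≤ t → stokesN (w t) ≤ M := fun t ht =>
    Ow.N_le hκ (le_max_left _ _) hM0.le (q5.le.trans (le_max_right _ _)) ht
  have key := norm_sub_le_of_exp_deriv (T := 0) (c := n / 2) (K := K * (√m * (γ + κ) * M))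
    (derivOn_cosine hκ hγ h hw hz q1 h0) (by positivity) (by positivity) (fun s hs => ?_) ht
  · rw [Real.norm_eq_abs] at key
    have := (abs_le.1 (key.trans m3)).1
    linarith
  · rw [Real.norm_eq_abs]
    refine (cosine_rate_le hκ h (Ow.N_pos hκ q1 hs) ((hz.orbit hγ).N_pos hκ hN0 hs)).trans ?_
    rw [mul_assoc K]
    refine mul_le_mul_of_nonneg_left ?_ hK0.le
    have h1 := Ow.D_decay_of_W hκ h q1 m2 hm0.le (fun t ht => (q2 t ht).1) hlow' hs
    refine abs_le_of_sq_le_sq (h1.trans ?_) (by positivity)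
    have e : (√m * (γ + κ) * M * Real.exp (-(n / 2) * (s - 0))) ^ 2
        = m * (γ + κ) ^ 2 * Real.exp (-n * s) * M ^ 2 := by
      rw [mul_pow, mul_pow, mul_pow, Real.sq_sqrt hm0.le, sq (Real.exp _), ← Real.exp_add]
      ring_nf
    rw [e]
    have := hup s hs
    have := Ow.nonneg s
    gcongr

/-- The displayed expression is the numerator of the derivative of `W₁/W₂`. As `N₁/W₁` and `N₂/W₂`
are close, a larger form comes with a larger energy and hence with stronger damping. This restores
the quotient towards `1`; the `D²` term is too small to matter. -/
theorem form_barrier {N₁ N₂ W₁ W₂ D g κ γ e : ℝ} (hg : 0 < γ + κ) (hW₁ : 0 < W₁) (hW₂ : 0 < W₂)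
    (he0 : 0 < e) (he : e ≤ 1 / 2)
    (hN₂ : W₂ ≤ (γ + κ) * N₂) (hg0 : 0 ≤ g) (hgD : g * D ^ 2 ≤ e / (4 * (γ + κ)) * W₁ ^ 2)
    (hp : |N₁ * W₂ - N₂ * W₁| ≤ e / (4 * (γ + κ)) * (W₁ * W₂)) :
    ((1 + e) * W₂ < W₁ → W₁ * W₂ * (N₂ - N₁) - g * D ^ 2 * W₂ ≤ 0) ∧
    (W₁ < (1 - e) * W₂ → 0 ≤ W₁ * W₂ * (N₂ - N₁) - g * D ^ 2 * W₂) := by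
  obtain ⟨p1, p2⟩ := abs_le.1 hp
  set q := e / (4 * (γ + κ)) with hq
  have hq0 : 0 < q := by positivity
  have hqe : q * (γ + κ) = e / 4 := by rw [hq]; field_simp
  have hN₂' : q * W₂ ≤ e / 4 * N₂ := by
    calc q * W₂ ≤ q * ((γ + κ) * N₂) := by gcongr
      _ = q * (γ + κ) * N₂ := by ring
      _ = _ := by rw [hqe]
  have hD := mul_nonneg hg0 (sq_nonneg D)
  constructor
  · intro h1
    have h2 : e / 2 * W₁ ≤ W₁ - W₂ := by
      refine le_of_mul_le_mul_left (a := 1 + e) ?_ (by linarith)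
      linarith [mul_pos he0 hW₁, mul_nonneg (mul_pos he0 hW₁).le (sub_nonneg.2 he)]
    have hN : 0 < N₂ := by
      by_contra hc
      nlinarith [mul_nonneg hg.le (sub_nonneg.2 (not_lt.1 hc))]
    have h3 : q * W₂ * W₁ ≤ N₂ * (W₁ - W₂) := by
      have := mul_le_mul_of_nonneg_left h2 hN.le
      nlinarith [mul_le_mul_of_nonneg_right hN₂' hW₁.le, mul_pos (mul_pos hN hW₁) he0]
    have h4 : W₂ * (N₂ - N₁) ≤ 0 := by linarith
    linarith [mul_nonneg hD hW₂.le, mul_nonneg hW₁.le (neg_nonneg.2 h4)]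
  · intro h1
    have h2 : e * W₂ ≤ W₂ - W₁ := by linarith
    have hN : 0 < N₂ := by
      by_contra hc
      nlinarith [mul_nonneg hg.le (sub_nonneg.2 (not_lt.1 hc))]
    have h3 : 4 * (q * W₂ * W₂) ≤ N₂ * (W₂ - W₁) := by
      have := mul_le_mul_of_nonneg_left h2 hN.le
      nlinarith [mul_le_mul_of_nonneg_right hN₂' hW₂.le]
    have h5 : W₁ ≤ W₂ := by nlinarith
    have h6 : q * (W₁ * W₂) ≤ q * W₂ * W₂ := by
      nlinarith [mul_le_mul_of_nonneg_left h5 (mul_pos hq0 hW₂).le]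
    have h7 : q * W₁ * W₁ ≤ q * W₂ * W₁ := by
      nlinarith [mul_le_mul_of_nonneg_left h5 (mul_pos hq0 hW₁).le]
    have h4 : q * W₁ * W₁ ≤ W₁ * (W₂ * (N₂ - N₁)) / W₂ := by
      rw [le_div_iff₀ hW₂]
      have h8 : q * W₂ * W₂ ≤ W₂ * (N₂ - N₁) := by nlinarith
      linarith [mul_le_mul_of_nonneg_left h8 hW₁.le, mul_le_mul_of_nonneg_right h7 hW₂.le]
    rw [le_div_iff₀ hW₂] at h4
    nlinarith [mul_le_mul_of_nonneg_right hgD hW₂.le]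

theorem lyapunovStable_of_detuned (hκ : 0 < κ) (hγ : γ = 2 * ω) (h : κ < γ) (hα : κ < 2 * α)
    (hz : IsSolution α κ ω z) (h0 : z 0 ∈ manifoldM) : LyapunovStable α κ ω z := by
  intro ε hε
  have hg : 0 < γ - κ := sub_pos.2 h
  have hγ0 : 0 < γ := hκ.trans h
  have Oz := hz.orbit hγ
  obtain ⟨hD0, hN0⟩ := mem_manifoldM_iff.1 h0
  obtain ⟨M, hM, hMN⟩ := Oz.exists_bound hκ
  -- Here `e` is the tolerance for the quotient of the forms. It makes the final bound `4e(γ + κ)M`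
  -- for the form of `w - z` smaller than `ε²(γ - κ)`. The constants `q` and `η` below are the
  -- tolerances for `N/W` and for the cosine that `form_barrier` then requires.
  set e := min (1 / 2) (ε ^ 2 * (γ - κ) / (8 * ((γ + κ) * M))) with he
  have he0 : 0 < e := by positivity
  have he1 : e ≤ 1 / 2 := min_le_left _ _
  have he2 : (γ + κ) * M * (4 * e) < ε ^ 2 * (γ - κ) := by
    have : e ≤ ε ^ 2 * (γ - κ) / (8 * ((γ + κ) * M)) := min_le_right _ _
    rw [le_div_iff₀ (by positivity)] at this
    nlinarith [mul_pos (pow_pos hε 2) hg]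
  set q := e / (4 * (γ + κ)) with hq
  have hq0 : 0 < q := by positivity
  set η := min e (min (q / γ) ((q * (γ - κ)) ^ 2 / 8)) with hη
  have hη0 : 0 < η := by positivity
  have g1 : η ≤ e := min_le_left _ _
  have g2 : γ * η ≤ q := by
    rw [mul_comm, ← le_div_iff₀ hγ0]
    exact (min_le_right _ _).trans (min_le_left _ _)
  have g3 : 8 * η ≤ (q * (γ - κ)) ^ 2 := by
    have : η ≤ (q * (γ - κ)) ^ 2 / 8 := (min_le_right _ _).trans (min_le_right _ _)
    linarith
  have hWz0 : 0 < detuningForm κ γ (z 0) (z 0) :=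
    (mul_pos hg hN0).trans_le (le_detuningForm_self hκ _)
  have hini : ∀ᶠ p in 𝓝 (z 0), (1 - e) * detuningForm κ γ (z 0) (z 0) < detuningForm κ γ p p ∧
      detuningForm κ γ p p < (1 + e) * detuningForm κ γ (z 0) (z 0) := by
    have h1 : Continuous fun p => detuningForm κ γ p p := by unfold detuningForm; fun_prop
    exact (h1.continuousAt.eventually (lt_mem_nhds (by nlinarith))).and
      (h1.continuousAt.eventually (gt_mem_nhds (by nlinarith)))
  refine ((near_cosine hκ hγ h hα hz h0 hη0).and (NearSolutions.initial hini)).exists_ball.imp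
    fun δ hδ => ⟨hδ.1, fun w hw hd t ht => ?_⟩
  obtain ⟨⟨hw0, hq1⟩, hq2, hq3⟩ := hδ.2 w hw hd
  have Ow := hw.orbit hγ
  have pw : ∀ t, 0 ≤ t → 0 < detuningForm κ γ (w t) (w t) := fun t ht => by
    rw [detuningForm_self]; exact Ow.W_pos hκ h hw0 ht
  have pz : ∀ t, 0 ≤ t → 0 < detuningForm κ γ (z t) (z t) := fun t ht => by
    rw [detuningForm_self]; exact Oz.W_pos hκ h hN0 ht
  have dw : DerivOn (fun t => detuningForm κ γ (w t) (w t)) (fun t => (2 * α - κ - stokesN (w t))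
      * detuningForm κ γ (w t) (w t) - γ * stokesD (w t) ^ 2) (Ici 0) := by
    simp only [detuningForm_self]; exact Ow.hW
  have dz : DerivOn (fun t => detuningForm κ γ (z t) (z t)) (fun t => (2 * α - κ - stokesN (z t))
      * detuningForm κ γ (z t) (z t)) (Ici 0) := by
    refine DerivOn.congr (f' := fun t => (2 * α - κ - stokesN (z t))
      * detuningForm κ γ (z t) (z t) - γ * stokesD (z t) ^ 2) ?_ fun t ht => ?_
    · simp only [detuningForm_self]; exact Oz.hW
    · rw [show stokesD (z t) = 0 from Oz.D_eq_zero hκ hD0 ht]; ring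
  have hcos : ∀ t, 0 ≤ t → √(detuningForm κ γ (w t) (w t)) * √(detuningForm κ γ (z t) (z t))
      - detuningForm κ γ (w t) (z t)
      ≤ η * (√(detuningForm κ γ (w t) (w t)) * √(detuningForm κ γ (z t) (z t))) := fun t ht => by
    have s1 := mul_pos (Real.sqrt_pos.2 (pw t ht)) (Real.sqrt_pos.2 (pz t ht))
    have := (hq1 t ht).2
    rw [sub_le_comm, le_div_iff₀ s1] at this
    linarith
  have hbar : ∀ s, 0 ≤ s → |stokesN (w s) * detuningForm κ γ (z s) (z s)
      - stokesN (z s) * detuningForm κ γ (w s) (w s)|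
      ≤ q * (detuningForm κ γ (w s) (w s) * detuningForm κ γ (z s) (z s)) := fun s hs => by
    have p1 := pw s hs
    have p2 := pz s hs
    have c1 := Real.sq_sqrt p1.le
    have c2 := Real.sq_sqrt p2.le
    have h1 := sq_stokesN_mul_sub_le hκ h c1.symm c2.symm
    rw [c1, c2] at h1
    refine abs_le_of_sq_le_sq (h1.trans ?_) (by positivity)
    have h2 := hcos s hs
    have s1 := Real.sqrt_pos.2 p1
    have s2 := Real.sqrt_pos.2 p2
    rw [div_le_iff₀ (by positivity)]
    set S := √(detuningForm κ γ (w s) (w s))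
    set R := √(detuningForm κ γ (z s) (z s))
    calc _ ≤ 8 * (S * R) ^ 3 * (η * (S * R)) := by gcongr
      _ = 8 * η * (S ^ 2 * R ^ 2) ^ 2 := by ring
      _ ≤ (q * (γ - κ)) ^ 2 * (S ^ 2 * R ^ 2) ^ 2 := by gcongr
      _ = _ := by rw [c1, c2]; ring
  have key : ∀ s, 0 ≤ s →
      ((1 + e) * detuningForm κ γ (z s) (z s) < detuningForm κ γ (w s) (w s) →
        detuningForm κ γ (w s) (w s) * detuningForm κ γ (z s) (z s) * (stokesN (z s) - stokesN (w s))
          - γ * stokesD (w s) ^ 2 * detuningForm κ γ (z s) (z s) ≤ 0) ∧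
      (detuningForm κ γ (w s) (w s) < (1 - e) * detuningForm κ γ (z s) (z s) →
        0 ≤ detuningForm κ γ (w s) (w s) * detuningForm κ γ (z s) (z s)
          * (stokesN (z s) - stokesN (w s))
          - γ * stokesD (w s) ^ 2 * detuningForm κ γ (z s) (z s)) := fun s hs => by
    refine form_barrier (by positivity) (pw s hs) (pz s hs) he0 he1 (detuningForm_self_le hκ _) hγ0.le
      ?_ (hbar s hs)
    calc _ ≤ γ * (η * detuningForm κ γ (w s) (w s) ^ 2) := by gcongr; exact (hq1 s hs).1
      _ = γ * η * detuningForm κ γ (w s) (w s) ^ 2 := by ring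
      _ ≤ _ := by gcongr
  have dquot := dw.div dz fun s hs => (pz s hs).ne'
  have hnum : ∀ s, ((2 * α - κ - stokesN (w s)) * detuningForm κ γ (w s) (w s)
      - γ * stokesD (w s) ^ 2) * detuningForm κ γ (z s) (z s)
      - detuningForm κ γ (w s) (w s) * ((2 * α - κ - stokesN (z s)) * detuningForm κ γ (z s) (z s))
      = detuningForm κ γ (w s) (w s) * detuningForm κ γ (z s) (z s) * (stokesN (z s) - stokesN (w s))
          - γ * stokesD (w s) ^ 2 * detuningForm κ γ (z s) (z s) := fun s => by ring
  have hup : detuningForm κ γ (w t) (w t) ≤ (1 + e) * detuningForm κ γ (z t) (z t) := by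
    rw [← div_le_iff₀ (pz t ht)]
    refine dquot.le_barrier ((div_le_iff₀ hWz0).2 hq3.le) (fun s hs h1 => ?_) ht
    rw [lt_div_iff₀ (pz s hs)] at h1
    rw [hnum]
    exact div_nonpos_of_nonpos_of_nonneg ((key s hs).1 h1) (sq_nonneg _)
  have hlo : (1 - e) * detuningForm κ γ (z t) (z t) ≤ detuningForm κ γ (w t) (w t) := by
    rw [← le_div_iff₀ (pz t ht)]
    refine dquot.ge_barrier ((le_div_iff₀ hWz0).2 hq2.le) (fun s hs h1 => ?_) ht
    rw [div_lt_iff₀ (pz s hs)] at h1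
    rw [hnum]
    exact div_nonneg ((key s hs).2 h1) (sq_nonneg _)
  have p1 := pw t ht
  have p2 := pz t ht
  have c1 := Real.sq_sqrt p1.le
  have c2 := Real.sq_sqrt p2.le
  have s1 := Real.sqrt_pos.2 p1
  have s2 := Real.sqrt_pos.2 p2
  have h1 := hcos t ht
  have h2 : (γ - κ) * stokesN (w t - z t) ≤ (γ + κ) * M * (4 * e) := by
    refine (le_detuningForm_self hκ _).trans ?_
    rw [detuningForm_sub_self]
    have hzM : detuningForm κ γ (z t) (z t) ≤ (γ + κ) * M :=
      (detuningForm_self_le hκ _).trans (by have := hMN t ht; gcongr)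
    set S := √(detuningForm κ γ (w t) (w t))
    set R := √(detuningForm κ γ (z t) (z t))
    rw [← c1, ← c2] at hup hlo ⊢
    rw [← c2] at hzM
    -- The square of `S - R` is at most `|S² - R²|`, which the two barriers bound by `eR²`.
    have h3 : S ^ 2 + R ^ 2 - 2 * (S * R) ≤ e * R ^ 2 := by
      have h5 : 0 ≤ S + R := by positivity
      rcases le_total S R with h4 | h4
      · nlinarith [mul_nonneg (sub_nonneg.2 h4) s1.le]
      · nlinarith [mul_nonneg (sub_nonneg.2 h4) s2.le]
    have h7 : e * R ^ 2 ≤ 1 / 2 * R ^ 2 := mul_le_mul_of_nonneg_right he1 (sq_nonneg R)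
    have h5 : S * R ≤ 3 / 2 * R ^ 2 := by linarith [two_mul_le_add_sq S R, sq_nonneg R]
    have h6 : η * (S * R) ≤ e * (3 / 2 * R ^ 2) := by gcongr
    calc _ ≤ e * R ^ 2 + 2 * (e * (3 / 2 * R ^ 2)) := by linarith
      _ = R ^ 2 * (4 * e) := by ring
      _ ≤ _ := by gcongr
  have h3 : stokesN (w t - z t) < ε ^ 2 := by
    have := h2.trans_lt he2
    rw [mul_comm] at this
    exact lt_of_mul_lt_mul_right this hg.le
  rw [dist_eq_norm]
  exact (norm_le_sqrt_stokesN _).trans_lt ((Real.sqrt_lt_sqrt (stokesN_nonneg _) h3).trans_eq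
    (Real.sqrt_sq hε.le))

theorem lyapunovStable_of_mem_manifoldM (hκ : 0 < κ) (hω : 0 ≤ ω) (hγ : γ = 2 * ω)
    (hz : IsSolution α κ ω z) (h0 : z 0 ∈ manifoldM)
    (h : κ < γ ∨ phaseFactor (z 0) ≠ unitAt (unstableAngle κ γ)) : LyapunovStable α κ ω z := by
  have hγ0 : 0 ≤ γ := by linarith
  rcases lt_or_ge κ γ with hlt | hle
  · rcases le_or_gt (2 * α) κ with hα | hα
    · exact lyapunovStable_of_death hκ hω hγ (Or.inr (Or.inl ⟨hlt, hα⟩)) hz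
    · exact lyapunovStable_of_detuned hκ hγ hlt hα hz h0
  · have h := h.resolve_left (not_lt.2 hle)
    obtain ⟨a, b, ha, hb, ha0, hb0, hb1, hab, hγb, hκa, -⟩ := lock_params hκ hγ0 hle
    rw [(unitAt_lockAngle hκ hγ0 hle).2, ← ha, ← hb] at h
    rcases le_or_gt (2 * α - κ + κ * a) 0 with hL | hL
    · exact lyapunovStable_of_death hκ hω hγ (Or.inr (Or.inr ⟨hle, by rwa [← hκa]⟩)) hz
    · exact lyapunovStable_of_lock hκ hγ hz h0 hab hγb ha0 hb0 h hL

end Detuned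

/-! ### Almost every initial datum: detuning at most the coupling -/

namespace Orbit

variable {α κ γ : ℝ} {N D u v : ℝ → ℝ} (O : Orbit α κ γ N D u v)
include O

theorem lock_of_u_pos (hκ : 0 < κ) {a b : ℝ} (hab : a ^ 2 + b ^ 2 = 1) (hb : γ = κ * b)
    (ha : 0 ≤ a) (hb0 : 0 ≤ b) {T : ℝ} (hT : 0 ≤ T) (hu : 0 < u T) :
    Tendsto (fun t => 2 * u t / N t) atTop (𝓝 a) ∧
      Tendsto (fun t => 2 * v t / N t) atTop (𝓝 b) := by
  obtain ⟨e, he, hl⟩ := uniform_lock hκ hab hb ha hb0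
  refine tendsto_of_sq_add_sq ((eventually_gt_atTop T).mono fun t ht => ?_)
    (he.comp (tendsto_atTop_add_const_right _ (-T) tendsto_id))
  have := hl _ _ _ _ _ (O.shift hT) (by simpa using hu) (t - T) (by linarith)
  simpa [sub_eq_add_neg] using this

/-- If `u ≤ 0` for all times, then `N' ≤ (2α - κ)N`, so the solution vanishes exponentially and the
cubic terms become negligible. The linear dynamics then drives `u` to positive values as in the
locking estimates, unless `P` vanishes. -/
theorem exists_u_pos (hκ : 0 < κ) (hα : 2 * α < κ) {a b : ℝ} (hab : a ^ 2 + b ^ 2 = 1)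
    (hb : γ = κ * b) (ha : 0 ≤ a) (hb0 : 0 ≤ b) (hP : 0 < N 0 + 2 * a * u 0 - 2 * b * v 0) :
    ∃ T, 0 ≤ T ∧ 0 < u T := by
  by_contra hu
  push Not at hu
  have hPp : ∀ s, 0 ≤ s → 0 < N s + 2 * a * u s - 2 * b * v s := fun s hs =>
    O.P_pos hκ hab hb hP hs
  have hN' : ∀ t, 0 ≤ t → (2 * α - κ) * N t - N t ^ 2 - D t ^ 2 + 2 * κ * u t
      ≤ (2 * α - κ) * N t := fun t ht => by
    nlinarith [sq_nonneg (N t), sq_nonneg (D t), mul_nonneg hκ.le (neg_nonneg.2 (hu t ht))]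
  have hN0 : Tendsto N atTop (𝓝 0) := by
    have h1 : Tendsto (fun t : ℝ => N 0 * Real.exp ((2 * α - κ) * (t - 0))) atTop (𝓝 0) := by
      have : Tendsto (fun t : ℝ => (2 * α - κ) * (t - 0)) atTop atBot := by
        simp only [sub_zero]
        exact tendsto_id.const_mul_atTop_of_neg (by linarith)
      simpa using (Real.tendsto_exp_atBot.comp this).const_mul (N 0)
    exact tendsto_of_tendsto_of_tendsto_of_le_of_le' tendsto_const_nhds h1
      (Eventually.of_forall O.nonneg) ((eventually_ge_atTop 0).mono fun t ht =>
        O.hN.le_mul_exp hN' ht)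
  rcases ha.eq_or_lt with rfl | ha
  · have hb1 : b = 1 := by nlinarith [sq_nonneg (b - 1)]
    subst hb1
    have hμ : 0 < κ - 2 * α := by linarith
    -- For `σ = -u/P` only `σ' ≤ -κ/2 + 2Nσ` is available. The weight `1 + kN` compensates the last
    -- term, since `kN' ≤ -4N` and eventually `kN ≤ 1`.
    set k := 4 / (κ - 2 * α) with hk
    have hk0 : 0 < k := by positivity
    obtain ⟨T', hT'⟩ := eventually_atTop.1 (hN0.eventually (gt_mem_nhds (inv_pos.2 hk0)))
    set T := max T' 0
    have hT0 : 0 ≤ T := le_max_right _ _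
    have := (((O.hu.div (O.hP hab hb) (fun s hs => (hPp s hs).ne')).neg.mul
      ((DerivOn.affine 1 0 0 _).add (O.hN.const_mul k))).Ici_of_le hT0).eventually_le_of_speed
      (M := -1) (c := κ / 2) (fun s hs _ => ?_) (by positivity)
    · obtain ⟨t, ht, ht0⟩ := (this.and (eventually_ge_atTop T)).exists
      have h1 := hPp t (hT0.trans ht0)
      have h2 : 0 ≤ -(u t / (N t + 2 * 0 * u t - 2 * 1 * v t)) := by
        have := div_nonpos_of_nonpos_of_nonneg (hu t (hT0.trans ht0)) h1.le
        linarith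
      have h3 : 0 ≤ 1 + 0 * (t - 0) + k * N t := by
        have := O.nonneg t
        rw [zero_mul, add_zero]; positivity
      linarith [mul_nonneg h2 h3]
    · have hs0 : 0 ≤ s := hT0.trans hs
      have hp := hPp s hs0
      have hn := O.nonneg s
      have hus := hu s hs0
      have hD := O.D_sq_le_P hab s
      have hns : k * N s ≤ 1 := by
        have h1 := (hT' s ((le_max_left _ _).trans hs)).le
        calc k * N s ≤ k * k⁻¹ := by gcongr
          _ = 1 := mul_inv_cancel₀ hk0.ne'
      have hNs := hN' s hs0
      have hkμ : k * (κ - 2 * α) = 4 := by rw [hk]; field_simp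
      set P := N s + 2 * 0 * u s - 2 * 1 * v s with hPd
      set σ := -(u s / P) with hσ
      have hσ0 : 0 ≤ σ := by
        have := div_nonpos_of_nonpos_of_nonneg hus hp.le
        rw [hσ]; linarith
      have huP : u s = -(σ * P) := by rw [hσ]; field_simp
      have e1 : -((((2 * α - κ - N s) * u s - γ * v s + κ / 2 * N s) * P
          - u s * ((2 * α - κ + κ * 0 - N s) * P - D s ^ 2)) / P ^ 2)
          = -(κ / 2) + σ * (D s ^ 2 / P) := by
        rw [huP, hb]
        have hv : 2 * v s = N s - P := by rw [hPd]; ring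
        field_simp
        linear_combination κ * hv
      have h4 : D s ^ 2 / P ≤ 2 * N s := by rwa [div_le_iff₀ hp]
      have h5 : σ * (D s ^ 2 / P) ≤ σ * (2 * N s) := mul_le_mul_of_nonneg_left h4 hσ0
      rw [e1]
      set N' := (2 * α - κ) * N s - N s ^ 2 - D s ^ 2 + 2 * κ * u s
      have h6 : σ * (k * N') ≤ σ * (-(4 * N s)) := by
        refine mul_le_mul_of_nonneg_left ?_ hσ0
        have := mul_le_mul_of_nonneg_left hNs hk0.le
        nlinarith
      have h7 : 0 ≤ k * N s := by positivity
      have h8 : (-(κ / 2) + σ * (D s ^ 2 / P)) * (1 + k * N s)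
          ≤ (-(κ / 2) + σ * (2 * N s)) * (1 + k * N s) := by gcongr
      have h9 : σ * (2 * N s) * (k * N s) ≤ σ * (2 * N s) * 1 :=
        mul_le_mul_of_nonneg_left hns (by positivity)
      simp only [zero_mul, add_zero, zero_add]
      nlinarith [mul_nonneg hκ.le h7]
  · have hκa : 0 < κ * a := mul_pos hκ ha
    have hm : (-a) ^ 2 + b ^ 2 = 1 := by rw [neg_sq, hab]
    obtain ⟨T', hT'⟩ := eventually_atTop.1 (hN0.eventually (gt_mem_nhds (half_pos hκa)))
    set T := max T' 0
    have hT0 : 0 ≤ T := le_max_right _ _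
    -- The quotient `P₋/P₊` would fall to `1/2`, but `u ≤ 0` keeps it at least `1`.
    have := (((O.hP hm hb).div (O.hP hab hb)
      (fun s hs => (hPp s hs).ne')).Ici_of_le hT0).eventually_le_of_speed
      (M := 1 / 2) (c := κ * a / 2) (fun s hs h1 => ?_) (by positivity)
    · obtain ⟨t, ht, ht0⟩ := (this.and (eventually_ge_atTop T)).exists
      have h1 := hPp t (hT0.trans ht0)
      rw [div_le_iff₀ h1] at ht
      nlinarith [mul_nonneg ha.le (neg_nonneg.2 (hu t (hT0.trans ht0)))]
    · have hs0 : 0 ≤ s := hT0.trans hs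
      have hp := hPp s hs0
      have hpm := O.P_nonneg hm s
      have hD := O.D_sq_le_P hab s
      have hns := (hT' s ((le_max_left _ _).trans hs)).le
      rw [lt_div_iff₀ hp] at h1
      rw [div_le_iff₀ (by positivity)]
      set P := N s + 2 * a * u s - 2 * b * v s
      set P' := N s + 2 * -a * u s - 2 * b * v s
      have h2 : D s ^ 2 * (P' - P) ≤ κ * a * (P * P') := by
        calc D s ^ 2 * (P' - P) ≤ D s ^ 2 * P' := by
              gcongr; linarith
          _ ≤ 2 * N s * P * P' := by gcongr
          _ ≤ 2 * (κ * a / 2) * P * P' := by gcongr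
          _ = _ := by ring
      have h3 : P * (1 / 2 * P) ≤ P * P' := by gcongr
      nlinarith [mul_le_mul_of_nonneg_left h3 hκa.le]

end Orbit

section AlmostEvery

variable {α κ ω γ : ℝ} {z : ℝ → ℂ × ℂ}

/-- A complex line in `ℂ²` is a null set. -/
theorem addHaar_line (μ : Measure (ℂ × ℂ)) [μ.IsAddHaarMeasure] (c : ℂ) :
    μ {w | w.1 = c * w.2} = 0 := by
  let s : Submodule ℝ (ℂ × ℂ) :=
    { carrier := {w | w.1 = c * w.2}
      add_mem' := fun {x y} hx hy => by
        simp only [mem_ofPred_eq, Prod.fst_add, Prod.snd_add] at *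
        rw [hx, hy, mul_add]
      zero_mem' := by simp
      smul_mem' := fun r x hx => by
        simp only [mem_ofPred_eq, Prod.smul_fst, Prod.smul_snd] at *
        rw [hx, mul_smul_comm] }
  refine Measure.addHaar_submodule μ s fun h => ?_
  have : ((1, 0) : ℂ × ℂ) ∈ s := by rw [h]; trivial
  have h1 : (1 : ℂ) = c * 0 := this
  simp at h1

theorem P_pos_of_ne {a b : ℝ} (hab : a ^ 2 + b ^ 2 = 1) {w : ℂ × ℂ}
    (hw : w.1 ≠ ⟨-a, b⟩ * w.2) : 0 < stokesN w + 2 * a * stokesU w - 2 * b * stokesV w := by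
  have h1 := norm_fst_sub_mul_snd_sq (-a) b (by rw [neg_sq, hab]) w
  have h2 : 0 < ‖w.1 - ⟨-a, b⟩ * w.2‖ ^ 2 := pow_pos (norm_pos_iff.2 (sub_ne_zero.2 hw)) 2
  rw [h1] at h2
  linarith

/-- The only data to exclude are those on the complex line `z₁ = (-a + ib)z₂`, where the form `P`
vanishes. They include the origin. -/
theorem ae_lock (hκ : 0 < κ) (hω : 0 ≤ ω) (hγ : γ = 2 * ω) (hα : 2 * α < κ) (h : γ ≤ κ) :
    ∀ᵐ p : ℂ × ℂ, ∀ z : ℝ → ℂ × ℂ, IsSolution α κ ω z → z 0 = p →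
      PhaseLockedAt z (lockAngle κ γ) ∧
        ((α ≤ 0 ∨ κ ≤ kappaStar α γ) → AmplitudeDeath z) ∧
        (0 < α → kappaStar α γ < κ → Active z ∧
          Tendsto (fun t => ‖(z t).1‖ ^ 2) atTop (𝓝 (lockedAmplitudeSq α κ γ)) ∧
          Tendsto (fun t => ‖(z t).2‖ ^ 2) atTop (𝓝 (lockedAmplitudeSq α κ γ))) := by
  have hγ0 : 0 ≤ γ := by linarith
  obtain ⟨a, b, ha, hb, ha0, hb0, hb1, hab, hγb, hκa, -⟩ := lock_params hκ hγ0 h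
  have hnull : ∀ᵐ p : ℂ × ℂ, p.1 ≠ ⟨-a, b⟩ * p.2 := by
    rw [ae_iff]
    have := addHaar_line (volume.prod volume) ⟨-a, b⟩
    rw [← Measure.volume_eq_prod] at this
    simpa using this
  filter_upwards [hnull] with p hp z hz h0
  rw [← h0] at hp
  have O := hz.orbit hγ
  have hP := P_pos_of_ne hab hp
  have hN : 0 < stokesN (z 0) := by linarith [O.P_le hab 0]
  obtain ⟨T, hT, hu⟩ := O.exists_u_pos hκ hα hab hγb ha0 hb0 hP
  obtain ⟨hX, hY⟩ := O.lock_of_u_pos hκ hab hγb ha0 hb0 hT hu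
  obtain ⟨c1, -, c3, c4, -, -⟩ := locked_consequences hκ hγ hz hN hab hX hY
  refine ⟨?_, fun hα' => ?_, fun hα0 hκs => ?_⟩
  · unfold PhaseLockedAt
    rwa [(unitAt_lockAngle hκ hγ0 h).1, ← ha, ← hb]
  · exact amplitudeDeath_of_tendsto (O.tendsto_zero hκ hγ0 (deathRegime_of_kappaStar h
      (hα'.imp_right fun h' => ⟨hα.le, h'⟩)))
  · have hL := active_condition hκ hγ0 h hα0 (Or.inr hκs)
    rw [← hκa] at hL
    rw [max_eq_left hL.le] at c3 c4
    rw [lockedAmplitudeSq_eq, ← hκa]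
    exact ⟨active_of_sq_tendsto (by linarith) c3 c4, c3, c4⟩

end AlmostEvery

/-! ### Almost every initial datum: detuning above the coupling -/

namespace Orbit

variable {α κ γ : ℝ} {N D u v : ℝ → ℝ} (O : Orbit α κ γ N D u v)
include O

theorem hX (hN : ∀ t, 0 ≤ t → 0 < N t) : DerivOn (fun t => 2 * u t / N t)
    (fun t => κ - γ * (2 * v t / N t) - κ * (2 * u t / N t) ^ 2
      + 2 * u t / N t * (D t ^ 2 / N t)) (Ici 0) :=
  ((O.hu.const_mul 2).div O.hN fun t ht => (hN t ht).ne').congr fun t ht => by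
    have := hN t ht
    field_simp
    ring

theorem hY (hN : ∀ t, 0 ≤ t → 0 < N t) : DerivOn (fun t => 2 * v t / N t)
    (fun t => γ * (2 * u t / N t) - κ * (2 * u t / N t) * (2 * v t / N t)
      + 2 * v t / N t * (D t ^ 2 / N t)) (Ici 0) :=
  ((O.hv.const_mul 2).div O.hN fun t ht => (hN t ht).ne').congr fun t ht => by
    have := hN t ht
    field_simp
    ring

/-- Above the locking threshold, a vanishing solution whose phase difference converges has an
asymptotically determined polarization. -/
theorem polarization_limit (hκ : 0 < κ) (h : κ < γ) (h0 : 0 < N 0) (hN0 : Tendsto N atTop (𝓝 0))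
    {s c : ℝ} (hsc : s ^ 2 + c ^ 2 = 1)
    (hl : Tendsto (fun t => s * (2 * u t / N t) - c * (2 * v t / N t)) atTop (𝓝 0)) :
    Tendsto (fun t => 2 * u t / N t) atTop (𝓝 0) ∧
      Tendsto (fun t => 2 * v t / N t) atTop (𝓝 (κ / γ)) := by
  have hγ : 0 < γ := hκ.trans h
  have hN : ∀ t, 0 ≤ t → 0 < N t := fun t ht => O.N_pos hκ h0 ht
  obtain ⟨M, hM, hMN⟩ := O.exists_bound hκ
  have dX := O.hX hN
  have dY := O.hY hN
  have bX : ∀ t, 0 ≤ t → |2 * u t / N t| ≤ 1 := fun t ht => by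
    rw [abs_div, abs_of_pos (hN t ht), div_le_one (hN t ht)]; exact O.abs_u_le t
  have bY : ∀ t, 0 ≤ t → |2 * v t / N t| ≤ 1 := fun t ht => by
    rw [abs_div, abs_of_pos (hN t ht), div_le_one (hN t ht)]; exact O.abs_v_le t
  have be : ∀ t, 0 ≤ t → 0 ≤ D t ^ 2 / N t ∧ D t ^ 2 / N t ≤ N t := fun t ht => by
    refine ⟨div_nonneg (sq_nonneg _) (hN t ht).le, ?_⟩
    rw [div_le_iff₀ (hN t ht), ← sq, ← sq_abs (D t)]
    have := O.abs_D_le t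
    gcongr
  have he : Tendsto (fun t => D t ^ 2 / N t) atTop (𝓝 0) :=
    tendsto_of_tendsto_of_tendsto_of_le_of_le' tendsto_const_nhds hN0
      ((eventually_ge_atTop 0).mono fun t ht => (be t ht).1)
      ((eventually_ge_atTop 0).mono fun t ht => (be t ht).2)
  obtain ⟨X, hXd⟩ : ∃ X : ℝ → ℝ, X = fun t => 2 * u t / N t := ⟨_, rfl⟩
  obtain ⟨Y, hYd⟩ : ∃ Y : ℝ → ℝ, Y = fun t => 2 * v t / N t := ⟨_, rfl⟩
  obtain ⟨e, hed⟩ : ∃ e : ℝ → ℝ, e = fun t => D t ^ 2 / N t := ⟨_, rfl⟩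
  have hX' : ∀ t, X t = 2 * u t / N t := fun t => by rw [hXd]
  have hY' : ∀ t, Y t = 2 * v t / N t := fun t => by rw [hYd]
  have he' : ∀ t, e t = D t ^ 2 / N t := fun t => by rw [hed]
  simp only [← hX', ← hY', ← he'] at *
  have beM : ∀ t, 0 ≤ t → |e t| ≤ M := fun t ht => by
    rw [abs_of_nonneg (be t ht).1]; exact (be t ht).2.trans (hMN t ht)
  have bX' : ∀ t, 0 ≤ t → |κ - γ * Y t - κ * X t ^ 2 + X t * e t| ≤ κ + γ + κ + M := fun t ht => by
    refine (abs_add_le _ _).trans (add_le_add ((abs_sub _ _).trans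
      (add_le_add ((abs_sub _ _).trans (add_le_add ?_ ?_)) ?_)) ?_)
    · rw [abs_of_pos hκ]
    · rw [abs_mul, abs_of_pos hγ]; exact mul_le_of_le_one_right hγ.le (bY t ht)
    · rw [abs_mul, abs_of_pos hκ, abs_pow]
      exact mul_le_of_le_one_right hκ.le (pow_le_one₀ (abs_nonneg _) (bX t ht))
    · rw [abs_mul]
      exact (mul_le_of_le_one_left (abs_nonneg _) (bX t ht)).trans (beM t ht)
  have bY' : ∀ t, 0 ≤ t → |γ * X t - κ * X t * Y t + Y t * e t| ≤ γ + κ + M := fun t ht => by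
    refine (abs_add_le _ _).trans (add_le_add ((abs_sub _ _).trans (add_le_add ?_ ?_)) ?_)
    · rw [abs_mul, abs_of_pos hγ]; exact mul_le_of_le_one_right hγ.le (bX t ht)
    · rw [abs_mul, abs_mul, abs_of_pos hκ, mul_assoc]
      exact mul_le_of_le_one_right hκ.le (mul_le_one₀ (bX t ht) (abs_nonneg _) (bY t ht))
    · rw [abs_mul]
      exact (mul_le_of_le_one_left (abs_nonneg _) (bY t ht)).trans (beM t ht)
  -- The derivative of `sX - cY` is `κs - γ(sY + cX)` plus `(sX - cY)(e - κX)`, and the latter tends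
  -- to `0`. Barbalat's lemma gives `sY + cX → κs/γ`; together with `sX - cY → 0` this makes `X` and
  -- `Y` converge.
  have dg := (DerivOn.affine (κ * s) 0 0 (Ici 0)).sub
    (((dY.const_mul s).add (dX.const_mul c)).const_mul γ)
  have lim := ((dX.const_mul s).sub (dY.const_mul c)).tendsto_zero_of_sub dg
    (K := γ * (|s| * (γ + κ + M) + |c| * (κ + γ + κ + M))) (fun t ht => ?_) hl ?_
  · have lX : Tendsto X atTop (𝓝 (κ * s / γ * c)) := by
      have h1 := (((lim.const_sub (κ * s)).div_const γ).mul_const c).add (hl.mul_const s)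
      simp only [sub_zero, zero_mul, add_zero] at h1
      refine h1.congr fun t => ?_
      field_simp
      linear_combination γ * X t * hsc
    have lY : Tendsto Y atTop (𝓝 (κ * s / γ * s)) := by
      have h1 := (((lim.const_sub (κ * s)).div_const γ).mul_const s).sub (hl.mul_const c)
      simp only [sub_zero, zero_mul, add_zero] at h1
      refine h1.congr fun t => ?_
      field_simp
      linear_combination γ * Y t * hsc
    set x := κ * s / γ * c
    set y := κ * s / γ * s
    have hy : y ≤ 1 := le_of_tendsto lY ((eventually_ge_atTop 0).mono fun t ht =>
      (abs_le.1 (bY t ht)).2)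
    -- The limit is an equilibrium of the limiting system. As `y ≤ 1` and `κ < γ`, the factor `γ -
    -- κy` is nonzero, so `x = 0`, and then `γy = κ`.
    have h1 := dY.limit_deriv_eq_zero lY (((lX.const_mul γ).sub ((lX.const_mul κ).mul lY)).add
      (lY.mul he))
    have hx : x = 0 := by
      have : x * (γ - κ * y) = 0 := by linarith
      rcases mul_eq_zero.1 this with h2 | h2
      · exact h2
      · nlinarith
    have h2 := dX.limit_deriv_eq_zero lX ((((lY.const_mul γ).const_sub κ).sub
      ((lX.pow 2).const_mul κ)).add (lX.mul he))
    rw [hx] at h2 lX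
    have hy' : y = κ / γ := by
      rw [eq_div_iff hγ.ne']; linarith
    rw [hy'] at lY
    exact ⟨lX, lY⟩
  · rw [zero_sub, abs_neg, abs_mul, abs_of_pos hγ]
    gcongr
    refine (abs_add_le _ _).trans (add_le_add ?_ ?_)
    · rw [abs_mul]; gcongr; exact bY' t ht
    · rw [abs_mul]; gcongr; exact bX' t ht
  · have h1 : Tendsto (fun t => -(κ * X t) * (s * X t - c * Y t) + (s * X t - c * Y t) * e t) atTop
        (𝓝 0) := by
      have h2 : Tendsto (fun t => (s * X t - c * Y t) * (-(κ * X t))) atTop (𝓝 0) := by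
        refine hl.zero_mul_isBoundedUnder_le (isBoundedUnder_of_eventually_le (a := κ)
          ((eventually_ge_atTop 0).mono fun t ht => ?_))
        simp only [Function.comp_apply, Real.norm_eq_abs, abs_neg, abs_mul, abs_of_pos hκ]
        exact mul_le_of_le_one_right hκ.le (bX t ht)
      have h3 := h2.add (hl.mul he)
      simp only [zero_mul, add_zero] at h3
      exact h3.congr fun t => by ring
    refine h1.congr fun t => ?_
    ring

end Orbit

/-! ### Bounded contraction of the rescaled flow. -/

section Contraction

variable {α κ ω γ : ℝ}

theorem stokesN_add_le (w z : ℂ × ℂ) : stokesN (w + z) ≤ 2 * stokesN w + 2 * stokesN z := by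
  have : 2 * stokesN w + 2 * stokesN z = stokesN (w + z) + stokesN (w - z) := by
    simp only [stokesN, Complex.normSq_apply, Prod.fst_sub, Prod.snd_sub, Complex.sub_re,
      Complex.sub_im, Prod.fst_add, Prod.snd_add, Complex.add_re, Complex.add_im]
    ring
  linarith [stokesN_nonneg (w - z)]

theorem flipSnd_sub (w z : ℂ × ℂ) : flipSnd (w - z) = flipSnd w - flipSnd z := by
  simp [flipSnd, neg_add_eq_sub]

theorem abs_stokesD_le (w : ℂ × ℂ) : |stokesD w| ≤ stokesN w :=
  abs_le_of_sq_le_sq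
    (by nlinarith [stokes_identity w, sq_nonneg (stokesU w), sq_nonneg (stokesV w)])
    (stokesN_nonneg w)

/-- A Lipschitz bound for the two parts of the cubic term, through `ax - by = a(x - y) + (a - b)y`.
It is applied with `x, y` equal to `w, z` and to their reflections. -/
theorem stokesN_smul_sub_smul_le {w z x y : ℂ × ℂ} {a b B : ℝ} (hB : 0 < B) (ha : |a| ≤ B)
    (hz : stokesN y ≤ B) (hxy : stokesN (x - y) = stokesN (w - z))
    (hab : (a - b) ^ 2 ≤ stokesN (w - z) * (4 * B)) :
    stokesN (a • x - b • y) ≤ (4 * B) ^ 2 * stokesN (w - z) := by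
  have e : a • x - b • y = a • (x - y) + (a - b) • y := by
    rw [smul_sub, sub_smul]; abel
  rw [e]
  refine (stokesN_add_le _ _).trans ?_
  rw [stokesN_smul, stokesN_smul, hxy]
  have hn := stokesN_nonneg (w - z)
  have hy := stokesN_nonneg y
  have h1 : a ^ 2 * stokesN (w - z) ≤ B ^ 2 * stokesN (w - z) := by
    rw [← sq_abs a]; gcongr
  have h2 : (a - b) ^ 2 * stokesN y ≤ stokesN (w - z) * (4 * B) * B := by gcongr
  nlinarith [mul_nonneg (sq_nonneg B) hn]

theorem abs_detuningForm_le_of_stokesN_le (hκ : 0 ≤ κ) (hγ : 0 ≤ γ) {x y : ℂ × ℂ} {k : ℝ}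
    (hk : 0 < k) (h : stokesN x ≤ k ^ 2 * stokesN y) :
    |detuningForm κ γ x y| ≤ k * ((γ + κ) * stokesN y) := by
  have h1 := abs_detuningForm_le hκ hγ (k⁻¹ • x) ((1 : ℝ) • y)
  rw [detuningForm_smul, mul_one, abs_mul, abs_of_pos (inv_pos.2 hk), stokesN_smul, one_smul,
    inv_mul_le_iff₀ hk] at h1
  refine h1.trans ?_
  have : k⁻¹ ^ 2 * stokesN x ≤ stokesN y := by
    rw [inv_pow, inv_mul_le_iff₀ (by positivity)]; exact h
  gcongr
  linarith

theorem derivOn_detuningForm_sub (hγ : γ = 2 * ω) {w z : ℝ → ℂ × ℂ} (hw : IsSolution α κ ω w)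
    (hz : IsSolution α κ ω z) :
    DerivOn (fun t => detuningForm κ γ (w t - z t) (w t - z t))
      (fun t => (2 * α - κ) * detuningForm κ γ (w t - z t) (w t - z t)
        - detuningForm κ γ (stokesN (w t) • w t - stokesN (z t) • z t) (w t - z t)
        - detuningForm κ γ (stokesD (w t) • flipSnd (w t) - stokesD (z t) • flipSnd (z t))
          (w t - z t)) (Ici 0) := by
  have h := (((derivOn_detuningForm (κ := κ) hγ hw hw).add
    (derivOn_detuningForm hγ hz hz)).sub ((derivOn_detuningForm hγ hw hz).const_mul 2))
  simp only [← detuningForm_sub_self] at h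
  refine h.congr fun t _ => ?_
  generalize stokesN (w t) = nw
  generalize stokesD (w t) = dw
  generalize stokesN (z t) = nz
  generalize stokesD (z t) = dz
  simp only [detuningForm, flipSnd, Complex.neg_re, Complex.neg_im, Prod.fst_sub, Prod.snd_sub,
    Complex.sub_re, Complex.sub_im, Prod.smul_fst, Prod.smul_snd, Complex.smul_re, Complex.smul_im,
    smul_eq_mul]
  ring

theorem detuningForm_sub_rate (hκ : 0 < κ) (h : κ < γ) {w z : ℂ × ℂ} {B : ℝ} (hB : 0 < B)
    (hw : stokesN w ≤ B) (hz : stokesN z ≤ B) :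
    detuningForm κ γ (stokesN w • w - stokesN z • z) (w - z)
      + detuningForm κ γ (stokesD w • flipSnd w - stokesD z • flipSnd z) (w - z)
      ≤ 8 * (γ + κ) / (γ - κ) * B * detuningForm κ γ (w - z) (w - z) := by
  have hg : 0 < γ - κ := sub_pos.2 h
  have hγ : 0 < γ := hκ.trans h
  have hn := stokesN_nonneg (w - z)
  obtain ⟨h1, h2⟩ := sq_stokes_sub_le w z
  have h3 : stokesN (w - z) * (2 * (stokesN w + stokesN z)) ≤ stokesN (w - z) * (4 * B) :=
    mul_le_mul_of_nonneg_left (by linarith) hn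
  have a1 := abs_detuningForm_le_of_stokesN_le hκ.le hγ.le (by positivity : 0 < 4 * B)
    (stokesN_smul_sub_smul_le hB (by rwa [abs_of_nonneg (stokesN_nonneg w)]) hz rfl (h1.trans h3))
  have a2 := abs_detuningForm_le_of_stokesN_le hκ.le hγ.le (by positivity : 0 < 4 * B)
    (stokesN_smul_sub_smul_le (x := flipSnd w) (y := flipSnd z) hB ((abs_stokesD_le w).trans hw)
      (by rwa [stokesN_flipSnd]) (by rw [← flipSnd_sub, stokesN_flipSnd]) (h2.trans h3))
  have h4 : stokesN (w - z) ≤ detuningForm κ γ (w - z) (w - z) / (γ - κ) := by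
    rw [le_div_iff₀ hg, mul_comm]; exact le_detuningForm_self hκ _
  calc _ ≤ 4 * B * ((γ + κ) * stokesN (w - z)) + 4 * B * ((γ + κ) * stokesN (w - z)) :=
        add_le_add ((le_abs_self _).trans a1) ((le_abs_self _).trans a2)
    _ = 8 * (γ + κ) * B * stokesN (w - z) := by ring
    _ ≤ 8 * (γ + κ) * B * (detuningForm κ γ (w - z) (w - z) / (γ - κ)) := by gcongr
    _ = _ := by ring

theorem stokesN_le_exp (hκ : 0 < κ) (hγ : γ = 2 * ω) (h : κ < γ) {z : ℝ → ℂ × ℂ}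
    (hz : IsSolution α κ ω z) {t : ℝ} (ht : 0 ≤ t) :
    stokesN (z t) ≤ (γ + κ) / (γ - κ) * stokesN (z 0) * Real.exp ((2 * α - κ) * t) := by
  have hg : 0 < γ - κ := sub_pos.2 h
  have h1 := (hz.orbit hγ).hW.le_mul_exp (c := 2 * α - κ) (fun s hs => ?_) ht
  · simp only [sub_zero, ← detuningForm_self] at h1
    have h2 := (le_detuningForm_self hκ (z t)).trans (h1.trans
      (mul_le_mul_of_nonneg_right (detuningForm_self_le hκ (z 0)) (Real.exp_pos _).le))
    rw [div_mul_eq_mul_div, div_mul_eq_mul_div, le_div_iff₀ hg]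
    linarith
  · rw [← detuningForm_self]
    have h2 : 0 ≤ detuningForm κ γ (z s) (z s) :=
      (mul_nonneg hg.le (stokesN_nonneg _)).trans (le_detuningForm_self hκ _)
    nlinarith [mul_nonneg (stokesN_nonneg (z s)) h2,
      mul_nonneg (hκ.trans h).le (sq_nonneg (stokesD (z s)))]

/-- The rescaled flow expands distances at most by a bounded factor, backwards in time. -/
theorem exists_antilipschitz (hκ : 0 < κ) (hγ : γ = 2 * ω) (h : κ < γ) (hα : 2 * α < κ) {M : ℝ}
    (hM : 0 < M) : ∃ L : ℝ, 0 ≤ L ∧ ∀ w z : ℝ → ℂ × ℂ, IsSolution α κ ω w → IsSolution α κ ω z →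
      stokesN (w 0) ≤ M → stokesN (z 0) ≤ M → ∀ t, 0 ≤ t →
      ‖w 0 - z 0‖ ≤ L * ‖Real.exp ((κ - 2 * α) / 2 * t) • (w t - z t)‖ := by
  have hg : 0 < γ - κ := sub_pos.2 h
  have hγ0 : 0 < γ := hκ.trans h
  have hc : 0 < κ - 2 * α := by linarith
  set C := (γ + κ) / (γ - κ) * M with hC
  set k := 8 * (γ + κ) / (γ - κ) with hk
  -- This is the integral over all positive times of `kC exp((2α - κ)t)`, the largest additional
  -- contraction rate caused by the cubic terms. The form of `w - z` times the integrating factor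
  -- below is nondecreasing, and the total loss is at most the factor `exp A`.
  set A := k * C / (κ - 2 * α) with hA
  have hAc : A * (κ - 2 * α) = k * C := by rw [hA]; field_simp
  have hA0 : 0 ≤ A := by positivity
  refine ⟨√(2 * (γ + κ) / (γ - κ) * Real.exp A), Real.sqrt_nonneg _,
    fun w z hw hz hw0 hz0 t ht => ?_⟩
  have hexp : DerivOn (fun t => Real.exp ((κ - 2 * α) * t + A * (1 - Real.exp ((2 * α - κ) * t))))
      (fun t => Real.exp ((κ - 2 * α) * t + A * (1 - Real.exp ((2 * α - κ) * t)))
        * ((κ - 2 * α) + k * C * Real.exp ((2 * α - κ) * t))) (Ici 0) := fun s _ => by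
    have h1 : HasDerivAt (fun t => Real.exp ((2 * α - κ) * t))
        (Real.exp ((2 * α - κ) * s) * (2 * α - κ)) s := by
      simpa using ((hasDerivAt_id s).const_mul (2 * α - κ)).exp
    have h2 : HasDerivAt (fun t => (κ - 2 * α) * t) (κ - 2 * α) s := by
      simpa using (hasDerivAt_id s).const_mul (κ - 2 * α)
    refine ((h2.add ((h1.const_sub 1).const_mul A)).exp.congr_deriv ?_).hasDerivWithinAt
    rw [← hAc]
    simp only [Pi.add_apply]
    ring
  have mono := ((derivOn_detuningForm_sub (κ := κ) hγ hw hz).mul hexp).monotoneOn (convex_Ici 0)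
    (fun s hs => ?_) self_mem_Ici ht ht
  · simp only [mul_zero, Real.exp_zero, sub_self, add_zero, mul_one] at mono
    have hV : 0 ≤ detuningForm κ γ (w t - z t) (w t - z t) :=
      (mul_nonneg hg.le (stokesN_nonneg _)).trans (le_detuningForm_self hκ _)
    have h1 : Real.exp ((κ - 2 * α) * t + A * (1 - Real.exp ((2 * α - κ) * t)))
        ≤ Real.exp A * Real.exp ((κ - 2 * α) / 2 * t) ^ 2 := by
      rw [sq, ← Real.exp_add, ← Real.exp_add]
      refine Real.exp_le_exp.2 ?_
      nlinarith [mul_nonneg hA0 (Real.exp_pos ((2 * α - κ) * t)).le]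
    set E := Real.exp ((κ - 2 * α) / 2 * t)
    have h2 : (γ - κ) * ‖w 0 - z 0‖ ^ 2 ≤ (γ + κ) * (2 * ‖w t - z t‖ ^ 2) * (Real.exp A * E ^ 2) := by
      calc (γ - κ) * ‖w 0 - z 0‖ ^ 2 ≤ (γ - κ) * stokesN (w 0 - z 0) := by
            gcongr
            have := pow_le_pow_left₀ (norm_nonneg _) (norm_le_sqrt_stokesN (w 0 - z 0)) 2
            rwa [Real.sq_sqrt (stokesN_nonneg _)] at this
        _ ≤ _ := le_detuningForm_self hκ _
        _ ≤ _ := mono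
        _ ≤ detuningForm κ γ (w t - z t) (w t - z t) * (Real.exp A * E ^ 2) := by gcongr
        _ ≤ _ := by
            gcongr
            exact (detuningForm_self_le hκ _).trans (by gcongr; exact stokesN_le_norm _)
    refine le_of_sq_le_sq ?_ (by positivity)
    rw [mul_pow, Real.sq_sqrt (by positivity), norm_smul, Real.norm_of_nonneg (Real.exp_pos _).le,
      mul_pow, div_mul_eq_mul_div, div_mul_eq_mul_div, le_div_iff₀ hg]
    linarith
  · have hs0 : 0 ≤ s := hs
    have bound : ∀ z : ℝ → ℂ × ℂ, IsSolution α κ ω z → stokesN (z 0) ≤ M →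
        stokesN (z s) ≤ C * Real.exp ((2 * α - κ) * s) := fun z hz hz0 =>
      (stokesN_le_exp hκ hγ h hz hs0).trans (by rw [hC]; gcongr)
    have h1 := detuningForm_sub_rate hκ h (by positivity) (bound w hw hw0) (bound z hz hz0)
    have h2 := Real.exp_pos ((κ - 2 * α) * s + A * (1 - Real.exp ((2 * α - κ) * s)))
    rw [← hk] at h1
    nlinarith [mul_le_mul_of_nonneg_right h1 h2.le]

end Contraction

/-! ### Null sets, and data with the limiting polarization. -/

section Measure

/-- A map that does not contract distances on a set by more than a bounded factor cannot shrink
this set to a null set. -/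
theorem hausdorffMeasure_le_image {E : Type*} [NormedAddCommGroup E] [MeasurableSpace E]
    [BorelSpace E] {s : Set E} {f : E → E} {L : NNReal} {d : ℝ} (hd : 0 ≤ d)
    (h : ∀ x ∈ s, ∀ y ∈ s, ‖x - y‖ ≤ L * ‖f x - f y‖) :
    μH[d] s ≤ (L : ENNReal) ^ d * μH[d] (f '' s) := by
  have h1 : AntilipschitzWith L (fun x : s => f x) := AntilipschitzWith.of_le_mul_dist fun x y => by
    rw [Subtype.dist_eq, dist_eq_norm, dist_eq_norm]
    exact h x x.2 y y.2
  have h2 := h1.le_hausdorffMeasure_image hd univ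
  have h3 := (isometry_subtype_coe (s := s)).hausdorffMeasure_image (Or.inl hd) univ
  rwa [← h3, image_univ, Subtype.range_coe, image_univ, ← image_eq_range] at h2

variable {κ γ : ℝ}

/-- The points that carry the limiting polarization of the system above the locking threshold,
up to an error `ε`. -/
def polarizedSet (κ γ C ε : ℝ) : Set (ℂ × ℂ) :=
  {w | stokesN w ≤ C ∧ |2 * stokesU w| ≤ ε * stokesN w ∧
    |2 * stokesV w - κ / γ * stokesN w| ≤ ε * stokesN w}

theorem isClosed_polarizedSet (C ε : ℝ) : IsClosed (polarizedSet κ γ C ε) := by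
  have h1 := continuous_stokesN
  have h2 := continuous_stokesU
  have h3 := continuous_stokesV
  exact (isClosed_le h1 continuous_const).inter ((isClosed_le
    (h2.const_mul 2).abs (h1.const_mul ε)).inter
    (isClosed_le ((h3.const_mul 2).sub (h1.const_mul _)).abs (h1.const_mul ε)))

theorem isCompact_polarizedSet (C ε : ℝ) : IsCompact (polarizedSet κ γ C ε) :=
  Metric.isCompact_of_isClosed_isBounded (isClosed_polarizedSet C ε)
    ((Metric.isBounded_closedBall (x := (0 : ℂ × ℂ)) (r := √C)).subset fun w hw => by
      rw [mem_closedBall_zero_iff]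
      exact (norm_le_sqrt_stokesN w).trans (Real.sqrt_le_sqrt hw.1))

theorem polarizedSet_mono {C ε δ : ℝ} (h : ε ≤ δ) : polarizedSet κ γ C ε ⊆ polarizedSet κ γ C δ :=
  fun w hw => ⟨hw.1, hw.2.1.trans (mul_le_mul_of_nonneg_right h (stokesN_nonneg w)),
    hw.2.2.trans (mul_le_mul_of_nonneg_right h (stokesN_nonneg w))⟩

/-- Under these relations the squared modulus of `z₁ - ikz₂`, with `k = κ/(γ - s)`, vanishes. The
two signs of `s` give the two complex eigenlines of the linear part. -/
theorem fst_eq_of_polarized (hκ : 0 < κ) (h : κ < γ) {w : ℂ × ℂ}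
    (hv : 2 * stokesV w = κ / γ * stokesN w) {s : ℝ} (hs : s ^ 2 = γ ^ 2 - κ ^ 2)
    (hD : stokesD w = s / γ * stokesN w) :
    w.1 = ((κ / (γ - s) : ℝ) : ℂ) * Complex.I * w.2 := by
  have hγ : 0 < γ := hκ.trans h
  have hne : γ - s ≠ 0 := fun h0 => by
    have : s = γ := by linarith
    rw [this] at hs
    nlinarith
  set k := κ / (γ - s) with hk
  have hk' : k * (γ - s) = κ := by rw [hk]; field_simp
  have h1 : Complex.normSq (w.1 - (k : ℂ) * Complex.I * w.2)
      = (stokesN w + stokesD w) / 2 + k ^ 2 * ((stokesN w - stokesD w) / 2)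
        - k * (2 * stokesV w) := by
    simp only [stokesN, stokesD, stokesV, Complex.normSq_apply]
    simp
    ring
  have h2 : (stokesN w + stokesD w) / 2 + k ^ 2 * ((stokesN w - stokesD w) / 2)
        - k * (2 * stokesV w) = 0 := by
    rw [hv, hD]
    have : (γ - s) * ((γ + s) + k ^ 2 * (γ - s) - 2 * k * κ) = 0 := by
      linear_combination (k * (γ - s) - κ) * hk' - hs
    have := (mul_eq_zero.1 this).resolve_left hne
    field_simp
    linear_combination stokesN w * this
  rw [h2, Complex.normSq_eq_zero, sub_eq_zero] at h1
  exact h1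

/-- In the intersection the errors vanish, so `u = 0` and `2v = (κ/γ)N`. The identity for `N²` then
leaves `D = ±(s/γ)N`, that is, two complex lines. -/
theorem measure_iInter_polarizedSet (hκ : 0 < κ) (h : κ < γ) (C : ℝ) (μ : Measure (ℂ × ℂ))
    [μ.IsAddHaarMeasure] : μ (⋂ n : ℕ, polarizedSet κ γ C (1 / ((n : ℝ) + 1))) = 0 := by
  have hγ : 0 < γ := hκ.trans h
  set s := √(γ ^ 2 - κ ^ 2)
  have hs : s ^ 2 = γ ^ 2 - κ ^ 2 := Real.sq_sqrt (by nlinarith)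
  refine measure_mono_null (fun w hw => ?_) (measure_union_null
    (addHaar_line μ (((κ / (γ - s) : ℝ) : ℂ) * Complex.I))
    (addHaar_line μ (((κ / (γ - -s) : ℝ) : ℂ) * Complex.I)))
  have key : ∀ x : ℝ, (∀ n : ℕ, |x| ≤ 1 / ((n : ℝ) + 1) * stokesN w) → x = 0 := fun x hx => by
    have h1 := ge_of_tendsto' ((tendsto_one_div_add_atTop_nhds_zero_nat (𝕜 := ℝ)).mul_const
      (stokesN w)) hx
    rw [zero_mul] at h1
    exact abs_eq_zero.1 (le_antisymm h1 (abs_nonneg x))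
  have hw' := fun n => mem_iInter.1 hw n
  have hu := key _ fun n => (hw' n).2.1
  have hv := key _ fun n => (hw' n).2.2
  have hu0 : stokesU w = 0 := by linarith
  have hv0 : 2 * stokesV w = κ / γ * stokesN w := by linarith
  have hD : (stokesD w - s / γ * stokesN w) * (stokesD w - -s / γ * stokesN w) = 0 := by
    have h1 := stokes_identity w
    rw [hu0] at h1
    have : (stokesD w - s / γ * stokesN w) * (stokesD w - -s / γ * stokesN w)
        = stokesD w ^ 2 + (2 * stokesV w) ^ 2 - stokesN w ^ 2
          - ((2 * stokesV w) ^ 2 - (κ / γ * stokesN w) ^ 2)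
          - (s ^ 2 - (γ ^ 2 - κ ^ 2)) * stokesN w ^ 2 / γ ^ 2 := by
      field_simp
      ring
    rw [this, hs, hv0]
    rw [← hv0]
    linear_combination -h1
  rcases mul_eq_zero.1 hD with h1 | h1
  · exact Or.inl (fst_eq_of_polarized hκ h hv0 hs (by linarith))
  · exact Or.inr (fst_eq_of_polarized hκ h hv0 (by rwa [neg_sq]) (by linarith))

end Measure

/-! ### Incoherence for almost every initial datum. -/

section Drift

variable {α κ ω γ : ℝ}

theorem polarization_of_phaseLocked (hκ : 0 < κ) (hγ : γ = 2 * ω) (h : κ < γ)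
    {z : ℝ → ℂ × ℂ} (hz : IsSolution α κ ω z) (h0 : 0 < stokesN (z 0))
    (hN0 : Tendsto (fun t => stokesN (z t)) atTop (𝓝 0)) (hl : PhaseLocked z) :
    Tendsto (fun t => 2 * stokesU (z t) / stokesN (z t)) atTop (𝓝 0) ∧
      Tendsto (fun t => 2 * stokesV (z t) / stokesN (z t)) atTop (𝓝 (κ / γ)) := by
  obtain ⟨θ, hθ⟩ := hl
  have O := hz.orbit hγ
  refine O.polarization_limit hκ h h0 hN0 (Real.sin_sq_add_cos_sq θ) ?_
  have hθ' : Tendsto (fun t => phaseFactor (z t)) atTop (𝓝 (unitAt θ)) := hθ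
  rw [unitAt_eq_mk] at hθ'
  have h1 := ((Complex.continuous_re.tendsto _).comp hθ').const_mul (Real.sin θ)
  have h2 := ((Complex.continuous_im.tendsto _).comp hθ').const_mul (Real.cos θ)
  have h3 := h1.sub h2
  have e0 : Real.sin θ * Real.cos θ - Real.cos θ * Real.sin θ = 0 := by ring
  simp only [e0] at h3
  have h4 := h3.zero_mul_isBoundedUnder_le (g := fun t =>
      ‖(⟨2 * stokesU (z t) / stokesN (z t), 2 * stokesV (z t) / stokesN (z t)⟩ : ℂ)‖)
    (isBoundedUnder_of_eventually_le (a := 2) ((eventually_ge_atTop 0).mono fun t ht => ?_))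
  · refine h4.congr' ((eventually_ge_atTop 0).mono fun t ht => ?_)
    have hN := O.N_pos hκ h0 ht
    simp only [Function.comp_apply, phaseFactor_eq_normalized _ hN]
    rw [Complex.div_ofReal_re, Complex.div_ofReal_im]
    set p : ℂ := ⟨2 * stokesU (z t) / stokesN (z t), 2 * stokesV (z t) / stokesN (z t)⟩ with hp
    have e1 : 2 * stokesU (z t) / stokesN (z t) = p.re := rfl
    have e2 : 2 * stokesV (z t) / stokesN (z t) = p.im := rfl
    rw [e1, e2]
    by_cases hp0 : p = 0
    · simp [hp0]
    · have := norm_ne_zero_iff.2 hp0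
      field_simp
  · have hN := O.N_pos hκ h0 ht
    simp only [Function.comp_apply, norm_norm]
    refine (Complex.norm_le_abs_re_add_abs_im _).trans ?_
    have b1 : |2 * stokesU (z t) / stokesN (z t)| ≤ 1 := by
      rw [abs_div, abs_of_pos hN, div_le_one hN]; exact O.abs_u_le t
    have b2 : |2 * stokesV (z t) / stokesN (z t)| ≤ 1 := by
      rw [abs_div, abs_of_pos hN, div_le_one hN]; exact O.abs_v_le t
    linarith

/-- The map from the datum to the state at time `T`, rescaled by `exp((κ - 2α)T/2)`, carries the
data polarized up to `1/(n + 1)` from time `T` on into one compact set `S n`, and it contracts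
distances by a factor bounded uniformly in `T`. The measure of the basin is thus at most a constant
times that of `S n`. These sets decrease to a null set. -/
theorem hausdorffMeasure_polarized_basin (hκ : 0 < κ) (hγ : γ = 2 * ω) (h : κ < γ)
    (hα : 2 * α < κ) {M : ℝ} (hM : 0 < M) {Z : ℂ × ℂ → ℝ → ℂ × ℂ}
    (hZ : ∀ p, IsSolution α κ ω (Z p)) (hZ0 : ∀ p, Z p 0 = p) :
    μH[(Module.finrank ℝ (ℂ × ℂ) : ℝ)] {p | 0 < stokesN p ∧ stokesN p ≤ M ∧
      Tendsto (fun t => 2 * stokesU (Z p t) / stokesN (Z p t)) atTop (𝓝 0) ∧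
      Tendsto (fun t => 2 * stokesV (Z p t) / stokesN (Z p t)) atTop (𝓝 (κ / γ))} = 0 := by
  have hg : 0 < γ - κ := sub_pos.2 h
  have hγ0 : 0 < γ := hκ.trans h
  obtain ⟨L, hL, hLip⟩ := exists_antilipschitz hκ hγ h hα hM
  set d := Module.finrank ℝ (ℂ × ℂ)
  set C := (γ + κ) / (γ - κ) * M with hC
  set S : ℕ → Set (ℂ × ℂ) := fun n => polarizedSet κ γ C (1 / ((n : ℝ) + 1)) with hS
  set P := {p | 0 < stokesN p ∧ stokesN p ≤ M ∧
      Tendsto (fun t => 2 * stokesU (Z p t) / stokesN (Z p t)) atTop (𝓝 0) ∧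
      Tendsto (fun t => 2 * stokesV (Z p t) / stokesN (Z p t)) atTop (𝓝 (κ / γ))}
  obtain ⟨L, rfl⟩ : ∃ l : NNReal, (l : ℝ) = L := ⟨⟨L, hL⟩, rfl⟩
  set K : ENNReal := (L : ENNReal) ^ (d : ℝ) with hK
  have hKtop : K ≠ ⊤ := ENNReal.rpow_ne_top_of_nonneg (Nat.cast_nonneg _) ENNReal.coe_ne_top
  have bound : ∀ n, μH[(d : ℝ)] P ≤ K * μH[(d : ℝ)] (S n) := fun n => by
    set ε : ℝ := 1 / ((n : ℝ) + 1)
    have hε : 0 < ε := by positivity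
    -- The sets `B T` increase with `T` and cover the basin. A bound for each of them that is
    -- uniform in `T` passes to the union.
    set B : ℕ → Set (ℂ × ℂ) := fun T => {p | stokesN p ≤ M ∧ ∀ t, (T : ℝ) ≤ t →
      |2 * stokesU (Z p t)| ≤ ε * stokesN (Z p t) ∧
      |2 * stokesV (Z p t) - κ / γ * stokesN (Z p t)| ≤ ε * stokesN (Z p t)} with hB
    have hmono : Monotone B := fun T T' hT p hp =>
      ⟨hp.1, fun t ht => hp.2 t (le_trans (by exact_mod_cast hT) ht)⟩
    have hsub : P ⊆ ⋃ T, B T := fun p hp => by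
      obtain ⟨p0, pM, pu, pv⟩ := hp
      have e1 := (Metric.tendsto_nhds.1 pu ε hε).and
        ((Metric.tendsto_nhds.1 pv ε hε).and (eventually_ge_atTop 0))
      obtain ⟨T, hT⟩ := eventually_atTop.1 e1
      obtain ⟨m, hm⟩ := exists_nat_ge T
      refine mem_iUnion.2 ⟨m, pM, fun t ht => ?_⟩
      obtain ⟨q1, q2, q3⟩ := hT t (hm.trans ht)
      have hN : 0 < stokesN (Z p t) := ((hZ p).orbit hγ).N_pos hκ (by rwa [hZ0]) q3
      rw [Real.dist_eq] at q1 q2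
      constructor
      · rw [sub_zero, abs_div, abs_of_pos hN, div_lt_iff₀ hN] at q1
        exact q1.le
      · have : 2 * stokesV (Z p t) - κ / γ * stokesN (Z p t)
            = (2 * stokesV (Z p t) / stokesN (Z p t) - κ / γ) * stokesN (Z p t) := by
          field_simp
        rw [this, abs_mul, abs_of_pos hN]
        exact mul_le_mul_of_nonneg_right q2.le hN.le
    refine (measure_mono hsub).trans ?_
    rw [hmono.measure_iUnion]
    refine iSup_le fun T => ?_
    set E : ℝ := Real.exp ((κ - 2 * α) / 2 * T)
    refine (hausdorffMeasure_le_image (f := fun p => E • Z p T) (L := L) (Nat.cast_nonneg _)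
      fun p hp q hq => ?_).trans ?_
    · have := hLip (Z p) (Z q) (hZ p) (hZ q) (by rw [hZ0]; exact hp.1) (by rw [hZ0]; exact hq.1) T
        (Nat.cast_nonneg _)
      rw [hZ0, hZ0, smul_sub] at this
      exact this
    · refine mul_le_mul_right (measure_mono ?_) _
      rintro _ ⟨p, hp, rfl⟩
      have hu : stokesU (E • Z p T) = E ^ 2 * stokesU (Z p T) := by
        simp only [stokesU, Prod.smul_fst, Prod.smul_snd, Complex.smul_re, Complex.smul_im,
          smul_eq_mul]
        ring
      have hv : stokesV (E • Z p T) = E ^ 2 * stokesV (Z p T) := by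
        simp only [stokesV, Prod.smul_fst, Prod.smul_snd, Complex.smul_re, Complex.smul_im,
          smul_eq_mul]
        ring
      have hE : 0 < E := Real.exp_pos _
      obtain ⟨h1, h2⟩ := hp.2 T le_rfl
      refine ⟨?_, ?_, ?_⟩
      · rw [stokesN_smul]
        have h3 := stokesN_le_exp hκ hγ h (hZ p) (Nat.cast_nonneg T)
        rw [hZ0] at h3
        have h4 : E ^ 2 * Real.exp ((2 * α - κ) * T) = 1 := by
          rw [sq, ← Real.exp_add, ← Real.exp_add, ← Real.exp_zero]
          ring_nf
        calc E ^ 2 * stokesN (Z p T)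
            ≤ E ^ 2 * ((γ + κ) / (γ - κ) * stokesN p * Real.exp ((2 * α - κ) * T)) := by gcongr
          _ = (γ + κ) / (γ - κ) * stokesN p * (E ^ 2 * Real.exp ((2 * α - κ) * T)) := by ring
          _ = (γ + κ) / (γ - κ) * stokesN p := by rw [h4, mul_one]
          _ ≤ C := by rw [hC]; gcongr; exact hp.1
      · rw [stokesN_smul, hu, mul_left_comm, abs_mul, abs_of_pos (by positivity : 0 < E ^ 2),
          mul_left_comm]
        gcongr
      · have : 2 * (E ^ 2 * stokesV (Z p T)) - κ / γ * (E ^ 2 * stokesN (Z p T))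
            = E ^ 2 * (2 * stokesV (Z p T) - κ / γ * stokesN (Z p T)) := by ring
        rw [stokesN_smul, hv, this, abs_mul, abs_of_pos (by positivity : 0 < E ^ 2),
          mul_left_comm ε]
        gcongr
  have lim := tendsto_measure_iInter_atTop (μ := μH[(d : ℝ)]) (s := S)
    (fun n => (isClosed_polarizedSet _ _).measurableSet.nullMeasurableSet)
    (fun m n hmn => polarizedSet_mono (by gcongr))
    ⟨0, (isCompact_polarizedSet _ _).measure_lt_top.ne⟩
  rw [measure_iInter_polarizedSet hκ h] at lim
  have lim2 := ENNReal.Tendsto.const_mul lim (Or.inr hKtop)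
  rw [mul_zero] at lim2
  exact le_antisymm (ge_of_tendsto' lim2 bound) zero_le

theorem ae_incoherent (hκ : 0 < κ) (hγ : γ = 2 * ω) (h : κ < γ) (hα : 2 * α < κ) :
    ∀ᵐ p : ℂ × ℂ, ∀ z : ℝ → ℂ × ℂ, IsSolution α κ ω z → z 0 = p →
      AmplitudeDeath z ∧ Incoherent z := by
  choose Z hZ hZ0 using fun p => exists_solution (α := α) ω hκ p
  have hμ : (volume : Measure (ℂ × ℂ)) ≪ μH[(Module.finrank ℝ (ℂ × ℂ) : ℝ)] := by
    rw [Measure.volume_eq_prod]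
    exact Measure.absolutelyContinuous_isAddHaarMeasure _ _
  have h1 : ∀ n : ℕ, ∀ᵐ p : ℂ × ℂ, p ∉ {p | 0 < stokesN p ∧ stokesN p ≤ (n : ℝ) + 1 ∧
      Tendsto (fun t => 2 * stokesU (Z p t) / stokesN (Z p t)) atTop (𝓝 0) ∧
      Tendsto (fun t => 2 * stokesV (Z p t) / stokesN (Z p t)) atTop (𝓝 (κ / γ))} := fun n =>
    measure_eq_zero_iff_ae_notMem.1
      (hμ (hausdorffMeasure_polarized_basin hκ hγ h hα (by positivity) hZ hZ0))
  have h2 : ∀ᵐ p : ℂ × ℂ, p ∉ {w : ℂ × ℂ | w.1 = 0 * w.2} := by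
    have := addHaar_line (volume.prod volume) 0
    rw [← Measure.volume_eq_prod] at this
    exact measure_eq_zero_iff_ae_notMem.1 this
  filter_upwards [ae_all_iff.2 h1, h2] with p hp1 hp2 z hz h0
  have hN : 0 < stokesN p := by
    refine stokesN_pos_iff.2 fun hp => hp2 ?_
    simp [hp]
  have hlim := (hz.orbit hγ).tendsto_zero hκ (hκ.trans h).le (Or.inr (Or.inl ⟨h, hα.le⟩))
  refine ⟨amplitudeDeath_of_tendsto hlim, fun hl => ?_⟩
  obtain ⟨l1, l2⟩ := polarization_of_phaseLocked hκ hγ h hz (by rwa [h0]) hlim hl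
  have hu : ∀ t, 0 ≤ t → z t = Z p t := fun t ht =>
    solution_unique hκ (hZ p) hz (by rw [h0, hZ0]) ht
  obtain ⟨n, hn⟩ := exists_nat_ge (stokesN p)
  refine hp1 n ⟨hN, by linarith, l1.congr' ?_, l2.congr' ?_⟩ <;>
  · filter_upwards [eventually_ge_atTop 0] with t ht
    rw [hu t ht]

end Drift

end TwinSL

end

theorem theorem1 (α κ ω γ : ℝ) (hκ : 0 < κ) (hω : 0 ≤ ω) (hγ : γ = 2 * ω) :
    -- forward solutions exist for all initial data
    (∀ p : ℂ × ℂ, ∃ z : ℝ → ℂ × ℂ, IsSolution α κ ω z ∧ z 0 = p) ∧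
    -- the set `R = 1` is an invariant manifold
    IsSmoothHypersurface manifoldM ∧
    (∀ (I : Set ℝ) (z : ℝ → ℂ × ℂ), I.OrdConnected → IsSolutionOn α κ ω I z →
      ∀ t₀ ∈ I, z t₀ ∈ manifoldM → ∀ t ∈ I, z t ∈ manifoldM) ∧
    -- asymptotic behaviour on the manifold
    (∀ z : ℝ → ℂ × ℂ, IsSolution α κ ω z → z 0 ∈ manifoldM →
      -- Active, Incoherent
      (κ < γ → κ < 2 * α → Active z ∧ Incoherent z ∧ PeriodicPhase z) ∧
      -- Amplitude Death, Incoherent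
      (κ < γ → 2 * α ≤ κ → AmplitudeDeath z ∧ Incoherent z ∧ PeriodicPhase z) ∧
      -- Amplitude Death, Phase-Locked
      (γ ≤ κ → (α ≤ 0 ∨ (2 * α ≤ γ ∧ κ ≤ kappaStar α γ)) → AmplitudeDeath z ∧ PhaseLocked z) ∧
      -- Active, Phase-Locked
      (γ ≤ κ → 0 < α → (γ < 2 * α ∨ kappaStar α γ < κ) →
        PhaseLocked z ∧
        ((γ < κ → phaseFactor (z 0) ≠ unitAt (unstableAngle κ γ)) →
          Active z ∧
          Tendsto (fun t => ‖(z t).1‖ ^ 2) atTop (𝓝 (lockedAmplitudeSq α κ γ)) ∧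
          Tendsto (fun t => ‖(z t).2‖ ^ 2) atTop (𝓝 (lockedAmplitudeSq α κ γ)))) ∧
      -- the limit and the rate of phase-locking: exponential for `γ < κ`, algebraic for `γ = κ`
      (γ < κ → phaseFactor (z 0) ≠ unitAt (unstableAngle κ γ) →
        PhaseLockedAt z (lockAngle κ γ) ∧
        ∃ C : ℝ, ∀ t, 0 ≤ t → ‖phaseFactor (z t) - unitAt (lockAngle κ γ)‖
          ≤ C * Real.exp (-(Real.sqrt (κ ^ 2 - γ ^ 2) * t))) ∧
      (γ = κ → PhaseLockedAt z (lockAngle κ γ) ∧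
        (phaseFactor (z 0) ≠ unitAt (lockAngle κ γ) →
          (fun t => ‖phaseFactor (z t) - unitAt (lockAngle κ γ)‖) =Θ[atTop]
            (fun t : ℝ => t⁻¹)))) ∧
    -- the rate of amplitude death for `α < 0`, and for `α = 0`
    (α < 0 → ∃ c > 0, ∀ z : ℝ → ℂ × ℂ, IsSolution α κ ω z →
      ∃ C : ℝ, ∀ t, 0 ≤ t → ‖(z t).1‖ ≤ C * Real.exp (-(c * t)) ∧
        ‖(z t).2‖ ≤ C * Real.exp (-(c * t))) ∧
    (α = 0 → ∀ z : ℝ → ℂ × ℂ, IsSolution α κ ω z →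
      ∃ C : ℝ, ∀ t, 0 ≤ t → ‖(z t).1‖ ≤ C * (1 + t) ^ (-(1 / 2 : ℝ)) ∧
        ‖(z t).2‖ ≤ C * (1 + t) ^ (-(1 / 2 : ℝ))) ∧
    (α = 0 → γ = 0 → ∀ z : ℝ → ℂ × ℂ, IsSolution α κ ω z → z 0 ∈ manifoldM →
      phaseFactor (z 0) ≠ unitAt (unstableAngle κ γ) →
      (fun t => ‖(z t).1‖) =Θ[atTop] (fun t : ℝ => t ^ (-(1 / 2 : ℝ))) ∧
      (fun t => ‖(z t).2‖) =Θ[atTop] (fun t : ℝ => t ^ (-(1 / 2 : ℝ)))) ∧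
    (α = 0 → 0 < γ → ∃ c > 0, ∀ z : ℝ → ℂ × ℂ, IsSolution α κ ω z → z 0 ∈ manifoldM →
      ∃ C : ℝ, ∀ t, 0 ≤ t → ‖(z t).1‖ ≤ C * Real.exp (-(c * t)) ∧
        ‖(z t).2‖ ≤ C * Real.exp (-(c * t))) ∧
    -- stability of the manifold
    (2 * α ≤ κ → GloballyAsymptoticallyStable α κ ω manifoldM) ∧
    (∀ p ∈ manifoldM,
      (κ < γ ∨ (κ = γ ∧ κ < 2 * α) ∨ phaseFactor p ≠ unitAt (unstableAngle κ γ)) →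
      RatioStableAt α κ ω p ∧ (γ ≤ κ ∨ κ ≤ 2 * α → RatioAttractingAt α κ ω p)) ∧
    -- stability of the asymptotic states
    (∀ z : ℝ → ℂ × ℂ, IsSolution α κ ω z → z 0 ∈ manifoldM →
      ((κ < γ ∨ (κ = γ ∧ κ < 2 * α) ∨ phaseFactor (z 0) ≠ unitAt (unstableAngle κ γ)) →
        AsymptoticStateStable α κ ω z) ∧
      ((κ < γ ∨ phaseFactor (z 0) ≠ unitAt (unstableAngle κ γ)) → LyapunovStable α κ ω z)) ∧
    ((α ≤ 0 ∨ (2 * α < κ ∧ κ < kappaStar α γ)) →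
      LyapunovStable α κ ω (fun _ => 0) ∧
      ∀ z : ℝ → ℂ × ℂ, IsSolution α κ ω z → AmplitudeDeath z) ∧
    -- convergence for almost all initial data in `ℂ²`
    (2 * α < κ → ∀ᵐ p : ℂ × ℂ, ∀ z : ℝ → ℂ × ℂ, IsSolution α κ ω z → z 0 = p →
      (κ < γ → AmplitudeDeath z ∧ Incoherent z) ∧
      (γ ≤ κ → PhaseLockedAt z (lockAngle κ γ) ∧
        ((α ≤ 0 ∨ κ ≤ kappaStar α γ) → AmplitudeDeath z) ∧
        (0 < α → kappaStar α γ < κ → Active z ∧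
          Tendsto (fun t => ‖(z t).1‖ ^ 2) atTop (𝓝 (lockedAmplitudeSq α κ γ)) ∧
          Tendsto (fun t => ‖(z t).2‖ ^ 2) atTop (𝓝 (lockedAmplitudeSq α κ γ))))) := by
  refine ⟨exists_solution ω hκ, isSmoothHypersurface_manifoldM,
    fun I z hI hz t₀ ht₀ hM t ht => invariance hI hz ht₀ hM ht,
    fun z hz h0 => manifold_asymptotics hκ hω hγ hz h0, fun hα => death_rate_neg hκ hα,
    fun hα z hz => death_rate_zero hκ hα hz,
    fun hα hγ0 z hz h0 hne => death_exact_rate hκ hγ hα hγ0 hz h0 hne,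
    fun hα hγ0 => death_exp_rate hκ hγ hα hγ0, fun h => globallyAsymptoticallyStable hκ h,
    fun p hp h => ?_, fun z hz h0 => ⟨fun h => (ratio_stability hκ hω hγ hz h0 h).2.2,
      fun h => lyapunovStable_of_mem_manifoldM hκ hω hγ hz h0 h⟩,
    fun h => origin_stable hκ hω hγ h, fun hα => ?_⟩
  · obtain ⟨z, hz, rfl⟩ := exists_solution (α := α) ω hκ p
    obtain ⟨h1, h2, -⟩ := ratio_stability hκ hω hγ hz hp h
    exact ⟨h1, h2⟩
  · rcases lt_or_ge κ γ with h | h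
    · filter_upwards [ae_incoherent hκ hγ h hα] with p hp z hz h0
      exact ⟨fun _ => hp z hz h0, fun h' => absurd h (not_lt.2 h')⟩
    · filter_upwards [ae_lock hκ hω hγ hα h] with p hp z hz h0
      exact ⟨fun h' => absurd h' (not_lt.2 h), fun _ => hp z hz h0⟩
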